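/- **Theorem (Corner Lemma).** Let $k\ge 1$, $m,l\ge 0$, $r\ge 3$ be integers, $\Delta>0$, and let $V\subset\mathbb R^l$ be bounded and open. For $0<\delta\le\Delta$ put $\mathcal B_\delta=\{|a|<\delta\}\times\{|b|<\delta\}\times V\subset\mathbb R^k\times\mathbb R^m\times\mathbb R^l$ (Euclidean norms). Consider $$\dot a=A^u(a,b,c)\,a,\qquad \dot b=A^s(a,b,c)\,b,\qquad \dot c=E(a,b,c),$$ with coefficients of class $C^r$ on a neighbourhood of $\overline{\mathcal B_\Delta}$, and assume on $\overline{\mathcal B_\Delta}$: * (spectral gap) for some $\nu>0$, all eigenvalues of $A^u$ have real part $>2\nu$ and all eigenvalues of $A^s$ have real part $<-2\nu$; * ($\{a_k=0\}$ is invariant and transverse to an unstable direction) the last row of $A^u$ is $(0,\dots,0,\lambda_k)$ with a scalar function $\lambda_k>0$; * $E=0$ on $\{a=0\}\cap\{b=0\}$. Then there is $\delta_0\in(0,\Delta]$ such that for every $\delta\in(0,\delta_0]$ the following holds, where all orbits are orbits in $\mathcal B=\mathcal B_\delta$. For $p\in\mathcal B$ write $\pi^s(p)=z$ (resp. $\pi^u(p)=z$)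 if the forward (resp. backward) orbit of $p$ exists for all time in $\mathcal B$ and converges to the point $z\in\mathcal B\cap\{a=0,\,b=0\}$; these are the projections along stable and unstable fibers. (0) For every compact $K\subset V$ there is $\eta>0$ such that $\pi^s(0,b,c)$ and $\pi^u(a,0,c)$ exist whenever $|a|,|b|<\eta$ and $c\in K$. Let $0\le\sigma\le l$, let $\Lambda\subset V$ be a $\sigma$-dimensional embedded $C^r$ submanifold, let $0<\Delta_1<\delta$ and $0<|b^0|<\delta$, let $\theta$ be an $(l\times k)$-matrix function of class $C^r$ on $\{|a|<\Delta_1\}\times\Lambda$, and suppose that $$\mathcal I=\{(a,b,c):|a|<\Delta_1,\ b=b^0,\ c=c^0+\theta(a,c^0)a,\ c^0\in\Lambda\}$$ is a $(k+\sigma)$-dimensional embedded $C^r$ submanifold. Put $\mathcal I_\epsilon=\mathcal I\cap\{a_k=\epsilon\}$ and $\mathcal I_\epsilon^*=\mathcal I_\epsilon\cdot[0,\infty)$. Let $\Lambda^s=\{\pi^s(p):p\in\mathcal I,\ \pi^s(p)\text{ exists}\}$ be the projection of $\mathcal I$ along stable fibers, and let $W^u(\Lambda^s)=\{q:\pi^u(q)\text{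 exists and lies in }\Lambda^s\}$ be its unstable manifold. Fix any $q_0\in W^u(\Lambda^s)$ with positive $a_k$-coordinate. Then there are an open neighbourhood $V_0$ of $q_0$ and a constant $C>0$ such that: (1) $\mathcal I_\epsilon^*\cap V_0$ is $C^{r-3}$-close to $W^u(\Lambda^s)\cap V_0$ as $\epsilon\to0^+$: for some open $P\subset\mathbb R^{k+\sigma}$ there are $C^{r-3}$ embeddings $\varphi_0,\varphi_\epsilon$ ($\epsilon>0$ small) of $P$ with images $W^u(\Lambda^s)\cap V_0$ and $\mathcal I_\epsilon^*\cap V_0$, respectively, such that $\varphi_\epsilon\to\varphi_0$ uniformly on $P$ together with all derivatives of order at most $r-3$. (A $C^0$ embedding is a topological one; for $r-3\ge1$ the embeddings are immersions.) (2) Let $q_\epsilon\in\mathcal I_\epsilon^*\cap V_0$ be any family or sequence with $\epsilon\to0^+$ that converges to a point $q_0'\in W^u(\Lambda^s)$, and let $p_\epsilon\in\mathcal I_\epsilon$ and $T_\epsilon>0$ satisfy $q_\epsilon=p_\epsilon\cdot T_\epsilon$. Then there is a unique point $p_0\in\mathcal I_0$ with $\pi^s(p_0)=\pi^u(q_0')$,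 one has $p_\epsilon\to p_0$, and for all sufficiently small $\epsilon$ $$C^{-1}\log\tfrac1\epsilon\le T_\epsilon\le C\log\tfrac1\epsilon .$$ -/

import Mathlib

open Set Filter Topology

noncomputable section

/-- The `(a, b, c)`-space `ℝᵏ × ℝᵐ × ℝˡ`; each factor carries its Euclidean norm. -/
abbrev PhaseSpace (k m l : ℕ) : Type :=
  EuclideanSpace ℝ (Fin k) × EuclideanSpace ℝ (Fin m) × EuclideanSpace ℝ (Fin l)

/-- The coefficients of the system `a' = Au(a,b,c) a`, `b' = As(a,b,c) b`, `c' = E(a,b,c)`. -/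
structure FenichelSystem (k m l : ℕ) where
  Au : PhaseSpace k m l → Matrix (Fin k) (Fin k) ℝ
  As : PhaseSpace k m l → Matrix (Fin m) (Fin m) ℝ
  E : PhaseSpace k m l → EuclideanSpace ℝ (Fin l)

/-- The open box `{|a| < δ} × {|b| < δ} × V`. -/
def cornerBox (k m : ℕ) {l : ℕ} (δ : ℝ) (V : Set (EuclideanSpace ℝ (Fin l))) :
    Set (PhaseSpace k m l) :=
  Metric.ball 0 δ ×ˢ Metric.ball 0 δ ×ˢ V

namespace FenichelSystem

variable {k m l : ℕ}

/-- The right-hand side of the system. -/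
def field (S : FenichelSystem k m l) (x : PhaseSpace k m l) : PhaseSpace k m l :=
  (WithLp.toLp 2 ((S.Au x).mulVec x.1), WithLp.toLp 2 ((S.As x).mulVec x.2.1), S.E x)

/-- The coefficients are of class `C^r` on `U` (matrices entrywise). -/
def IsCk (S : FenichelSystem k m l) (r : ℕ) (U : Set (PhaseSpace k m l)) : Prop :=
  (∀ i j, ContDiffOn ℝ r (fun x => S.Au x i j) U) ∧
  (∀ i j, ContDiffOn ℝ r (fun x => S.As x i j) U) ∧
  ContDiffOn ℝ r S.E U

/-- Spectral gap on `D`: the (complex) eigenvalues of `Au` have real part `> 2ν`, those of `As`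
have real part `< -2ν`, for some `ν > 0`. -/
def HasSpectralGap (S : FenichelSystem k m l) (D : Set (PhaseSpace k m l)) : Prop :=
  ∃ ν : ℝ, 0 < ν ∧ ∀ x ∈ D,
    (∀ z ∈ spectrum ℂ ((S.Au x).map Complex.ofReal), 2 * ν < z.re) ∧
    (∀ z ∈ spectrum ℂ ((S.As x).map Complex.ofReal), z.re < -(2 * ν))

/-- On `D` the last row of `Au` is `(0, …, 0, λ)` with `λ > 0`. -/
def HasInvariantHyperplane {n : ℕ} (S : FenichelSystem (n + 1) m l)
    (D : Set (PhaseSpace (n + 1) m l)) : Prop :=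
  ∀ x ∈ D, (∀ j, j ≠ Fin.last n → S.Au x (Fin.last n) j = 0) ∧
    0 < S.Au x (Fin.last n) (Fin.last n)

/-- `E` vanishes on `{a = 0} ∩ {b = 0}` (within `D`). -/
def VanishesOnCritical (S : FenichelSystem k m l) (D : Set (PhaseSpace k m l)) : Prop :=
  ∀ x ∈ D, x.1 = 0 → x.2.1 = 0 → S.E x = 0

/-- `x` solves the system on the time interval `J` and stays in `B` there. -/
def IsOrbitOn (S : FenichelSystem k m l) (B : Set (PhaseSpace k m l))
    (x : ℝ → PhaseSpace k m l) (J : Set ℝ) : Prop :=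
  ∀ t ∈ J, x t ∈ B ∧ HasDerivWithinAt x (S.field (x t)) J t

/-- `q = p · T` for the flow of the system in `B`. -/
def FlowsTo (S : FenichelSystem k m l) (B : Set (PhaseSpace k m l))
    (p : PhaseSpace k m l) (T : ℝ) (q : PhaseSpace k m l) : Prop :=
  0 ≤ T ∧ ∃ x : ℝ → PhaseSpace k m l, S.IsOrbitOn B x (Icc 0 T) ∧ x 0 = p ∧ x T = q

/-- The forward evolution `M · [0, ∞)` of a set `M` in `B`. -/
def forwardEvolution (S : FenichelSystem k m l) (B M : Set (PhaseSpace k m l)) :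
    Set (PhaseSpace k m l) :=
  {q | ∃ p ∈ M, ∃ T : ℝ, S.FlowsTo B p T q}

/-- `πˢ(p) = z`: the forward orbit of `p` stays in `B` and converges to `z`, where `z` is a point
of `{a = 0} ∩ {b = 0}` in `B`. -/
def StableProj (S : FenichelSystem k m l) (B : Set (PhaseSpace k m l))
    (p z : PhaseSpace k m l) : Prop :=
  z ∈ B ∧ z.1 = 0 ∧ z.2.1 = 0 ∧
    ∃ x : ℝ → PhaseSpace k m l, S.IsOrbitOn B x (Ici 0) ∧ x 0 = p ∧ Tendsto x atTop (𝓝 z)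

/-- `πᵘ(q) = z`: the backward orbit of `q` stays in `B` and converges to `z`, where `z` is a point
of `{a = 0} ∩ {b = 0}` in `B`. -/
def UnstableProj (S : FenichelSystem k m l) (B : Set (PhaseSpace k m l))
    (q z : PhaseSpace k m l) : Prop :=
  z ∈ B ∧ z.1 = 0 ∧ z.2.1 = 0 ∧
    ∃ x : ℝ → PhaseSpace k m l, S.IsOrbitOn B x (Iic 0) ∧ x 0 = q ∧ Tendsto x atBot (𝓝 z)

/-- The projection along stable fibers of (the part in the stable manifold of) a set `M`. -/
def stableProjImage (S : FenichelSystem k m l) (B M : Set (PhaseSpace k m l)) :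
    Set (PhaseSpace k m l) :=
  {z | ∃ p ∈ M, S.StableProj B p z}

/-- The unstable manifold `Wᵘ(L)` in `B` of a set `L ⊆ {a = 0} ∩ {b = 0}` of equilibria. -/
def unstableManifold (S : FenichelSystem k m l) (B L : Set (PhaseSpace k m l)) :
    Set (PhaseSpace k m l) :=
  {q | ∃ z ∈ L, S.UnstableProj B q z}

end FenichelSystem

/-- `φ` is a `C^j` parametrization, over the open set `P ⊆ ℝᵈ`, of the set `M`: an embedding
with image `M`, and an immersion if `j ≥ 1`. -/
structure IsCkParam {X : Type*} [NormedAddCommGroup X] [NormedSpace ℝ X] (j : ℕ) {d : ℕ}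
    (P : Set (EuclideanSpace ℝ (Fin d))) (φ : EuclideanSpace ℝ (Fin d) → X) (M : Set X) :
    Prop where
  isOpen : IsOpen P
  contDiffOn : ContDiffOn ℝ j φ P
  immersion : 1 ≤ j → ∀ u ∈ P, Function.Injective (fderiv ℝ φ u)
  isEmbedding : IsEmbedding (fun u : P => φ u)
  image_eq : φ '' P = M

/-- `M` is a `d`-dimensional (embedded) `C^j` submanifold of `X`. -/
def IsCkSubmanifold {X : Type*} [NormedAddCommGroup X] [NormedSpace ℝ X] (j d : ℕ)
    (M : Set X) : Prop :=
  ∀ x ∈ M, ∃ U : Set X, IsOpen U ∧ x ∈ U ∧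
    ∃ (P : Set (EuclideanSpace ℝ (Fin d))) (φ : EuclideanSpace ℝ (Fin d) → X),
      IsCkParam j P φ (M ∩ U)

/-- The `d`-dimensional sets `M ε` are `C^j`-close to `M₀` as `ε → 0+`: they have `C^j`
parametrizations over one common open set that converge uniformly, with all derivatives of
order at most `j`, to a `C^j` parametrization of `M₀`. -/
def CkClose {X : Type*} [NormedAddCommGroup X] [NormedSpace ℝ X] (j d : ℕ)
    (M : ℝ → Set X) (M₀ : Set X) : Prop :=
  ∃ (P : Set (EuclideanSpace ℝ (Fin d))) (φ₀ : EuclideanSpace ℝ (Fin d) → X)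
    (φ : ℝ → EuclideanSpace ℝ (Fin d) → X),
    IsCkParam j P φ₀ M₀ ∧
    (∀ᶠ ε in 𝓝[>] (0 : ℝ), IsCkParam j P (φ ε) (M ε)) ∧
    ∀ i ≤ j, TendstoUniformlyOn (fun ε => iteratedFDeriv ℝ i (φ ε)) (iteratedFDeriv ℝ i φ₀)
      (𝓝[>] (0 : ℝ)) P

/-- `{(a, b, c) : |a| < Δ₁, b = b⁰, c = c⁰ + θ(a, c⁰) a, c⁰ ∈ Λ}`. -/
def entryManifold {k m l : ℕ} (Δ₁ : ℝ) (b₀ : EuclideanSpace ℝ (Fin m))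
    (θ : EuclideanSpace ℝ (Fin k) → EuclideanSpace ℝ (Fin l) → Matrix (Fin l) (Fin k) ℝ)
    (Λ : Set (EuclideanSpace ℝ (Fin l))) : Set (PhaseSpace k m l) :=
  {x | ‖x.1‖ < Δ₁ ∧ x.2.1 = b₀ ∧
    ∃ c₀ ∈ Λ, x.2.2 = c₀ + WithLp.toLp 2 ((θ x.1 c₀).mulVec x.1)}

/-- The slice `M ∩ {a_k = ε}`, where `a_k` is the last component of `a`. -/
def slice {n m l : ℕ} (M : Set (PhaseSpace (n + 1) m l)) (ε : ℝ) :
    Set (PhaseSpace (n + 1) m l) :=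
  {x ∈ M | x.1 (Fin.last n) = ε}

end

/-! Dividing the field by the growth rate of a_k makes a_k grow exactly like e^t, so the rescaled
transit time from {a_k = ε} to a point q is log(a_k(q)/ε). Hadamard's lemma then writes the drift as
Q(a,b), at the price of one derivative. In the manner of Shilnikov, an orbit is described by
boundary values that stay regular as the transit time tends to infinity: a at the exit, b at the
entry, and one condition that couples the values of c at both ends, here that the entry point lies
on the given manifold.

The singular limit becomes regular by a compactification. The point at time r after the entry of a
passage of length L gets the label ξ = e^{-r}, η = e^{r-L}. Passages of length L then live on the
hyperbola ξη = e^{-L} in the unit square. For L → ∞ the hyperbolas degenerate to the two axes: η = 0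
carries a stable fiber, ξ = 0 an unstable fiber, and the corner is their common base point. All
passages, the infinite one included, are solved by one fixed point problem for continuous functions
on the square. In the unknowns α, β, γ given by a = ϱ²η^μ α, b = ϱ²ξ^μ β, c = z₀ + ϱγ, and after
cutting off, the operator is a contraction for small ϱ.

Superposition with a C^n map is C^n on a space of continuous functions. Hence the fixed point is C^n
in the boundary data as an element of that space (`exists_contDiffOn_fixedPoint`). Nothing is ever
differentiated in ξ and η. The derivatives in the data are continuous up to the axes, and their
continuity at e = ξη = 0 is the asserted closeness (`tendstoUniformlyOn_iteratedFDeriv`). For this,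
e must not depend on the data. Let α now be the last coordinate of q₀. A slice {a_k = ε} corresponds
to the single hyperbola e = ε/α, and the excess s = log(a_k/α) of the transit time is moved into the
speed 1 + s/L, where 1/L = 1/log(1/e) extends continuously by 0 to e = 0.

Conversely, every orbit in the box has to be such a solution. The spectral gap gives exponential
decay for frozen coefficients, uniformly by compactness. In a thin box c moves slowly, so b decays
forward and a decays backward along every orbit, fast enough for its weighted coordinates to be
continuous and small. The operator acts on each hyperbola separately, so uniqueness of the fixed
point identifies the orbit (`phys_eq_of_isOrbit`) and, on the axes, a pair of fibers
(`phys_eq_of_fibers`).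

With the whole exit point prescribed, this shows that passages ending near q₀ start near one entry
point p (`exists_entry_near`). There the entry manifold is a graph over the a-directions and its
tangent directions with a = 0 (`exists_exitGraph`). With the graph as the coupling condition, the
solution map parametrizes both the evolved slices and the unstable manifold (`exists_passage`), and
`ckClose_of_family` concludes. The bounds for the transit time come from the exact growth of a_k. -/

set_option linter.unusedSectionVars false

/-! ### Smoothness of superposition operators and of fixed points -/

noncomputable section

/-- Superposition with a fixed continuous map is `C^n` on the space of continuous maps. -/
theorem contDiff_comp_continuousMap {K : Type} [TopologicalSpace K] [CompactSpace K]
    {E : Type} [NormedAddCommGroup E] [NormedSpace ℝ E] (n : ℕ) :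
    ∀ {F : Type} [NormedAddCommGroup F] [NormedSpace ℝ F] (f : C(E, F)) (_ : ContDiff ℝ n f),
      ContDiff ℝ n (fun x : C(K, E) => f.comp x) := by
  -- The target F stays quantified, since the induction hypothesis is applied to the derivative of
  -- f, whose values are operators.
  induction n with
  | zero =>
    intro F _ _ f _
    exact contDiff_zero.2 (ContinuousMap.continuous_postcomp f)
  | succ n ih =>
    intro F _ _ f hf
    let f' : C(E, E →L[ℝ] F) := ⟨fderiv ℝ f, hf.continuous_fderiv (by simp)⟩
    let Lm : C(K, E →L[ℝ] F) →ₗ[ℝ] (C(K, E) →L[ℝ] C(K, F)) :=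
      { toFun := fun g => LinearMap.mkContinuous
          { toFun := fun u => ⟨fun k => g k (u k), by fun_prop⟩
            map_add' := fun u v => by ext; simp
            map_smul' := fun c u => by ext; simp } ‖g‖ (fun u => by
              rw [ContinuousMap.norm_le _ (by positivity)]
              intro k
              exact ((g k).le_opNorm_of_le (u.norm_coe_le_norm k)).trans
                (mul_le_mul_of_nonneg_right (g.norm_coe_le_norm k) (norm_nonneg u)))
        map_add' := fun g h => by ext; simp
        map_smul' := fun c g => by ext; simp }
    have hLm : ∀ g, ‖Lm g‖ ≤ 1 * ‖g‖ := by
      intro g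
      rw [one_mul]
      refine (Lm g).opNorm_le_bound (norm_nonneg g) fun u => ?_
      rw [ContinuousMap.norm_le _ (by positivity)]
      intro k
      exact ((g k).le_opNorm_of_le (u.norm_coe_le_norm k)).trans
        (mul_le_mul_of_nonneg_right (g.norm_coe_le_norm k) (norm_nonneg u))
    let L : C(K, E →L[ℝ] F) →L[ℝ] (C(K, E) →L[ℝ] C(K, F)) :=
      ⟨Lm, AddMonoidHomClass.continuous_of_bound Lm 1 hLm⟩
    have hder : ∀ x : C(K, E), HasFDerivAt (fun x : C(K, E) => f.comp x) (L (f'.comp x)) x := by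
      intro x
      rw [hasFDerivAt_iff_isLittleO_nhds_zero, Asymptotics.isLittleO_iff]
      intro ε hε
      -- The derivative of f need not be uniformly continuous on E. Uniform continuity at the points
      -- of the compact range of x suffices to make the mean value estimate uniform over K.
      have hcomp : IsCompact (range x) := isCompact_range x.continuous
      have hunif := hcomp.uniformContinuousAt_of_continuousAt f'
        (fun a _ => f'.continuous.continuousAt) (Metric.dist_mem_uniformity hε)
      obtain ⟨δ, hδ, hδε⟩ := Metric.mem_uniformity_dist.1 hunif
      filter_upwards [Metric.ball_mem_nhds (0 : C(K, E)) hδ] with u hu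
      rw [mem_ball_zero_iff] at hu
      rw [ContinuousMap.norm_le _ (by positivity)]
      intro k
      have hmv := (convex_ball (x k) δ).norm_image_sub_le_of_norm_hasFDerivWithin_le'
        (f := f) (f' := fderiv ℝ f) (φ := fderiv ℝ f (x k)) (C := ε)
        (x := x k) (y := x k + u k)
        (fun y _ => ((hf.differentiable (by simp)) y).hasFDerivAt.hasFDerivWithinAt)
        (fun y hy => by
          have := hδε (a := x k) (b := y) (by rwa [dist_comm]) (mem_range_self k)
          simp only [mem_ofPred_eq] at this
          rw [dist_comm, dist_eq_norm] at this
          exact this.le)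
        (Metric.mem_ball_self hδ)
        (by simpa [dist_eq_norm] using (u.norm_coe_le_norm k).trans_lt hu)
      have h2 : ‖x k + u k - x k‖ ≤ ‖u‖ := by simpa using u.norm_coe_le_norm k
      refine le_trans ?_ (hmv.trans (mul_le_mul_of_nonneg_left h2 hε.le))
      apply le_of_eq
      congr 1
      simp [L, Lm, f']
    rw [show ((n + 1 : ℕ) : WithTop ℕ∞) = (n : WithTop ℕ∞) + 1 by norm_cast,
      contDiff_succ_iff_hasFDerivAt]
    refine ⟨fun x => L (f'.comp x), ?_, hder⟩
    exact L.contDiff.comp (ih f' (hf.fderiv_right (by norm_cast)))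

/-- Uniform contraction principle: the fixed point of a contraction depending on a parameter is as
smooth as the contraction. -/
theorem exists_contDiffOn_fixedPoint {X Y : Type} [NormedAddCommGroup X] [NormedSpace ℝ X]
    [CompleteSpace X] [NormedAddCommGroup Y] [NormedSpace ℝ Y] [CompleteSpace Y] {n : ℕ}
    (hn : n ≠ 0) (Φ : Y × X → X) (hΦ : ContDiff ℝ n Φ) (O : Set Y)
    (hlip : ∀ y ∈ O, ∀ x x', ‖Φ (y, x) - Φ (y, x')‖ ≤ (1 / 2) * ‖x - x'‖) (hO : IsOpen O) :
    ∃ ψ : Y → X, ContDiffOn ℝ n ψ O ∧ ∀ y ∈ O, Φ (y, ψ y) = ψ y := by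
  have hc : ∀ y ∈ O, ContractingWith (1 / 2) (fun x => Φ (y, x)) := by
    intro y hy
    refine ⟨by norm_num, LipschitzWith.of_dist_le_mul fun x x' => ?_⟩
    simpa [dist_eq_norm] using hlip y hy x x'
  classical
  let ψ : Y → X := fun y => if hy : y ∈ O then (hc y hy).fixedPoint else 0
  have hψ : ∀ y ∈ O, Φ (y, ψ y) = ψ y := by
    intro y hy
    simp only [ψ, hy, dif_pos]
    exact (hc y hy).fixedPoint_isFixedPt
  have huniq : ∀ y ∈ O, ∀ x, Φ (y, x) = x → x = ψ y := by
    intro y hy x hx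
    have h1 : ψ y = (hc y hy).fixedPoint := by simp [ψ, hy]
    rw [h1]
    exact (hc y hy).fixedPoint_unique hx
  refine ⟨ψ, fun y hy => ContDiffAt.contDiffWithinAt ?_, hψ⟩
  let G : Y × X → X := fun u => u.2 - Φ u
  have hG : ContDiff ℝ n G := contDiff_snd.sub hΦ
  have hn' : (n : WithTop ℕ∞) ≠ 0 := by exact_mod_cast hn
  set T : X →L[ℝ] X := fderiv ℝ Φ (y, ψ y) ∘L .inr ℝ Y X with hT
  have hTd : HasFDerivAt (fun x => Φ (y, x)) T (ψ y) := by
    have h1 := ((hΦ.differentiable hn') (y, ψ y)).hasFDerivAt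
    exact h1.comp (ψ y) (hasFDerivAt_prodMk_right y (ψ y))
  have hTn : ‖T‖ ≤ 1 / 2 := by
    have := hTd.le_of_lipschitz (C := 1 / 2) (LipschitzWith.of_dist_le_mul fun x x' => by
      simpa [dist_eq_norm] using hlip y hy x x')
    simpa using this
  have hinv : (fderiv ℝ G (y, ψ y) ∘L .inr ℝ Y X).IsInvertible := by
    have h1 : fderiv ℝ G (y, ψ y) ∘L .inr ℝ Y X = 1 - T := by
      have hd : HasFDerivAt G (.snd ℝ Y X - fderiv ℝ Φ (y, ψ y)) (y, ψ y) :=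
        hasFDerivAt_snd.sub ((hΦ.differentiable hn') (y, ψ y)).hasFDerivAt
      rw [hd.fderiv]
      ext v
      simp [hT]
    rw [h1]
    have hu : IsUnit (1 - T) := isUnit_one_sub_of_norm_lt_one (hTn.trans_lt (by norm_num))
    obtain ⟨u, hu⟩ := hu
    exact ⟨ContinuousLinearEquiv.unitsEquiv ℝ X u, by ext v; simp [← hu]⟩
  have hGat : ContDiffAt ℝ n G (y, ψ y) := hG.contDiffAt
  have h0 : G (y, ψ y) = 0 := by simp [G, hψ y hy]
  -- Near y the values of the implicit function are fixed points, so by uniqueness the implicit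
  -- function is ψ. Invertibility of 1 - T came from ‖T‖ ≤ 1/2.
  refine (hGat.contDiffAt_implicitFunction hn' hinv).congr_of_eventuallyEq ?_
  filter_upwards [hGat.eventually_apply_implicitFunction hn' hinv, hO.mem_nhds hy] with y' h1 h2
  refine (huniq y' h2 _ ?_).symm
  rw [h0] at h1
  exact (sub_eq_zero.1 h1).symm

end

/-! ### The flow on hyperbolas in the unit square and integration along it -/

noncomputable section

open MeasureTheory


noncomputable section

section Semigroup

variable {F : Type} [NormedAddCommGroup F] [NormedSpace ℝ F]

/-- The one-parameter group generated by `D`. -/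
def expFlow (D : F →L[ℝ] F) (r : ℝ) : F →L[ℝ] F := NormedSpace.exp (r • D)

variable [CompleteSpace F]

theorem expFlow_zero (D : F →L[ℝ] F) : expFlow D 0 = 1 := by simp [expFlow]

theorem expFlow_add (D : F →L[ℝ] F) (r s : ℝ) :
    expFlow D (r + s) = expFlow D r * expFlow D s := by
  let _ : NormedAlgebra ℚ (F →L[ℝ] F) := NormedAlgebra.restrictScalars ℚ ℝ _
  rw [expFlow, add_smul, NormedSpace.exp_add_of_commute]
  · rfl
  · exact ((Commute.refl D).smul_left r).smul_right s

theorem hasDerivAt_expFlow (D : F →L[ℝ] F) (r : ℝ) :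
    HasDerivAt (expFlow D) (D * expFlow D r) r := hasDerivAt_exp_smul_const' D r

theorem hasDerivAt_expFlow' (D : F →L[ℝ] F) (r : ℝ) :
    HasDerivAt (expFlow D) (expFlow D r * D) r := hasDerivAt_exp_smul_const D r

theorem continuous_expFlow (D : F →L[ℝ] F) : Continuous (expFlow D) :=
  continuous_iff_continuousAt.2 fun r => (hasDerivAt_expFlow D r).continuousAt

theorem expFlow_neg_mul (D : F →L[ℝ] F) (r : ℝ) : expFlow D (-r) * expFlow D r = 1 := by
  rw [← expFlow_add, neg_add_cancel, expFlow_zero]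

/-- Solutions of `u' = A u` are given by the group generated by `A`. -/
theorem eq_expFlow_of_hasDerivWithinAt (D : F →L[ℝ] F) {h : ℝ} {u : ℝ → F}
    (hu : ∀ r ∈ Icc 0 h, HasDerivWithinAt u (D (u r)) (Icc 0 h) r) {r : ℝ} (hr : r ∈ Icc 0 h) :
    u r = expFlow D r (u 0) := by
  have hconst : ∀ r ∈ Icc 0 h,
      HasDerivWithinAt (fun r => expFlow D (-r) (u r)) 0 (Icc 0 h) r := by
    intro r hr
    have h1 : HasDerivAt (fun r => expFlow D (-r)) (-(expFlow D (-r) * D)) r := by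
      exact ((hasDerivAt_expFlow' D (-r)).scomp r (hasDerivAt_neg r)).congr_deriv (by simp)
    have h2 := h1.hasDerivWithinAt.clm_apply (hu r hr)
    simpa using h2
  have := constant_of_has_deriv_right_zero (f := fun r => expFlow D (-r) (u r))
    (fun r hr => (hconst r hr).continuousWithinAt)
    (fun r hr => (hconst r ⟨hr.1, hr.2.le⟩).mono_of_mem_nhdsWithin
      (Icc_mem_nhdsGE_of_mem hr)) r hr
  simp only [neg_zero, expFlow_zero] at this
  have h3 := congrArg (expFlow D r) this
  rw [← mul_apply_eq_comp, ← expFlow_add, add_neg_cancel, expFlow_zero] at h3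
  simpa using h3

end Semigroup

/-- The square of entry and exit coordinates `(ξ, η)`. -/
abbrev UnitSquare : Type := unitInterval × unitInterval

namespace UnitSquare

/-- The retraction of the plane onto the unit square. -/
def clamp (u : ℝ × ℝ) : UnitSquare :=
  (projIcc 0 1 zero_le_one u.1, projIcc 0 1 zero_le_one u.2)

theorem continuous_clamp : Continuous clamp :=
  (continuous_projIcc.comp continuous_fst).prodMk (continuous_projIcc.comp continuous_snd)

theorem clamp_fst {u : ℝ × ℝ} (h : u.1 ∈ Icc (0 : ℝ) 1) : ((clamp u).1 : ℝ) = u.1 := by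
  simp [clamp, projIcc_of_mem zero_le_one h]

theorem clamp_snd {u : ℝ × ℝ} (h : u.2 ∈ Icc (0 : ℝ) 1) : ((clamp u).2 : ℝ) = u.2 := by
  simp [clamp, projIcc_of_mem zero_le_one h]

/-- The flow `(ξ, η) ↦ (ξ e⁻ʳ, η eʳ)`, clamped to the square. -/
def flow (r : ℝ) (p : UnitSquare) : UnitSquare :=
  clamp (p.1 * Real.exp (-r), p.2 * Real.exp r)

theorem continuous_flow : Continuous (fun u : ℝ × UnitSquare => flow u.1 u.2) :=
  continuous_clamp.comp (by fun_prop)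

variable {p : UnitSquare} {r s : ℝ}

theorem flow_fst (hr : 0 ≤ r) : ((flow r p).1 : ℝ) = p.1 * Real.exp (-r) :=
  clamp_fst ⟨mul_nonneg p.1.2.1 (Real.exp_pos _).le,
    mul_le_one₀ p.1.2.2 (Real.exp_pos _).le (Real.exp_le_one_iff.2 (by linarith))⟩

theorem flow_snd (hr : p.2 * Real.exp r ≤ 1) : ((flow r p).2 : ℝ) = p.2 * Real.exp r :=
  clamp_snd ⟨mul_nonneg p.2.2.1 (Real.exp_pos _).le, hr⟩

theorem flow_zero : flow 0 p = p := by
  ext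
  · simp [flow_fst le_rfl]
  · rw [flow_snd (by simpa using p.2.2.2)]; simp

theorem le_one_of_le (hs : p.2 * Real.exp s ≤ 1) (hrs : r ≤ s) : p.2 * Real.exp r ≤ 1 :=
  (mul_le_mul_of_nonneg_left (Real.exp_le_exp.2 hrs) p.2.2.1).trans hs

theorem flow_mul (hr : 0 ≤ r) (h : p.2 * Real.exp r ≤ 1) :
    ((flow r p).1 : ℝ) * (flow r p).2 = p.1 * p.2 := by
  rw [flow_fst hr, flow_snd h, Real.exp_neg]
  field_simp

theorem flow_flow (hr : 0 ≤ r) (hs : 0 ≤ s) (h : p.2 * Real.exp (r + s) ≤ 1) :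
    flow s (flow r p) = flow (r + s) p := by
  have hr' := le_one_of_le h (r := r) (by linarith)
  have hsnd : ((flow r p).2 : ℝ) * Real.exp s = p.2 * Real.exp (r + s) := by
    rw [flow_snd hr', Real.exp_add]; ring
  ext
  · rw [flow_fst hs, flow_fst hr, flow_fst (by linarith), neg_add, Real.exp_add]; ring
  · rw [flow_snd (by rw [hsnd]; exact h), hsnd, flow_snd h]

/-- Exchange of entry and exit. -/
def swap : C(UnitSquare, UnitSquare) := ⟨Prod.swap, continuous_swap⟩

/-- Exchanging the coordinates reverses time on a hyperbola. Everything about integration from the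
entry reduces in this way to integration to the exit. -/
theorem swap_flow {h : ℝ} (hr : 0 ≤ r) (hrh : r ≤ h) (hh : p.2 * Real.exp h ≤ 1) :
    swap (flow r p) = flow (h - r) (swap (flow h p)) := by
  have h2 : (flow h p).1 * Real.exp (h - r) = p.1 * Real.exp (-r) := by
    rw [flow_fst (hr.trans hrh), mul_assoc, ← Real.exp_add]; ring_nf
  have h3 : (p.1 : ℝ) * Real.exp (-r) ≤ 1 := mul_le_one₀ p.1.2.2 (Real.exp_pos _).le
    (Real.exp_le_one_iff.2 (by linarith))
  ext
  · rw [flow_fst (by linarith)]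
    simp only [swap, ContinuousMap.coe_mk, Prod.fst_swap]
    rw [flow_snd (le_one_of_le hh hrh), flow_snd hh, mul_assoc, ← Real.exp_add]; ring_nf
  · rw [flow_snd (by simpa [swap, h2] using h3)]
    simp only [swap, ContinuousMap.coe_mk, Prod.snd_swap]
    rw [h2, flow_fst hr]

end UnitSquare

open UnitSquare

section Transport

variable {F : Type} [NormedAddCommGroup F] [NormedSpace ℝ F]

/-- The integrand of `transport`. -/
def transportIntegrand (D : F →L[ℝ] F) (f : C(UnitSquare, F)) (p : UnitSquare) (r : ℝ) : F :=
  if p.2 * Real.exp r ≤ 1 then expFlow D r (f (flow r p)) else 0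

/-- The integral `∫ e^{rD} f(ξ e⁻ʳ, η eʳ) dr` from the point `(ξ, η)` to the exit `η = 1`. -/
def transportFun (D : F →L[ℝ] F) (f : C(UnitSquare, F)) (p : UnitSquare) : F :=
  ∫ r in Ioi (0 : ℝ), transportIntegrand D f p r

/-- Exponential stability of the group generated by `D`. -/
def ExpStable (D : F →L[ℝ] F) (K μ : ℝ) : Prop :=
  0 < μ ∧ ∀ r, 0 ≤ r → ‖expFlow D r‖ ≤ K * Real.exp (-μ * r)

variable {D : F →L[ℝ] F} {K μ : ℝ}

variable [CompleteSpace F]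

theorem ExpStable.nonneg (hD : ExpStable D K μ) : 0 ≤ K := by
  have h1 := hD.2 0 le_rfl
  have h2 := norm_nonneg (expFlow D 0)
  simp at h1; linarith

theorem continuous_transport_aux (D : F →L[ℝ] F) (f : C(UnitSquare, F)) :
    Continuous (fun u : ℝ × UnitSquare => expFlow D u.1 (f (flow u.1 u.2))) :=
  ((continuous_expFlow D).comp continuous_fst).clm_apply (f.continuous.comp continuous_flow)

theorem transportIntegrand_aestronglyMeasurable (D : F →L[ℝ] F) (f : C(UnitSquare, F))
    (p : UnitSquare) (ν : Measure ℝ) : AEStronglyMeasurable (transportIntegrand D f p) ν := by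
  have hs : MeasurableSet {r : ℝ | p.2 * Real.exp r ≤ 1} :=
    measurableSet_le (by fun_prop) measurable_const
  have hc : Continuous (fun r => expFlow D r (f (flow r p))) :=
    (continuous_transport_aux D f).comp (by fun_prop : Continuous fun r : ℝ => (r, p))
  exact (StronglyMeasurable.ite hs hc.stronglyMeasurable stronglyMeasurable_const).aestronglyMeasurable

theorem transportIntegrand_norm_le (hD : ExpStable D K μ) (f : C(UnitSquare, F)) (p : UnitSquare)
    {r : ℝ} (hr : 0 ≤ r) : ‖transportIntegrand D f p r‖ ≤ K * ‖f‖ * Real.exp (-μ * r) := by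
  have hK := hD.nonneg
  unfold transportIntegrand
  split_ifs
  · calc _ ≤ ‖expFlow D r‖ * ‖f (flow r p)‖ := (expFlow D r).le_opNorm _
      _ ≤ (K * Real.exp (-μ * r)) * ‖f‖ := by
          gcongr
          · exact hD.2 r hr
          · exact f.norm_coe_le_norm _
      _ = _ := by ring
  · rw [norm_zero]; positivity

theorem integrable_exp_bound (hμ : 0 < μ) (C : ℝ) :
    Integrable (fun r => C * Real.exp (-μ * r)) (volume.restrict (Ioi (0 : ℝ))) :=
  (exp_neg_integrableOn_Ioi 0 hμ).const_mul C

theorem transportIntegrand_integrable (hD : ExpStable D K μ) (f : C(UnitSquare, F))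
    (p : UnitSquare) : IntegrableOn (transportIntegrand D f p) (Ioi 0) :=
  Integrable.mono' (integrable_exp_bound hD.1 (K * ‖f‖))
    (transportIntegrand_aestronglyMeasurable D f p _)
    ((ae_restrict_iff' measurableSet_Ioi).2 (Eventually.of_forall fun _ hr =>
      transportIntegrand_norm_le hD f p (le_of_lt hr)))

theorem transportFun_norm_le (hD : ExpStable D K μ) (f : C(UnitSquare, F)) (p : UnitSquare) :
    ‖transportFun D f p‖ ≤ K / μ * ‖f‖ := by
  have h1 := norm_integral_le_of_norm_le (integrable_exp_bound hD.1 (K * ‖f‖))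
    ((ae_restrict_iff' measurableSet_Ioi).2 (Eventually.of_forall fun _ hr =>
      transportIntegrand_norm_le hD f p (le_of_lt hr)))
  refine h1.trans (le_of_eq ?_)
  rw [integral_const_mul, integral_exp_mul_Ioi (by linarith [hD.1])]
  have := hD.1.ne'
  simp; field_simp

/-- The integration stops at r = -log η, which tends to infinity as η → 0. Dominated convergence
still applies: the exponential bound does not depend on p, and for fixed p the integrand is
discontinuous in p at most for this one value of r. This is the point where finite passages are
joined to the infinite one. -/
theorem continuous_transportFun (hD : ExpStable D K μ) (f : C(UnitSquare, F)) :
    Continuous (transportFun D f) := by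
  rw [continuous_iff_continuousAt]
  intro p
  refine continuousAt_of_dominated (bound := fun r => K * ‖f‖ * Real.exp (-μ * r))
    (Eventually.of_forall fun q => transportIntegrand_aestronglyMeasurable D f q _)
    (Eventually.of_forall fun q => (ae_restrict_iff' measurableSet_Ioi).2
      (Eventually.of_forall fun _ hr => transportIntegrand_norm_le hD f q (le_of_lt hr)))
    (integrable_exp_bound hD.1 _) ?_
  apply ae_restrict_of_ae
  have hnull : ∀ᵐ r : ℝ, r ≠ -Real.log p.2 := by
    simp [ae_iff]
  filter_upwards [hnull] with r hr
  have hne : (p.2 : ℝ) * Real.exp r ≠ 1 := by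
    intro h
    apply hr
    have h2 : (p.2 : ℝ) ≠ 0 := by rintro h0; simp [h0] at h
    have := congrArg Real.log h
    rw [Real.log_mul h2 (Real.exp_pos r).ne', Real.log_exp, Real.log_one] at this
    linarith
  have hcont : Continuous (fun q : UnitSquare => (q.2 : ℝ) * Real.exp r) := by fun_prop
  have hcf : Continuous (fun q : UnitSquare => expFlow D r (f (flow r q))) :=
    (continuous_transport_aux D f).comp (by fun_prop : Continuous fun q : UnitSquare => (r, q))
  rcases lt_or_gt_of_ne hne with h | h
  · have hev : ∀ᶠ q in 𝓝 p, (q.2 : ℝ) * Real.exp r < 1 :=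
      hcont.continuousAt.eventually (gt_mem_nhds h)
    refine hcf.continuousAt.congr ?_
    filter_upwards [hev] with q hq
    simp [transportIntegrand, hq.le]
  · have hev : ∀ᶠ q in 𝓝 p, 1 < (q.2 : ℝ) * Real.exp r :=
      hcont.continuousAt.eventually (lt_mem_nhds h)
    refine (continuousAt_const (y := (0 : F))).congr ?_
    filter_upwards [hev] with q hq
    simp [transportIntegrand, not_le.2 hq]

/-- `transportFun` as a bounded operator on the continuous functions on the square. -/
def transport (hD : ExpStable D K μ) : C(UnitSquare, F) →L[ℝ] C(UnitSquare, F) :=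
  ⟨{ toFun := fun f => ⟨transportFun D f, continuous_transportFun hD f⟩
     map_add' := fun f g => by
       ext p
       simp only [ContinuousMap.coe_mk, ContinuousMap.add_apply, transportFun]
       rw [← integral_add (transportIntegrand_integrable hD f p)
         (transportIntegrand_integrable hD g p)]
       congr 1; ext r
       simp only [transportIntegrand]
       split_ifs <;> simp
     map_smul' := fun c f => by
       ext p
       simp only [ContinuousMap.coe_mk, ContinuousMap.smul_apply, transportFun, RingHom.id_apply]
       rw [← integral_smul]
       congr 1; ext r
       simp only [transportIntegrand]
       split_ifs <;> simp }, by
    refine AddMonoidHomClass.continuous_of_bound (LinearMap.mk _ _) (K / μ) fun f => ?_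
    exact (ContinuousMap.norm_le _ (mul_nonneg (div_nonneg hD.nonneg hD.1.le)
      (norm_nonneg f))).2 fun p => transportFun_norm_le hD f p⟩

theorem transport_apply (hD : ExpStable D K μ) (f : C(UnitSquare, F)) (p : UnitSquare) :
    transport hD f p = transportFun D f p := rfl

theorem transport_norm_le (hD : ExpStable D K μ) (f : C(UnitSquare, F)) :
    ‖transport hD f‖ ≤ K / μ * ‖f‖ :=
  (ContinuousMap.norm_le _ (mul_nonneg (div_nonneg hD.nonneg hD.1.le)
      (norm_nonneg f))).2 fun p => transportFun_norm_le hD f p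

theorem transport_exit (hD : ExpStable D K μ) (f : C(UnitSquare, F)) {p : UnitSquare}
    (hp : (p.2 : ℝ) = 1) : transport hD f p = 0 := by
  rw [transport_apply, transportFun]
  refine setIntegral_eq_zero_of_forall_eq_zero fun r hr => ?_
  have : ¬ ((p.2 : ℝ) * Real.exp r ≤ 1) := by
    rw [hp, one_mul, not_le]; exact Real.one_lt_exp_iff.2 hr
  simp [transportIntegrand, this]

/-- The integral is split at r. After a shift of time the remainder is the transport integral at the
flowed point, by the group property of the exponential and of the flow. -/
theorem transport_cocycle (hD : ExpStable D K μ) (f : C(UnitSquare, F)) {p : UnitSquare} {r : ℝ}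
    (hr : 0 ≤ r) (h : p.2 * Real.exp r ≤ 1) :
    transport hD f p = (∫ s in (0 : ℝ)..r, expFlow D s (f (flow s p))) +
      expFlow D r (transport hD f (flow r p)) := by
  have hint := transportIntegrand_integrable hD f p
  rw [transport_apply, transportFun, ← intervalIntegral.integral_interval_add_Ioi hint
    (hint.mono_set (Ioi_subset_Ioi hr))]
  congr 1
  · refine intervalIntegral.integral_congr fun s hs => ?_
    rw [uIcc_of_le hr] at hs
    simp [transportIntegrand, le_one_of_le h hs.2]
  · rw [transport_apply, transportFun,
      ← ContinuousLinearMap.integral_comp_comm _ (transportIntegrand_integrable hD f _)]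
    have h1 := (measurePreserving_add_right (volume : Measure ℝ) r).setIntegral_preimage_emb
      (MeasurableEquiv.addRight r).measurableEmbedding (transportIntegrand D f p) (Ioi r)
    rw [← h1]
    have h2 : (fun x : ℝ => x + r) ⁻¹' Ioi r = Ioi 0 := by ext x; simp
    rw [h2]
    refine setIntegral_congr_fun measurableSet_Ioi fun s hs => ?_
    have hsnd : ((flow r p).2 : ℝ) * Real.exp s = p.2 * Real.exp (s + r) := by
      rw [flow_snd h, Real.exp_add]; ring
    simp only [transportIntegrand, hsnd]
    split_ifs with h3
    · rw [add_comm s r, expFlow_add, flow_flow hr (le_of_lt hs) (by rwa [add_comm])]; rfl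
    · simp

/-- Solving the cocycle identity for the value at `flow r p` leaves an integral with moving upper
limit. It is differentiable in r although f is only continuous. -/
theorem transport_hasDerivWithinAt (hD : ExpStable D K μ) (f : C(UnitSquare, F)) {p : UnitSquare}
    {h : ℝ} (hh : p.2 * Real.exp h ≤ 1) {r : ℝ} (hr : r ∈ Icc 0 h) :
    HasDerivWithinAt (fun r => transport hD f (flow r p))
      (-(D (transport hD f (flow r p))) - f (flow r p)) (Icc 0 h) r := by
  have hc : Continuous (fun r => expFlow D r (f (flow r p))) :=
    (continuous_transport_aux D f).comp (by fun_prop : Continuous fun r : ℝ => (r, p))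
  have key : ∀ r ∈ Icc 0 h, transport hD f (flow r p) = expFlow D (-r)
      (transport hD f p - ∫ s in (0 : ℝ)..r, expFlow D s (f (flow s p))) := by
    intro r hr
    rw [transport_cocycle hD f hr.1 (le_one_of_le hh hr.2), add_sub_cancel_left,
      ← mul_apply_eq_comp, expFlow_neg_mul]
    rfl
  have h1 : HasDerivAt (fun r => expFlow D (-r)) (-(D * expFlow D (-r))) r := by
    exact ((hasDerivAt_expFlow D (-r)).scomp r (hasDerivAt_neg r)).congr_deriv (by simp)
  have h2 : HasDerivAt (fun r => transport hD f p - ∫ s in (0 : ℝ)..r, expFlow D s (f (flow s p)))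
      (-(expFlow D r (f (flow r p)))) r :=
    (hc.integral_hasStrictDerivAt 0 r).hasDerivAt.const_sub _
  have h3 := (h1.clm_apply h2).hasDerivWithinAt (s := Icc 0 h)
  refine HasDerivWithinAt.congr_deriv (h3.congr key (key r hr)) ?_
  rw [key r hr, map_neg, ← mul_apply_eq_comp (expFlow D (-r)), expFlow_neg_mul]
  simp [sub_eq_add_neg]

/-- Transport from the entry `ξ = 1`. -/
def transportBack (hD : ExpStable D K μ) : C(UnitSquare, F) →L[ℝ] C(UnitSquare, F) :=
  ContinuousMap.compCLM ℝ F swap ∘L transport hD ∘L ContinuousMap.compCLM ℝ F swap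

theorem transportBack_apply (hD : ExpStable D K μ) (f : C(UnitSquare, F)) (p : UnitSquare) :
    transportBack hD f p = transport hD (f.comp swap) (swap p) := rfl

theorem transportBack_norm_le (hD : ExpStable D K μ) (f : C(UnitSquare, F)) :
    ‖transportBack hD f‖ ≤ K / μ * ‖f‖ := by
  have h0 : 0 ≤ K / μ := div_nonneg hD.nonneg hD.1.le
  refine (ContinuousMap.norm_le _ (by positivity)).2 fun p => ?_
  rw [transportBack_apply]
  refine (transportFun_norm_le hD (f.comp swap) _).trans ?_
  gcongr
  exact (ContinuousMap.norm_le _ (norm_nonneg f)).2 fun q => f.norm_coe_le_norm _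

theorem transportBack_entry (hD : ExpStable D K μ) (f : C(UnitSquare, F)) {p : UnitSquare}
    (hp : (p.1 : ℝ) = 1) : transportBack hD f p = 0 :=
  transport_exit hD _ hp

theorem transportBack_hasDerivWithinAt (hD : ExpStable D K μ) (f : C(UnitSquare, F))
    {p : UnitSquare} {h : ℝ} (hh : p.2 * Real.exp h ≤ 1) {r : ℝ} (hr : r ∈ Icc 0 h) :
    HasDerivWithinAt (fun r => transportBack hD f (flow r p))
      (D (transportBack hD f (flow r p)) + f (flow r p)) (Icc 0 h) r := by
  have h0 : 0 ≤ h := hr.1.trans hr.2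
  have hq : ((swap (flow h p)).2 : ℝ) * Real.exp h ≤ 1 := by
    simp only [swap, ContinuousMap.coe_mk, Prod.snd_swap]
    rw [flow_fst h0, mul_assoc, ← Real.exp_add]
    simpa using p.1.2.2
  have h1 := transport_hasDerivWithinAt hD (f.comp swap) hq (r := h - r)
    ⟨by linarith [hr.2], by linarith [hr.1]⟩
  have h2 : HasDerivWithinAt (fun r => h - r) (-1) (Icc 0 h) r := by
    simpa using ((hasDerivAt_id r).const_sub h).hasDerivWithinAt
  have h3 := h1.scomp r h2 (fun s hs => ⟨by linarith [hs.2], by linarith [hs.1]⟩)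
  have key : ∀ r ∈ Icc 0 h, transportBack hD f (flow r p) =
      transport hD (f.comp swap) (flow (h - r) (swap (flow h p))) := by
    intro r hr
    rw [transportBack_apply, swap_flow hr.1 hr.2 hh]
  refine HasDerivWithinAt.congr_deriv (h3.congr key (key r hr)) ?_
  rw [← key r hr, ContinuousMap.comp_apply, ← swap_flow hr.1 hr.2 hh]
  simp [swap, add_comm]

end Transport

end

end

open MeasureTheory UnitSquare

/-! ### The boundary value problem as a fixed point problem on the square -/

noncomputable section

theorem expStable_scalar {F : Type} [NormedAddCommGroup F] [NormedSpace ℝ F] [CompleteSpace F]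
    {μ : ℝ} (hμ : 0 < μ) : ExpStable (-(μ • (1 : F →L[ℝ] F))) 1 μ := by
  refine ⟨hμ, fun r _ => ?_⟩
  have h1 : ∀ v : F, expFlow (-(μ • (1 : F →L[ℝ] F))) r v = Real.exp (-μ * r) • v := by
    intro v
    have hd : ∀ t : ℝ, HasDerivAt (fun t => Real.exp (μ * t) • expFlow (-(μ • (1 : F →L[ℝ] F))) t v)
        0 t := by
      intro t
      have h1 : HasDerivAt (fun t => Real.exp (μ * t)) (Real.exp (μ * t) * (μ * 1)) t :=
        ((hasDerivAt_id t).const_mul μ).exp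
      have h2 := (hasDerivAt_expFlow (-(μ • (1 : F →L[ℝ] F))) t).clm_apply
        (hasDerivAt_const t v)
      refine (h1.smul h2).congr_deriv ?_
      simp [smul_smul]
    have := is_const_of_deriv_eq_zero (fun t => (hd t).differentiableAt)
      (fun t => (hd t).deriv) r 0
    simp only [mul_zero, Real.exp_zero, one_smul, expFlow_zero, one_apply_eq_self] at this
    conv_rhs => rw [← this]
    rw [smul_smul, ← Real.exp_add]
    simp
  refine ContinuousLinearMap.opNorm_le_bound _ (by positivity) fun v => ?_
  rw [h1, norm_smul, Real.norm_of_nonneg (Real.exp_pos _).le, one_mul]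

namespace UnitSquare

/-- The point `(ξη, 1)` at which the hyperbola through `(ξ, η)` leaves the square. -/
def exitPt : C(UnitSquare, UnitSquare) := ⟨fun p => (p.1 * p.2, 1), by fun_prop⟩

/-- The point `(1, ξη)` at which the hyperbola through `(ξ, η)` enters the square. -/
def entryPt : C(UnitSquare, UnitSquare) := ⟨fun p => (1, p.1 * p.2), by fun_prop⟩

/-- The weight `ξ^μ`. -/
def weightFst {μ : ℝ} (hμ : 0 < μ) : C(UnitSquare, ℝ) :=
  ⟨fun p => (p.1 : ℝ) ^ μ, Continuous.rpow_const (by fun_prop) (fun _ => Or.inr hμ.le)⟩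

/-- The weight `η^μ`. -/
def weightSnd {μ : ℝ} (hμ : 0 < μ) : C(UnitSquare, ℝ) :=
  ⟨fun p => (p.2 : ℝ) ^ μ, Continuous.rpow_const (by fun_prop) (fun _ => Or.inr hμ.le)⟩

variable {p : UnitSquare} {r s : ℝ}

theorem flow_exit (h : 0 < (p.2 : ℝ)) : flow (-Real.log p.2) p = exitPt p := by
  have h0 : 0 ≤ -Real.log p.2 := by
    have := Real.log_nonpos p.2.2.1 p.2.2.2; linarith
  have h1 : (p.2 : ℝ) * Real.exp (-Real.log p.2) = 1 := by
    rw [Real.exp_neg, Real.exp_log h, mul_inv_cancel₀ h.ne']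
  ext
  · rw [flow_fst h0, neg_neg, Real.exp_log h]; simp [exitPt]
  · rw [flow_snd h1.le, h1]; simp [exitPt]

theorem mul_exitPt : ((exitPt p).1 : ℝ) * (exitPt p).2 = p.1 * p.2 := by simp [exitPt]

theorem mul_entryPt : ((entryPt p).1 : ℝ) * (entryPt p).2 = p.1 * p.2 := by simp [entryPt]

/-- A continuous function that is constant along the flow on a hyperbola takes its exit value. -/
theorem eq_exitPt_of_flow {F : Type} [TopologicalSpace F] [T2Space F] {e : ℝ}
    (g : C(UnitSquare, F))
    (hg : ∀ p : UnitSquare, (p.1 : ℝ) * p.2 = e → ∀ r, 0 ≤ r → p.2 * Real.exp r ≤ 1 →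
      g (flow r p) = g p) (hp : (p.1 : ℝ) * p.2 = e) : g p = g (exitPt p) := by
  have pos : ∀ p : UnitSquare, (p.1 : ℝ) * p.2 = e → 0 < (p.2 : ℝ) → g p = g (exitPt p) := by
    intro p hp h
    rw [← flow_exit h]
    refine (hg p hp _ ?_ ?_).symm
    · have := Real.log_nonpos p.2.2.1 p.2.2.2; linarith
    · rw [Real.exp_neg, Real.exp_log h, mul_inv_cancel₀ h.ne']
  rcases lt_or_eq_of_le p.2.2.1 with h | h
  · exact pos p hp h
  · have he : e = 0 := by rw [← hp, ← h, mul_zero]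
    have hp2 : p.2 = 0 := Subtype.ext h.symm
    -- A point of the axis η = 0 never reaches the exit. It flows to the corner, where continuity of
    -- g takes over.
    have h0 : g p = g (0, 0) := by
      have ht : Tendsto (fun r => flow r p) atTop (𝓝 (0, 0)) := by
        have hc : Tendsto (fun r => clamp ((p.1 : ℝ) * Real.exp (-r), 0)) atTop
            (𝓝 (clamp (p.1 * 0, 0))) := by
          refine (continuous_clamp.tendsto _).comp (Tendsto.prodMk_nhds ?_ tendsto_const_nhds)
          exact (Real.tendsto_exp_neg_atTop_nhds_zero).const_mul _
        have h2 : clamp (p.1 * 0, 0) = (0, 0) := by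
          simp [clamp, projIcc_left]
        rw [h2] at hc
        refine hc.congr fun r => ?_
        simp [flow, hp2]
      refine tendsto_nhds_unique ?_ ((g.continuous.tendsto _).comp ht)
      refine tendsto_const_nhds.congr' ?_
      filter_upwards [eventually_ge_atTop 0] with r hr
      exact (hg p hp r hr (by simp [hp2])).symm
    -- The corner does not move, so the other axis is entered through the points (0, 1/(n+1)). These
    -- tend to the corner, and all of them flow to (0, 1).
    have h1 : g (0, 0) = g (0, 1) := by
      have ht : Tendsto (fun n : ℕ => ((0, projIcc 0 1 zero_le_one (1 / ((n : ℝ) + 1))) : UnitSquare))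
          atTop (𝓝 (0, 0)) := by
        refine tendsto_const_nhds.prodMk_nhds ?_
        have := ((continuous_projIcc (h := zero_le_one (α := ℝ))).tendsto 0).comp
          tendsto_one_div_add_atTop_nhds_zero_nat
        simpa [Function.comp_def] using this
      refine tendsto_nhds_unique ((g.continuous.tendsto _).comp ht) ?_
      refine tendsto_const_nhds.congr fun n => ?_
      have hpos : (0 : ℝ) < 1 / ((n : ℝ) + 1) := by positivity
      have hle : 1 / ((n : ℝ) + 1) ≤ 1 := by
        rw [div_le_one (by positivity)]; linarith [Nat.cast_nonneg (α := ℝ) n]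
      simp only [Function.comp]
      rw [pos (0, projIcc 0 1 zero_le_one (1 / ((n : ℝ) + 1))) (by simp [he])
        (by rw [projIcc_of_mem zero_le_one ⟨hpos.le, hle⟩]; exact hpos)]
      simp [exitPt]
    rw [h0, h1]; simp [exitPt, hp2]

end UnitSquare

variable (EA EB EC Y Θ : Type)
  [NormedAddCommGroup EA] [NormedSpace ℝ EA] [CompleteSpace EA]
  [NormedAddCommGroup EB] [NormedSpace ℝ EB] [CompleteSpace EB]
  [NormedAddCommGroup EC] [NormedSpace ℝ EC] [CompleteSpace EC]
  [NormedAddCommGroup Y] [NormedSpace ℝ Y] [CompleteSpace Y]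
  [NormedAddCommGroup Θ] [NormedSpace ℝ Θ]

/-- A boundary value problem, in weighted coordinates, for orbits that pass near a normally
hyperbolic manifold of equilibria; all passage times are treated simultaneously. -/
structure CornerProblem where
  n : ℕ
  n_ne_zero : n ≠ 0
  (μ K κ : ℝ)
  DA : EA →L[ℝ] EA
  DB : EB →L[ℝ] EB
  stableA : ExpStable DA K μ
  stableB : ExpStable DB K μ
  -- All explicit dependence on the point of the square passes through θ, which is only continuous.
  -- The nonlinearities are smooth in their arguments, and this is what smoothness in the parameter
  -- y requires.
  θ : C(UnitSquare, Θ)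
  fa : C(Θ × Y × EA × EB × EC, EA)
  fb : C(Θ × Y × EA × EB × EC, EB)
  f₁ : C(Θ × Y × EA × EB × EC, EC)
  f₂ : C(Θ × Y × EA × EB × EC, EC)
  k : C(Θ × Y × EA × EC, EC)
  a₁ : Y → EA
  b₁ : Y → EB
  smooth_fa : ContDiff ℝ n fa
  smooth_fb : ContDiff ℝ n fb
  smooth_f₁ : ContDiff ℝ n f₁
  smooth_f₂ : ContDiff ℝ n f₂
  smooth_k : ContDiff ℝ n k
  smooth_a₁ : ContDiff ℝ n a₁
  smooth_b₁ : ContDiff ℝ n b₁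
  O : Set Y
  isOpen_O : IsOpen O
  lip_fa : ∀ p, ∀ y ∈ O, ∀ x x', ‖fa (θ p, y, x) - fa (θ p, y, x')‖ ≤ κ * ‖x - x'‖
  lip_fb : ∀ p, ∀ y ∈ O, ∀ x x', ‖fb (θ p, y, x) - fb (θ p, y, x')‖ ≤ κ * ‖x - x'‖
  lip_f₁ : ∀ p, ∀ y ∈ O, ∀ x x', ‖f₁ (θ p, y, x) - f₁ (θ p, y, x')‖ ≤ κ * ‖x - x'‖
  lip_f₂ : ∀ p, ∀ y ∈ O, ∀ x x', ‖f₂ (θ p, y, x) - f₂ (θ p, y, x')‖ ≤ κ * ‖x - x'‖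
  -- The constant 2 is 1 for the part of I complementary to the tangent of the entry graph, plus 1
  -- for the graph function. See `ExitGraph.data`.
  lip_k : ∀ p, ∀ y ∈ O, ∀ a a' I I',
    ‖k (θ p, y, a, I) - k (θ p, y, a', I')‖ ≤ κ * ‖a - a'‖ + 2 * ‖I - I'‖
  κ_nonneg : 0 ≤ κ
  κ_small : κ * (K / μ) ≤ 1 / 2
  -- The drift integral has norm 3/μ. It enters the third component once directly and twice through
  -- `k`, which gives 9; the 1 is the dependence of `k` on a.
  κ_small' : κ * (1 + 9 / μ) ≤ 1 / 2

namespace CornerProblem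

variable {EA EB EC Y Θ}
variable (P : CornerProblem EA EB EC Y Θ)

/-- The space of triples of continuous functions on the square. -/
abbrev Triple (EA EB EC : Type) [TopologicalSpace EA] [TopologicalSpace EB] [TopologicalSpace EC] :
    Type := C(UnitSquare, EA) × C(UnitSquare, EB) × C(UnitSquare, EC)

theorem μ_pos : 0 < P.μ := P.stableA.1

/-- The value of a triple at a point. -/
def at' (x : Triple EA EB EC) (p : UnitSquare) : EA × EB × EC := (x.1 p, x.2.1 p, x.2.2 p)

/-- The arguments of the nonlinearities. -/
def pack (u : Y × Triple EA EB EC) : C(UnitSquare, Θ × Y × EA × EB × EC) :=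
  ⟨fun p => (P.θ p, u.1, u.2.1 p, u.2.2.1 p, u.2.2.2 p), by fun_prop⟩

theorem contDiff_pack : ContDiff ℝ P.n P.pack := by
  let c : C(UnitSquare, Θ × Y × EA × EB × EC) := ⟨fun p => (P.θ p, 0, 0, 0, 0), by fun_prop⟩
  let L₁ : Y →L[ℝ] Θ × Y × EA × EB × EC := .inr ℝ _ _ ∘L .inl ℝ _ _
  let L₂ : EA →L[ℝ] Θ × Y × EA × EB × EC := .inr ℝ _ _ ∘L .inr ℝ _ _ ∘L .inl ℝ _ _
  let L₃ : EB →L[ℝ] Θ × Y × EA × EB × EC := .inr ℝ _ _ ∘L .inr ℝ _ _ ∘L .inr ℝ _ _ ∘L .inl ℝ _ _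
  let L₄ : EC →L[ℝ] Θ × Y × EA × EB × EC := .inr ℝ _ _ ∘L .inr ℝ _ _ ∘L .inr ℝ _ _ ∘L .inr ℝ _ _
  have h : P.pack = fun u => c + L₁.compLeftContinuous ℝ UnitSquare (ContinuousLinearMap.const ℝ UnitSquare u.1)
      + L₂.compLeftContinuous ℝ UnitSquare u.2.1 + L₃.compLeftContinuous ℝ UnitSquare u.2.2.1
      + L₄.compLeftContinuous ℝ UnitSquare u.2.2.2 := by
    funext u
    ext p <;> simp [pack, c, L₁, L₂, L₃, L₄]
  rw [h]
  fun_prop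

/-- The arguments of the exit condition. -/
def packK (u : Y × C(UnitSquare, EA) × C(UnitSquare, EC)) : C(UnitSquare, Θ × Y × EA × EC) :=
  ⟨fun p => (P.θ (exitPt p), u.1, u.2.1 (entryPt p), u.2.2 (entryPt p)), by fun_prop⟩

theorem contDiff_packK : ContDiff ℝ P.n P.packK := by
  let c : C(UnitSquare, Θ × Y × EA × EC) := ⟨fun p => (P.θ (exitPt p), 0, 0, 0), by fun_prop⟩
  let L₁ : Y →L[ℝ] Θ × Y × EA × EC := .inr ℝ _ _ ∘L .inl ℝ _ _
  let L₂ : EA →L[ℝ] Θ × Y × EA × EC := .inr ℝ _ _ ∘L .inr ℝ _ _ ∘L .inl ℝ _ _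
  let L₃ : EC →L[ℝ] Θ × Y × EA × EC := .inr ℝ _ _ ∘L .inr ℝ _ _ ∘L .inr ℝ _ _
  have h : P.packK = fun u => c + L₁.compLeftContinuous ℝ UnitSquare (ContinuousLinearMap.const ℝ UnitSquare u.1)
      + L₂.compLeftContinuous ℝ UnitSquare (ContinuousMap.compCLM ℝ EA entryPt u.2.1)
      + L₃.compLeftContinuous ℝ UnitSquare (ContinuousMap.compCLM ℝ EC entryPt u.2.2) := by
    funext u
    ext p <;> simp [packK, c, L₁, L₂, L₃]
  rw [h]
  fun_prop

/-- Multiplication by a fixed scalar function. -/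
def smulCLM {F : Type} [NormedAddCommGroup F] [NormedSpace ℝ F] (w : C(UnitSquare, ℝ)) :
    C(UnitSquare, F) →L[ℝ] C(UnitSquare, F) :=
  ⟨{ toFun := fun f => ⟨fun p => w p • f p, by fun_prop⟩
     map_add' := fun f g => by ext; simp
     map_smul' := fun c f => by ext p; exact smul_comm (w p) c (f p) }, by
    refine AddMonoidHomClass.continuous_of_bound (LinearMap.mk _ _) ‖w‖ fun f => ?_
    refine (ContinuousMap.norm_le _ (by positivity)).2 fun p => ?_
    show ‖w p • f p‖ ≤ _
    rw [norm_smul]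
    gcongr
    · exact w.norm_coe_le_norm p
    · exact f.norm_coe_le_norm p⟩

theorem smulCLM_apply {F : Type} [NormedAddCommGroup F] [NormedSpace ℝ F] (w : C(UnitSquare, ℝ))
    (f : C(UnitSquare, F)) (p : UnitSquare) : smulCLM w f p = w p • f p := rfl

/-- Transport with the scalar generator -μ integrates against e^{-μr}, the factor by which ξ^μ
changes along the flow. The weighted drift integrals are transports of this kind. -/
theorem stableC : ExpStable (-(P.μ • (1 : EC →L[ℝ] EC))) 1 P.μ := expStable_scalar P.μ_pos

/-- The integral of the drift from a point to the exit. -/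
def tail : C(UnitSquare, EC) × C(UnitSquare, EC) →L[ℝ] C(UnitSquare, EC) :=
  -- Drift with weight ξ^μ is integrated forward to the exit. Drift with weight η^μ is integrated
  -- backward from the exit over the whole passage, and the part before the point is subtracted.
  -- Neither integral grows with the length of the passage.
  smulCLM (weightFst P.μ_pos) ∘L transport P.stableC ∘L .snd ℝ _ _ +
  ContinuousMap.compCLM ℝ EC exitPt ∘L transportBack P.stableC ∘L .fst ℝ _ _ -
  smulCLM (weightSnd P.μ_pos) ∘L transportBack P.stableC ∘L .fst ℝ _ _

theorem tail_apply (f : C(UnitSquare, EC) × C(UnitSquare, EC)) (p : UnitSquare) :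
    P.tail f p = (p.1 : ℝ) ^ P.μ • transport P.stableC f.2 p +
      transportBack P.stableC f.1 (exitPt p) -
      (p.2 : ℝ) ^ P.μ • transportBack P.stableC f.1 p := rfl

theorem tail_norm_le (f : C(UnitSquare, EC) × C(UnitSquare, EC)) :
    ‖P.tail f‖ ≤ 3 / P.μ * ‖f‖ := by
  have hμ := P.μ_pos
  refine (ContinuousMap.norm_le _ (by positivity)).2 fun p => ?_
  have hw : ∀ t : unitInterval, ‖(t : ℝ) ^ P.μ‖ ≤ 1 := fun t => by
    rw [Real.norm_of_nonneg (Real.rpow_nonneg t.2.1 _)]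
    exact Real.rpow_le_one t.2.1 t.2.2 hμ.le
  have h1 : ‖transport P.stableC f.2 p‖ ≤ 1 / P.μ * ‖f‖ :=
    ((transport P.stableC f.2).norm_coe_le_norm p).trans ((transport_norm_le P.stableC f.2).trans
      (by gcongr; exact norm_snd_le f))
  have h2 : ∀ p, ‖transportBack P.stableC f.1 p‖ ≤ 1 / P.μ * ‖f‖ := fun p =>
    ((transportBack P.stableC f.1).norm_coe_le_norm p).trans
      ((transportBack_norm_le P.stableC f.1).trans (by gcongr; exact norm_fst_le f))
  rw [tail_apply]
  have h3 : ∀ (c : ℝ) (v : EC), ‖c‖ ≤ 1 → ‖v‖ ≤ 1 / P.μ * ‖f‖ → ‖c • v‖ ≤ 1 / P.μ * ‖f‖ := by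
    intro c v hc hv
    rw [norm_smul]
    exact (mul_le_of_le_one_left (norm_nonneg v) hc).trans hv
  calc _ ≤ ‖(p.1 : ℝ) ^ P.μ • transport P.stableC f.2 p‖ +
        ‖transportBack P.stableC f.1 (exitPt p)‖ +
        ‖(p.2 : ℝ) ^ P.μ • transportBack P.stableC f.1 p‖ :=
          (norm_sub_le _ _).trans (add_le_add_left (norm_add_le _ _) _)
    _ ≤ 1 / P.μ * ‖f‖ + 1 / P.μ * ‖f‖ + 1 / P.μ * ‖f‖ :=
          add_le_add (add_le_add (h3 _ _ (hw _) h1) (h2 _)) (h3 _ _ (hw _) (h2 _))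
    _ = _ := by ring

/-- The drift terms along a triple. -/
def drift (u : Y × Triple EA EB EC) : C(UnitSquare, EC) × C(UnitSquare, EC) :=
  (P.f₁.comp (P.pack u), P.f₂.comp (P.pack u))

/-- The fixed point operator. -/
def op (u : Y × Triple EA EB EC) : Triple EA EB EC :=
  -- Transport vanishes at the exit, so the constant carries the boundary value. The correction of
  -- the integrand by `DA` applied to it restores the differential equation.
  (ContinuousLinearMap.const ℝ UnitSquare (P.a₁ u.1) - transport P.stableA
      (P.fa.comp (P.pack u) - ContinuousLinearMap.const ℝ UnitSquare (P.DA (P.a₁ u.1))),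
    ContinuousLinearMap.const ℝ UnitSquare (P.b₁ u.1) + transportBack P.stableB
      (P.fb.comp (P.pack u) + ContinuousLinearMap.const ℝ UnitSquare (P.DB (P.b₁ u.1))),
    -- The exit value minus the remaining drift. The first term is constant on each hyperbola,
    -- because `packK` evaluates at its entry and exit points only.
    P.k.comp (P.packK (u.1, u.2.1, P.tail (P.drift u))) - P.tail (P.drift u))

theorem contDiff_drift : ContDiff ℝ P.n P.drift :=
  ((contDiff_comp_continuousMap P.n P.f₁ P.smooth_f₁).comp P.contDiff_pack).prodMk
    ((contDiff_comp_continuousMap P.n P.f₂ P.smooth_f₂).comp P.contDiff_pack)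

theorem contDiff_op : ContDiff ℝ P.n P.op := by
  have ha : ContDiff ℝ P.n (fun u : Y × Triple EA EB EC => P.a₁ u.1) :=
    P.smooth_a₁.comp contDiff_fst
  have hb : ContDiff ℝ P.n (fun u : Y × Triple EA EB EC => P.b₁ u.1) :=
    P.smooth_b₁.comp contDiff_fst
  have hfa := (contDiff_comp_continuousMap P.n P.fa P.smooth_fa).comp P.contDiff_pack
  have hfb := (contDiff_comp_continuousMap P.n P.fb P.smooth_fb).comp P.contDiff_pack
  have ht : ContDiff ℝ P.n (fun u => P.tail (P.drift u)) := P.tail.contDiff.comp P.contDiff_drift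
  have hk : ContDiff ℝ P.n (fun u : Y × Triple EA EB EC =>
      P.k.comp (P.packK (u.1, u.2.1, P.tail (P.drift u)))) :=
    (contDiff_comp_continuousMap P.n P.k P.smooth_k).comp (P.contDiff_packK.comp
      (contDiff_fst.prodMk ((contDiff_fst.comp contDiff_snd).prodMk ht)))
  refine ContDiff.prodMk ?_ (ContDiff.prodMk ?_ (hk.sub ht))
  · exact ((ContinuousLinearMap.const ℝ UnitSquare).contDiff.comp ha).sub
      ((transport P.stableA).contDiff.comp (hfa.sub
        ((ContinuousLinearMap.const ℝ UnitSquare).contDiff.comp (P.DA.contDiff.comp ha))))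
  · exact ((ContinuousLinearMap.const ℝ UnitSquare).contDiff.comp hb).add
      ((transportBack P.stableB).contDiff.comp (hfb.add
        ((ContinuousLinearMap.const ℝ UnitSquare).contDiff.comp (P.DB.contDiff.comp hb))))

theorem comp_pack_sub_le {F : Type} [NormedAddCommGroup F]
    (f : C(Θ × Y × EA × EB × EC, F)) {y : Y}
    (hf : ∀ p x x', ‖f (P.θ p, y, x) - f (P.θ p, y, x')‖ ≤ P.κ * ‖x - x'‖)
    (x x' : Triple EA EB EC) :
    ‖f.comp (P.pack (y, x)) - f.comp (P.pack (y, x'))‖ ≤ P.κ * ‖x - x'‖ := by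
  have hκ := P.κ_nonneg
  refine (ContinuousMap.norm_le _ (by positivity)).2 fun p => ?_
  refine (hf p (at' x p) (at' x' p)).trans ?_
  gcongr
  refine norm_prod_le_iff.2 ⟨?_, norm_prod_le_iff.2 ⟨?_, ?_⟩⟩
  · exact ((x - x').1.norm_coe_le_norm p).trans (norm_fst_le (x - x'))
  · exact ((x - x').2.1.norm_coe_le_norm p).trans
      ((norm_fst_le (x - x').2).trans (norm_snd_le (x - x')))
  · exact ((x - x').2.2.norm_coe_le_norm p).trans
      ((norm_snd_le (x - x').2).trans (norm_snd_le (x - x')))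

theorem op_lipschitz {y : Y} (hy : y ∈ P.O) (x x' : Triple EA EB EC) :
    ‖P.op (y, x) - P.op (y, x')‖ ≤ 1 / 2 * ‖x - x'‖ := by
  have hκ := P.κ_nonneg
  have hμ := P.μ_pos
  have hKμ : 0 ≤ P.K / P.μ := div_nonneg P.stableA.nonneg hμ.le
  have hfin : P.K / P.μ * (P.κ * ‖x - x'‖) ≤ 1 / 2 * ‖x - x'‖ := by
    rw [← mul_assoc, mul_comm _ P.κ]
    exact mul_le_mul_of_nonneg_right P.κ_small (norm_nonneg _)
  have hdrift : ‖P.tail (P.drift (y, x)) - P.tail (P.drift (y, x'))‖ ≤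
      3 / P.μ * (P.κ * ‖x - x'‖) := by
    rw [← map_sub]
    refine (P.tail_norm_le _).trans ?_
    gcongr
    exact norm_prod_le_iff.2 ⟨P.comp_pack_sub_le P.f₁ (fun p => P.lip_f₁ p y hy) x x',
      P.comp_pack_sub_le P.f₂ (fun p => P.lip_f₂ p y hy) x x'⟩
  refine norm_prod_le_iff.2 ⟨?_, norm_prod_le_iff.2 ⟨?_, ?_⟩⟩
  · have h : (P.op (y, x) - P.op (y, x')).1 = -(transport P.stableA
        (P.fa.comp (P.pack (y, x)) - P.fa.comp (P.pack (y, x')))) := by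
      simp only [op, Prod.fst_sub, map_sub]; abel
    rw [h, norm_neg]
    refine (transport_norm_le _ _).trans (le_trans ?_ hfin)
    gcongr
    exact P.comp_pack_sub_le P.fa (fun p => P.lip_fa p y hy) x x'
  · have h : (P.op (y, x) - P.op (y, x')).2.1 = transportBack P.stableB
        (P.fb.comp (P.pack (y, x)) - P.fb.comp (P.pack (y, x'))) := by
      simp only [op, Prod.snd_sub, Prod.fst_sub, map_sub, map_add]; abel
    rw [h]
    refine (transportBack_norm_le _ _).trans (le_trans ?_ hfin)
    gcongr
    exact P.comp_pack_sub_le P.fb (fun p => P.lip_fb p y hy) x x'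
  · have h : (P.op (y, x) - P.op (y, x')).2.2 =
        (P.k.comp (P.packK (y, x.1, P.tail (P.drift (y, x)))) -
          P.k.comp (P.packK (y, x'.1, P.tail (P.drift (y, x'))))) -
        (P.tail (P.drift (y, x)) - P.tail (P.drift (y, x'))) := by
      simp only [op, Prod.snd_sub]; abel
    have hk : ‖P.k.comp (P.packK (y, x.1, P.tail (P.drift (y, x)))) -
          P.k.comp (P.packK (y, x'.1, P.tail (P.drift (y, x'))))‖ ≤
        P.κ * ‖x - x'‖ + 2 * (3 / P.μ * (P.κ * ‖x - x'‖)) := by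
      refine (ContinuousMap.norm_le _ (by positivity)).2 fun p => ?_
      refine (P.lip_k (exitPt p) y hy _ _ _ _).trans ?_
      gcongr
      · exact ((x - x').1.norm_coe_le_norm _).trans (norm_fst_le (x - x'))
      · exact ((P.tail (P.drift (y, x)) - P.tail (P.drift (y, x'))).norm_coe_le_norm _).trans hdrift
    rw [h]
    calc _ ≤ _ := norm_sub_le _ _
      _ ≤ P.κ * ‖x - x'‖ + 2 * (3 / P.μ * (P.κ * ‖x - x'‖)) + 3 / P.μ * (P.κ * ‖x - x'‖) :=
          add_le_add hk hdrift
      _ = P.κ * (1 + 9 / P.μ) * ‖x - x'‖ := by ring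
      _ ≤ _ := mul_le_mul_of_nonneg_right P.κ_small' (norm_nonneg _)

theorem exists_solution : ∃ ψ : Y → Triple EA EB EC, ContDiffOn ℝ P.n ψ P.O ∧
    ∀ y ∈ P.O, P.op (y, ψ y) = ψ y :=
  exists_contDiffOn_fixedPoint P.n_ne_zero P.op P.contDiff_op P.O
    (fun _ hy => P.op_lipschitz hy) P.isOpen_O

/-- The solution of the boundary value problem. -/
def sol : Y → Triple EA EB EC := P.exists_solution.choose

theorem contDiffOn_sol : ContDiffOn ℝ P.n P.sol P.O := P.exists_solution.choose_spec.1

theorem op_sol {y : Y} (hy : y ∈ P.O) : P.op (y, P.sol y) = P.sol y :=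
  P.exists_solution.choose_spec.2 y hy

/-- The flow preserves ξη, so the integral at p sees only the hyperbola through p. This allows
uniqueness to be tested on one passage time at a time. -/
theorem transport_local {F : Type} [NormedAddCommGroup F] [NormedSpace ℝ F] [CompleteSpace F]
    {D : F →L[ℝ] F} {K μ e : ℝ} (hD : ExpStable D K μ) {f g : C(UnitSquare, F)}
    (hfg : ∀ p : UnitSquare, (p.1 : ℝ) * p.2 = e → f p = g p) {p : UnitSquare}
    (hp : (p.1 : ℝ) * p.2 = e) : transport hD f p = transport hD g p := by
  refine setIntegral_congr_fun measurableSet_Ioi fun r hr => ?_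
  simp only [transportIntegrand]
  split_ifs with h
  · rw [hfg _ ((flow_mul (le_of_lt hr) h).trans hp)]
  · rfl

theorem transportBack_local {F : Type} [NormedAddCommGroup F] [NormedSpace ℝ F] [CompleteSpace F]
    {D : F →L[ℝ] F} {K μ e : ℝ} (hD : ExpStable D K μ) {f g : C(UnitSquare, F)}
    (hfg : ∀ p : UnitSquare, (p.1 : ℝ) * p.2 = e → f p = g p) {p : UnitSquare}
    (hp : (p.1 : ℝ) * p.2 = e) : transportBack hD f p = transportBack hD g p :=
  transport_local (e := e) hD (fun q hq => hfg (swap q) ((mul_comm _ _).trans hq))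
    (p := swap p) ((mul_comm _ _).trans hp)

/-- The operator acts on each hyperbola separately. -/
theorem op_local {e : ℝ} {y : Y} {x x' : Triple EA EB EC}
    (h : ∀ p : UnitSquare, (p.1 : ℝ) * p.2 = e → at' x p = at' x' p) {p : UnitSquare}
    (hp : (p.1 : ℝ) * p.2 = e) : at' (P.op (y, x)) p = at' (P.op (y, x')) p := by
  have hpack : ∀ p : UnitSquare, (p.1 : ℝ) * p.2 = e → P.pack (y, x) p = P.pack (y, x') p := by
    intro p hp
    have := h p hp
    simp only [at', Prod.mk.injEq] at this
    simp [pack, this]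
  have htail : ∀ p : UnitSquare, (p.1 : ℝ) * p.2 = e →
      P.tail (P.drift (y, x)) p = P.tail (P.drift (y, x')) p := by
    intro p hp
    have h1 : ∀ p : UnitSquare, (p.1 : ℝ) * p.2 = e →
        (P.drift (y, x)).1 p = (P.drift (y, x')).1 p := fun p hp => by simp [drift, hpack p hp]
    have h2 : ∀ p : UnitSquare, (p.1 : ℝ) * p.2 = e →
        (P.drift (y, x)).2 p = (P.drift (y, x')).2 p := fun p hp => by simp [drift, hpack p hp]
    rw [tail_apply, tail_apply, transport_local P.stableC h2 hp,
      transportBack_local P.stableC h1 hp,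
      transportBack_local P.stableC h1 (mul_exitPt.trans hp)]
  refine Prod.ext ?_ (Prod.ext ?_ ?_)
  · have hA : transport P.stableA (P.fa.comp (P.pack (y, x)) -
        ContinuousLinearMap.const ℝ UnitSquare (P.DA (P.a₁ y))) p =
        transport P.stableA (P.fa.comp (P.pack (y, x')) -
        ContinuousLinearMap.const ℝ UnitSquare (P.DA (P.a₁ y))) p :=
      transport_local (e := e) P.stableA (fun p hp => by simp [hpack p hp]) hp
    simp only [at', op, ContinuousMap.sub_apply]
    rw [hA]
  · have hB : transportBack P.stableB (P.fb.comp (P.pack (y, x)) +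
        ContinuousLinearMap.const ℝ UnitSquare (P.DB (P.b₁ y))) p =
        transportBack P.stableB (P.fb.comp (P.pack (y, x')) +
        ContinuousLinearMap.const ℝ UnitSquare (P.DB (P.b₁ y))) p :=
      transportBack_local (e := e) P.stableB (fun p hp => by simp [hpack p hp]) hp
    simp only [at', op, ContinuousMap.add_apply]
    rw [hB]
  · have h3 := h _ (mul_entryPt.trans hp)
    simp only [at', Prod.mk.injEq] at h3
    simp only [at', op, ContinuousMap.sub_apply, ContinuousMap.comp_apply]
    rw [htail p hp]
    congr 2
    simp [packK, h3.1, htail _ (mul_entryPt.trans hp)]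

/-- A triple that solves the fixed point equation on a hyperbola is the solution there. -/
theorem sol_eq_of_op_eq {e : ℝ} {y : Y} (hy : y ∈ P.O) {x : Triple EA EB EC}
    (h : ∀ p : UnitSquare, (p.1 : ℝ) * p.2 = e → at' (P.op (y, x)) p = at' x p) {p : UnitSquare}
    (hp : (p.1 : ℝ) * p.2 = e) : at' (P.sol y) p = at' x p := by
  have hc : ContractingWith (1 / 2) (fun x => P.op (y, x)) :=
    ⟨by norm_num, LipschitzWith.of_dist_le_mul fun x x' => by
      simpa [dist_eq_norm] using P.op_lipschitz hy x x'⟩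
  -- The iterates of the contraction starting at x never change x on the hyperbola, while they
  -- converge to the solution.
  have hit : ∀ n : ℕ, ∀ p : UnitSquare, (p.1 : ℝ) * p.2 = e →
      at' ((fun x => P.op (y, x))^[n] x) p = at' x p := by
    intro n
    induction n with
    | zero => intro p _; rfl
    | succ n ih =>
      intro p hp
      rw [Function.iterate_succ_apply']
      exact (P.op_local ih hp).trans (h p hp)
  have hlim := hc.tendsto_iterate_fixedPoint x
  rw [← hc.fixedPoint_unique (show Function.IsFixedPt _ _ from P.op_sol hy)] at hlim
  have hcont : Continuous (fun x : Triple EA EB EC => at' x p) := by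
    unfold at'
    exact (((ContinuousMap.evalCLM ℝ p).continuous.comp continuous_fst).prodMk
      (((ContinuousMap.evalCLM ℝ p).continuous.comp (continuous_fst.comp continuous_snd)).prodMk
        ((ContinuousMap.evalCLM ℝ p).continuous.comp (continuous_snd.comp continuous_snd))))
  refine tendsto_nhds_unique ((hcont.tendsto _).comp hlim) ?_
  exact tendsto_const_nhds.congr fun n => (hit n p hp).symm

end CornerProblem

end

/-! ### Evolution equations and boundary conditions characterize the solution -/

noncomputable section

namespace UnitSquare

variable {p : UnitSquare} {r h : ℝ}

theorem exitPt_flow (hr : 0 ≤ r) (h : p.2 * Real.exp r ≤ 1) : exitPt (flow r p) = exitPt p := by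
  ext
  · simpa [exitPt] using flow_mul hr h
  · rfl

theorem entryPt_flow (hr : 0 ≤ r) (h : p.2 * Real.exp r ≤ 1) :
    entryPt (flow r p) = entryPt p := by
  ext
  · rfl
  · simpa [entryPt] using flow_mul hr h

theorem hasDerivWithinAt_fst_rpow (μ : ℝ) (hr : r ∈ Icc 0 h) :
    HasDerivWithinAt (fun r => ((flow r p).1 : ℝ) ^ μ) (-μ * ((flow r p).1 : ℝ) ^ μ) (Icc 0 h) r := by
  have key : ∀ r ∈ Icc 0 h, ((flow r p).1 : ℝ) ^ μ = (p.1 : ℝ) ^ μ * Real.exp (-μ * r) := by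
    intro r hr
    rw [flow_fst hr.1, Real.mul_rpow p.1.2.1 (Real.exp_pos _).le, ← Real.exp_mul]
    ring_nf
  have h1 : HasDerivAt (fun r => (p.1 : ℝ) ^ μ * Real.exp (-μ * r))
      ((p.1 : ℝ) ^ μ * (Real.exp (-μ * r) * (-μ * 1))) r :=
    (((hasDerivAt_id r).const_mul (-μ)).exp).const_mul _
  refine (h1.hasDerivWithinAt.congr key (key r hr)).congr_deriv ?_
  rw [key r hr]; ring

theorem hasDerivWithinAt_snd_rpow (μ : ℝ) (hh : p.2 * Real.exp h ≤ 1) (hr : r ∈ Icc 0 h) :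
    HasDerivWithinAt (fun r => ((flow r p).2 : ℝ) ^ μ) (μ * ((flow r p).2 : ℝ) ^ μ) (Icc 0 h) r := by
  have key : ∀ r ∈ Icc 0 h, ((flow r p).2 : ℝ) ^ μ = (p.2 : ℝ) ^ μ * Real.exp (μ * r) := by
    intro r hr
    rw [flow_snd (le_one_of_le hh hr.2), Real.mul_rpow p.2.2.1 (Real.exp_pos _).le, ← Real.exp_mul]
    ring_nf
  have h1 : HasDerivAt (fun r => (p.2 : ℝ) ^ μ * Real.exp (μ * r))
      ((p.2 : ℝ) ^ μ * (Real.exp (μ * r) * (μ * 1))) r :=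
    (((hasDerivAt_id r).const_mul μ).exp).const_mul _
  refine (h1.hasDerivWithinAt.congr key (key r hr)).congr_deriv ?_
  rw [key r hr]; ring

end UnitSquare

namespace CornerProblem

variable {EA EB EC Y Θ : Type}
  [NormedAddCommGroup EA] [NormedSpace ℝ EA] [CompleteSpace EA]
  [NormedAddCommGroup EB] [NormedSpace ℝ EB] [CompleteSpace EB]
  [NormedAddCommGroup EC] [NormedSpace ℝ EC] [CompleteSpace EC]
  [NormedAddCommGroup Y] [NormedSpace ℝ Y] [CompleteSpace Y]
  [NormedAddCommGroup Θ] [NormedSpace ℝ Θ]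
  (P : CornerProblem EA EB EC Y Θ) {y : Y} {x : Triple EA EB EC} {p : UnitSquare} {r h e : ℝ}

/-- The evolution equations along the flow on hyperbolas, with nonlinearities evaluated at `x`. -/
structure Evolves (y : Y) (x z : Triple EA EB EC) (p : UnitSquare) (h : ℝ) : Prop where
  fst : ∀ r ∈ Icc 0 h, HasDerivWithinAt (fun r => z.1 (flow r p))
    (-(P.DA (z.1 (flow r p))) + P.fa (P.pack (y, x) (flow r p))) (Icc 0 h) r
  snd : ∀ r ∈ Icc 0 h, HasDerivWithinAt (fun r => z.2.1 (flow r p))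
    (P.DB (z.2.1 (flow r p)) + P.fb (P.pack (y, x) (flow r p))) (Icc 0 h) r
  thd : ∀ r ∈ Icc 0 h, HasDerivWithinAt (fun r => z.2.2 (flow r p))
    (((flow r p).2 : ℝ) ^ P.μ • P.f₁ (P.pack (y, x) (flow r p)) +
      ((flow r p).1 : ℝ) ^ P.μ • P.f₂ (P.pack (y, x) (flow r p))) (Icc 0 h) r

theorem tail_hasDerivWithinAt (f : C(UnitSquare, EC) × C(UnitSquare, EC))
    (hh : p.2 * Real.exp h ≤ 1) (hr : r ∈ Icc 0 h) :
    HasDerivWithinAt (fun r => P.tail f (flow r p))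
      (-(((flow r p).2 : ℝ) ^ P.μ • f.1 (flow r p) + ((flow r p).1 : ℝ) ^ P.μ • f.2 (flow r p)))
      (Icc 0 h) r := by
  have h1 := (hasDerivWithinAt_fst_rpow (p := p) P.μ hr).smul
    (transport_hasDerivWithinAt P.stableC f.2 hh hr)
  have h2 := (hasDerivWithinAt_snd_rpow P.μ hh hr).smul
    (transportBack_hasDerivWithinAt P.stableC f.1 hh hr)
  have key : ∀ r ∈ Icc 0 h, P.tail f (flow r p) = ((flow r p).1 : ℝ) ^ P.μ •
      transport P.stableC f.2 (flow r p) - ((flow r p).2 : ℝ) ^ P.μ •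
      transportBack P.stableC f.1 (flow r p) + transportBack P.stableC f.1 (exitPt p) := by
    intro r hr
    rw [tail_apply, exitPt_flow hr.1 (le_one_of_le hh hr.2)]; abel
  refine (((h1.sub h2).add_const _).congr key (key r hr)).congr_deriv ?_
  simp only [_root_.neg_apply, _root_.smul_apply,
    one_apply_eq_self, smul_add, smul_sub, smul_neg, smul_smul, mul_comm]
  simp only [neg_neg]
  module

theorem tail_exit (f : C(UnitSquare, EC) × C(UnitSquare, EC)) (hp : (p.2 : ℝ) = 1) :
    P.tail f p = 0 := by
  have : exitPt p = p := by
    ext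
    · simp [exitPt, hp]
    · simp [exitPt, hp]
  rw [tail_apply, transport_exit P.stableC _ hp, this, hp]
  simp

theorem op_evolves (y : Y) (x : Triple EA EB EC) (hh : p.2 * Real.exp h ≤ 1) :
    P.Evolves y x (P.op (y, x)) p h where
  fst r hr := by
    have h1 := (transport_hasDerivWithinAt P.stableA (P.fa.comp (P.pack (y, x)) -
      ContinuousLinearMap.const ℝ UnitSquare (P.DA (P.a₁ y))) hh hr).const_sub (P.a₁ y)
    refine h1.congr_deriv ?_
    simp [op]; abel
  snd r hr := by
    have h1 := (transportBack_hasDerivWithinAt P.stableB (P.fb.comp (P.pack (y, x)) +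
      ContinuousLinearMap.const ℝ UnitSquare (P.DB (P.b₁ y))) hh hr).const_add (P.b₁ y)
    refine h1.congr_deriv ?_
    simp [op]; abel
  thd r hr := by
    have h1 := (P.tail_hasDerivWithinAt (P.drift (y, x)) hh hr).const_sub
      (P.k (P.packK (y, x.1, P.tail (P.drift (y, x))) p))
    have key : ∀ r ∈ Icc 0 h, (P.op (y, x)).2.2 (flow r p) =
        P.k (P.packK (y, x.1, P.tail (P.drift (y, x))) p) - P.tail (P.drift (y, x)) (flow r p) := by
      intro r hr
      simp [op, packK, exitPt_flow hr.1 (le_one_of_le hh hr.2),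
        entryPt_flow hr.1 (le_one_of_le hh hr.2)]
    refine (h1.congr key (key r hr)).congr_deriv ?_
    simp [drift]

theorem op_fst_exit (hp : (p.2 : ℝ) = 1) : (P.op (y, x)).1 p = P.a₁ y := by
  simp only [op, ContinuousMap.sub_apply]
  rw [transport_exit P.stableA _ hp]; simp

theorem op_snd_entry (hp : (p.1 : ℝ) = 1) : (P.op (y, x)).2.1 p = P.b₁ y := by
  simp only [op, ContinuousMap.add_apply]
  rw [transportBack_entry P.stableB _ hp]; simp

theorem sol_evolves (hy : y ∈ P.O) (hh : p.2 * Real.exp h ≤ 1) :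
    P.Evolves y (P.sol y) (P.sol y) p h := by
  have := P.op_evolves y (P.sol y) hh
  rwa [P.op_sol hy] at this

theorem sol_fst_exit (hy : y ∈ P.O) (hp : (p.2 : ℝ) = 1) : (P.sol y).1 p = P.a₁ y := by
  rw [← P.op_sol hy]; exact P.op_fst_exit hp

theorem sol_snd_entry (hy : y ∈ P.O) (hp : (p.1 : ℝ) = 1) : (P.sol y).2.1 p = P.b₁ y := by
  rw [← P.op_sol hy]; exact P.op_snd_entry hp

/-- The fixed point equation is read at both ends of the hyperbola. The drift integral vanishes at
the exit, so at the entry it equals the difference of the two values of the third component, and the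
auxiliary integral can be eliminated. -/
theorem sol_thd_exit (hy : y ∈ P.O) (p : UnitSquare) : (P.sol y).2.2 (exitPt p) =
    P.k (P.θ (exitPt p), y, (P.sol y).1 (entryPt p),
      (P.sol y).2.2 (exitPt p) - (P.sol y).2.2 (entryPt p)) := by
  have h1 : ∀ q, (P.sol y).2.2 q = P.k (P.θ (exitPt q), y, (P.sol y).1 (entryPt q),
      P.tail (P.drift (y, P.sol y)) (entryPt q)) - P.tail (P.drift (y, P.sol y)) q := by
    intro q
    conv_lhs => rw [← P.op_sol hy]
    rfl
  have e1 : exitPt (exitPt p) = exitPt p := by ext <;> simp [exitPt]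
  have e2 : entryPt (exitPt p) = entryPt p := by ext <;> simp [exitPt, entryPt]
  have e3 : exitPt (entryPt p) = exitPt p := by ext <;> simp [exitPt, entryPt]
  have e4 : entryPt (entryPt p) = entryPt p := by ext <;> simp [entryPt]
  have h2 := h1 (exitPt p)
  have h3 := h1 (entryPt p)
  rw [P.tail_exit (p := exitPt p) _ (by simp [exitPt]), sub_zero, e1, e2] at h2
  rw [e3, e4, ← h2] at h3
  have h4 : P.tail (P.drift (y, P.sol y)) (entryPt p) =
      (P.sol y).2.2 (exitPt p) - (P.sol y).2.2 (entryPt p) := by rw [h3]; abel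
  rw [h4] at h2
  exact h2

/-- Decaying solutions of the homogeneous equation vanish. -/
theorem eq_zero_of_evolves_neg {F : Type} [NormedAddCommGroup F] [NormedSpace ℝ F]
    [CompleteSpace F] {D : F →L[ℝ] F} {K μ : ℝ} (hD : ExpStable D K μ) (d : C(UnitSquare, F))
    (hd : ∀ p : UnitSquare, (p.1 : ℝ) * p.2 = e → ∀ h, 0 ≤ h → p.2 * Real.exp h ≤ 1 →
      d p = expFlow D h (d (flow h p)))
    (hexit : ∀ p : UnitSquare, (p.1 : ℝ) * p.2 = e → (p.2 : ℝ) = 1 → d p = 0)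
    (hp : (p.1 : ℝ) * p.2 = e) : d p = 0 := by
  rcases lt_or_eq_of_le p.2.2.1 with h | h
  · have h0 : 0 ≤ -Real.log p.2 := by
      have := Real.log_nonpos p.2.2.1 p.2.2.2; linarith
    have h1 : (p.2 : ℝ) * Real.exp (-Real.log p.2) ≤ 1 := by
      rw [Real.exp_neg, Real.exp_log h, mul_inv_cancel₀ h.ne']
    rw [hd p hp _ h0 h1, flow_exit h, hexit _ (mul_exitPt.trans hp) (by simp [exitPt]), map_zero]
  -- On the axis η = 0 there is no exit condition. It is replaced by boundedness: d p is the image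
  -- of a bounded value under an operator of norm at most K e^{-μr}, for every r.
  · have hb : ∀ r : ℝ, 0 ≤ r → ‖d p‖ ≤ K * Real.exp (-μ * r) * ‖d‖ := by
      intro r hr
      rw [hd p hp r hr (by rw [← h]; simp)]
      exact (ContinuousLinearMap.le_of_opNorm_le_of_le _ (hD.2 r hr) (d.norm_coe_le_norm _))
    have hlim : Tendsto (fun r : ℝ => K * Real.exp (-μ * r) * ‖d‖) atTop (𝓝 (K * 0 * ‖d‖)) := by
      refine Tendsto.mul_const _ (Tendsto.const_mul _ ?_)
      refine Real.tendsto_exp_atBot.comp ?_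
      exact tendsto_id.const_mul_atTop_of_neg (by linarith [hD.1])
    have := ge_of_tendsto hlim (by filter_upwards [eventually_ge_atTop 0] with r hr using hb r hr)
    simpa using this

/-- A triple that satisfies the evolution equations and the boundary conditions on a hyperbola is
the solution there. -/
theorem sol_eq_of_evolves (hy : y ∈ P.O)
    (hev : ∀ p : UnitSquare, (p.1 : ℝ) * p.2 = e → ∀ h, 0 ≤ h → p.2 * Real.exp h ≤ 1 →
      P.Evolves y x x p h)
    (hA : ∀ p : UnitSquare, (p.1 : ℝ) * p.2 = e → (p.2 : ℝ) = 1 → x.1 p = P.a₁ y)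
    (hB : ∀ p : UnitSquare, (p.1 : ℝ) * p.2 = e → (p.1 : ℝ) = 1 → x.2.1 p = P.b₁ y)
    (hC : ∀ p : UnitSquare, (p.1 : ℝ) * p.2 = e → x.2.2 (exitPt p) =
      P.k (P.θ (exitPt p), y, x.1 (entryPt p), x.2.2 (exitPt p) - x.2.2 (entryPt p)))
    (hp : (p.1 : ℝ) * p.2 = e) : at' (P.sol y) p = at' x p := by
  refine P.sol_eq_of_op_eq hy (fun p hp => ?_) hp
  have hop : ∀ p : UnitSquare, ∀ h, p.2 * Real.exp h ≤ 1 → P.Evolves y x (P.op (y, x)) p h :=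
    fun p h hh => P.op_evolves y x hh
  have hα : (P.op (y, x)).1 p - x.1 p = 0 := by
    refine eq_zero_of_evolves_neg P.stableA ((P.op (y, x)).1 - x.1) ?_ ?_ hp
    · intro p hp h h0 hh
      have hd : ∀ r ∈ Icc 0 h, HasDerivWithinAt (fun r => ((P.op (y, x)).1 - x.1) (flow r p))
          ((-P.DA) (((P.op (y, x)).1 - x.1) (flow r p))) (Icc 0 h) r := by
        intro r hr
        refine (((hop p h hh).fst r hr).sub ((hev p hp h h0 hh).fst r hr)).congr_deriv ?_
        simp only [ContinuousMap.sub_apply, _root_.neg_apply, map_sub]; abel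
      have := eq_expFlow_of_hasDerivWithinAt (-P.DA) hd (r := h) ⟨h0, le_rfl⟩
      rw [flow_zero] at this
      rw [this, ← mul_apply_eq_comp]
      have h2 : expFlow (-P.DA) h = expFlow P.DA (-h) := by simp [expFlow]
      rw [h2, ← expFlow_add, add_neg_cancel, expFlow_zero]; rfl
    · intro p hp h1
      rw [ContinuousMap.sub_apply, P.op_fst_exit h1, hA p hp h1, sub_self]
  have hβ : (P.op (y, x)).2.1 p - x.2.1 p = 0 := by
    have := eq_zero_of_evolves_neg (e := e) (p := swap p) P.stableB
      (((P.op (y, x)).2.1 - x.2.1).comp swap) ?_ ?_ ((mul_comm _ _).trans hp)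
    · exact this
    · intro q hq h h0 hh
      have hq' : ((swap (flow h q)).1 : ℝ) * (swap (flow h q)).2 = e :=
        (mul_comm _ _).trans ((flow_mul h0 hh).trans hq)
      have hs := swap_flow (p := q) (r := 0) le_rfl h0 hh
      rw [flow_zero, sub_zero] at hs
      have hh' : ((swap (flow h q)).2 : ℝ) * Real.exp h ≤ 1 := by
        simp only [swap, ContinuousMap.coe_mk, Prod.snd_swap]
        rw [flow_fst h0, mul_assoc, ← Real.exp_add]
        simpa using q.1.2.2
      have hd : ∀ r ∈ Icc 0 h, HasDerivWithinAt
          (fun r => ((P.op (y, x)).2.1 - x.2.1) (flow r (swap (flow h q))))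
          (P.DB (((P.op (y, x)).2.1 - x.2.1) (flow r (swap (flow h q))))) (Icc 0 h) r := by
        intro r hr
        refine (((hop _ h hh').snd r hr).sub ((hev _ hq' h h0 hh').snd r hr)).congr_deriv ?_
        simp only [ContinuousMap.sub_apply, map_sub]; abel
      have := eq_expFlow_of_hasDerivWithinAt P.DB hd (r := h) ⟨h0, le_rfl⟩
      rw [flow_zero, ← hs] at this
      exact this
    · intro q hq h1
      rw [ContinuousMap.comp_apply, ContinuousMap.sub_apply, P.op_snd_entry (p := swap q) h1,
        hB (swap q) ((mul_comm _ _).trans hq) h1, sub_self]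
  -- Third component plus remaining drift has derivative zero along the flow. It is therefore
  -- constant on the hyperbola, through the corner too when e = 0.
  have hconst : ∀ p : UnitSquare, (p.1 : ℝ) * p.2 = e →
      (x.2.2 + P.tail (P.drift (y, x))) p = (x.2.2 + P.tail (P.drift (y, x))) (exitPt p) := by
    intro p hp
    refine eq_exitPt_of_flow _ (fun p hp h h0 hh => ?_) hp
    have hd : ∀ r ∈ Icc 0 h, HasDerivWithinAt
        (fun r => (x.2.2 + P.tail (P.drift (y, x))) (flow r p)) 0 (Icc 0 h) r := by
      intro r hr
      refine (((hev p hp h h0 hh).thd r hr).add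
        (P.tail_hasDerivWithinAt (P.drift (y, x)) hh hr)).congr_deriv ?_
      simp only [drift, ContinuousMap.comp_apply]; abel
    have := constant_of_has_deriv_right_zero
      (fun r hr => (hd r hr).continuousWithinAt)
      (fun r hr => (hd r ⟨hr.1, hr.2.le⟩).mono_of_mem_nhdsWithin
        (Icc_mem_nhdsGE_of_mem hr)) h ⟨h0, le_rfl⟩
    rw [flow_zero] at this
    exact this
  have hγ : (P.op (y, x)).2.2 p = x.2.2 p := by
    have h1 := hconst p hp
    have h2 := hconst (entryPt p) (mul_entryPt.trans hp)
    have e3 : exitPt (entryPt p) = exitPt p := by ext <;> simp [exitPt, entryPt]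
    rw [e3] at h2
    simp only [ContinuousMap.add_apply] at h1 h2
    rw [P.tail_exit _ (by simp [exitPt] : ((exitPt p).2 : ℝ) = 1), add_zero] at h1 h2
    have h3 : P.tail (P.drift (y, x)) (entryPt p) = x.2.2 (exitPt p) - x.2.2 (entryPt p) := by
      rw [← h2]; abel
    have h4 : (P.op (y, x)).2.2 p = P.k (P.θ (exitPt p), y, x.1 (entryPt p),
      P.tail (P.drift (y, x)) (entryPt p)) - P.tail (P.drift (y, x)) p := rfl
    rw [h4, h3, ← hC p hp, ← h1]; abel
  refine Prod.ext (sub_eq_zero.1 hα) (Prod.ext (sub_eq_zero.1 hβ) hγ)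

end CornerProblem

end

/-! ### Cutoffs and scaled coordinates near an equilibrium -/

noncomputable section

section Cutoff

variable (E : Type) [NormedAddCommGroup E] [InnerProductSpace ℝ E] [FiniteDimensional ℝ E]

/-- Smooth bounded Lipschitz maps that are the identity on a ball exist. -/
theorem exists_cutoff {R : ℝ} (hR : 0 < R) : ∃ ζ : E → E, (∀ n : ℕ, ContDiff ℝ n ζ) ∧
    (∃ C : ℝ, 0 ≤ C ∧ ∀ x x', ‖ζ x - ζ x'‖ ≤ C * ‖x - x'‖) ∧ (∀ x, ‖ζ x‖ ≤ 2 * R) ∧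
    ∀ x, ‖x‖ ≤ R → ζ x = x := by
  let f : ContDiffBump (0 : E) := ⟨R, 2 * R, hR, by linarith⟩
  have hs : ∀ n : ℕ, ContDiff ℝ n (fun x : E => f x • x) := fun n => f.contDiff.smul contDiff_id
  refine ⟨fun x => f x • x, hs, ?_, ?_, ?_⟩
  · have hc : HasCompactSupport (fun x : E => f x • x) := f.hasCompactSupport.smul_right
    obtain ⟨C, hC⟩ := (hs 1).lipschitzWith_of_hasCompactSupport hc (by simp)
    exact ⟨C, C.2, fun x x' => by simpa [dist_eq_norm] using hC.dist_le_mul x x'⟩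
  · intro x
    rw [norm_smul, Real.norm_of_nonneg f.nonneg]
    rcases le_or_gt (2 * R) ‖x‖ with h | h
    · rw [f.zero_of_le_dist (by simpa using h)]
      simpa using hR.le
    · exact (mul_le_of_le_one_left (norm_nonneg x) f.le_one).trans h.le
  · intro x hx
    show f x • x = x
    rw [f.one_of_mem_closedBall (by simpa using hx), one_smul]

variable {E}

/-- A smooth map with values in the ball of radius `2 R` that is the identity on the ball of
radius `R`. -/
def cutoff (R : ℝ) (x : E) : E :=
  if hR : 0 < R then (exists_cutoff E hR).choose x else 0

variable (E) in
/-- A Lipschitz constant of `cutoff`. -/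
def cutoffLip (R : ℝ) : ℝ :=
  if hR : 0 < R then (exists_cutoff E hR).choose_spec.2.1.choose else 0

variable {R : ℝ}

theorem contDiff_cutoff (hR : 0 < R) (n : ℕ) : ContDiff ℝ n (cutoff R : E → E) := by
  have : (cutoff R : E → E) = (exists_cutoff E hR).choose := by ext1 x; simp [cutoff, hR]
  rw [this]; exact (exists_cutoff E hR).choose_spec.1 n

theorem cutoffLip_nonneg (hR : 0 < R) : 0 ≤ cutoffLip E R := by
  simp only [cutoffLip, hR, dif_pos]
  exact (exists_cutoff E hR).choose_spec.2.1.choose_spec.1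

theorem cutoff_lipschitz (hR : 0 < R) (x x' : E) : ‖cutoff R x - cutoff R x'‖ ≤ cutoffLip E R * ‖x - x'‖ := by
  simp only [cutoffLip, cutoff, hR, dif_pos]
  exact (exists_cutoff E hR).choose_spec.2.1.choose_spec.2 x x'

theorem cutoff_norm_le (hR : 0 < R) (x : E) : ‖cutoff R x‖ ≤ 2 * R := by
  simp only [cutoff, hR, dif_pos]
  exact (exists_cutoff E hR).choose_spec.2.2.1 x

theorem cutoff_eq_self (hR : 0 < R) {x : E} (hx : ‖x‖ ≤ R) : cutoff R x = x := by
  simp only [cutoff, hR, dif_pos]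
  exact (exists_cutoff E hR).choose_spec.2.2.2 x hx

end Cutoff

/-- The function `1 / max(1, log (1 / e))`, extended by `0`. -/
def timeWeight (e : ℝ) : ℝ := if e ≤ 0 then 0 else (max 1 (-Real.log e))⁻¹

theorem timeWeight_mem (e : ℝ) : timeWeight e ∈ Icc (0 : ℝ) 1 := by
  unfold timeWeight
  split_ifs
  · simp
  · exact ⟨by positivity, inv_le_one_of_one_le₀ (le_max_left _ _)⟩

/-- At 0 this rests on log(1/e) → ∞. The function is not differentiable there, which is harmless
since only continuity on the square is needed. -/
theorem continuous_timeWeight : Continuous timeWeight := by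
  rw [continuous_iff_continuousAt]
  intro e
  rcases lt_trichotomy e 0 with h | rfl | h
  · refine (continuousAt_const (y := (0 : ℝ))).congr ?_
    filter_upwards [gt_mem_nhds h] with x hx
    simp [timeWeight, le_of_lt hx]
  · have hr : Tendsto timeWeight (𝓝[>] 0) (𝓝 0) := by
      have h1 : Tendsto (fun e : ℝ => (max 1 (-Real.log e))⁻¹) (𝓝[>] 0) (𝓝 0) := by
        refine tendsto_inv_atTop_zero.comp ?_
        exact tendsto_atTop_mono (fun x => le_max_right _ _)
          (tendsto_neg_atBot_atTop.comp Real.tendsto_log_nhdsGT_zero)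
      refine h1.congr' ?_
      filter_upwards [self_mem_nhdsWithin] with x hx
      simp [timeWeight, not_le.2 (show (0 : ℝ) < x from hx)]
    have hl : Tendsto timeWeight (𝓝[≤] 0) (𝓝 0) := by
      refine tendsto_const_nhds.congr' ?_
      filter_upwards [self_mem_nhdsWithin] with x hx
      simp [timeWeight, show x ≤ 0 from hx]
    rw [ContinuousAt, show timeWeight 0 = 0 by simp [timeWeight]]
    have := hl.sup hr
    rwa [nhdsLE_sup_nhdsGT] at this
  · have h1 : ContinuousAt (fun e : ℝ => (max 1 (-Real.log e))⁻¹) e := by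
      refine ContinuousAt.inv₀ ?_ (by positivity)
      exact continuousAt_const.max (Real.continuousAt_log h.ne').neg
    refine h1.congr ?_
    filter_upwards [lt_mem_nhds h] with x hx
    simp [timeWeight, not_le.2 hx]

theorem timeWeight_of_le {L : ℝ} (hL : 1 ≤ L) : timeWeight (Real.exp (-L)) = L⁻¹ := by
  simp [timeWeight, not_le.2 (Real.exp_pos (-L)), hL]

theorem timeWeight_zero : timeWeight 0 = 0 := by simp [timeWeight]

variable (EA EB EC : Type)
  [NormedAddCommGroup EA] [InnerProductSpace ℝ EA] [FiniteDimensional ℝ EA]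
  [NormedAddCommGroup EB] [InnerProductSpace ℝ EB] [FiniteDimensional ℝ EB]
  [NormedAddCommGroup EC] [InnerProductSpace ℝ EC] [FiniteDimensional ℝ EC]

/-- An admissible Lipschitz constant for the nonlinearities of a corner problem. -/
def cornerLip (K μ : ℝ) : ℝ := min (μ / (2 * (K + 1))) (1 / (2 * (1 + 9 / μ)))

/-- A field `a' = A a, b' = B b, c' = Q (a, b)` near the equilibrium `(0, 0, z₀)`. -/
structure CornerField where
  n : ℕ
  n_ne_zero : n ≠ 0
  (μ K R ϱ Cb L ρ₀ : ℝ)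
  A : EA × EB × EC → EA →L[ℝ] EA
  B : EA × EB × EC → EB →L[ℝ] EB
  Q : EA × EB × EC → EA × EB →L[ℝ] EC
  z₀ : EC
  -- With a = ϱ²η^μ α the linearized equation is α' = (A - μ)α, and it is integrated backward from
  -- the exit. With b = ϱ²ξ^μ β it is β' = (B + μ)β, integrated forward from the entry.
  stableA : ExpStable (μ • (1 : EA →L[ℝ] EA) - A (0, 0, z₀)) K μ
  stableB : ExpStable (μ • (1 : EB →L[ℝ] EB) + B (0, 0, z₀)) K μ
  smoothA : ContDiffOn ℝ n A (Metric.ball (0, 0, z₀) ρ₀)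
  smoothB : ContDiffOn ℝ n B (Metric.ball (0, 0, z₀) ρ₀)
  smoothQ : ContDiffOn ℝ n Q (Metric.ball (0, 0, z₀) ρ₀)
  boundA : ∀ x ∈ Metric.ball (0, 0, z₀) ρ₀, ‖A x‖ ≤ Cb
  boundB : ∀ x ∈ Metric.ball (0, 0, z₀) ρ₀, ‖B x‖ ≤ Cb
  boundQ : ∀ x ∈ Metric.ball (0, 0, z₀) ρ₀, ‖Q x‖ ≤ Cb
  lipA : ∀ x ∈ Metric.ball (0, 0, z₀) ρ₀, ∀ x' ∈ Metric.ball (0, 0, z₀) ρ₀,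
    ‖A x - A x'‖ ≤ L * ‖x - x'‖
  lipB : ∀ x ∈ Metric.ball (0, 0, z₀) ρ₀, ∀ x' ∈ Metric.ball (0, 0, z₀) ρ₀,
    ‖B x - B x'‖ ≤ L * ‖x - x'‖
  lipQ : ∀ x ∈ Metric.ball (0, 0, z₀) ρ₀, ∀ x' ∈ Metric.ball (0, 0, z₀) ρ₀,
    ‖Q x - Q x'‖ ≤ L * ‖x - x'‖
  R_pos : 0 < R
  ϱ_pos : 0 < ϱ
  ϱ_le : ϱ ≤ 1
  Cb_nonneg : 0 ≤ Cb
  L_nonneg : 0 ≤ L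
  ϱ_small : (4 * R + 2) * ϱ < ρ₀
  -- With a, b of size ϱ² and c - z₀ of size ϱ, all coefficients are frozen up to O(ϱ) and the
  -- scaled drift is O(ϱ). The factors collect the bounds and Lipschitz constants of coefficients
  -- and cutoffs.
  ϱ_small' : 16 * (Cb + L + 1) * (R + 1) *
    (cutoffLip EA R + cutoffLip EB R + cutoffLip EC 1 + 1) * ϱ ≤ cornerLip K μ

/-- Boundary data for a corner problem. -/
structure CornerData (Y : Type) [NormedAddCommGroup Y] [NormedSpace ℝ Y] (n : ℕ) (μ K : ℝ) where
  (La ρ : ℝ)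
  -- The excess of the transit time over L = -log(ξη). It enters through the speed 1 + s/L.
  s : Y → ℝ
  a₁ : Y → EA
  b₁ : Y → EB
  k : Y × EA × EC → EC
  smooth_s : ContDiff ℝ n s
  smooth_a₁ : ContDiff ℝ n a₁
  smooth_b₁ : ContDiff ℝ n b₁
  smooth_k : ContDiff ℝ n k
  lip_k : ∀ y a a' I I', ‖k (y, a, I) - k (y, a', I')‖ ≤ La * ‖a - a'‖ + 2 * ‖I - I'‖
  La_nonneg : 0 ≤ La
  ρ_pos : 0 < ρ
  ρ_le : ρ ≤ 1
  -- The value of a at the entry carries the weight (ξη)^μ, so a large Lipschitz constant in a is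
  -- compensated by restricting to ξη ≤ ρ.
  ρ_small : La * ρ ^ μ ≤ cornerLip K μ

namespace CornerField

variable {EA EB EC}
variable (C : CornerField EA EB EC)

theorem μ_pos : 0 < C.μ := C.stableA.1

theorem K_nonneg : 0 ≤ C.K := C.stableA.nonneg

/-- The sum of the Lipschitz constants of the cutoffs. -/
def ζLip : ℝ := cutoffLip EA C.R + cutoffLip EB C.R + cutoffLip EC 1 + 1

theorem ζLip_one_le : 1 ≤ C.ζLip := by
  have h1 := cutoffLip_nonneg (E := EA) C.R_pos
  have h2 := cutoffLip_nonneg (E := EB) C.R_pos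
  have h3 := cutoffLip_nonneg (E := EC) one_pos
  unfold ζLip; linarith

theorem ζA (x x' : EA) : ‖cutoff C.R x - cutoff C.R x'‖ ≤ C.ζLip * ‖x - x'‖ := by
  refine (cutoff_lipschitz C.R_pos x x').trans (mul_le_mul_of_nonneg_right ?_ (norm_nonneg _))
  have h2 := cutoffLip_nonneg (E := EB) C.R_pos
  have h3 := cutoffLip_nonneg (E := EC) one_pos
  unfold ζLip; linarith

theorem ζB (x x' : EB) : ‖cutoff C.R x - cutoff C.R x'‖ ≤ C.ζLip * ‖x - x'‖ := by
  refine (cutoff_lipschitz C.R_pos x x').trans (mul_le_mul_of_nonneg_right ?_ (norm_nonneg _))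
  have h2 := cutoffLip_nonneg (E := EA) C.R_pos
  have h3 := cutoffLip_nonneg (E := EC) one_pos
  unfold ζLip; linarith

theorem ζC (x x' : EC) : ‖cutoff 1 x - cutoff 1 x'‖ ≤ C.ζLip * ‖x - x'‖ := by
  refine (cutoff_lipschitz one_pos x x').trans (mul_le_mul_of_nonneg_right ?_ (norm_nonneg _))
  have h2 := cutoffLip_nonneg (E := EA) C.R_pos
  have h3 := cutoffLip_nonneg (E := EB) C.R_pos
  unfold ζLip; linarith

/-- The cut-off physical point with given weights and scaled coordinates. -/
def arg (u : (ℝ × ℝ × ℝ × ℝ) × EA × EB × EC) : EA × EB × EC :=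
  ((C.ϱ ^ 2 * cutoff 1 u.1.2.1) • cutoff C.R u.2.1, (C.ϱ ^ 2 * cutoff 1 u.1.1) • cutoff C.R u.2.2.1,
    C.z₀ + C.ϱ • cutoff 1 u.2.2.2)

theorem contDiff_arg : ContDiff ℝ C.n C.arg := by
  have h1 := contDiff_cutoff (E := ℝ) one_pos C.n
  have h2 := contDiff_cutoff (E := EA) C.R_pos C.n
  have h3 := contDiff_cutoff (E := EB) C.R_pos C.n
  have h4 := contDiff_cutoff (E := EC) one_pos C.n
  unfold arg
  refine ContDiff.prodMk ?_ (ContDiff.prodMk ?_ ?_)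
  · exact (contDiff_const.mul (h1.comp (by fun_prop))).smul (h2.comp (by fun_prop))
  · exact (contDiff_const.mul (h1.comp (by fun_prop))).smul (h3.comp (by fun_prop))
  · exact contDiff_const.add ((h4.comp (by fun_prop)).const_smul C.ϱ)

theorem ϱ_sq_le : C.ϱ ^ 2 ≤ C.ϱ := by
  have := C.ϱ_pos; have := C.ϱ_le; nlinarith

theorem arg_sub_le (u : (ℝ × ℝ × ℝ × ℝ) × EA × EB × EC) :
    ‖C.arg u - (0, 0, C.z₀)‖ ≤ (4 * C.R + 2) * C.ϱ := by
  have hϱ := C.ϱ_pos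
  have hR := C.R_pos
  have hsq := C.ϱ_sq_le
  have key : ∀ {E : Type} [NormedAddCommGroup E] [InnerProductSpace ℝ E] [FiniteDimensional ℝ E]
      (t : ℝ) (x : E), ‖(C.ϱ ^ 2 * cutoff 1 t) • cutoff C.R x‖ ≤ (4 * C.R + 2) * C.ϱ := by
    intro E _ _ _ t x
    rw [norm_smul, norm_mul, Real.norm_of_nonneg (sq_nonneg _)]
    have h1 := cutoff_norm_le one_pos t
    have h2 := cutoff_norm_le C.R_pos x
    calc C.ϱ ^ 2 * ‖cutoff 1 t‖ * ‖cutoff C.R x‖ ≤ C.ϱ * (2 * 1) * (2 * C.R) := by gcongr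
      _ ≤ _ := by nlinarith
  refine norm_prod_le_iff.2 ⟨?_, norm_prod_le_iff.2 ⟨?_, ?_⟩⟩
  · simpa [arg] using key u.1.2.1 u.2.1
  · simpa [arg] using key u.1.1 u.2.2.1
  · simp only [arg, Prod.snd_sub, add_sub_cancel_left]
    rw [norm_smul, Real.norm_of_nonneg hϱ.le]
    have h1 := cutoff_norm_le one_pos u.2.2.2
    nlinarith

theorem arg_mem (u : (ℝ × ℝ × ℝ × ℝ) × EA × EB × EC) :
    C.arg u ∈ Metric.ball (0, 0, C.z₀) C.ρ₀ := by
  rw [mem_ball_iff_norm]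
  exact (C.arg_sub_le u).trans_lt C.ϱ_small

theorem arg_lipschitz {θ : ℝ × ℝ × ℝ × ℝ} (x x' : EA × EB × EC) :
    ‖C.arg (θ, x) - C.arg (θ, x')‖ ≤ 2 * C.ζLip * C.ϱ * ‖x - x'‖ := by
  have hϱ := C.ϱ_pos
  have hsq := C.ϱ_sq_le
  have hζ := C.ζLip_one_le
  have key : ∀ {E : Type} [NormedAddCommGroup E] [InnerProductSpace ℝ E] [FiniteDimensional ℝ E]
      (t : ℝ) (v v' : E), ‖cutoff C.R v - cutoff C.R v'‖ ≤ C.ζLip * ‖v - v'‖ → ‖v - v'‖ ≤ ‖x - x'‖ →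
      ‖(C.ϱ ^ 2 * cutoff 1 t) • cutoff C.R v - (C.ϱ ^ 2 * cutoff 1 t) • cutoff C.R v'‖ ≤
        2 * C.ζLip * C.ϱ * ‖x - x'‖ := by
    intro E _ _ _ t v v' hv hv'
    rw [← smul_sub, norm_smul, norm_mul, Real.norm_of_nonneg (sq_nonneg _)]
    have h1 := cutoff_norm_le one_pos t
    calc C.ϱ ^ 2 * ‖cutoff 1 t‖ * ‖cutoff C.R v - cutoff C.R v'‖
        ≤ C.ϱ * (2 * 1) * (C.ζLip * ‖x - x'‖) := by
          gcongr
          exact hv.trans (by gcongr)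
      _ = _ := by ring
  refine norm_prod_le_iff.2 ⟨?_, norm_prod_le_iff.2 ⟨?_, ?_⟩⟩
  · exact key _ _ _ (C.ζA _ _) (norm_fst_le (x - x'))
  · exact key _ _ _ (C.ζB _ _) ((norm_fst_le (x - x').2).trans (norm_snd_le (x - x')))
  · simp only [arg, Prod.snd_sub, add_sub_add_left_eq_sub]
    rw [← smul_sub, norm_smul, Real.norm_of_nonneg hϱ.le]
    calc _ ≤ C.ϱ * (C.ζLip * ‖x - x'‖) := by
          gcongr
          exact (C.ζC _ _).trans (by
            gcongr; exact (norm_snd_le (x - x').2).trans (norm_snd_le (x - x')))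
      _ ≤ _ := by
          have : 0 ≤ C.ϱ * (C.ζLip * ‖x - x'‖) := by positivity
          linarith

end CornerField

end

/-! ### Lipschitz estimates and the corner problem of a field -/

noncomputable section

theorem norm_clm_apply_sub_le {E F : Type} [NormedAddCommGroup E] [NormedSpace ℝ E]
    [NormedAddCommGroup F] [NormedSpace ℝ F] {T T' : E →L[ℝ] F} {v v' : E} {a b c d t : ℝ}
    (hT : ‖T - T'‖ ≤ a * t) (hT' : ‖T'‖ ≤ b) (hv : ‖v‖ ≤ c) (hv' : ‖v - v'‖ ≤ d * t) :
    ‖T v - T' v'‖ ≤ (a * c + b * d) * t := by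
  have h : T v - T' v' = (T - T') v + T' (v - v') := by simp
  rw [h]
  calc _ ≤ ‖(T - T') v‖ + ‖T' (v - v')‖ := norm_add_le _ _
    _ ≤ a * t * c + b * (d * t) := by
        gcongr
        · exact ContinuousLinearMap.le_of_opNorm_le_of_le _ hT hv
        · exact ContinuousLinearMap.le_of_opNorm_le_of_le _ hT' hv'
    _ = _ := by ring

variable {EA EB EC : Type}
  [NormedAddCommGroup EA] [InnerProductSpace ℝ EA] [FiniteDimensional ℝ EA]
  [NormedAddCommGroup EB] [InnerProductSpace ℝ EB] [FiniteDimensional ℝ EB]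
  [NormedAddCommGroup EC] [InnerProductSpace ℝ EC] [FiniteDimensional ℝ EC]

theorem cornerLip_bounds {K μ : ℝ} (hK : 0 ≤ K) (hμ : 0 < μ) : 0 < cornerLip K μ ∧
    cornerLip K μ * (K / μ) ≤ 1 / 2 ∧ cornerLip K μ * (1 + 9 / μ) ≤ 1 / 2 := by
  have h1 : 0 < cornerLip K μ := lt_min (by positivity) (by positivity)
  refine ⟨h1, ?_, ?_⟩
  · calc cornerLip K μ * (K / μ) ≤ (μ / (2 * (K + 1))) * (K / μ) := by
          gcongr; exact min_le_left _ _
      _ = K / (2 * (K + 1)) := by field_simp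
      _ ≤ 1 / 2 := by rw [div_le_div_iff₀ (by positivity) (by norm_num)]; linarith
  · calc cornerLip K μ * (1 + 9 / μ) ≤ (1 / (2 * (1 + 9 / μ))) * (1 + 9 / μ) := by
          gcongr; exact min_le_right _ _
      _ = 1 / 2 := by field_simp

namespace CornerField

variable (C : CornerField EA EB EC)

theorem κ_pos : 0 < cornerLip C.K C.μ := (cornerLip_bounds C.K_nonneg C.μ_pos).1

theorem contDiff_comp_arg {F Y : Type} [NormedAddCommGroup F] [NormedSpace ℝ F]
    [NormedAddCommGroup Y] [NormedSpace ℝ Y] {G : EA × EB × EC → F}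
    (hG : ContDiffOn ℝ C.n G (Metric.ball (0, 0, C.z₀) C.ρ₀)) :
    ContDiff ℝ C.n (fun u : (ℝ × ℝ × ℝ × ℝ) × Y × EA × EB × EC => G (C.arg (u.1, u.2.2))) := by
  rw [← contDiffOn_univ]
  refine hG.comp (t := Metric.ball (0, 0, C.z₀) C.ρ₀)
    (C.contDiff_arg.comp (by fun_prop)).contDiffOn (fun u _ => C.arg_mem _)

theorem comp_arg_sub_le {F : Type} [NormedAddCommGroup F] {G : EA × EB × EC → F}
    (hG : ∀ x ∈ Metric.ball (0, 0, C.z₀) C.ρ₀, ∀ x' ∈ Metric.ball (0, 0, C.z₀) C.ρ₀,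
      ‖G x - G x'‖ ≤ C.L * ‖x - x'‖) {θ : ℝ × ℝ × ℝ × ℝ} (x x' : EA × EB × EC) :
    ‖G (C.arg (θ, x)) - G (C.arg (θ, x'))‖ ≤ 2 * C.L * C.ζLip * C.ϱ * ‖x - x'‖ := by
  refine (hG _ (C.arg_mem _) _ (C.arg_mem _)).trans ?_
  calc _ ≤ C.L * (2 * C.ζLip * C.ϱ * ‖x - x'‖) := by
        have := C.L_nonneg
        gcongr; exact C.arg_lipschitz x x'
    _ = _ := by ring

theorem center_mem : ((0, 0, C.z₀) : EA × EB × EC) ∈ Metric.ball (0, 0, C.z₀) C.ρ₀ := by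
  have := C.R_pos; have := C.ϱ_pos
  exact Metric.mem_ball_self (lt_of_le_of_lt (by positivity) C.ϱ_small)

theorem const_le {a : ℝ} (ha : a ≤ 16 * (C.Cb + C.L + 1) * (C.R + 1) * C.ζLip * C.ϱ) :
    a ≤ cornerLip C.K C.μ := ha.trans C.ϱ_small'

/-- Lipschitz estimate for the terms `(g G - G₀) ζ`. -/
theorem lip_linear {E : Type} [NormedAddCommGroup E] [InnerProductSpace ℝ E]
    [FiniteDimensional ℝ E] {G : EA × EB × EC → E →L[ℝ] E}
    (hb : ∀ x ∈ Metric.ball (0, 0, C.z₀) C.ρ₀, ‖G x‖ ≤ C.Cb)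
    (hG : ∀ x ∈ Metric.ball (0, 0, C.z₀) C.ρ₀, ∀ x' ∈ Metric.ball (0, 0, C.z₀) C.ρ₀,
      ‖G x - G x'‖ ≤ C.L * ‖x - x'‖) {g : ℝ} (hg : |g - 1| ≤ C.ϱ) (θ : ℝ × ℝ × ℝ × ℝ)
    (x x' : EA × EB × EC) {v v' : E} (hv : ‖cutoff C.R v - cutoff C.R v'‖ ≤ C.ζLip * ‖x - x'‖) :
    ‖(g • G (C.arg (θ, x)) - G (0, 0, C.z₀)) (cutoff C.R v) -
      (g • G (C.arg (θ, x')) - G (0, 0, C.z₀)) (cutoff C.R v')‖ ≤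
      cornerLip C.K C.μ * ‖x - x'‖ := by
  have hϱ := C.ϱ_pos
  have hϱ1 := C.ϱ_le
  have hζ := C.ζLip_one_le
  have hL := C.L_nonneg
  have hC := C.Cb_nonneg
  have hR := C.R_pos
  have hg2 : |g| ≤ 2 := by
    have := abs_add_le (g - 1) 1
    simp at this; linarith
  have h1 : ‖(g • G (C.arg (θ, x)) - G (0, 0, C.z₀)) - (g • G (C.arg (θ, x')) - G (0, 0, C.z₀))‖ ≤
      (4 * C.L * C.ζLip * C.ϱ) * ‖x - x'‖ := by
    rw [sub_sub_sub_cancel_right, ← smul_sub, norm_smul, Real.norm_eq_abs]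
    calc _ ≤ 2 * (2 * C.L * C.ζLip * C.ϱ * ‖x - x'‖) := by
          gcongr; exact C.comp_arg_sub_le hG x x'
      _ = _ := by ring
  -- The speed deviates from 1 by at most ϱ, and the argument from the equilibrium by at most (4R +
  -- 2)ϱ.
  have h2 : ‖g • G (C.arg (θ, x')) - G (0, 0, C.z₀)‖ ≤
      (C.Cb + C.L * (4 * C.R + 2)) * C.ϱ := by
    have : g • G (C.arg (θ, x')) - G (0, 0, C.z₀) = (g - 1) • G (C.arg (θ, x')) +
        (G (C.arg (θ, x')) - G (0, 0, C.z₀)) := by rw [sub_smul, one_smul]; abel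
    rw [this]
    calc _ ≤ ‖(g - 1) • G (C.arg (θ, x'))‖ + ‖G (C.arg (θ, x')) - G (0, 0, C.z₀)‖ :=
          norm_add_le _ _
      _ ≤ C.ϱ * C.Cb + C.L * ((4 * C.R + 2) * C.ϱ) := by
          gcongr
          · rw [norm_smul, Real.norm_eq_abs]
            gcongr
            exact hb _ (C.arg_mem _)
          · refine (hG _ (C.arg_mem _) _ C.center_mem).trans ?_
            gcongr
            exact C.arg_sub_le _
      _ = _ := by ring
  refine (norm_clm_apply_sub_le h1 h2 (cutoff_norm_le C.R_pos v) hv).trans ?_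
  refine mul_le_mul_of_nonneg_right (C.const_le ?_) (norm_nonneg _)
  have e1 : 4 * C.L * C.ζLip * C.ϱ * (2 * C.R) + (C.Cb + C.L * (4 * C.R + 2)) * C.ϱ * C.ζLip =
    (12 * C.L * C.R + C.Cb + 2 * C.L) * (C.ζLip * C.ϱ) := by ring
  have e2 : 16 * (C.Cb + C.L + 1) * (C.R + 1) * C.ζLip * C.ϱ =
    (16 * (C.Cb + C.L + 1) * (C.R + 1)) * (C.ζLip * C.ϱ) := by ring
  rw [e1, e2]
  refine mul_le_mul_of_nonneg_right ?_ (by positivity)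
  have := mul_nonneg hL hR.le
  have := mul_nonneg hC hR.le
  nlinarith

/-- Lipschitz estimate for the drift terms. -/
theorem lip_drift {E : Type} [NormedAddCommGroup E] [InnerProductSpace ℝ E]
    [FiniteDimensional ℝ E] (i : E →L[ℝ] EA × EB) (hi : ∀ v, ‖i v‖ ≤ ‖v‖)
    {g : ℝ} (hg : |g - 1| ≤ C.ϱ) (θ : ℝ × ℝ × ℝ × ℝ)
    (x x' : EA × EB × EC) {v v' : E} (hv : ‖cutoff C.R v - cutoff C.R v'‖ ≤ C.ζLip * ‖x - x'‖) :
    ‖(g * C.ϱ) • C.Q (C.arg (θ, x)) (i (cutoff C.R v)) -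
      (g * C.ϱ) • C.Q (C.arg (θ, x')) (i (cutoff C.R v'))‖ ≤
      cornerLip C.K C.μ * ‖x - x'‖ := by
  have hϱ := C.ϱ_pos
  have hϱ1 := C.ϱ_le
  have hζ := C.ζLip_one_le
  have hL := C.L_nonneg
  have hC := C.Cb_nonneg
  have hR := C.R_pos
  have hg2 : |g| ≤ 2 := by
    have := abs_add_le (g - 1) 1
    simp at this; linarith
  have h3 := norm_clm_apply_sub_le (T := C.Q (C.arg (θ, x))) (T' := C.Q (C.arg (θ, x')))
    (v := i (cutoff C.R v)) (v' := i (cutoff C.R v')) (t := ‖x - x'‖)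
    (C.comp_arg_sub_le C.lipQ x x')
    (C.boundQ _ (C.arg_mem _)) ((hi _).trans (cutoff_norm_le C.R_pos v))
    (d := C.ζLip) (by rw [← map_sub]; exact (hi _).trans hv)
  rw [← smul_sub, norm_smul, norm_mul, Real.norm_eq_abs, Real.norm_of_nonneg hϱ.le]
  calc _ ≤ (2 * C.ϱ) * ((2 * C.L * C.ζLip * C.ϱ * (2 * C.R) + C.Cb * C.ζLip) * ‖x - x'‖) := by
        gcongr
    _ ≤ (2 * C.ϱ) * ((2 * C.L * C.ζLip * 1 * (2 * C.R) + C.Cb * C.ζLip) * ‖x - x'‖) := by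
        gcongr
    _ = ((8 * C.L * C.R + 2 * C.Cb) * (C.ζLip * C.ϱ)) * ‖x - x'‖ := by ring
    _ ≤ _ := by
        refine mul_le_mul_of_nonneg_right (C.const_le ?_) (norm_nonneg _)
        have e2 : 16 * (C.Cb + C.L + 1) * (C.R + 1) * C.ζLip * C.ϱ =
          (16 * (C.Cb + C.L + 1) * (C.R + 1)) * (C.ζLip * C.ϱ) := by ring
        rw [e2]
        refine mul_le_mul_of_nonneg_right ?_ (by positivity)
        have := mul_nonneg hL hR.le
        have := mul_nonneg hC hR.le
        nlinarith

variable {Y : Type} [NormedAddCommGroup Y] [NormedSpace ℝ Y] [CompleteSpace Y]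
  (D : CornerData EA EB EC Y C.n C.μ C.K)

/-- The weights of a corner problem. -/
def weights : C(UnitSquare, ℝ × ℝ × ℝ × ℝ) :=
  -- The third weight is 1/L. The fourth is the value of η^μ at the entry of the hyperbola,
  -- truncated so that the exit condition is contracting on the whole square.
  ⟨fun p => ((p.1 : ℝ) ^ C.μ, (p.2 : ℝ) ^ C.μ, timeWeight (p.1 * p.2), (min (p.1 * p.2 : ℝ) D.ρ) ^ C.μ),
    ((weightFst C.μ_pos).continuous.prodMk ((weightSnd C.μ_pos).continuous.prodMk
      ((continuous_timeWeight.comp (by fun_prop)).prodMk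
        (Continuous.rpow_const (by fun_prop) (fun _ => Or.inr C.μ_pos.le)))))⟩

/-- The nonlinearity in the expanding direction. -/
def nlA (u : (ℝ × ℝ × ℝ × ℝ) × Y × EA × EB × EC) : EA :=
  ((1 + D.s u.2.1 * u.1.2.2.1) • C.A (C.arg (u.1, u.2.2)) - C.A (0, 0, C.z₀)) (cutoff C.R u.2.2.1)

/-- The nonlinearity in the contracting direction. -/
def nlB (u : (ℝ × ℝ × ℝ × ℝ) × Y × EA × EB × EC) : EB :=
  ((1 + D.s u.2.1 * u.1.2.2.1) • C.B (C.arg (u.1, u.2.2)) - C.B (0, 0, C.z₀))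
    (cutoff C.R u.2.2.2.1)

/-- The drift caused by the expanding coordinates. -/
def nl₁ (u : (ℝ × ℝ × ℝ × ℝ) × Y × EA × EB × EC) : EC :=
  ((1 + D.s u.2.1 * u.1.2.2.1) * C.ϱ) • C.Q (C.arg (u.1, u.2.2))
    (ContinuousLinearMap.inl ℝ EA EB (cutoff C.R u.2.2.1))

/-- The drift caused by the contracting coordinates. -/
def nl₂ (u : (ℝ × ℝ × ℝ × ℝ) × Y × EA × EB × EC) : EC :=
  ((1 + D.s u.2.1 * u.1.2.2.1) * C.ϱ) • C.Q (C.arg (u.1, u.2.2))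
    (ContinuousLinearMap.inr ℝ EA EB (cutoff C.R u.2.2.2.1))

/-- The scaled exit condition. -/
def exitCond (u : (ℝ × ℝ × ℝ × ℝ) × Y × EA × EC) : EC :=
  C.ϱ⁻¹ • (D.k (u.2.1, (C.ϱ ^ 2 * u.1.2.2.2) • u.2.2.1, C.ϱ • u.2.2.2) - C.z₀)

theorem contDiff_speed : ContDiff ℝ C.n
    (fun u : (ℝ × ℝ × ℝ × ℝ) × Y × EA × EB × EC => 1 + D.s u.2.1 * u.1.2.2.1) :=
  contDiff_const.add ((D.smooth_s.comp (by fun_prop)).mul (by fun_prop))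

theorem contDiff_nlA : ContDiff ℝ C.n (C.nlA D) := by
  refine ContDiff.clm_apply ?_ ((contDiff_cutoff C.R_pos C.n).comp (by fun_prop))
  exact ((C.contDiff_speed D).smul (C.contDiff_comp_arg C.smoothA)).sub contDiff_const

theorem contDiff_nlB : ContDiff ℝ C.n (C.nlB D) := by
  refine ContDiff.clm_apply ?_ ((contDiff_cutoff C.R_pos C.n).comp (by fun_prop))
  exact ((C.contDiff_speed D).smul (C.contDiff_comp_arg C.smoothB)).sub contDiff_const

theorem contDiff_nl₁ : ContDiff ℝ C.n (C.nl₁ D) := by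
  refine ((C.contDiff_speed D).mul contDiff_const).smul (ContDiff.clm_apply
    (C.contDiff_comp_arg C.smoothQ) ?_)
  exact (ContinuousLinearMap.contDiff _).comp ((contDiff_cutoff C.R_pos C.n).comp (by fun_prop))

theorem contDiff_nl₂ : ContDiff ℝ C.n (C.nl₂ D) := by
  refine ((C.contDiff_speed D).mul contDiff_const).smul (ContDiff.clm_apply
    (C.contDiff_comp_arg C.smoothQ) ?_)
  exact (ContinuousLinearMap.contDiff _).comp ((contDiff_cutoff C.R_pos C.n).comp (by fun_prop))

theorem contDiff_exitCond : ContDiff ℝ C.n (C.exitCond D) := by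
  refine ((D.smooth_k.comp ?_).sub contDiff_const).const_smul _
  fun_prop

theorem speed_bound {y : Y} (hy : |D.s y| < C.ϱ) (p : UnitSquare) :
    |1 + D.s y * (C.weights D p).2.2.1 - 1| ≤ C.ϱ := by
  have h := timeWeight_mem (p.1 * p.2)
  rw [add_sub_cancel_left, abs_mul]
  have h2 : |(C.weights D p).2.2.1| ≤ 1 := by
    show |timeWeight (p.1 * p.2)| ≤ 1
    rw [abs_of_nonneg h.1]; exact h.2
  calc _ ≤ C.ϱ * 1 := mul_le_mul hy.le h2 (abs_nonneg _) C.ϱ_pos.le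
    _ = _ := mul_one _

/-- The corner problem of a field with boundary data. -/
def problem : CornerProblem EA EB EC Y (ℝ × ℝ × ℝ × ℝ) where
  n := C.n
  n_ne_zero := C.n_ne_zero
  μ := C.μ
  K := C.K
  κ := cornerLip C.K C.μ
  DA := C.μ • (1 : EA →L[ℝ] EA) - C.A (0, 0, C.z₀)
  DB := C.μ • (1 : EB →L[ℝ] EB) + C.B (0, 0, C.z₀)
  stableA := C.stableA
  stableB := C.stableB
  θ := C.weights D
  fa := ⟨C.nlA D, (C.contDiff_nlA D).continuous⟩
  fb := ⟨C.nlB D, (C.contDiff_nlB D).continuous⟩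
  f₁ := ⟨C.nl₁ D, (C.contDiff_nl₁ D).continuous⟩
  f₂ := ⟨C.nl₂ D, (C.contDiff_nl₂ D).continuous⟩
  k := ⟨C.exitCond D, (C.contDiff_exitCond D).continuous⟩
  a₁ := fun y => (C.ϱ ^ 2)⁻¹ • D.a₁ y
  b₁ := fun y => (C.ϱ ^ 2)⁻¹ • D.b₁ y
  smooth_fa := C.contDiff_nlA D
  smooth_fb := C.contDiff_nlB D
  smooth_f₁ := C.contDiff_nl₁ D
  smooth_f₂ := C.contDiff_nl₂ D
  smooth_k := C.contDiff_exitCond D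
  smooth_a₁ := D.smooth_a₁.const_smul _
  smooth_b₁ := D.smooth_b₁.const_smul _
  O := {y | |D.s y| < C.ϱ}
  isOpen_O := isOpen_lt (D.smooth_s.continuous.abs) continuous_const
  lip_fa := fun p y hy x x' => C.lip_linear C.boundA C.lipA (C.speed_bound D hy p) _ x x'
    ((C.ζA _ _).trans (mul_le_mul_of_nonneg_left (norm_fst_le (x - x'))
      (zero_le_one.trans C.ζLip_one_le)))
  lip_fb := fun p y hy x x' => C.lip_linear C.boundB C.lipB (C.speed_bound D hy p) _ x x'
    ((C.ζB _ _).trans (mul_le_mul_of_nonneg_left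
      ((norm_fst_le (x - x').2).trans (norm_snd_le (x - x')))
      (zero_le_one.trans C.ζLip_one_le)))
  lip_f₁ := fun p y hy x x' => C.lip_drift _ (fun v => by simp) (C.speed_bound D hy p) _ x x'
    ((C.ζA _ _).trans (mul_le_mul_of_nonneg_left (norm_fst_le (x - x'))
      (zero_le_one.trans C.ζLip_one_le)))
  lip_f₂ := fun p y hy x x' => C.lip_drift _ (fun v => by simp) (C.speed_bound D hy p) _ x x'
    ((C.ζB _ _).trans (mul_le_mul_of_nonneg_left
      ((norm_fst_le (x - x').2).trans (norm_snd_le (x - x')))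
      (zero_le_one.trans C.ζLip_one_le)))
  lip_k := fun p y hy a a' I I' => by
    have hϱ := C.ϱ_pos
    have hm : 0 ≤ min (p.1 * p.2 : ℝ) D.ρ := le_min (mul_nonneg p.1.2.1 p.2.2.1) D.ρ_pos.le
    have hw : (min (p.1 * p.2 : ℝ) D.ρ) ^ C.μ ≤ D.ρ ^ C.μ :=
      Real.rpow_le_rpow hm (min_le_right _ _) C.μ_pos.le
    have hw0 : 0 ≤ (min (p.1 * p.2 : ℝ) D.ρ) ^ C.μ := Real.rpow_nonneg hm _
    have hw1 : ((C.weights D) p).2.2.2 = (min (p.1 * p.2 : ℝ) D.ρ) ^ C.μ := rfl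
    simp only [ContinuousMap.coe_mk, exitCond, ← smul_sub, sub_sub_sub_cancel_right]
    rw [norm_smul, norm_inv, Real.norm_of_nonneg hϱ.le, inv_mul_le_iff₀ hϱ]
    refine (D.lip_k _ _ _ _ _).trans ?_
    rw [← smul_sub, ← smul_sub, norm_smul, norm_smul, Real.norm_of_nonneg hϱ.le, norm_mul,
      Real.norm_of_nonneg (sq_nonneg _), hw1, Real.norm_of_nonneg hw0]
    have hLa := D.La_nonneg
    calc _ ≤ D.La * (C.ϱ ^ 2 * D.ρ ^ C.μ * ‖a - a'‖) + 2 * (C.ϱ * ‖I - I'‖) := by gcongr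
      _ = C.ϱ ^ 2 * ((D.La * D.ρ ^ C.μ) * ‖a - a'‖) + 2 * (C.ϱ * ‖I - I'‖) := by ring
      _ ≤ C.ϱ * (cornerLip C.K C.μ * ‖a - a'‖) + 2 * (C.ϱ * ‖I - I'‖) := by
          have h1 := D.ρ_small
          have h2 := C.ϱ_sq_le
          have h3 : 0 ≤ D.ρ ^ C.μ := Real.rpow_nonneg D.ρ_pos.le _
          gcongr
      _ = _ := by ring
  κ_nonneg := C.κ_pos.le
  κ_small := (cornerLip_bounds C.K_nonneg C.μ_pos).2.1
  κ_small' := (cornerLip_bounds C.K_nonneg C.μ_pos).2.2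

end CornerField

end

/-! ### Return to physical coordinates -/

noncomputable section

namespace CornerField

open CornerProblem

variable {EA EB EC : Type}
  [NormedAddCommGroup EA] [InnerProductSpace ℝ EA] [FiniteDimensional ℝ EA]
  [NormedAddCommGroup EB] [InnerProductSpace ℝ EB] [FiniteDimensional ℝ EB]
  [NormedAddCommGroup EC] [InnerProductSpace ℝ EC] [FiniteDimensional ℝ EC]
  (C : CornerField EA EB EC)
  {Y : Type} [NormedAddCommGroup Y] [NormedSpace ℝ Y] [CompleteSpace Y]
  (D : CornerData EA EB EC Y C.n C.μ C.K)

/-- The vector field of a corner field. -/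
def vf (x : EA × EB × EC) : EA × EB × EC := (C.A x x.1, C.B x x.2.1, C.Q x (x.1, x.2.1))

/-- The linear part of the passage from weighted to physical coordinates. -/
def scale : Triple EA EB EC →L[ℝ] C(UnitSquare, EA × EB × EC) :=
  (C.ϱ ^ 2) • ((ContinuousLinearMap.inl ℝ EA (EB × EC)).compLeftContinuous ℝ UnitSquare ∘L
    smulCLM (weightSnd C.μ_pos) ∘L .fst ℝ _ _) +
  (C.ϱ ^ 2) • ((ContinuousLinearMap.inr ℝ EA (EB × EC) ∘L
    ContinuousLinearMap.inl ℝ EB EC).compLeftContinuous ℝ UnitSquare ∘L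
    smulCLM (weightFst C.μ_pos) ∘L .fst ℝ _ _ ∘L .snd ℝ _ _) +
  C.ϱ • ((ContinuousLinearMap.inr ℝ EA (EB × EC) ∘L
    ContinuousLinearMap.inr ℝ EB EC).compLeftContinuous ℝ UnitSquare ∘L
    .snd ℝ _ _ ∘L .snd ℝ _ _)

theorem scale_apply (x : Triple EA EB EC) (p : UnitSquare) : C.scale x p =
    ((C.ϱ ^ 2 * (p.2 : ℝ) ^ C.μ) • x.1 p, (C.ϱ ^ 2 * (p.1 : ℝ) ^ C.μ) • x.2.1 p,
      C.ϱ • x.2.2 p) := by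
  ext <;> simp [scale, smulCLM_apply, weightSnd, weightFst, mul_smul]

/-- The solution of the corner problem in physical coordinates. -/
def phys (y : Y) : C(UnitSquare, EA × EB × EC) :=
  ContinuousMap.const _ (0, 0, C.z₀) + C.scale ((C.problem D).sol y)

theorem phys_apply (y : Y) (p : UnitSquare) : C.phys D y p =
    ((C.ϱ ^ 2 * (p.2 : ℝ) ^ C.μ) • ((C.problem D).sol y).1 p,
      (C.ϱ ^ 2 * (p.1 : ℝ) ^ C.μ) • ((C.problem D).sol y).2.1 p,
      C.z₀ + C.ϱ • ((C.problem D).sol y).2.2 p) := by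
  simp [phys, scale_apply]

theorem contDiffOn_phys : ContDiffOn ℝ C.n (C.phys D) (C.problem D).O :=
  contDiffOn_const.add (C.scale.contDiff.comp_contDiffOn (C.problem D).contDiffOn_sol)

/-- The points where the cutoffs are inactive. -/
def Good (y : Y) (p : UnitSquare) : Prop := ‖((C.problem D).sol y).1 p‖ < C.R ∧
  ‖((C.problem D).sol y).2.1 p‖ < C.R ∧ ‖((C.problem D).sol y).2.2 p‖ < 1

variable {C D} {y : Y} {p : UnitSquare} {h e : ℝ}

theorem arg_eq {t : ℝ × ℝ × ℝ × ℝ} {x : EA × EB × EC} (h1 : ‖t.1‖ ≤ 1) (h2 : ‖t.2.1‖ ≤ 1)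
    (ha : ‖x.1‖ ≤ C.R) (hb : ‖x.2.1‖ ≤ C.R) (hc : ‖x.2.2‖ ≤ 1) : C.arg (t, x) =
      ((C.ϱ ^ 2 * t.2.1) • x.1, (C.ϱ ^ 2 * t.1) • x.2.1, C.z₀ + C.ϱ • x.2.2) := by
  simp only [arg]
  rw [cutoff_eq_self one_pos h1, cutoff_eq_self one_pos h2, cutoff_eq_self C.R_pos ha,
    cutoff_eq_self C.R_pos hb, cutoff_eq_self one_pos hc]

theorem norm_rpow_le_one (t : unitInterval) : ‖(t : ℝ) ^ C.μ‖ ≤ 1 := by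
  rw [Real.norm_of_nonneg (Real.rpow_nonneg t.2.1 _)]
  exact Real.rpow_le_one t.2.1 t.2.2 C.μ_pos.le

theorem arg_weights (x : Triple EA EB EC) (ha : ‖x.1 p‖ ≤ C.R) (hb : ‖x.2.1 p‖ ≤ C.R)
    (hc : ‖x.2.2 p‖ ≤ 1) : C.arg (C.weights D p, x.1 p, x.2.1 p, x.2.2 p) =
      ((C.ϱ ^ 2 * (p.2 : ℝ) ^ C.μ) • x.1 p, (C.ϱ ^ 2 * (p.1 : ℝ) ^ C.μ) • x.2.1 p,
        C.z₀ + C.ϱ • x.2.2 p) :=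
  arg_eq (C := C) (norm_rpow_le_one p.1) (norm_rpow_le_one p.2) ha hb hc

/-- Differentiating the weights η^μ and ξ^μ produces the terms ±μ which cancel those in `DA` and
`DB`. Where the cutoffs are inactive, the original field with its speed factor remains. -/
theorem phys_hasDerivWithinAt (hy : y ∈ (C.problem D).O) (hh : p.2 * Real.exp h ≤ 1)
    (hgood : ∀ r ∈ Icc 0 h, C.Good D y (flow r p)) {r : ℝ} (hr : r ∈ Icc 0 h) :
    HasDerivWithinAt (fun r => C.phys D y (flow r p))
      ((1 + D.s y * timeWeight (p.1 * p.2)) • C.vf (C.phys D y (flow r p))) (Icc 0 h) r := by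
  have hev := (C.problem D).sol_evolves hy hh
  obtain ⟨ga, gb, gc⟩ := hgood r hr
  have harg := arg_weights (D := D) ((C.problem D).sol y) ga.le gb.le gc.le
  rw [← phys_apply] at harg
  have hw : ((C.weights D) (flow r p)).2.2.1 = timeWeight (p.1 * p.2) := by
    show timeWeight _ = _
    rw [flow_mul hr.1 (le_one_of_le hh hr.2)]
  have h1 := (((hasDerivWithinAt_snd_rpow C.μ hh hr).const_mul (C.ϱ ^ 2)).smul
    (hev.fst r hr))
  have h2 := (((hasDerivWithinAt_fst_rpow (p := p) C.μ hr).const_mul (C.ϱ ^ 2)).smul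
    (hev.snd r hr))
  have h3 := ((hev.thd r hr).const_smul C.ϱ).const_add C.z₀
  have key : (fun r => C.phys D y (flow r p)) = fun r => _ := funext fun r => phys_apply C D y _
  rw [key]
  refine (h1.prodMk (h2.prodMk h3)).congr_deriv ?_
  have ca := cutoff_eq_self C.R_pos ga.le
  have cb := cutoff_eq_self C.R_pos gb.le
  simp only [problem, pack, ContinuousMap.coe_mk, nlA, nlB, nl₁, nl₂] at harg ca cb hw ⊢
  rw [harg, ca, cb, hw, ← problem]
  simp only [problem] at harg ⊢
  set X := C.phys D y (flow r p) with hX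
  have hX1 := phys_apply C D y (flow r p)
  simp only [problem, ← hX] at hX1
  have e1 : X.1 = _ := congrArg Prod.fst hX1
  have e2 : X.2.1 = _ := congrArg (fun z => z.2.1) hX1
  simp only [vf]
  rw [e1, e2]
  refine Prod.ext ?_ (Prod.ext ?_ ?_)
  · simp only [Prod.smul_fst, _root_.sub_apply, _root_.smul_apply,
      one_apply_eq_self, map_smul]
    module
  · simp only [Prod.smul_fst, Prod.smul_snd, _root_.sub_apply, _root_.add_apply, _root_.smul_apply,
      one_apply_eq_self, map_smul]
    module
  · simp only [Prod.smul_snd]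
    have : ∀ (a : EA) (b : EB) (u v : ℝ), C.Q X (u • a, v • b) =
        u • C.Q X (a, 0) + v • C.Q X (0, b) := by
      intro a b u v
      rw [← map_smul, ← map_smul, ← map_add]; simp
    rw [this]
    simp only [ContinuousLinearMap.inl_apply, ContinuousLinearMap.inr_apply]
    module

end CornerField

end

/-! ### Orbits with the right decay are solutions of the corner problem -/

noncomputable section

section Weighted

variable {F : Type} [NormedAddCommGroup F] [NormedSpace ℝ F]

theorem norm_weighted_le {c d w : ℝ} {v : F} (hd : 0 < d) (hw : 0 ≤ w) (hv : ‖v‖ ≤ d * c * w ^ 2) :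
    ‖(d * w)⁻¹ • v‖ ≤ c * w := by
  rcases hw.eq_or_lt with rfl | hw
  · simp
  · rw [norm_smul, norm_inv, Real.norm_of_nonneg (by positivity), inv_mul_le_iff₀ (by positivity)]
    calc _ ≤ _ := hv
      _ = _ := by ring

theorem smul_weighted {c d w : ℝ} {v : F} (hd : 0 < d) (hv : ‖v‖ ≤ d * c * w ^ 2) :
    (d * w) • (d * w)⁻¹ • v = v := by
  rcases eq_or_ne w 0 with rfl | hw
  · have : v = 0 := by simpa using hv
    simp [this]
  · rw [smul_smul, mul_inv_cancel₀ (mul_ne_zero hd.ne' hw), one_smul]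

/-- A bound by the square of the weight leaves one factor w after the division, so the quotient
tends to 0 where w vanishes. Its value there is also 0, because the inverse of 0 is 0. -/
theorem continuousOn_weighted {X : Type} [TopologicalSpace X] {c d : ℝ} {w : X → ℝ} {v : X → F}
    {S : Set X} (hd : 0 < d) (hw : Continuous w) (hw0 : ∀ x, 0 ≤ w x) (hv : ContinuousOn v S)
    (hb : ∀ x ∈ S, ‖v x‖ ≤ d * c * w x ^ 2) : ContinuousOn (fun x => (d * w x)⁻¹ • v x) S := by
  intro x hx
  rcases (hw0 x).eq_or_lt with h | h
  · have h0 : (d * w x)⁻¹ • v x = 0 := by simp [← h]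
    rw [ContinuousWithinAt, h0]
    refine squeeze_zero_norm' (a := fun x => c * w x) ?_ ?_
    · filter_upwards [self_mem_nhdsWithin] with z hz using norm_weighted_le hd (hw0 z) (hb z hz)
    · have : Tendsto (fun x => c * w x) (𝓝[S] x) (𝓝 (c * w x)) :=
        (hw.const_mul c).continuousWithinAt
      rwa [← h, mul_zero] at this
  · exact ((hw.continuousWithinAt.const_mul d).inv₀ (mul_pos hd h).ne').smul (hv x hx)

theorem hasDerivWithinAt_weighted {d κ : ℝ} {w : ℝ → ℝ} {v : ℝ → F} {v' : F} {J : Set ℝ} {t : ℝ}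
    (hd : 0 < d) (hw : HasDerivWithinAt w (κ * w t) J t) (hwt : w t ≠ 0)
    (hv : HasDerivWithinAt v v' J t) : HasDerivWithinAt (fun t => (d * w t)⁻¹ • v t)
      ((d * w t)⁻¹ • v' - κ • (d * w t)⁻¹ • v t) J t := by
  refine (((hw.const_mul d).fun_inv (mul_ne_zero hd.ne' hwt)).smul hv).congr_deriv ?_
  rw [sub_eq_add_neg, ← neg_smul, smul_smul]
  congr 2
  field_simp

/-- Tietze extension. An orbit on one hyperbola becomes an element of the function space on the
square; the values elsewhere do not matter, as the operator acts on each hyperbola separately. -/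
theorem ContinuousOn.exists_continuousMap_eqOn {X : Type} [TopologicalSpace X] [NormalSpace X]
    [FiniteDimensional ℝ F] {S : Set X} (hS : IsClosed S) {f : X → F} (hf : ContinuousOn f S) :
    ∃ g : C(X, F), ∀ x ∈ S, g x = f x := by
  obtain ⟨g, hg⟩ := ContinuousMap.exists_restrict_eq (Y := F) hS ⟨S.domRestrict f, hf.domRestrict⟩
  exact ⟨g, fun x hx => congr($hg ⟨x, hx⟩)⟩

end Weighted

namespace CornerField

open CornerProblem

variable {EA EB EC : Type}
  [NormedAddCommGroup EA] [InnerProductSpace ℝ EA] [FiniteDimensional ℝ EA]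
  [NormedAddCommGroup EB] [InnerProductSpace ℝ EB] [FiniteDimensional ℝ EB]
  [NormedAddCommGroup EC] [InnerProductSpace ℝ EC] [FiniteDimensional ℝ EC]
  {C : CornerField EA EB EC}
  {Y : Type} [NormedAddCommGroup Y] [NormedSpace ℝ Y] [CompleteSpace Y]
  {D : CornerData EA EB EC Y C.n C.μ C.K} {y : Y} {p : UnitSquare} {h e : ℝ}

theorem isClosed_hyperbola (e : ℝ) : IsClosed {p : UnitSquare | (p.1 : ℝ) * p.2 = e} :=
  isClosed_eq (by fun_prop) continuous_const

/-- The evolution equations in weighted coordinates follow from those in physical coordinates. -/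
theorem evolves_of_hasDerivWithinAt {x : Triple EA EB EC} {g : ℝ}
    (hg : g = 1 + D.s y * timeWeight (p.1 * p.2))
    (hh : p.2 * Real.exp h ≤ 1)
    (ha : ∀ r ∈ Icc 0 h, ‖x.1 (flow r p)‖ ≤ C.R) (hb : ∀ r ∈ Icc 0 h, ‖x.2.1 (flow r p)‖ ≤ C.R)
    (hc : ∀ r ∈ Icc 0 h, ‖x.2.2 (flow r p)‖ ≤ 1)
    (h1 : ∀ r ∈ Icc 0 h, HasDerivWithinAt (fun r => x.1 (flow r p))
      (g • C.A ((0, 0, C.z₀) + C.scale x (flow r p)) (x.1 (flow r p)) -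
        C.μ • x.1 (flow r p)) (Icc 0 h) r)
    (h2 : ∀ r ∈ Icc 0 h, HasDerivWithinAt (fun r => x.2.1 (flow r p))
      (g • C.B ((0, 0, C.z₀) + C.scale x (flow r p)) (x.2.1 (flow r p)) +
        C.μ • x.2.1 (flow r p)) (Icc 0 h) r)
    (h3 : ∀ r ∈ Icc 0 h, HasDerivWithinAt (fun r => x.2.2 (flow r p))
      ((g * C.ϱ) • C.Q ((0, 0, C.z₀) + C.scale x (flow r p))
        (((flow r p).2 : ℝ) ^ C.μ • x.1 (flow r p), ((flow r p).1 : ℝ) ^ C.μ • x.2.1 (flow r p)))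
      (Icc 0 h) r) :
    (C.problem D).Evolves y x x p h := by
  have harg : ∀ r ∈ Icc 0 h, C.arg (C.weights D (flow r p), x.1 (flow r p), x.2.1 (flow r p),
      x.2.2 (flow r p)) = (0, 0, C.z₀) + C.scale x (flow r p) := by
    intro r hr
    rw [arg_weights x (ha r hr) (hb r hr) (hc r hr), scale_apply]
    simp
  have hw : ∀ r ∈ Icc 0 h, 1 + D.s y * ((C.weights D) (flow r p)).2.2.1 = g := by
    intro r hr
    show 1 + D.s y * timeWeight _ = _
    rw [flow_mul hr.1 (le_one_of_le hh hr.2), hg]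
  constructor
  · intro r hr
    refine (h1 r hr).congr_deriv ?_
    have ca := cutoff_eq_self C.R_pos (ha r hr)
    simp only [problem, pack, ContinuousMap.coe_mk, nlA]
    rw [harg r hr, hw r hr, ca]
    simp only [_root_.sub_apply, _root_.smul_apply, one_apply_eq_self]
    module
  · intro r hr
    refine (h2 r hr).congr_deriv ?_
    have ca := cutoff_eq_self C.R_pos (hb r hr)
    simp only [problem, pack, ContinuousMap.coe_mk, nlB]
    rw [harg r hr, hw r hr, ca]
    simp only [_root_.sub_apply, _root_.add_apply, _root_.smul_apply, one_apply_eq_self]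
    module
  · intro r hr
    refine (h3 r hr).congr_deriv ?_
    have ca := cutoff_eq_self C.R_pos (ha r hr)
    have cb := cutoff_eq_self C.R_pos (hb r hr)
    simp only [problem, pack, ContinuousMap.coe_mk, nl₁, nl₂]
    rw [harg r hr, hw r hr, ca, cb]
    have : ∀ (X : EA × EB × EC) (a : EA) (b : EB) (u v : ℝ), C.Q X (u • a, v • b) =
        u • C.Q X (a, 0) + v • C.Q X (0, b) := by
      intro X a b u v
      rw [← map_smul, ← map_smul, ← map_add]; simp
    rw [this]
    simp only [ContinuousLinearMap.inl_apply, ContinuousLinearMap.inr_apply]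
    module

/-- A family of orbits along a hyperbola that satisfies the boundary conditions and decays like the
solution of the corner problem is the solution of the corner problem. -/
theorem phys_eq_of_orbit (hy : y ∈ (C.problem D).O) (heρ : e ≤ D.ρ)
    {Z : UnitSquare → EA × EB × EC} (hZ : ContinuousOn Z {p | (p.1 : ℝ) * p.2 = e})
    (ha : ∀ p : UnitSquare, (p.1 : ℝ) * p.2 = e →
      ‖(Z p).1‖ ≤ C.ϱ ^ 2 * (C.R / 2) * ((p.2 : ℝ) ^ C.μ) ^ 2)
    (hb : ∀ p : UnitSquare, (p.1 : ℝ) * p.2 = e →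
      ‖(Z p).2.1‖ ≤ C.ϱ ^ 2 * (C.R / 2) * ((p.1 : ℝ) ^ C.μ) ^ 2)
    (hc : ∀ p : UnitSquare, (p.1 : ℝ) * p.2 = e → ‖(Z p).2.2 - C.z₀‖ ≤ C.ϱ / 2)
    (hev : ∀ p : UnitSquare, (p.1 : ℝ) * p.2 = e → ∀ h, 0 ≤ h → p.2 * Real.exp h ≤ 1 →
      ∀ r ∈ Icc 0 h, HasDerivWithinAt (fun r => Z (flow r p))
        ((1 + D.s y * timeWeight e) • C.vf (Z (flow r p))) (Icc 0 h) r)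
    (hA : ∀ p : UnitSquare, (p.1 : ℝ) * p.2 = e → (p.2 : ℝ) = 1 → (Z p).1 = D.a₁ y)
    (hB : ∀ p : UnitSquare, (p.1 : ℝ) * p.2 = e → (p.1 : ℝ) = 1 → (Z p).2.1 = D.b₁ y)
    (hC : ∀ p : UnitSquare, (p.1 : ℝ) * p.2 = e → (Z (exitPt p)).2.2 =
      D.k (y, (Z (entryPt p)).1, (Z (exitPt p)).2.2 - (Z (entryPt p)).2.2))
    (hp : (p.1 : ℝ) * p.2 = e) : C.phys D y p = Z p ∧ C.Good D y p := by
  have hϱ := C.ϱ_pos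
  have hϱ2 : 0 < C.ϱ ^ 2 := by positivity
  have hμ := C.μ_pos
  have hR := C.R_pos
  have hw0 : ∀ t : unitInterval, 0 ≤ (t : ℝ) ^ C.μ := fun t => Real.rpow_nonneg t.2.1 _
  have hw1 : ∀ t : unitInterval, (t : ℝ) ^ C.μ ≤ 1 := fun t =>
    Real.rpow_le_one t.2.1 t.2.2 hμ.le
  have hcl := isClosed_hyperbola e
  obtain ⟨α, hα⟩ := (continuousOn_weighted (w := fun p : UnitSquare => (p.2 : ℝ) ^ C.μ) hϱ2
    (weightSnd hμ).continuous (fun p => hw0 p.2) (continuous_fst.comp_continuousOn hZ)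
    ha).exists_continuousMap_eqOn hcl
  obtain ⟨β, hβ⟩ := (continuousOn_weighted (w := fun p : UnitSquare => (p.1 : ℝ) ^ C.μ) hϱ2
    (weightFst hμ).continuous (fun p => hw0 p.1)
    ((continuous_fst.comp continuous_snd).comp_continuousOn hZ) hb).exists_continuousMap_eqOn hcl
  obtain ⟨γ, hγ⟩ := (((((continuous_snd.comp continuous_snd).comp_continuousOn hZ).sub
    (continuousOn_const (c := C.z₀))).const_smul C.ϱ⁻¹)).exists_continuousMap_eqOn hcl
  simp only [mem_ofPred_eq, Function.comp_apply, Pi.smul_apply, Pi.sub_apply] at hα hβ hγ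
  have nα : ∀ p : UnitSquare, (p.1 : ℝ) * p.2 = e → ‖α p‖ ≤ C.R / 2 := fun p hp => by
    rw [hα p hp]
    exact (norm_weighted_le hϱ2 (hw0 _) (ha p hp)).trans
      (mul_le_of_le_one_right (by positivity) (hw1 _))
  have nβ : ∀ p : UnitSquare, (p.1 : ℝ) * p.2 = e → ‖β p‖ ≤ C.R / 2 := fun p hp => by
    rw [hβ p hp]
    exact (norm_weighted_le hϱ2 (hw0 _) (hb p hp)).trans
      (mul_le_of_le_one_right (by positivity) (hw1 _))
  have nγ : ∀ p : UnitSquare, (p.1 : ℝ) * p.2 = e → ‖γ p‖ ≤ 1 / 2 := fun p hp => by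
    rw [hγ p hp, norm_smul, norm_inv, Real.norm_of_nonneg hϱ.le, inv_mul_le_iff₀ hϱ]
    simpa [div_eq_mul_inv] using hc p hp
  let x : Triple EA EB EC := (α, β, γ)
  have hx : ∀ p : UnitSquare, (p.1 : ℝ) * p.2 = e →
      (0, 0, C.z₀) + C.scale x p = Z p := fun p hp => by
    rw [scale_apply]
    simp only [x, hα p hp, hβ p hp, hγ p hp]
    rw [smul_weighted hϱ2 (ha p hp), smul_weighted hϱ2 (hb p hp), smul_smul,
      mul_inv_cancel₀ hϱ.ne', one_smul]
    ext <;> simp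
  have key : ∀ p : UnitSquare, (p.1 : ℝ) * p.2 = e →
      at' ((C.problem D).sol y) p = at' x p := by
    intro p hp
    refine (C.problem D).sol_eq_of_evolves hy ?_ ?_ ?_ ?_ hp
    · intro p hp h h0 hh
      have hpr : ∀ r ∈ Icc 0 h, ((flow r p).1 : ℝ) * (flow r p).2 = e := fun r hr =>
        (flow_mul hr.1 (le_one_of_le hh hr.2)).trans hp
      have hd := hev p hp h h0 hh
      refine evolves_of_hasDerivWithinAt (g := 1 + D.s y * timeWeight e) (by rw [hp]) hh
        (fun r hr => (nα _ (hpr r hr)).trans (by linarith))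
        (fun r hr => (nβ _ (hpr r hr)).trans (by linarith))
        (fun r hr => (nγ _ (hpr r hr)).trans (by linarith)) ?_ ?_ ?_
      · intro r hr
        rw [hx _ (hpr r hr)]
        -- On the axis η = 0 the weight cannot be divided out, but there a and α vanish identically
        -- and the equation is trivial.
        rcases eq_or_ne (p.2 : ℝ) 0 with h2 | h2
        · have hz : ∀ r ∈ Icc 0 h, α (flow r p) = 0 := fun r hr => by
            rw [hα _ (hpr r hr), flow_snd (le_one_of_le hh hr.2), h2, zero_mul,
              Real.zero_rpow hμ.ne']
            simp
          refine ((hasDerivWithinAt_const r (Icc 0 h) (0 : EA)).congr hz (hz r hr)).congr_deriv ?_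
          simp [x, hz r hr]
        · have hwd := hasDerivWithinAt_snd_rpow C.μ hh hr
          have hwn : ((flow r p).2 : ℝ) ^ C.μ ≠ 0 := by
            rw [flow_snd (le_one_of_le hh hr.2)]
            have := lt_of_le_of_ne p.2.2.1 (Ne.symm h2)
            positivity
          have := hasDerivWithinAt_weighted hϱ2 hwd hwn (hd r hr).fst
          refine (this.congr (fun r hr => hα _ (hpr r hr)) (hα _ (hpr r hr))).congr_deriv ?_
          simp only [x, hα _ (hpr r hr), vf, Prod.smul_fst, map_smul]
          module
      · intro r hr
        rw [hx _ (hpr r hr)]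
        rcases eq_or_ne (p.1 : ℝ) 0 with h2 | h2
        · have hz : ∀ r ∈ Icc 0 h, β (flow r p) = 0 := fun r hr => by
            rw [hβ _ (hpr r hr), flow_fst hr.1, h2, zero_mul,
              Real.zero_rpow hμ.ne']
            simp
          refine ((hasDerivWithinAt_const r (Icc 0 h) (0 : EB)).congr hz (hz r hr)).congr_deriv ?_
          simp [x, hz r hr]
        · have hwd := hasDerivWithinAt_fst_rpow (p := p) C.μ hr
          have hwn : ((flow r p).1 : ℝ) ^ C.μ ≠ 0 := by
            rw [flow_fst hr.1]
            have := lt_of_le_of_ne p.1.2.1 (Ne.symm h2)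
            positivity
          have := hasDerivWithinAt_weighted hϱ2 hwd hwn (hd r hr).snd.fst
          refine (this.congr (fun r hr => hβ _ (hpr r hr)) (hβ _ (hpr r hr))).congr_deriv ?_
          simp only [x, hβ _ (hpr r hr), vf, Prod.smul_fst, Prod.smul_snd, map_smul]
          module
      · intro r hr
        rw [hx _ (hpr r hr)]
        have h1 : HasDerivWithinAt (fun r => C.ϱ⁻¹ • ((Z (flow r p)).2.2 - C.z₀))
            (C.ϱ⁻¹ • ((1 + D.s y * timeWeight e) • C.vf (Z (flow r p))).2.2) (Icc 0 h) r :=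
          HasDerivWithinAt.const_smul _ (HasDerivWithinAt.sub_const _
            ((hd r hr).hasFDerivWithinAt.snd.snd.hasDerivWithinAt.congr_deriv (by simp)))
        refine (h1.congr (fun r hr => hγ _ (hpr r hr)) (hγ _ (hpr r hr))).congr_deriv ?_
        have e1 := congrArg Prod.fst (hx _ (hpr r hr))
        have e2 := congrArg (fun z => z.2.1) (hx _ (hpr r hr))
        simp only [scale_apply, Prod.fst_add, Prod.snd_add, zero_add]
          at e1 e2
        simp only [vf, Prod.smul_snd]
        have e3 : ((Z (flow r p)).1, (Z (flow r p)).2.1) = C.ϱ ^ 2 •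
            ((((flow r p).2 : ℝ) ^ C.μ • x.1 (flow r p),
              ((flow r p).1 : ℝ) ^ C.μ • x.2.1 (flow r p)) : EA × EB) := by
          rw [← e1, ← e2]; simp [mul_smul]
        rw [e3, map_smul, smul_smul, smul_smul]
        congr 1
        field_simp
    · intro p hp h1
      show α p = (C.ϱ ^ 2)⁻¹ • D.a₁ y
      rw [hα p hp, hA p hp h1, h1, Real.one_rpow, mul_one]
    · intro p hp h1
      show β p = (C.ϱ ^ 2)⁻¹ • D.b₁ y
      rw [hβ p hp, hB p hp h1, h1, Real.one_rpow, mul_one]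
    · intro p hp
      have hpe : ((entryPt p).1 : ℝ) * (entryPt p).2 = e := mul_entryPt.trans hp
      have hpx : ((exitPt p).1 : ℝ) * (exitPt p).2 = e := mul_exitPt.trans hp
      show γ (exitPt p) = C.ϱ⁻¹ • (D.k (y, (C.ϱ ^ 2 *
        (min ((exitPt p).1 * (exitPt p).2 : ℝ) D.ρ) ^ C.μ) • α (entryPt p),
        C.ϱ • (γ (exitPt p) - γ (entryPt p))) - C.z₀)
      -- For e ≤ ρ the truncation of the fourth weight is inactive, and the scaled exit condition is
      -- the physical one.
      rw [hpx, min_eq_left heρ]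
      have e1 : (C.ϱ ^ 2 * e ^ C.μ) • α (entryPt p) = (Z (entryPt p)).1 := by
        have h2 : ((entryPt p).2 : ℝ) = e := by rw [← hp]; simp [entryPt]
        rw [hα _ hpe, h2]
        have := ha _ hpe
        rw [h2] at this
        exact smul_weighted hϱ2 this
      have e2 : C.ϱ • (γ (exitPt p) - γ (entryPt p)) =
          (Z (exitPt p)).2.2 - (Z (entryPt p)).2.2 := by
        rw [hγ _ hpe, hγ _ hpx, ← smul_sub, smul_smul, mul_inv_cancel₀ hϱ.ne', one_smul]
        abel
      rw [e1, e2, ← hC p hp, hγ _ hpx]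
  have hk := key p hp
  have k1 : ((C.problem D).sol y).1 p = α p := congrArg Prod.fst hk
  have k2 : ((C.problem D).sol y).2.1 p = β p := congrArg (fun z => z.2.1) hk
  have k3 : ((C.problem D).sol y).2.2 p = γ p := congrArg (fun z => z.2.2) hk
  refine ⟨?_, ?_, ?_, ?_⟩
  · rw [← hx p hp, phys, ContinuousMap.add_apply, ContinuousMap.const_apply, scale_apply, scale_apply, k1, k2, k3]
  · rw [k1]; exact (nα p hp).trans_lt (by linarith)
  · rw [k2]; exact (nβ p hp).trans_lt (by linarith)
  · rw [k3]; exact (nγ p hp).trans_lt (by linarith)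

end CornerField

end

/-! ### From eigenvalues to decay of the matrix exponential -/

noncomputable section

section Spectrum

/-- The exponential series are compared term by term. The scalar fields may differ because the
coefficients 1/n! are real; the use is the inclusion of real into complex Euclidean space. -/
theorem exp_apply_of_intertwine {𝕜 𝕜' : Type} [RCLike 𝕜] [RCLike 𝕜'] {E F : Type}
    [NormedAddCommGroup E] [NormedSpace 𝕜 E] [CompleteSpace E]
    [NormedAddCommGroup F] [NormedSpace 𝕜' F] [CompleteSpace F] [NormedSpace ℝ E] [NormedSpace ℝ F]
    [IsScalarTower ℝ 𝕜 E] [IsScalarTower ℝ 𝕜' F]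
    (j : E →L[ℝ] F) (T : E →L[𝕜] E) (T' : F →L[𝕜'] F) (h : ∀ x, T' (j x) = j (T x)) (x : E) :
    NormedSpace.exp T' (j x) = j (NormedSpace.exp T x) := by
  have hn : ∀ n : ℕ, (T' ^ n) (j x) = j ((T ^ n) x) := by
    intro n
    induction n with
    | zero => simp
    | succ n ih => rw [pow_succ', pow_succ', mul_apply_eq_comp, mul_apply_eq_comp, ih, h]
  have h1 := (NormedSpace.exp_series_hasSum_exp' (𝕂 := 𝕜) T).mapL
    (ContinuousLinearMap.apply 𝕜 E x)
  have h2 := (NormedSpace.exp_series_hasSum_exp' (𝕂 := 𝕜') T').mapL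
    (ContinuousLinearMap.apply 𝕜' F (j x))
  have h3 := h1.mapL j
  refine h2.unique (h3.congr_fun ?_)
  intro n
  simp only [ContinuousLinearMap.apply_apply, _root_.smul_apply, hn]
  have e1 : ((n.factorial : 𝕜)⁻¹) • (T ^ n) x = ((n.factorial : ℝ)⁻¹) • (T ^ n) x := by
    rw [← algebraMap_smul 𝕜 ((n.factorial : ℝ)⁻¹)]; simp
  have e2 : ((n.factorial : 𝕜')⁻¹) • j ((T ^ n) x) = ((n.factorial : ℝ)⁻¹) • j ((T ^ n) x) := by
    rw [← algebraMap_smul 𝕜' ((n.factorial : ℝ)⁻¹)]; simp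
  rw [e1, e2, map_smul]

variable {E : Type} [NormedAddCommGroup E] [NormedSpace ℂ E] [FiniteDimensional ℂ E]

/-- The eigenspace of exp T for w is invariant under T, since the two commute. It therefore contains
an eigenvector of T, with an eigenvalue z, and on this vector exp T acts as e^z. -/
theorem exists_eigenvalue_of_mem_spectrum_exp (T : E →L[ℂ] E) {w : ℂ}
    (hw : w ∈ spectrum ℂ (NormedSpace.exp T)) : ∃ z ∈ spectrum ℂ T, w = Complex.exp z := by
  have : CompleteSpace E := FiniteDimensional.complete ℂ E
  let Φ := (Module.End.toContinuousLinearMap (𝕜 := ℂ) E).symm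
  have hs : ∀ S : E →L[ℂ] E, spectrum ℂ (Φ S) = spectrum ℂ S := fun S => AlgEquiv.spectrum_eq Φ S
  have hw' : Module.End.HasEigenvalue (Φ (NormedSpace.exp T)) w :=
    Module.End.hasEigenvalue_iff_mem_spectrum.2 (by rw [hs]; exact hw)
  have hcomm : Commute (Φ (NormedSpace.exp T)) (Φ T) :=
    ((Commute.refl T).exp_left).map Φ
  let W := Module.End.eigenspace (Φ (NormedSpace.exp T)) w
  have hmaps : MapsTo (Φ T) W W := Module.End.mapsTo_genEigenspace_of_comm hcomm w 1
  have : Nontrivial W := Submodule.nontrivial_iff_ne_bot.2 hw'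
  obtain ⟨z, hz⟩ := Module.End.exists_eigenvalue ((Φ T).restrict hmaps)
  obtain ⟨v, hv⟩ := hz.exists_hasEigenvector
  have hv1 : T v = z • (v : E) := congrArg Subtype.val hv.apply_eq_smul
  have hv0 : (v : E) ≠ 0 := fun h => hv.2 (Subtype.ext h)
  refine ⟨z, ?_, ?_⟩
  · rw [← hs]
    exact Module.End.hasEigenvalue_iff_mem_spectrum.1
      (Module.End.hasEigenvalue_of_hasEigenvector ⟨Module.End.mem_eigenspace_iff.2 hv1, hv0⟩)
  · have h1 : NormedSpace.exp T (v : E) = w • (v : E) := Module.End.mem_eigenspace_iff.1 v.2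
    have h2 := (NormedSpace.exp_series_hasSum_exp' (𝕂 := ℂ) T).mapL
      (ContinuousLinearMap.apply ℂ E (v : E))
    have h3 := (NormedSpace.exp_series_hasSum_exp' (𝕂 := ℂ) z).smul_const (v : E)
    have hn : ∀ n : ℕ, (T ^ n) (v : E) = z ^ n • (v : E) := by
      intro n
      induction n with
      | zero => simp
      | succ n ih =>
        rw [pow_succ', mul_apply_eq_comp, ih, map_smul, hv1, smul_smul, pow_succ]
    have h4 := h2.unique (h3.congr_fun (fun n => by
      simp only [ContinuousLinearMap.apply_apply, _root_.smul_apply, hn, smul_assoc]))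
    rw [ContinuousLinearMap.apply_apply, h1, ← Complex.exp_eq_exp_ℂ] at h4
    exact smul_left_injective ℂ hv0 h4

/-- The eigenvalues e^z of exp T have modulus below 1, so the spectral radius is below 1, and
Gelfand's formula gives a power of norm below 1. -/
theorem exists_norm_exp_pow_lt (T : E →L[ℂ] E) (hT : ∀ z ∈ spectrum ℂ T, z.re < 0) :
    ∃ n : ℕ, 0 < n ∧ ‖NormedSpace.exp T ^ n‖ < 1 := by
  have : CompleteSpace E := FiniteDimensional.complete ℂ E
  rcases subsingleton_or_nontrivial E with h | h
  · refine ⟨1, one_pos, ?_⟩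
    have : NormedSpace.exp T ^ 1 = 0 := Subsingleton.elim _ _
    rw [this]; simp
  · have hr : spectralRadius ℂ (NormedSpace.exp T) < (1 : NNReal) := by
      refine spectrum.spectralRadius_lt_of_forall_lt _ fun w hw => ?_
      obtain ⟨z, hz, rfl⟩ := exists_eigenvalue_of_mem_spectrum_exp T hw
      rw [← NNReal.coe_lt_coe, coe_nnnorm, Complex.norm_exp, NNReal.coe_one, Real.exp_lt_one_iff]
      exact hT z hz
    have hg := spectrum.pow_nnnorm_pow_one_div_tendsto_nhds_spectralRadius (NormedSpace.exp T)
    obtain ⟨n, hn, hn1⟩ := ((hg.eventually (gt_mem_nhds hr)).and (eventually_gt_atTop 0)).exists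
    refine ⟨n, hn1, ?_⟩
    by_contra hcon
    push Not at hcon
    refine absurd hn (not_lt.2 ?_)
    refine ENNReal.one_le_rpow ?_ (by positivity)
    exact_mod_cast (show (1 : NNReal) ≤ ‖NormedSpace.exp T ^ n‖₊ from hcon)

end Spectrum

/-- A real matrix as an operator on Euclidean space. -/
abbrev euclideanCLM {k : ℕ} (M : Matrix (Fin k) (Fin k) ℝ) :
    EuclideanSpace ℝ (Fin k) →L[ℝ] EuclideanSpace ℝ (Fin k) :=
  Matrix.toEuclideanCLM (𝕜 := ℝ) M

/-- The embedding of real into complex Euclidean space is isometric and intertwines the two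
exponentials, so the complex norm bound restricts to the real operator. -/
theorem exists_norm_expFlow_lt {k : ℕ} (M : Matrix (Fin k) (Fin k) ℝ)
    (hM : ∀ z ∈ spectrum ℂ (M.map Complex.ofReal), z.re < 0) :
    ∃ n : ℝ, 0 < n ∧ ‖expFlow (euclideanCLM M) n‖ < 1 := by
  let T' : EuclideanSpace ℂ (Fin k) →L[ℂ] EuclideanSpace ℂ (Fin k) :=
    Matrix.toEuclideanCLM (𝕜 := ℂ) (M.map Complex.ofReal)
  have hT' : ∀ z ∈ spectrum ℂ T', z.re < 0 := by
    intro z hz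
    refine hM z ?_
    rwa [← AlgEquiv.spectrum_eq (Matrix.toEuclideanCLM (n := Fin k) (𝕜 := ℂ)) (M.map Complex.ofReal)]
  obtain ⟨n, hn, hn1⟩ := exists_norm_exp_pow_lt T' hT'
  let j₀ : EuclideanSpace ℝ (Fin k) →ₗ[ℝ] EuclideanSpace ℂ (Fin k) :=
    { toFun := fun x => WithLp.toLp 2 (fun i => (x i : ℂ))
      map_add' := fun x y => by ext i; simp
      map_smul' := fun c x => by ext i; simp }
  let j : EuclideanSpace ℝ (Fin k) →L[ℝ] EuclideanSpace ℂ (Fin k) := LinearMap.toContinuousLinearMap j₀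
  have hj : ∀ x, ‖j x‖ = ‖x‖ := by
    intro x
    rw [EuclideanSpace.norm_eq, EuclideanSpace.norm_eq]
    simp [j, j₀]
  have hint : ∀ x, T' (j x) = j (euclideanCLM M x) := by
    intro x
    ext i
    simp [T', j, j₀, Matrix.mulVec, dotProduct, Matrix.ofLp_toEuclideanCLM]
  refine ⟨n, by exact_mod_cast hn, lt_of_le_of_lt ?_ hn1⟩
  refine ContinuousLinearMap.opNorm_le_bound _ (norm_nonneg _) fun x => ?_
  have hexp := exp_apply_of_intertwine j (euclideanCLM M) T' hint
  have hpow : ∀ m : ℕ, (NormedSpace.exp T' ^ m) (j x) = j ((NormedSpace.exp (euclideanCLM M) ^ m) x) := by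
    intro m
    induction m with
    | zero => simp
    | succ m ih => rw [pow_succ', pow_succ', mul_apply_eq_comp, mul_apply_eq_comp, ih, hexp]
  have hE : expFlow (euclideanCLM M) n = NormedSpace.exp (euclideanCLM M) ^ n := by
    rw [expFlow, Nat.cast_smul_eq_nsmul]
    let _ : NormedAlgebra ℚ (EuclideanSpace ℝ (Fin k) →L[ℝ] EuclideanSpace ℝ (Fin k)) :=
      NormedAlgebra.restrictScalars ℚ ℝ _
    exact NormedSpace.exp_nsmul _ _
  rw [hE, ← hj, ← hpow, ← hj x]
  exact ContinuousLinearMap.le_opNorm _ _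

end

/-! ### Uniform decay for linear equations with slowly varying coefficients -/

noncomputable section

/-- A quantity that is halved over time windows of length `N` decays exponentially. -/
theorem decay_of_windows {φ : ℝ → ℝ} {t₀ t₁ N G : ℝ} (hN : 0 < N) (hG : 0 ≤ G)
    (hφ : ∀ t, 0 ≤ φ t) (h1 : ∀ s t, t₀ ≤ s → s ≤ t → t ≤ t₁ → t - s ≤ N → φ t ≤ G * φ s)
    (h2 : ∀ s, t₀ ≤ s → s + N ≤ t₁ → φ (s + N) ≤ 1 / 2 * φ s) (h : t₀ ≤ t₁) :
    φ t₁ ≤ 2 * G * Real.exp (-(Real.log 2 / N) * (t₁ - t₀)) * φ t₀ := by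
  have key : ∀ n : ℕ, t₀ + n * N ≤ t₁ → φ (t₀ + n * N) ≤ (1 / 2) ^ n * φ t₀ := by
    intro n
    induction n with
    | zero => simp
    | succ n ih =>
      intro hn
      push_cast at hn ⊢
      have e : t₀ + ((n : ℝ) + 1) * N = t₀ + n * N + N := by ring
      rw [e] at hn ⊢
      calc _ ≤ 1 / 2 * φ (t₀ + n * N) := h2 _ (by linarith [mul_nonneg n.cast_nonneg hN.le]) hn
        _ ≤ 1 / 2 * ((1 / 2) ^ n * φ t₀) := by gcongr; exact ih (by linarith)
        _ = _ := by ring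
  let n := ⌊(t₁ - t₀) / N⌋₊
  have hn1 : (n : ℝ) ≤ (t₁ - t₀) / N := Nat.floor_le (div_nonneg (by linarith) hN.le)
  have hn2 : (t₁ - t₀) / N < n + 1 := Nat.lt_floor_add_one _
  have hn1' : (n : ℝ) * N ≤ t₁ - t₀ := (le_div_iff₀ hN).1 hn1
  have hn2' : t₁ - t₀ < (n + 1) * N := (div_lt_iff₀ hN).1 hn2
  have h3 := h1 (t₀ + n * N) t₁ (by linarith [mul_nonneg n.cast_nonneg hN.le]) (by linarith) le_rfl
    (by linarith)
  have h4 : ((1 : ℝ) / 2) ^ n ≤ 2 * Real.exp (-(Real.log 2 / N) * (t₁ - t₀)) := by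
    have e1 : ((1 : ℝ) / 2) ^ n = Real.exp (-(Real.log 2) * n) := by
      rw [mul_comm, Real.exp_nat_mul, Real.exp_neg, Real.exp_log two_pos, one_div]
    have e2 : (2 : ℝ) * Real.exp (-(Real.log 2 / N) * (t₁ - t₀)) =
        Real.exp (Real.log 2 + -(Real.log 2 / N) * (t₁ - t₀)) := by
      rw [Real.exp_add, Real.exp_log two_pos]
    rw [e1, e2, Real.exp_le_exp]
    have hl : 0 < Real.log 2 := Real.log_pos one_lt_two
    have : Real.log 2 / N * (t₁ - t₀) ≤ Real.log 2 * (n + 1) := by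
      rw [div_mul_eq_mul_div, mul_div_assoc]; gcongr
    linarith
  calc φ t₁ ≤ G * ((1 / 2) ^ n * φ t₀) := h3.trans (by gcongr; exact key n (by linarith))
    _ ≤ G * (2 * Real.exp (-(Real.log 2 / N) * (t₁ - t₀)) * φ t₀) := by gcongr; exact hφ _
    _ = _ := by ring

variable {F : Type} [NormedAddCommGroup F] [NormedSpace ℝ F] [CompleteSpace F]

theorem norm_expFlow_le (M : F →L[ℝ] F) (r : ℝ) : ‖expFlow M r‖ ≤ Real.exp (‖M‖ * |r|) := by
  rcases subsingleton_or_nontrivial F with h | h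
  · have : expFlow M r = 0 := Subsingleton.elim _ _
    rw [this]; simp
  · have h1 := NormedSpace.exp_series_hasSum_exp' (𝕂 := ℝ) (r • M)
    have h2 := NormedSpace.exp_series_hasSum_exp' (𝕂 := ℝ) (‖M‖ * |r|)
    rw [← Real.exp_eq_exp_ℝ] at h2
    refine tsum_of_norm_bounded h2 (fun n => ?_) |> fun h => by rwa [h1.tsum_eq] at h
    rw [norm_smul, smul_eq_mul, norm_inv, Real.norm_natCast]
    gcongr
    refine (norm_pow_le _ _).trans ?_
    rw [norm_smul, Real.norm_eq_abs, mul_comm]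

/-- On a compact set of exponentially stable operators the decay is uniform. -/
theorem uniform_expFlow_decay {𝒦 : Set (F →L[ℝ] F)} (h𝒦 : IsCompact 𝒦)
    (h : ∀ M ∈ 𝒦, ∃ n : ℝ, 0 < n ∧ ‖expFlow M n‖ < 1) :
    ∃ K ν : ℝ, 0 < ν ∧ ∀ M ∈ 𝒦, ∀ r, 0 ≤ r → ‖expFlow M r‖ ≤ K * Real.exp (-ν * r) := by
  obtain ⟨C, hC⟩ := h𝒦.isBounded.exists_norm_le
  -- The time at which the norm has fallen to 1/2 may vary with M. Smallness at a fixed time is an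
  -- open condition, so compactness bounds these times.
  have hw : ∃ N : ℝ, 0 < N ∧ ∀ M ∈ 𝒦, ∃ n : ℝ, 0 < n ∧ n ≤ N ∧ ‖expFlow M n‖ ≤ 1 / 2 := by
    refine h𝒦.induction_on (p := fun S => ∃ N : ℝ, 0 < N ∧ ∀ M ∈ S, ∃ n : ℝ, 0 < n ∧ n ≤ N ∧
      ‖expFlow M n‖ ≤ 1 / 2) ⟨1, one_pos, by simp⟩ ?_ ?_ ?_
    · rintro s t hst ⟨N, hN, h⟩
      exact ⟨N, hN, fun M hM => h M (hst hM)⟩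
    · rintro s t ⟨N, hN, h⟩ ⟨N', hN', h'⟩
      refine ⟨max N N', by positivity, ?_⟩
      rintro M (hM | hM)
      · obtain ⟨n, h1, h2, h3⟩ := h M hM
        exact ⟨n, h1, h2.trans (le_max_left _ _), h3⟩
      · obtain ⟨n, h1, h2, h3⟩ := h' M hM
        exact ⟨n, h1, h2.trans (le_max_right _ _), h3⟩
    · intro M hM
      obtain ⟨n, hn, hn1⟩ := h M hM
      -- A power brings the norm below 1/2. The exponent m + 1 is used in place of m to keep the
      -- time positive.
      obtain ⟨m, hm⟩ := exists_pow_lt_of_lt_one (show (0 : ℝ) < 1 / 2 by norm_num) hn1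
      have hpow : ∀ m : ℕ, ‖expFlow M (((m : ℕ) + 1 : ℕ) * n)‖ ≤ ‖expFlow M n‖ ^ (m + 1) := by
        intro m
        induction m with
        | zero => simp
        | succ m ih =>
          have e : (((m + 1 + 1 : ℕ) : ℝ)) * n = ((m + 1 : ℕ) : ℝ) * n + n := by push_cast; ring
          rw [e, expFlow_add, pow_succ]
          exact (norm_mul_le _ _).trans (by gcongr)
      have h1 : ‖expFlow M (((m : ℕ) + 1 : ℕ) * n)‖ < 1 / 2 := by
        refine (hpow m).trans_lt (lt_of_le_of_lt ?_ hm)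
        exact pow_le_pow_of_le_one (norm_nonneg _) hn1.le (Nat.le_succ m)
      have hcont : Continuous (fun M : F →L[ℝ] F => expFlow M (((m : ℕ) + 1 : ℕ) * n)) := by
        let _ : NormedAlgebra ℚ (F →L[ℝ] F) := NormedAlgebra.restrictScalars ℚ ℝ _
        exact NormedSpace.exp_continuous.comp (continuous_const_smul _)
      have hnp : 0 < (((m : ℕ) + 1 : ℕ) : ℝ) * n := by positivity
      refine ⟨{M' | ‖expFlow M' (((m : ℕ) + 1 : ℕ) * n)‖ < 1 / 2}, ?_, _, hnp, fun M' hM' =>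
        ⟨_, hnp, le_rfl, le_of_lt hM'⟩⟩
      exact mem_nhdsWithin_of_mem_nhds ((isOpen_lt hcont.norm continuous_const).mem_nhds h1)
  obtain ⟨N, hN, hw⟩ := hw
  have hl : 0 < Real.log 2 := Real.log_pos one_lt_two
  refine ⟨2 * Real.exp (|C| * N), Real.log 2 / N, by positivity, fun M hM r hr => ?_⟩
  obtain ⟨n, hn, hnN, h2⟩ := hw M hM
  have hMC : ‖M‖ ≤ |C| := (hC M hM).trans (le_abs_self C)
  have hd := decay_of_windows (φ := fun r => ‖expFlow M r‖) (t₀ := 0) (t₁ := r) (N := n)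
    (G := Real.exp (|C| * N)) hn (Real.exp_pos _).le (fun t => norm_nonneg _) ?_ ?_ hr
  · refine hd.trans ?_
    have h3 : ‖expFlow M 0‖ ≤ 1 := by
      rw [expFlow_zero]; exact ContinuousLinearMap.norm_id_le
    calc _ ≤ 2 * Real.exp (|C| * N) * Real.exp (-(Real.log 2 / N) * r) * 1 := by
          rw [sub_zero]
          gcongr
      _ = _ := mul_one _
  · intro s t _ hst _ hts
    have e : t = (t - s) + s := by ring
    conv_lhs => rw [e, expFlow_add]
    refine (norm_mul_le _ _).trans ?_
    gcongr
    refine (norm_expFlow_le M _).trans (Real.exp_le_exp.2 ?_)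
    rw [abs_of_nonneg (by linarith)]
    gcongr; linarith
  · intro s _ _
    rw [add_comm, expFlow_add]
    exact (norm_mul_le _ _).trans (by gcongr)

/-- Solutions of linear equations with slowly varying uniformly stable coefficients decay. -/
theorem exists_linear_decay {𝒦 : Set (F →L[ℝ] F)} {K ν Cb : ℝ} (hν : 0 < ν) (hCb : 0 < Cb)
    (hK : ∀ M ∈ 𝒦, ∀ r, 0 ≤ r → ‖expFlow M r‖ ≤ K * Real.exp (-ν * r))
    (hC : ∀ M ∈ 𝒦, ‖M‖ ≤ Cb) :
    ∃ N ε K₁ ν₁ : ℝ, 0 < N ∧ 0 < ε ∧ 0 < K₁ ∧ 0 < ν₁ ∧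
      ∀ (t₀ t₁ : ℝ) (Bm : ℝ → F →L[ℝ] F) (b : ℝ → F), t₀ ≤ t₁ →
      (∀ t ∈ Icc t₀ t₁, HasDerivWithinAt b (Bm t (b t)) (Icc t₀ t₁) t) →
      (∀ t ∈ Icc t₀ t₁, Bm t ∈ 𝒦) →
      (∀ s ∈ Icc t₀ t₁, ∀ t ∈ Icc t₀ t₁, |t - s| ≤ N → ‖Bm t - Bm s‖ ≤ ε) →
      ‖b t₁‖ ≤ K₁ * Real.exp (-ν₁ * (t₁ - t₀)) * ‖b t₀‖ := by
  -- Over a window of length N the frozen equation contracts by 1/4. The freezing error will be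
  -- another 1/4, so that the norm is halved.
  obtain ⟨N, hN, hKN⟩ : ∃ N : ℝ, 0 < N ∧ K * Real.exp (-ν * N) ≤ 1 / 4 := by
    have hlim : Tendsto (fun N : ℝ => K * Real.exp (-ν * N)) atTop (𝓝 (K * 0)) := by
      refine Tendsto.const_mul _ (Real.tendsto_exp_atBot.comp ?_)
      exact tendsto_id.const_mul_atTop_of_neg (by linarith)
    rw [mul_zero] at hlim
    obtain ⟨N, h1, h2⟩ := ((hlim.eventually (ge_mem_nhds (show (0 : ℝ) < 1 / 4 by norm_num))).and
      (eventually_gt_atTop 0)).exists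
    exact ⟨N, h2, h1⟩
  set G := Real.exp (Cb * N) with hG
  have hGp : 0 < G := Real.exp_pos _
  have hl : 0 < Real.log 2 := Real.log_pos one_lt_two
  -- The tolerance is chosen for Grönwall: an error of size εG‖b s‖ in the equation grows over the
  -- window to at most εG‖b s‖ G / Cb = ‖b s‖/4.
  refine ⟨N, Cb / (4 * G * G), 2 * G, Real.log 2 / N, hN, by positivity, by positivity,
    by positivity, ?_⟩
  intro t₀ t₁ Bm b h01 hb hB hslow
  have hcont : ContinuousOn b (Icc t₀ t₁) := fun t ht => (hb t ht).continuousWithinAt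
  have hright : ∀ t ∈ Ico t₀ t₁, HasDerivWithinAt b (Bm t (b t)) (Ici t) t := fun t ht =>
    (hb t ⟨ht.1, ht.2.le⟩).mono_of_mem_nhdsWithin (Icc_mem_nhdsGE_of_mem ht)
  have hgrow : ∀ s t, t₀ ≤ s → s ≤ t → t ≤ t₁ → t - s ≤ N → ‖b t‖ ≤ G * ‖b s‖ := by
    intro s t hs hst ht hN'
    have := norm_le_gronwallBound_of_norm_deriv_right_le (f := b) (f' := fun t => Bm t (b t))
      (δ := ‖b s‖) (K := Cb) (ε := 0) (a := s) (b := t)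
      (hcont.mono (Icc_subset_Icc hs ht))
      (fun u hu => hright u ⟨hs.trans hu.1, hu.2.trans_le ht⟩) le_rfl
      (fun u hu => by
        rw [add_zero]
        exact ContinuousLinearMap.le_of_opNorm_le _ (hC _ (hB u ⟨hs.trans hu.1, hu.2.le.trans ht⟩)) _)
      t ⟨hst, le_rfl⟩
    rw [gronwallBound_ε0] at this
    refine this.trans ?_
    rw [mul_comm, hG]
    gcongr
  refine decay_of_windows (φ := fun t => ‖b t‖) hN hGp.le (fun t => norm_nonneg _) hgrow ?_ h01
  intro s hs hsN
  have hsm : s ∈ Icc t₀ t₁ := ⟨hs, by linarith⟩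
  set M := Bm s with hM
  have hMC := hC _ (hB s hsm)
  have h1 := dist_le_of_approx_trajectories_ODE (v := fun _ x => M x) (K := Real.toNNReal Cb) (f := b)
    (f' := fun t => Bm t (b t)) (g := fun t => expFlow M (t - s) (b s))
    (g' := fun t => (M * expFlow M (t - s)) (b s)) (a := s) (b := s + N) (δ := 0)
    (εf := Cb / (4 * G * G) * (G * ‖b s‖)) (εg := 0)
    (fun _ => M.lipschitz.weaken (by
      rw [← NNReal.coe_le_coe, Real.coe_toNNReal _ hCb.le]; exact hMC))
    (hcont.mono (Icc_subset_Icc hs hsN))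
    (fun u hu => hright u ⟨hs.trans hu.1, hu.2.trans_le hsN⟩)
    (fun u hu => by
      have hu' : u ∈ Icc t₀ t₁ := ⟨hs.trans hu.1, hu.2.le.trans hsN⟩
      rw [dist_eq_norm, ← _root_.sub_apply]
      refine ContinuousLinearMap.le_of_opNorm_le_of_le _ (hslow s hsm u hu' ?_)
        (hgrow s u hs hu.1 hu'.2 (by linarith [hu.2]))
      rw [abs_of_nonneg (by linarith [hu.1])]; linarith [hu.2])
    ((((continuous_expFlow M).comp (by fun_prop)).clm_apply continuous_const).continuousOn)
    (fun u _ => by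
      have := (hasDerivAt_expFlow M (u - s)).scomp u ((hasDerivAt_id u).sub_const s)
      rw [one_smul] at this
      exact ((this.clm_apply (hasDerivAt_const u (b s))).congr_deriv
        (by simp)).hasDerivWithinAt)
    (fun u _ => by simp)
    (by simp [expFlow_zero])
    (s + N) ⟨by linarith, le_rfl⟩
  rw [Real.coe_toNNReal _ hCb.le, gronwallBound_of_K_ne_0 hCb.ne'] at h1
  simp only [add_sub_cancel_left, zero_mul, zero_add, add_zero] at h1
  rw [dist_eq_norm] at h1
  have h2 : ‖expFlow M N (b s)‖ ≤ 1 / 4 * ‖b s‖ :=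
    ContinuousLinearMap.le_of_opNorm_le _ ((hK _ (hB s hsm) N hN.le).trans hKN) _
  have h3 : Cb / (4 * G * G) * (G * ‖b s‖) / Cb * (Real.exp (Cb * N) - 1) ≤ 1 / 4 * ‖b s‖ := by
    have : Cb / (4 * G * G) * (G * ‖b s‖) / Cb = 1 / (4 * G) * ‖b s‖ := by field_simp
    rw [this]
    calc _ ≤ 1 / (4 * G) * ‖b s‖ * G := by gcongr; rw [← hG]; linarith
      _ = _ := by field_simp
  have h4 : b (s + N) = (b (s + N) - expFlow M N (b s)) + expFlow M N (b s) := by abel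
  calc ‖b (s + N)‖ ≤ ‖b (s + N) - expFlow M N (b s)‖ + ‖expFlow M N (b s)‖ := by
        conv_lhs => rw [h4]
        exact norm_add_le _ _
    _ ≤ 1 / 4 * ‖b s‖ + 1 / 4 * ‖b s‖ := add_le_add (h1.trans h3) h2
    _ = _ := by ring

end

/-! ### Extension of the coefficients and Hadamard's lemma -/

noncomputable section

section Hadamard

variable {X E F : Type} [NormedAddCommGroup X] [NormedSpace ℝ X] [NormedAddCommGroup E]
  [NormedSpace ℝ E] [NormedAddCommGroup F] [NormedSpace ℝ F]

/-- The integral over the unit interval as a functional on continuous maps. -/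
def unitIntegral : C(unitInterval, F) →L[ℝ] F :=
  ⟨{ toFun := fun f => ∫ t in (0 : ℝ)..1, f (projIcc 0 1 zero_le_one t)
     map_add' := fun f g => by
       simp only [ContinuousMap.add_apply]
       exact intervalIntegral.integral_add
         ((f.continuous.comp continuous_projIcc).intervalIntegrable _ _)
         ((g.continuous.comp continuous_projIcc).intervalIntegrable _ _)
     map_smul' := fun c f => by simp }, by
    refine AddMonoidHomClass.continuous_of_bound (LinearMap.mk _ _) 1 fun f => ?_
    refine (intervalIntegral.norm_integral_le_of_norm_le_const (C := ‖f‖) fun t _ =>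
      f.norm_coe_le_norm _).trans ?_
    simp⟩

theorem unitIntegral_apply (f : C(unitInterval, F)) :
    unitIntegral f = ∫ t in (0 : ℝ)..1, f (projIcc 0 1 zero_le_one t) := rfl

/-- The parameter integral is a bounded functional after a superposition operator after a linear map
into continuous functions on [0, 1]. Its smoothness is therefore that of superposition. -/
theorem contDiff_integral_comp {n : ℕ} {g : E → F} (hg : ContDiff ℝ n g) (P R : X →L[ℝ] E) :
    ContDiff ℝ n (fun x => ∫ t in (0 : ℝ)..1, g (t • P x + R x)) := by
  let G : C(E, F) := ⟨g, hg.continuous⟩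
  let A : E →L[ℝ] C(unitInterval, E) :=
    ⟨{ toFun := fun u => ⟨fun t => (t : ℝ) • u, by fun_prop⟩
       map_add' := fun u v => by ext; simp
       map_smul' := fun c u => by ext t; exact smul_comm _ _ _ }, by
      refine AddMonoidHomClass.continuous_of_bound (LinearMap.mk _ _) 1 fun u => ?_
      refine (ContinuousMap.norm_le _ (by positivity)).2 fun t => ?_
      show ‖(t : ℝ) • u‖ ≤ _
      rw [norm_smul, Real.norm_of_nonneg t.2.1]
      gcongr
      exact t.2.2⟩
  have h : (fun x => ∫ t in (0 : ℝ)..1, g (t • P x + R x)) = fun x =>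
      unitIntegral (G.comp (A (P x) + ContinuousLinearMap.const ℝ unitInterval (R x))) := by
    funext x
    rw [unitIntegral_apply]
    refine intervalIntegral.integral_congr fun t ht => ?_
    rw [uIcc_of_le zero_le_one] at ht
    simp [G, A, projIcc_of_mem zero_le_one ht]
  rw [h]
  have hin : ContDiff ℝ n (fun x => A (P x) + ContinuousLinearMap.const ℝ unitInterval (R x)) := by
    fun_prop
  exact unitIntegral.contDiff.comp ((contDiff_comp_continuousMap n G hg).comp hin)

theorem integral_fderiv_segment [CompleteSpace F] {f : E → F} (hf : ContDiff ℝ 1 f) (v w : E) :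
    (∫ t in (0 : ℝ)..1, fderiv ℝ f (t • v + w)) v = f (v + w) - f w := by
  have hc : Continuous (fun t : ℝ => fderiv ℝ f (t • v + w)) :=
    (hf.continuous_fderiv (by simp)).comp (by fun_prop)
  rw [ContinuousLinearMap.intervalIntegral_apply (hc.intervalIntegrable _ _)]
  have h := intervalIntegral.integral_eq_sub_of_hasDerivAt (a := 0) (b := 1)
    (f := fun t : ℝ => f (t • v + w)) (f' := fun t => fderiv ℝ f (t • v + w) v) (fun t _ => ?_)
    ((hc.clm_apply continuous_const).intervalIntegrable _ _)
  · rw [h]; simp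
  · have h1 : HasDerivAt (fun t : ℝ => t • v + w) v t := by
      simpa using ((hasDerivAt_id t).smul_const v).add_const w
    exact ((hf.differentiable (by simp)) _).hasFDerivAt.comp_hasDerivAt t h1

theorem contDiff_smul_of_tsupport_subset {n : ℕ} {U : Set E} (hU : IsOpen U) {χ : E → ℝ}
    (hχ : ContDiff ℝ n χ) (hs : tsupport χ ⊆ U) {f : E → F} (hf : ContDiffOn ℝ n f U) :
    ContDiff ℝ n (fun x => χ x • f x) := by
  refine contDiff_iff_contDiffAt.2 fun x => ?_
  by_cases hx : x ∈ U
  · exact hχ.contDiffAt.smul (hf.contDiffAt (hU.mem_nhds hx))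
  · have h0 : (fun x => χ x • f x) =ᶠ[𝓝 x] fun _ => 0 := by
      filter_upwards [(isClosed_tsupport χ).isOpen_compl.mem_nhds (fun h => hx (hs h))] with z hz
      rw [image_eq_zero_of_notMem_tsupport hz, zero_smul]
    exact contDiffAt_const.congr_of_eventuallyEq h0

theorem exists_smooth_cutoff [FiniteDimensional ℝ E] {K U : Set E} (hK : IsCompact K)
    (hU : IsOpen U) (hKU : K ⊆ U) : ∃ χ : E → ℝ, (∀ n : ℕ, ContDiff ℝ n χ) ∧
      HasCompactSupport χ ∧ tsupport χ ⊆ U ∧ ∀ x ∈ K, χ x = 1 := by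
  obtain ⟨L, hL, hKL, hLU⟩ := exists_compact_between hK hU hKU
  obtain ⟨χ, h1, h2, h3⟩ := exists_contMDiffMap_one_nhds_of_subset_interior
    (modelWithCornersSelf ℝ E) (n := ⊤) hK.isClosed hKL
  have hts : tsupport χ ⊆ L := closure_minimal (fun x hx => by
    by_contra hxL; exact hx (h2 x hxL)) hL.isClosed
  refine ⟨χ, fun n => ?_, hL.of_isClosed_subset (isClosed_tsupport _) hts, hts.trans hLU,
    fun x hx => ?_⟩
  · exact (χ.contMDiff.contDiff).of_le (by exact_mod_cast le_top)
  · exact (Filter.Eventually.self_of_nhdsSet h1) x hx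

theorem exists_bound_lipschitz_of_hasCompactSupport {f : E → F} (hf : ContDiff ℝ 1 f)
    (hs : HasCompactSupport f) : ∃ C : ℝ, 0 ≤ C ∧ (∀ x, ‖f x‖ ≤ C) ∧
      ∀ x x', ‖f x - f x'‖ ≤ C * ‖x - x'‖ := by
  obtain ⟨C, hC⟩ := hf.lipschitzWith_of_hasCompactSupport hs (by simp)
  obtain ⟨C', hC'⟩ := hs.exists_bound_of_continuous hf.continuous
  refine ⟨max C C', le_max_of_le_left C.2, fun x => (hC' x).trans (le_max_right _ _), fun x x' => ?_⟩
  have := hC.dist_le_mul x x'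
  rw [dist_eq_norm, dist_eq_norm] at this
  exact this.trans (by gcongr; exact le_max_left _ _)

end Hadamard

theorem ContDiffOn.euclideanCLM {E : Type} [NormedAddCommGroup E] [NormedSpace ℝ E] {k n : ℕ}
    {U : Set E} {M : E → Matrix (Fin k) (Fin k) ℝ} (h : ∀ i j, ContDiffOn ℝ n (fun x => M x i j) U) :
    ContDiffOn ℝ n (fun x => euclideanCLM (M x)) U := by
  have e : (fun x => _root_.euclideanCLM (M x)) = fun x => ∑ i, ∑ j, M x i j •
      _root_.euclideanCLM (Matrix.single i j (1 : ℝ)) := by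
    funext x
    conv_lhs => rw [Matrix.matrix_eq_sum_single (M x)]
    simp only [_root_.euclideanCLM, map_sum]
    refine Finset.sum_congr rfl fun i _ => Finset.sum_congr rfl fun j _ => ?_
    rw [← map_smul, Matrix.smul_single, smul_eq_mul, mul_one]
  rw [e]
  exact ContDiffOn.sum fun i _ => ContDiffOn.sum fun j _ => (h i j).smul contDiffOn_const

theorem euclideanCLM_apply {k : ℕ} (M : Matrix (Fin k) (Fin k) ℝ) (v : EuclideanSpace ℝ (Fin k)) :
    euclideanCLM M v = WithLp.toLp 2 (M.mulVec v) := rfl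

/-- Coefficients near a compact set extend to smooth bounded coefficients on the whole space; the
drift becomes linear in `(a, b)`. -/
theorem exists_coefficients {EA EB EC : Type}
    [NormedAddCommGroup EA] [InnerProductSpace ℝ EA] [FiniteDimensional ℝ EA]
    [NormedAddCommGroup EB] [InnerProductSpace ℝ EB] [FiniteDimensional ℝ EB]
    [NormedAddCommGroup EC] [InnerProductSpace ℝ EC] [FiniteDimensional ℝ EC]
    {r : ℕ} (hr : r ≠ 0) {D U : Set (EA × EB × EC)} (hD : IsCompact D) (hU : IsOpen U)
    (hDU : D ⊆ U) {A₀ : EA × EB × EC → EA →L[ℝ] EA} {B₀ : EA × EB × EC → EB →L[ℝ] EB}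
    {E₀ : EA × EB × EC → EC} (hA₀ : ContDiffOn ℝ (r + 1 : ℕ) A₀ U)
    (hB₀ : ContDiffOn ℝ (r + 1 : ℕ) B₀ U) (hE₀ : ContDiffOn ℝ (r + 1 : ℕ) E₀ U)
    (hE : ∀ x ∈ D, E₀ (0, 0, x.2.2) = 0) :
    ∃ (A : EA × EB × EC → EA →L[ℝ] EA) (B : EA × EB × EC → EB →L[ℝ] EB)
      (Q : EA × EB × EC → EA × EB →L[ℝ] EC) (C : ℝ), 0 < C ∧
      ContDiff ℝ r A ∧ ContDiff ℝ r B ∧ ContDiff ℝ r Q ∧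
      (∀ x, ‖A x‖ ≤ C) ∧ (∀ x, ‖B x‖ ≤ C) ∧ (∀ x, ‖Q x‖ ≤ C) ∧
      (∀ x x', ‖A x - A x'‖ ≤ C * ‖x - x'‖) ∧ (∀ x x', ‖B x - B x'‖ ≤ C * ‖x - x'‖) ∧
      (∀ x x', ‖Q x - Q x'‖ ≤ C * ‖x - x'‖) ∧
      ∀ x ∈ D, A x = A₀ x ∧ B x = B₀ x ∧ Q x (x.1, x.2.1) = E₀ x := by
  obtain ⟨χ, hχ, hχc, hχU, hχ1⟩ := exists_smooth_cutoff hD hU hDU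
  have hle : ((r : ℕ) : WithTop ℕ∞) ≤ (r + 1 : ℕ) := by exact_mod_cast Nat.le_succ r
  have h1r : (1 : WithTop ℕ∞) ≤ (r : ℕ) := by exact_mod_cast Nat.one_le_iff_ne_zero.2 hr
  have h1r' : (1 : WithTop ℕ∞) ≤ (r + 1 : ℕ) := h1r.trans hle
  have hA := contDiff_smul_of_tsupport_subset hU (hχ _) hχU hA₀
  have hB := contDiff_smul_of_tsupport_subset hU (hχ _) hχU hB₀
  have hE' := contDiff_smul_of_tsupport_subset hU (hχ _) hχU hE₀
  let P : EA × EB × EC →L[ℝ] EA × EB × EC :=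
    (ContinuousLinearMap.fst ℝ _ _).prod
      (((ContinuousLinearMap.fst ℝ _ _).comp (ContinuousLinearMap.snd ℝ _ _)).prod 0)
  let R : EA × EB × EC →L[ℝ] EA × EB × EC :=
    ContinuousLinearMap.prod 0 (ContinuousLinearMap.prod 0
      ((ContinuousLinearMap.snd ℝ _ _).comp (ContinuousLinearMap.snd ℝ _ _)))
  let J : EA × EB →L[ℝ] EA × EB × EC :=
    (ContinuousLinearMap.fst ℝ _ _).prod ((ContinuousLinearMap.snd ℝ _ _).prod 0)
  -- Hadamard's average of the derivative along the segment from (0,0,c) to (a,b,c). The drift is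
  -- cut off first, so the segment need not stay in D. The outer factor χ provides compact support,
  -- hence global bounds.
  let Q := fun x => χ x •
    (∫ t in (0 : ℝ)..1, fderiv ℝ (fun x => χ x • E₀ x) (t • P x + R x)).comp J
  have hQ : ContDiff ℝ r Q := by
    have h1 : ContDiff ℝ r (fun x => (∫ t in (0 : ℝ)..1,
        fderiv ℝ (fun x => χ x • E₀ x) (t • P x + R x)).comp J) :=
      ContDiff.clm_comp (contDiff_integral_comp (hE'.fderiv_right (by norm_cast)) P R)
        contDiff_const
    exact (contDiff_smul_of_tsupport_subset hU (hχ r) hχU h1.contDiffOn)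
  obtain ⟨CA, hCA, bA, lA⟩ := exists_bound_lipschitz_of_hasCompactSupport (hA.of_le h1r')
    hχc.smul_right
  obtain ⟨CB, hCB, bB, lB⟩ := exists_bound_lipschitz_of_hasCompactSupport (hB.of_le h1r')
    hχc.smul_right
  obtain ⟨CQ, hCQ, bQ, lQ⟩ := exists_bound_lipschitz_of_hasCompactSupport (hQ.of_le h1r)
    hχc.smul_right
  refine ⟨_, _, Q, CA + CB + CQ + 1, by positivity, hA.of_le hle, hB.of_le hle, hQ,
    fun x => (bA x).trans (by linarith), fun x => (bB x).trans (by linarith),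
    fun x => (bQ x).trans (by linarith),
    fun x x' => (lA x x').trans (by gcongr; linarith),
    fun x x' => (lB x x').trans (by gcongr; linarith),
    fun x x' => (lQ x x').trans (by gcongr; linarith), fun x hx => ⟨?_, ?_, ?_⟩⟩
  · simp [hχ1 x hx]
  · simp [hχ1 x hx]
  · have h1 := integral_fderiv_segment (hE'.of_le h1r') (P x) (R x)
    have hPR : P x + R x = x := by ext <;> simp [P, R]
    have hR : E₀ (R x) = 0 := hE x hx
    rw [hPR, hR, smul_zero, sub_zero, hχ1 x hx, one_smul] at h1
    have hJ : J (x.1, x.2.1) = P x := rfl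
    simp only [Q, hχ1 x hx, one_smul, ContinuousLinearMap.comp_apply, hJ, h1]

namespace FenichelSystem

variable {k m l : ℕ}

/-- The rate of growth of the last unstable coordinate. -/
def rate (S : FenichelSystem (k + 1) m l) (x : PhaseSpace (k + 1) m l) : ℝ :=
  S.Au x (Fin.last k) (Fin.last k)

/-- After division by the growth rate of the last coordinate, the coefficients extend to smooth
bounded coefficients on the whole space, and the drift is linear in `(a, b)`. -/
theorem exists_extension (S : FenichelSystem (k + 1) m l) {r : ℕ} {D U : Set (PhaseSpace (k + 1) m l)}
    (hD : IsCompact D) (hU : IsOpen U) (hDU : D ⊆ U) (hCk : S.IsCk (r + 1) U) (hr : r ≠ 0)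
    (hform : S.HasInvariantHyperplane D) (hE : S.VanishesOnCritical D)
    (hD0 : ∀ x ∈ D, (0, 0, x.2.2) ∈ D) :
    ∃ (A : PhaseSpace (k + 1) m l → EuclideanSpace ℝ (Fin (k + 1)) →L[ℝ] EuclideanSpace ℝ (Fin (k + 1)))
      (B : PhaseSpace (k + 1) m l → EuclideanSpace ℝ (Fin m) →L[ℝ] EuclideanSpace ℝ (Fin m))
      (Q : PhaseSpace (k + 1) m l → EuclideanSpace ℝ (Fin (k + 1)) × EuclideanSpace ℝ (Fin m) →L[ℝ]
        EuclideanSpace ℝ (Fin l)) (C : ℝ), 0 < C ∧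
      ContDiff ℝ r A ∧ ContDiff ℝ r B ∧ ContDiff ℝ r Q ∧
      (∀ x, ‖A x‖ ≤ C) ∧ (∀ x, ‖B x‖ ≤ C) ∧ (∀ x, ‖Q x‖ ≤ C) ∧
      (∀ x x', ‖A x - A x'‖ ≤ C * ‖x - x'‖) ∧ (∀ x x', ‖B x - B x'‖ ≤ C * ‖x - x'‖) ∧
      (∀ x x', ‖Q x - Q x'‖ ≤ C * ‖x - x'‖) ∧
      ∀ x ∈ D, A x = (S.rate x)⁻¹ • euclideanCLM (S.Au x) ∧
        B x = (S.rate x)⁻¹ • euclideanCLM (S.As x) ∧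
        Q x (x.1, x.2.1) = (S.rate x)⁻¹ • S.E x := by
  have hrate : ContDiffOn ℝ (r + 1 : ℕ) S.rate U := hCk.1 _ _
  -- Positivity of the rate is known on D only, so the division takes place on a smaller
  -- neighbourhood.
  have hU' : IsOpen (U ∩ S.rate ⁻¹' Ioi 0) :=
    hrate.continuousOn.isOpen_inter_preimage hU isOpen_Ioi
  have hsub : U ∩ S.rate ⁻¹' Ioi 0 ⊆ U := inter_subset_left
  have hinv : ContDiffOn ℝ (r + 1 : ℕ) (fun x => (S.rate x)⁻¹) (U ∩ S.rate ⁻¹' Ioi 0) :=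
    (hrate.mono hsub).inv fun x hx => ne_of_gt hx.2
  exact exists_coefficients hr hD hU' (fun x hx => ⟨hDU hx, (hform x hx).2⟩)
    (hinv.smul (ContDiffOn.euclideanCLM fun i j => (hCk.1 i j).mono hsub))
    (hinv.smul (ContDiffOn.euclideanCLM fun i j => (hCk.2.1 i j).mono hsub))
    (hinv.smul (hCk.2.2.mono hsub))
    (fun x hx => by rw [hE _ (hD0 x hx) rfl rfl, smul_zero])

end FenichelSystem

end

/-! ### A priori decay along all orbits in a thin box -/

noncomputable section

section Apriori

variable {EA EB EC : Type}
  [NormedAddCommGroup EA] [InnerProductSpace ℝ EA] [FiniteDimensional ℝ EA]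
  [NormedAddCommGroup EB] [InnerProductSpace ℝ EB] [FiniteDimensional ℝ EB]
  [NormedAddCommGroup EC] [InnerProductSpace ℝ EC] [FiniteDimensional ℝ EC]

/-- The field with coefficients `A`, `B`, `Q`. -/
def coeffField (A : EA × EB × EC → EA →L[ℝ] EA) (B : EA × EB × EC → EB →L[ℝ] EB)
    (Q : EA × EB × EC → EA × EB →L[ℝ] EC) (x : EA × EB × EC) : EA × EB × EC :=
  (A x x.1, B x x.2.1, Q x (x.1, x.2.1))

variable {A : EA × EB × EC → EA →L[ℝ] EA} {B : EA × EB × EC → EB →L[ℝ] EB}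
  {Q : EA × EB × EC → EA × EB →L[ℝ] EC} {C : ℝ} {X : ℝ → EA × EB × EC} {t₀ t₁ δ : ℝ}

theorem HasDerivWithinAt.coeffField_components {J : Set ℝ} {t : ℝ}
    (h : HasDerivWithinAt X (coeffField A B Q (X t)) J t) :
    HasDerivWithinAt (fun t => (X t).1) (A (X t) (X t).1) J t ∧
    HasDerivWithinAt (fun t => (X t).2.1) (B (X t) (X t).2.1) J t ∧
    HasDerivWithinAt (fun t => (X t).2.2) (Q (X t) ((X t).1, (X t).2.1)) J t :=
  ⟨h.hasFDerivWithinAt.fst.hasDerivWithinAt.congr_deriv (by simp [coeffField]),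
    h.hasFDerivWithinAt.snd.fst.hasDerivWithinAt.congr_deriv (by simp [coeffField]),
    h.hasFDerivWithinAt.snd.snd.hasDerivWithinAt.congr_deriv (by simp [coeffField])⟩

/-- In the box a and b differ by at most 2δ, and c moves with speed at most Cδ because the drift is
linear in (a, b). Along orbits the coefficients therefore vary slowly, as required by
`exists_linear_decay`. -/
theorem coeffField_slow (hC : 0 < C) (bQ : ∀ x, ‖Q x‖ ≤ C)
    (hX : ∀ t ∈ Icc t₀ t₁, ‖(X t).1‖ ≤ δ ∧ ‖(X t).2.1‖ ≤ δ ∧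
      HasDerivWithinAt X (coeffField A B Q (X t)) (Icc t₀ t₁) t)
    {s t N : ℝ} (hs : s ∈ Icc t₀ t₁) (ht : t ∈ Icc t₀ t₁) (hN : |t - s| ≤ N) :
    ‖X t - X s‖ ≤ (2 + C * N) * δ := by
  have hδ : 0 ≤ δ := (norm_nonneg _).trans (hX s hs).1
  have hN0 : 0 ≤ N := (abs_nonneg _).trans hN
  have h2 : 2 * δ ≤ (2 + C * N) * δ := by
    have : 0 ≤ C * N * δ := by positivity
    linarith
  refine norm_prod_le_iff.2 ⟨?_, norm_prod_le_iff.2 ⟨?_, ?_⟩⟩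
  · calc _ ≤ ‖(X t).1‖ + ‖(X s).1‖ := norm_sub_le _ _
      _ ≤ _ := by linarith [(hX t ht).1, (hX s hs).1]
  · calc _ ≤ ‖(X t).2.1‖ + ‖(X s).2.1‖ := norm_sub_le _ _
      _ ≤ _ := by linarith [(hX t ht).2.1, (hX s hs).2.1]
  · have h3 := (convex_Icc t₀ t₁).norm_image_sub_le_of_norm_hasDerivWithin_le
      (f := fun t => (X t).2.2) (C := C * δ)
      (fun u hu => (hX u hu).2.2.coeffField_components.2.2)
      (fun u hu => ContinuousLinearMap.le_of_opNorm_le_of_le _ (bQ _)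
        (norm_prod_le_iff.2 ⟨(hX u hu).1, (hX u hu).2.1⟩)) hs ht
    refine h3.trans ?_
    rw [Real.norm_eq_abs]
    calc _ ≤ C * δ * N := by gcongr
      _ ≤ _ := by linarith

/-- A priori estimates for orbits near a normally hyperbolic manifold of equilibria. -/
theorem exists_apriori (hC : 0 < C) (bA : ∀ x, ‖A x‖ ≤ C) (bB : ∀ x, ‖B x‖ ≤ C)
    (bQ : ∀ x, ‖Q x‖ ≤ C) (lA : ∀ x x', ‖A x - A x'‖ ≤ C * ‖x - x'‖)
    (lB : ∀ x x', ‖B x - B x'‖ ≤ C * ‖x - x'‖) {D : Set (EA × EB × EC)} (hD : IsCompact D)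
    (hA : ∀ x ∈ D, ∃ n : ℝ, 0 < n ∧ ‖expFlow (-A x) n‖ < 1)
    (hB : ∀ x ∈ D, ∃ n : ℝ, 0 < n ∧ ‖expFlow (B x) n‖ < 1) :
    ∃ K ν δ₁ C₂ : ℝ, 0 < K ∧ 0 < ν ∧ 0 < δ₁ ∧ 0 < C₂ ∧
      (∀ x ∈ D, ∀ r, 0 ≤ r → ‖expFlow (-A x) r‖ ≤ K * Real.exp (-ν * r) ∧
        ‖expFlow (B x) r‖ ≤ K * Real.exp (-ν * r)) ∧
      ∀ (X : ℝ → EA × EB × EC) (t₀ t₁ δ : ℝ), t₀ ≤ t₁ → δ ≤ δ₁ →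
        (∀ t ∈ Icc t₀ t₁, X t ∈ D ∧ ‖(X t).1‖ ≤ δ ∧ ‖(X t).2.1‖ ≤ δ ∧
          HasDerivWithinAt X (coeffField A B Q (X t)) (Icc t₀ t₁) t) →
        ‖(X t₁).2.1‖ ≤ K * Real.exp (-ν * (t₁ - t₀)) * ‖(X t₀).2.1‖ ∧
        ‖(X t₀).1‖ ≤ K * Real.exp (-ν * (t₁ - t₀)) * ‖(X t₁).1‖ ∧
        ‖(X t₁).2.2 - (X t₀).2.2‖ ≤ C₂ * δ := by
  have cA : Continuous A := (LipschitzWith.of_dist_le_mul (K := ⟨C, hC.le⟩) fun x x' => by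
    rw [dist_eq_norm, dist_eq_norm]; exact lA x x').continuous
  have cB : Continuous B := (LipschitzWith.of_dist_le_mul (K := ⟨C, hC.le⟩) fun x x' => by
    rw [dist_eq_norm, dist_eq_norm]; exact lB x x').continuous
  have kA : IsCompact ((fun x => -A x) '' D) := hD.image cA.neg
  have kB : IsCompact (B '' D) := hD.image cB
  obtain ⟨KA, νA, hνA, hKA⟩ := uniform_expFlow_decay kA (by rintro _ ⟨x, hx, rfl⟩; exact hA x hx)
  obtain ⟨KB, νB, hνB, hKB⟩ := uniform_expFlow_decay kB (by rintro _ ⟨x, hx, rfl⟩; exact hB x hx)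
  obtain ⟨NA, εA, K₁, ν₁, hNA, hεA, hK₁, hν₁, hdA⟩ := exists_linear_decay hνA hC hKA
    (by rintro _ ⟨x, hx, rfl⟩; rw [norm_neg]; exact bA x)
  obtain ⟨NB, εB, K₂, ν₂, hNB, hεB, hK₂, hν₂, hdB⟩ := exists_linear_decay hνB hC hKB
    (by rintro _ ⟨x, hx, rfl⟩; exact bB x)
  set ν := min (min νA νB) (min ν₁ ν₂) with hν
  have hνp : 0 < ν := lt_min (lt_min hνA hνB) (lt_min hν₁ hν₂)
  set K := max (max KA KB) (max K₁ K₂) with hKdef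
  have hKp : 0 < K := lt_of_lt_of_le hK₁ ((le_max_left _ _).trans (le_max_right _ _))
  have weaken : ∀ K' ν' r : ℝ, K' ≤ K → ν ≤ ν' → 0 ≤ r →
      K' * Real.exp (-ν' * r) ≤ K * Real.exp (-ν * r) := by
    intro K' ν' r hK' hν' hr
    gcongr
  have lKA : KA ≤ K := (le_max_left _ _).trans (le_max_left _ _)
  have lKB : KB ≤ K := (le_max_right _ _).trans (le_max_left _ _)
  have lK₁ : K₁ ≤ K := (le_max_left _ _).trans (le_max_right _ _)
  have lK₂ : K₂ ≤ K := (le_max_right _ _).trans (le_max_right _ _)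
  have lνA : ν ≤ νA := (min_le_left _ _).trans (min_le_left _ _)
  have lνB : ν ≤ νB := (min_le_left _ _).trans (min_le_right _ _)
  have lν₁ : ν ≤ ν₁ := (min_le_right _ _).trans (min_le_left _ _)
  have lν₂ : ν ≤ ν₂ := (min_le_right _ _).trans (min_le_right _ _)
  refine ⟨K, ν, min (εA / (C * (2 + C * NA))) (εB / (C * (2 + C * NB))), 2 * C * K / ν,
    hKp, hνp, by positivity, by positivity, fun x hx r hr =>
      ⟨(hKA _ ⟨x, hx, rfl⟩ r hr).trans (weaken _ _ _ lKA lνA hr),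
        (hKB _ ⟨x, hx, rfl⟩ r hr).trans (weaken _ _ _ lKB lνB hr)⟩, ?_⟩
  intro X t₀ t₁ δ h01 hδ hX
  have hX' : ∀ t ∈ Icc t₀ t₁, ‖(X t).1‖ ≤ δ ∧ ‖(X t).2.1‖ ≤ δ ∧
      HasDerivWithinAt X (coeffField A B Q (X t)) (Icc t₀ t₁) t := fun t ht => (hX t ht).2
  have hδ0 : 0 ≤ δ := (norm_nonneg _).trans (hX t₀ ⟨le_rfl, h01⟩).2.1
  have hbdec : ∀ s t, t₀ ≤ s → s ≤ t → t ≤ t₁ →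
      ‖(X t).2.1‖ ≤ K * Real.exp (-ν * (t - s)) * ‖(X s).2.1‖ := by
    intro s t hs hst ht
    have hsub : Icc s t ⊆ Icc t₀ t₁ := Icc_subset_Icc hs ht
    refine (hdB s t (fun t => B (X t)) (fun t => (X t).2.1) hst
      (fun u hu => ((hX' u (hsub hu)).2.2.mono hsub).coeffField_components.2.1)
      (fun u hu => ⟨_, (hX u (hsub hu)).1, rfl⟩) (fun u hu v hv huv => ?_)).trans ?_
    · calc _ ≤ C * ((2 + C * NB) * δ) := (lB _ _).trans (by
            gcongr; exact coeffField_slow hC bQ hX' (hsub hu) (hsub hv) huv)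
        _ ≤ C * ((2 + C * NB) * (εB / (C * (2 + C * NB)))) := by
            gcongr; exact hδ.trans (min_le_right _ _)
        _ = εB := by field_simp
    · gcongr ?_ * _
      exact weaken _ _ _ lK₂ lν₂ (by linarith)
  -- The decay estimate is applied to the time-reversed a, which obeys the equation with coefficient
  -- -A.
  have hadec : ∀ s t, t₀ ≤ s → s ≤ t → t ≤ t₁ →
      ‖(X s).1‖ ≤ K * Real.exp (-ν * (t - s)) * ‖(X t).1‖ := by
    intro s t hs hst ht
    have hneg : ∀ u ∈ Icc (-t) (-s), -u ∈ Icc t₀ t₁ := fun u hu =>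
      ⟨by linarith [hu.2], by linarith [hu.1]⟩
    have := hdA (-t) (-s) (fun u => -A (X (-u))) (fun u => (X (-u)).1) (by linarith)
      (fun u hu => ?_) (fun u hu => ⟨_, (hX _ (hneg u hu)).1, rfl⟩) (fun u hu v hv huv => ?_)
    · simp only [neg_neg] at this
      refine this.trans ?_
      have e : -s - -t = t - s := by ring
      rw [e]
      gcongr ?_ * _
      exact weaken _ _ _ lK₁ lν₁ (by linarith)
    · have h1 := (hX' _ (hneg u hu)).2.2.coeffField_components.1
      have h2 := h1.scomp u ((hasDerivAt_neg u).hasDerivWithinAt (s := Icc (-t) (-s))) hneg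
      exact h2.congr_deriv (by simp)
    · have e : -A (X (-v)) - -A (X (-u)) = A (X (-u)) - A (X (-v)) := by abel
      rw [e]
      calc _ ≤ C * ((2 + C * NA) * δ) := (lA _ _).trans (by
            gcongr
            refine coeffField_slow hC bQ hX' (hneg v hv) (hneg u hu) ?_
            have e2 : -u - -v = v - u := by ring
            rw [e2]; exact huv)
        _ ≤ C * ((2 + C * NA) * (εA / (C * (2 + C * NA)))) := by
            gcongr; exact hδ.trans (min_le_left _ _)
        _ = εA := by field_simp
  refine ⟨hbdec _ _ le_rfl h01 le_rfl, hadec _ _ le_rfl h01 le_rfl, ?_⟩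
  -- An antiderivative of the bound for |c'|: the bound for a decays from the exit backward and the
  -- one for b from the entry forward. The total is at most 2CKδ/ν, however long the orbit.
  let G : ℝ → ℝ := fun t => C * K * δ / ν * ((Real.exp (-ν * (t₁ - t)) - Real.exp (-ν * (t₁ - t₀))) +
    (1 - Real.exp (-ν * (t - t₀))))
  have hG : ∀ t, HasDerivAt G (C * (K * Real.exp (-ν * (t₁ - t)) * δ +
      K * Real.exp (-ν * (t - t₀)) * δ)) t := by
    intro t
    have h1 : HasDerivAt (fun t => Real.exp (-ν * (t₁ - t))) (Real.exp (-ν * (t₁ - t)) * (-ν * (-1))) t :=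
      (((hasDerivAt_id t).const_sub t₁).const_mul (-ν)).exp
    have h2 : HasDerivAt (fun t => Real.exp (-ν * (t - t₀))) (Real.exp (-ν * (t - t₀)) * (-ν * 1)) t :=
      (((hasDerivAt_id t).sub_const t₀).const_mul (-ν)).exp
    refine (((h1.sub_const (Real.exp (-ν * (t₁ - t₀)))).add (h2.const_sub 1)).const_mul
      (C * K * δ / ν)).congr_deriv ?_
    field_simp
  have hcd : ∀ t ∈ Icc t₀ t₁, HasDerivWithinAt (fun t => (X t).2.2 - (X t₀).2.2)
      (Q (X t) ((X t).1, (X t).2.1)) (Icc t₀ t₁) t := fun t ht =>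
    (hX' t ht).2.2.coeffField_components.2.2.sub_const _
  have hfin := image_norm_le_of_norm_deriv_right_le_deriv_boundary
    (f := fun t => (X t).2.2 - (X t₀).2.2) (f' := fun t => Q (X t) ((X t).1, (X t).2.1))
    (a := t₀) (b := t₁) (fun t ht => (hcd t ht).continuousWithinAt)
    (fun t ht => (hcd t ⟨ht.1, ht.2.le⟩).mono_of_mem_nhdsWithin (Icc_mem_nhdsGE_of_mem ht))
    (B := G) (B' := fun t => C * (K * Real.exp (-ν * (t₁ - t)) * δ +
      K * Real.exp (-ν * (t - t₀)) * δ)) (by simp [G]) hG (fun t ht => ?_) ⟨h01, le_rfl⟩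
  · refine hfin.trans ?_
    have e1 := Real.exp_pos (-ν * (t₁ - t₀))
    calc G t₁ = C * K * δ / ν * (2 - 2 * Real.exp (-ν * (t₁ - t₀))) := by
          simp only [G, sub_self, mul_zero, Real.exp_zero]; ring
      _ ≤ C * K * δ / ν * 2 := by gcongr; linarith
      _ = _ := by ring
  · have ha := hadec t t₁ ht.1 ht.2.le le_rfl
    have hb := hbdec t₀ t le_rfl ht.1 ht.2.le
    have ha' : ‖(X t).1‖ ≤ K * Real.exp (-ν * (t₁ - t)) * δ := ha.trans (by
      gcongr; exact (hX' t₁ ⟨h01, le_rfl⟩).1)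
    have hb' : ‖(X t).2.1‖ ≤ K * Real.exp (-ν * (t - t₀)) * δ := hb.trans (by
      gcongr; exact (hX' t₀ ⟨le_rfl, h01⟩).2.1)
    have ea := (norm_nonneg _).trans ha'
    have eb := (norm_nonneg _).trans hb'
    refine ContinuousLinearMap.le_of_opNorm_le_of_le _ (bQ _) (norm_prod_le_iff.2 ⟨?_, ?_⟩)
    · exact ha'.trans (by linarith)
    · exact hb'.trans (by linarith)

end Apriori

end

/-! ### The rescaled system and the choice of constants -/

noncomputable section

namespace FenichelSystem

variable {k m l : ℕ}

/-- A rescaling of time that turns a system into one for which corner problems can be solved,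
with all constants needed near the equilibria. -/
structure Reduction (S : FenichelSystem (k + 1) m l) (V : Set (EuclideanSpace ℝ (Fin l)))
    (δ₀ : ℝ) where
  n : ℕ
  n_ne_zero : n ≠ 0
  (μ K R ϱ C rate₁ rate₂ : ℝ)
  A : PhaseSpace (k + 1) m l → EuclideanSpace ℝ (Fin (k + 1)) →L[ℝ] EuclideanSpace ℝ (Fin (k + 1))
  B : PhaseSpace (k + 1) m l → EuclideanSpace ℝ (Fin m) →L[ℝ] EuclideanSpace ℝ (Fin m)
  Q : PhaseSpace (k + 1) m l → EuclideanSpace ℝ (Fin (k + 1)) × EuclideanSpace ℝ (Fin m) →L[ℝ]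
    EuclideanSpace ℝ (Fin l)
  C_pos : 0 < C
  smoothA : ContDiff ℝ n A
  smoothB : ContDiff ℝ n B
  smoothQ : ContDiff ℝ n Q
  boundA : ∀ x, ‖A x‖ ≤ C
  boundB : ∀ x, ‖B x‖ ≤ C
  boundQ : ∀ x, ‖Q x‖ ≤ C
  lipA : ∀ x x', ‖A x - A x'‖ ≤ C * ‖x - x'‖
  lipB : ∀ x x', ‖B x - B x'‖ ≤ C * ‖x - x'‖
  lipQ : ∀ x x', ‖Q x - Q x'‖ ≤ C * ‖x - x'‖
  stableA : ∀ z ∈ V, ExpStable (μ • (1 : EuclideanSpace ℝ (Fin (k + 1)) →L[ℝ] _) - A (0, 0, z)) K μ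
  stableB : ∀ z ∈ V, ExpStable (μ • (1 : EuclideanSpace ℝ (Fin m) →L[ℝ] _) + B (0, 0, z)) K μ
  R_pos : 0 < R
  ϱ_pos : 0 < ϱ
  ϱ_le : ϱ ≤ 1
  ϱ_small : 16 * (C + C + 1) * (R + 1) * (cutoffLip (EuclideanSpace ℝ (Fin (k + 1))) R +
    cutoffLip (EuclideanSpace ℝ (Fin m)) R + cutoffLip (EuclideanSpace ℝ (Fin l)) 1 + 1) * ϱ ≤
    cornerLip K μ
  μ_pos : 0 < μ
  δ₀_pos : 0 < δ₀
  -- Makes a and b in the box at most of the size ϱ² by which they are scaled.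
  δ₀_le : δ₀ ≤ ϱ ^ 2
  rate₁_pos : 0 < rate₁
  rate_mem : ∀ x ∈ cornerBox (k + 1) m δ₀ V, S.rate x ∈ Icc rate₁ rate₂
  rate_cont : ContinuousOn S.rate (cornerBox (k + 1) m δ₀ V)
  field_eq : ∀ x ∈ cornerBox (k + 1) m δ₀ V, S.field x = S.rate x • coeffField A B Q x
  last_eq : ∀ x ∈ cornerBox (k + 1) m δ₀ V, (A x x.1) (Fin.last k) = x.1 (Fin.last k)
  -- The rate 4μ leaves room for a speed as low as 1/2 and for the square of the weight. Half of R
  -- and an eighth of ϱ keep the orbit well inside the region without cutoff.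
  apriori : ∀ (X : ℝ → PhaseSpace (k + 1) m l) (t₀ t₁ : ℝ), t₀ ≤ t₁ →
    (∀ t ∈ Icc t₀ t₁, X t ∈ cornerBox (k + 1) m δ₀ V ∧
      HasDerivWithinAt X (coeffField A B Q (X t)) (Icc t₀ t₁) t) →
    ‖(X t₁).2.1‖ ≤ R / 2 * Real.exp (-(4 * μ) * (t₁ - t₀)) * ‖(X t₀).2.1‖ ∧
    ‖(X t₀).1‖ ≤ R / 2 * Real.exp (-(4 * μ) * (t₁ - t₀)) * ‖(X t₁).1‖ ∧
    ‖(X t₁).2.2 - (X t₀).2.2‖ ≤ ϱ / 8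

/-- The corner field of a reduction at an equilibrium. -/
def Reduction.corner {S : FenichelSystem (k + 1) m l} {V : Set (EuclideanSpace ℝ (Fin l))} {δ₀ : ℝ}
    (H : S.Reduction V δ₀) {z₀ : EuclideanSpace ℝ (Fin l)} (hz : z₀ ∈ V) :
    CornerField (EuclideanSpace ℝ (Fin (k + 1))) (EuclideanSpace ℝ (Fin m))
      (EuclideanSpace ℝ (Fin l)) where
  n := H.n
  n_ne_zero := H.n_ne_zero
  μ := H.μ
  K := H.K
  R := H.R
  ϱ := H.ϱ
  Cb := H.C
  L := H.C
  -- The extended coefficients live on the whole space, so any radius exceeding the range of the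
  -- cut-off argument will do.
  ρ₀ := (4 * H.R + 2) * H.ϱ + 1
  A := H.A
  B := H.B
  Q := H.Q
  z₀ := z₀
  stableA := H.stableA z₀ hz
  stableB := H.stableB z₀ hz
  smoothA := H.smoothA.contDiffOn
  smoothB := H.smoothB.contDiffOn
  smoothQ := H.smoothQ.contDiffOn
  boundA := fun x _ => H.boundA x
  boundB := fun x _ => H.boundB x
  boundQ := fun x _ => H.boundQ x
  lipA := fun x _ x' _ => H.lipA x x'
  lipB := fun x _ x' _ => H.lipB x x'
  lipQ := fun x _ x' _ => H.lipQ x x'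
  R_pos := H.R_pos
  ϱ_pos := H.ϱ_pos
  ϱ_le := H.ϱ_le
  Cb_nonneg := H.C_pos.le
  L_nonneg := H.C_pos.le
  ϱ_small := lt_add_one _
  ϱ_small' := H.ϱ_small

theorem cornerBox_mono {δ δ' : ℝ} (h : δ ≤ δ') (V : Set (EuclideanSpace ℝ (Fin l))) :
    cornerBox k m δ V ⊆ cornerBox k m δ' V :=
  prod_mono (Metric.ball_subset_ball h) (prod_mono (Metric.ball_subset_ball h) Subset.rfl)

theorem expFlow_smul {F : Type} [NormedAddCommGroup F] [NormedSpace ℝ F] (c r : ℝ) (M : F →L[ℝ] F) :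
    expFlow (c • M) r = expFlow M (c * r) := by
  rw [expFlow, expFlow, smul_smul, mul_comm]

/-- The scalar part commutes with M and contributes e^{μr}, which half of the decay rate absorbs. -/
theorem expStable_add {F : Type} [NormedAddCommGroup F] [NormedSpace ℝ F] [CompleteSpace F]
    {M : F →L[ℝ] F} {K μ ν : ℝ} (hμ : 0 < μ) (h : 2 * μ ≤ ν)
    (hM : ∀ r, 0 ≤ r → ‖expFlow M r‖ ≤ K * Real.exp (-ν * r)) :
    ExpStable (μ • (1 : F →L[ℝ] F) + M) K μ := by
  have hK : 0 ≤ K := by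
    have := (norm_nonneg _).trans (hM 0 le_rfl)
    simpa using this
  refine ⟨hμ, fun r hr => ?_⟩
  have h1 : expFlow (μ • (1 : F →L[ℝ] F) + M) r = Real.exp (μ * r) • expFlow M r := by
    let _ : NormedAlgebra ℚ (F →L[ℝ] F) := NormedAlgebra.restrictScalars ℚ ℝ _
    have hc : Commute (r • μ • (1 : F →L[ℝ] F)) (r • M) := by
      rw [smul_smul]
      exact ((Commute.one_left _).smul_left _)
    rw [expFlow, smul_add, NormedSpace.exp_add_of_commute hc, smul_smul,
      ← Algebra.algebraMap_eq_smul_one, ← NormedSpace.algebraMap_exp_comm, ← Real.exp_eq_exp_ℝ,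
      Algebra.algebraMap_eq_smul_one, smul_mul_assoc, one_mul, mul_comm r μ, expFlow]
  rw [h1, norm_smul, Real.norm_of_nonneg (Real.exp_pos _).le]
  calc _ ≤ Real.exp (μ * r) * (K * Real.exp (-ν * r)) := by gcongr; exact hM r hr
    _ = K * Real.exp (μ * r + -ν * r) := by rw [Real.exp_add]; ring
    _ ≤ _ := by gcongr; nlinarith

theorem exists_norm_expFlow_inv_smul_lt {k : ℕ} {M : Matrix (Fin k) (Fin k) ℝ} {c : ℝ} (hc : 0 < c)
    (hM : ∀ z ∈ spectrum ℂ (M.map Complex.ofReal), z.re < 0) :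
    ∃ n : ℝ, 0 < n ∧ ‖expFlow (c⁻¹ • euclideanCLM M) n‖ < 1 := by
  obtain ⟨n, hn, h⟩ := exists_norm_expFlow_lt M hM
  refine ⟨c * n, by positivity, ?_⟩
  rwa [expFlow_smul, inv_mul_cancel_left₀ hc.ne']

/-- The order of choices matters. The a priori constants K, ν, C₂ come first and give μ = ν/4 and R
= 2K, then ϱ is taken small in terms of these, and the size δ₀ of the box is chosen last. Hadamard's
lemma accounts for the drop from r + 1 to r. -/
theorem exists_reduction (S : FenichelSystem (k + 1) m l) {r : ℕ} (hr : 1 ≤ r) {Δ : ℝ} (hΔ : 0 < Δ)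
    {V : Set (EuclideanSpace ℝ (Fin l))} (hVbdd : Bornology.IsBounded V)
    {U : Set (PhaseSpace (k + 1) m l)} (hU : IsOpen U)
    (hBU : closure (cornerBox (k + 1) m Δ V) ⊆ U) (hCk : S.IsCk (r + 1) U)
    (hform : S.HasInvariantHyperplane (closure (cornerBox (k + 1) m Δ V)))
    (hgap : S.HasSpectralGap (closure (cornerBox (k + 1) m Δ V)))
    (hE : S.VanishesOnCritical (closure (cornerBox (k + 1) m Δ V))) :
    ∃ δ₀ : ℝ, 0 < δ₀ ∧ δ₀ ≤ Δ ∧ ∃ H : S.Reduction V δ₀, H.n = r := by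
  set D := closure (cornerBox (k + 1) m Δ V) with hDdef
  have hD : IsCompact D := (Metric.isBounded_ball.prod (Metric.isBounded_ball.prod hVbdd)).isCompact_closure
  have hD0 : ∀ x ∈ D, ((0, 0, x.2.2) : PhaseSpace (k + 1) m l) ∈ D := by
    have hmaps : MapsTo (fun x : PhaseSpace (k + 1) m l => ((0, 0, x.2.2) : PhaseSpace (k + 1) m l))
        (cornerBox (k + 1) m Δ V) (cornerBox (k + 1) m Δ V) := fun x hx =>
      ⟨Metric.mem_ball_self hΔ, Metric.mem_ball_self hΔ, hx.2.2⟩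
    exact fun x hx => hmaps.closure (by fun_prop) hx
  obtain ⟨A, B, Q, C, hC, sA, sB, sQ, bA, bB, bQ, lA, lB, lQ, hABQ⟩ :=
    S.exists_extension hD hU hBU hCk (by omega) hform hE hD0
  obtain ⟨ν₀, hν₀, hspec⟩ := hgap
  have hrate : ∀ x ∈ D, 0 < S.rate x := fun x hx => (hform x hx).2
  have hA : ∀ x ∈ D, ∃ n : ℝ, 0 < n ∧ ‖expFlow (-A x) n‖ < 1 := by
    intro x hx
    have e : -A x = (S.rate x)⁻¹ • euclideanCLM (-S.Au x) := by
      rw [(hABQ x hx).1, euclideanCLM, euclideanCLM, map_neg, smul_neg]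
    rw [e]
    refine exists_norm_expFlow_inv_smul_lt (hrate x hx) fun z hz => ?_
    have e2 : (-S.Au x).map Complex.ofReal = -((S.Au x).map Complex.ofReal) := by
      ext i j; simp
    rw [e2, ← spectrum.neg_eq, Set.mem_neg] at hz
    have := (hspec x hx).1 _ hz
    rw [Complex.neg_re] at this
    linarith
  have hB : ∀ x ∈ D, ∃ n : ℝ, 0 < n ∧ ‖expFlow (B x) n‖ < 1 := by
    intro x hx
    rw [(hABQ x hx).2.1]
    refine exists_norm_expFlow_inv_smul_lt (hrate x hx) fun z hz => ?_
    have := (hspec x hx).2 _ hz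
    linarith
  obtain ⟨K, ν, δ₁, C₂, hK, hν, hδ₁, hC₂, hexp, hap⟩ := exists_apriori hC bA bB bQ lA lB hD hA hB
  have hμ : 0 < ν / 4 := by positivity
  have hR : 0 < 2 * K := by positivity
  set T := 16 * (C + C + 1) * (2 * K + 1) * (cutoffLip (EuclideanSpace ℝ (Fin (k + 1))) (2 * K) +
    cutoffLip (EuclideanSpace ℝ (Fin m)) (2 * K) + cutoffLip (EuclideanSpace ℝ (Fin l)) 1 + 1) with hT
  have hTp : 0 < T := by
    have h1 := cutoffLip_nonneg (E := EuclideanSpace ℝ (Fin (k + 1))) hR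
    have h2 := cutoffLip_nonneg (E := EuclideanSpace ℝ (Fin m)) hR
    have h3 := cutoffLip_nonneg (E := EuclideanSpace ℝ (Fin l)) one_pos
    positivity
  have hκ := (cornerLip_bounds hK.le hμ).1
  -- The second entry makes the operator a contraction. The third makes the total drift C₂δ₀ ≤ C₂ϱ²
  -- at most ϱ/8.
  set ϱ := min (min 1 (cornerLip K (ν / 4) / T)) (1 / (8 * C₂)) with hϱ
  have hϱp : 0 < ϱ := by positivity
  have hϱ1 : ϱ ≤ 1 := (min_le_left _ _).trans (min_le_left _ _)
  have hϱ2 : ϱ ≤ cornerLip K (ν / 4) / T := (min_le_left _ _).trans (min_le_right _ _)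
  have hϱ3 : ϱ ≤ 1 / (8 * C₂) := min_le_right _ _
  set δ₀ := min (min Δ δ₁) (ϱ ^ 2) with hδ₀
  have hδ₀p : 0 < δ₀ := by positivity
  have hδΔ : δ₀ ≤ Δ := (min_le_left _ _).trans (min_le_left _ _)
  have hδδ₁ : δ₀ ≤ δ₁ := (min_le_left _ _).trans (min_le_right _ _)
  have hδϱ : δ₀ ≤ ϱ ^ 2 := min_le_right _ _
  have hbox : cornerBox (k + 1) m δ₀ V ⊆ D := (cornerBox_mono hδΔ V).trans subset_closure
  have hcrit : ∀ z ∈ V, ((0, 0, z) : PhaseSpace (k + 1) m l) ∈ D := fun z hz =>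
    subset_closure ⟨Metric.mem_ball_self hΔ, Metric.mem_ball_self hΔ, hz⟩
  have hratec : ContinuousOn S.rate D := (hCk.1 _ _).continuousOn.mono hBU
  obtain ⟨rate₁, hr1, hrate₁⟩ : ∃ c : ℝ, 0 < c ∧ ∀ x ∈ D, c ≤ S.rate x := by
    rcases D.eq_empty_or_nonempty with h | h
    · exact ⟨1, one_pos, by simp [h]⟩
    · obtain ⟨x₀, hx₀, hmin⟩ := hD.exists_isMinOn h hratec
      exact ⟨_, hrate x₀ hx₀, fun x hx => hmin hx⟩
  obtain ⟨rate₂, hrate₂⟩ : ∃ c : ℝ, ∀ x ∈ D, S.rate x ≤ c := by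
    obtain ⟨c, hc⟩ := (hD.image_of_continuousOn hratec).bddAbove
    exact ⟨c, fun x hx => hc ⟨x, hx, rfl⟩⟩
  refine ⟨δ₀, hδ₀p, hδΔ, ⟨r, by omega, ν / 4, K, 2 * K, ϱ, C, rate₁, rate₂, A, B, Q, hC, sA, sB, sQ,
    bA, bB, bQ, lA, lB, lQ, ?_, ?_, hR, hϱp, hϱ1, ?_, hμ, hδ₀p, hδϱ, hr1,
    fun x hx => ⟨hrate₁ x (hbox hx), hrate₂ x (hbox hx)⟩, hratec.mono hbox, ?_, ?_, ?_⟩, rfl⟩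
  · intro z hz
    rw [sub_eq_add_neg]
    exact expStable_add hμ (by linarith) fun r hr => (hexp _ (hcrit z hz) r hr).1
  · intro z hz
    exact expStable_add hμ (by linarith) fun r hr => (hexp _ (hcrit z hz) r hr).2
  · rw [← hT]
    calc T * ϱ ≤ T * (cornerLip K (ν / 4) / T) := by gcongr
      _ = _ := by field_simp
  · intro x hx
    obtain ⟨h1, h2, h3⟩ := hABQ x (hbox hx)
    have hne := (hrate x (hbox hx)).ne'
    simp only [coeffField, h1, h2, h3, _root_.smul_apply, Prod.smul_mk, smul_smul,
      mul_inv_cancel₀ hne, one_smul, euclideanCLM_apply]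
    rfl
  · intro x hx
    rw [(hABQ x (hbox hx)).1]
    have hne := (hrate x (hbox hx)).ne'
    simp only [_root_.smul_apply, euclideanCLM_apply, PiLp.smul_apply, smul_eq_mul]
    rw [Matrix.mulVec, dotProduct, Finset.sum_eq_single (Fin.last k)]
    · show _ * (S.rate x * _) = _
      rw [inv_mul_cancel_left₀ hne]
    · intro j _ hj
      rw [(hform x (hbox hx)).1 j hj, zero_mul]
    · simp
  · intro X t₀ t₁ h01 hX
    obtain ⟨h1, h2, h3⟩ := hap X t₀ t₁ δ₀ h01 hδδ₁ fun t ht =>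
      ⟨hbox (hX t ht).1, (mem_ball_zero_iff.1 (hX t ht).1.1).le,
        (mem_ball_zero_iff.1 (hX t ht).1.2.1).le, (hX t ht).2⟩
    have e : 2 * K / 2 = K := by ring
    have e2 : 4 * (ν / 4) = ν := by ring
    rw [e, e2]
    refine ⟨h1, h2, h3.trans ?_⟩
    calc C₂ * δ₀ ≤ C₂ * (ϱ * (1 / (8 * C₂))) := by
          gcongr
          calc δ₀ ≤ ϱ ^ 2 := hδϱ
            _ = ϱ * ϱ := sq ϱ
            _ ≤ _ := by gcongr
      _ = ϱ / 8 := by field_simp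

end FenichelSystem

end

/-! ### Change of time between the original and the rescaled field -/

noncomputable section

section TimeChange

/-- The inverse of the primitive of a positive function. -/
theorem exists_time_change {h : ℝ → ℝ} (hc : Continuous h) {c C : ℝ} (hc0 : 0 < c)
    (hb : ∀ t, h t ∈ Icc c C) : ∃ τ : ℝ → ℝ, StrictMono τ ∧ Function.Surjective τ ∧ τ 0 = 0 ∧
      (∀ u, HasDerivAt τ (h (τ u))⁻¹ u) ∧ ∀ u, 0 ≤ u → u ≤ C * τ u ∧ c * τ u ≤ u := by
  have hC0 : 0 < C := hc0.trans_le ((hb 0).1.trans (hb 0).2)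
  let σ : ℝ → ℝ := fun t => ∫ s in (0 : ℝ)..t, h s
  have hσ : ∀ t, HasDerivAt σ (h t) t := fun t => (hc.integral_hasStrictDerivAt 0 t).hasDerivAt
  have hσ0 : σ 0 = 0 := by simp [σ]
  have hlow : ∀ s t, s ≤ t → c * (t - s) ≤ σ t - σ s := fun s t hst =>
    mul_sub_le_image_sub_of_le_deriv (fun t => (hσ t).differentiableAt)
      (fun t => by rw [(hσ t).deriv]; exact (hb t).1) hst
  have hup : ∀ s t, s ≤ t → σ t - σ s ≤ C * (t - s) := fun s t hst =>
    image_sub_le_mul_sub_of_deriv_le (fun t => (hσ t).differentiableAt)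
      (fun t => by rw [(hσ t).deriv]; exact (hb t).2) hst
  have hmono : StrictMono σ := fun s t hst => by
    have := hlow s t hst.le
    have := mul_pos hc0 (sub_pos.2 hst)
    linarith
  have hcont : Continuous σ := continuous_iff_continuousAt.2 fun t => (hσ t).continuousAt
  have htop : Tendsto σ atTop atTop := by
    refine tendsto_atTop_mono' _ ?_ (tendsto_id.const_mul_atTop hc0)
    filter_upwards [eventually_ge_atTop 0] with t ht
    have := hlow 0 t ht
    rw [hσ0] at this
    simpa using this
  have hbot : Tendsto σ atBot atBot := by
    refine tendsto_atBot_mono' _ ?_ (tendsto_id.const_mul_atBot hc0)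
    filter_upwards [eventually_le_atBot 0] with t ht
    have := hlow t 0 ht
    rw [hσ0] at this
    simp only [id]; linarith
  have hsurj : Function.Surjective σ := hcont.surjective htop hbot
  let e : ℝ ≃o ℝ := hmono.orderIsoOfSurjective σ hsurj
  have he : ∀ t, e t = σ t := fun t => rfl
  have hes : ∀ u, σ (e.symm u) = u := fun u => by rw [← he]; exact e.apply_symm_apply u
  have he0 : e.symm 0 = 0 := by
    have := e.symm_apply_apply 0
    rwa [he, hσ0] at this
  refine ⟨e.symm, e.symm.strictMono, e.symm.surjective, he0, fun u => ?_, fun u hu => ?_⟩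
  · exact HasDerivAt.of_local_left_inverse e.symm.continuous.continuousAt (hσ _)
      (hc0.trans_le (hb _).1).ne' (Eventually.of_forall hes)
  · have h0 : 0 ≤ e.symm u := by rw [← he0]; exact e.symm.monotone hu
    have h1 := hup 0 _ h0
    have h2 := hlow 0 _ h0
    rw [hes, hσ0] at h1 h2
    exact ⟨by linarith, by linarith⟩

variable {X : Type} [NormedAddCommGroup X] [NormedSpace ℝ X] {x : ℝ → X} {F : X → X} {w : X → ℝ}
  {c C : ℝ}

/-- The retraction ρ extends the speed from J to the whole line, so that one global time change
serves compact intervals and both half lines. -/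
theorem exists_time_change_orbit {J : Set ℝ} {ρ : ℝ → ℝ} (hρ : Continuous ρ) (hρJ : ∀ t, ρ t ∈ J)
    (hρ1 : ∀ t ∈ J, ρ t = t) (hc : 0 < c) (hw : ∀ t ∈ J, w (x t) ∈ Icc c C)
    (hcont : ContinuousOn (fun t => w (x t)) J)
    (hx : ∀ t ∈ J, HasDerivWithinAt x (w (x t) • F (x t)) J t) :
    ∃ τ : ℝ → ℝ, StrictMono τ ∧ Function.Surjective τ ∧ τ 0 = 0 ∧
      (∀ u, 0 ≤ u → u ≤ C * τ u ∧ c * τ u ≤ u) ∧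
      ∀ u, τ u ∈ J → HasDerivWithinAt (fun u => x (τ u)) (F (x (τ u))) (τ ⁻¹' J) u := by
  obtain ⟨τ, h1, h2, h3, h4, h5⟩ := exists_time_change (h := fun t => w (x (ρ t)))
    (hcont.comp_continuous hρ hρJ) hc (fun t => hw _ (hρJ t))
  refine ⟨τ, h1, h2, h3, h5, fun u hu => ?_⟩
  have h6 := (hx _ hu).scomp u ((h4 u).hasDerivWithinAt (s := τ ⁻¹' J)) (fun v hv => hv)
  refine h6.congr_deriv ?_
  rw [hρ1 _ hu, smul_smul, inv_mul_cancel₀ (hc.trans_le (hw _ hu).1).ne', one_smul]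

theorem time_change_Icc {T : ℝ} (hT : 0 ≤ T) (hc : 0 < c)
    (hw : ∀ t ∈ Icc 0 T, w (x t) ∈ Icc c C) (hcont : ContinuousOn (fun t => w (x t)) (Icc 0 T))
    (hx : ∀ t ∈ Icc 0 T, HasDerivWithinAt x (w (x t) • F (x t)) (Icc 0 T) t) :
    ∃ (T' : ℝ) (z : ℝ → X), c * T ≤ T' ∧ T' ≤ C * T ∧ z 0 = x 0 ∧ z T' = x T ∧
      ∀ u ∈ Icc 0 T', (∃ t ∈ Icc 0 T, z u = x t) ∧
        HasDerivWithinAt z (F (z u)) (Icc 0 T') u := by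
  obtain ⟨τ, h1, h2, h3, h4, h5⟩ := exists_time_change_orbit (J := Icc 0 T)
    (ρ := fun t => max 0 (min t T))
    (by fun_prop) (fun t => ⟨le_max_left _ _, max_le hT (min_le_right _ _)⟩)
    (fun t ht => by rw [min_eq_left ht.2, max_eq_right ht.1]) hc hw hcont hx
  obtain ⟨T', hT'⟩ := h2 T
  have hT0 : 0 ≤ T' := by
    rw [← h1.le_iff_le, h3, hT']; exact hT
  have hpre : τ ⁻¹' Icc 0 T = Icc 0 T' := by
    ext u
    have e1 : τ 0 ≤ τ u ↔ 0 ≤ u := h1.le_iff_le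
    have e2 : τ u ≤ τ T' ↔ u ≤ T' := h1.le_iff_le
    rw [mem_preimage, mem_Icc, mem_Icc, ← e1, ← e2, h3, hT']
  have h6 := h4 T' hT0
  rw [hT'] at h6
  refine ⟨T', fun u => x (τ u), h6.2, h6.1, by simp [h3], by simp [hT'], fun u hu => ?_⟩
  rw [← hpre] at hu ⊢
  exact ⟨⟨_, hu, rfl⟩, h5 u hu⟩

theorem time_change_Ici (hc : 0 < c) (hw : ∀ t ∈ Ici (0 : ℝ), w (x t) ∈ Icc c C)
    (hcont : ContinuousOn (fun t => w (x t)) (Ici 0))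
    (hx : ∀ t ∈ Ici (0 : ℝ), HasDerivWithinAt x (w (x t) • F (x t)) (Ici 0) t) {z₀ : X}
    (hz : Tendsto x atTop (𝓝 z₀)) :
    ∃ z : ℝ → X, z 0 = x 0 ∧ Tendsto z atTop (𝓝 z₀) ∧
      ∀ u ∈ Ici (0 : ℝ), (∃ t ∈ Ici (0 : ℝ), z u = x t) ∧
        HasDerivWithinAt z (F (z u)) (Ici 0) u := by
  obtain ⟨τ, h1, h2, h3, h4, h5⟩ := exists_time_change_orbit (J := Ici 0) (ρ := fun t => max 0 t)
    (by fun_prop) (fun t => mem_Ici.2 (le_max_left _ _)) (fun t ht => max_eq_right ht) hc hw hcont hx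
  have hpre : τ ⁻¹' Ici 0 = Ici 0 := by
    ext u
    have e1 : τ 0 ≤ τ u ↔ 0 ≤ u := h1.le_iff_le
    rw [mem_preimage, mem_Ici, mem_Ici, ← e1, h3]
  refine ⟨fun u => x (τ u), by simp [h3], hz.comp ?_, fun u hu => ?_⟩
  · exact h1.monotone.tendsto_atTop_atTop fun b => (h2 b).imp fun a ha => ha.ge
  · have h6 := h5 u (by rw [← hpre] at hu; exact hu)
    rw [hpre] at h6
    exact ⟨⟨τ u, by rw [← hpre] at hu; exact hu, rfl⟩, h6⟩

theorem time_change_Iic (hc : 0 < c) (hw : ∀ t ∈ Iic (0 : ℝ), w (x t) ∈ Icc c C)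
    (hcont : ContinuousOn (fun t => w (x t)) (Iic 0))
    (hx : ∀ t ∈ Iic (0 : ℝ), HasDerivWithinAt x (w (x t) • F (x t)) (Iic 0) t) {z₀ : X}
    (hz : Tendsto x atBot (𝓝 z₀)) :
    ∃ z : ℝ → X, z 0 = x 0 ∧ Tendsto z atBot (𝓝 z₀) ∧
      ∀ u ∈ Iic (0 : ℝ), (∃ t ∈ Iic (0 : ℝ), z u = x t) ∧
        HasDerivWithinAt z (F (z u)) (Iic 0) u := by
  obtain ⟨τ, h1, h2, h3, h4, h5⟩ := exists_time_change_orbit (J := Iic 0) (ρ := fun t => min 0 t)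
    (by fun_prop) (fun t => mem_Iic.2 (min_le_left _ _)) (fun t ht => min_eq_right ht) hc hw hcont hx
  have hpre : τ ⁻¹' Iic 0 = Iic 0 := by
    ext u
    have e1 : τ u ≤ τ 0 ↔ u ≤ 0 := h1.le_iff_le
    rw [mem_preimage, mem_Iic, mem_Iic, ← e1, h3]
  refine ⟨fun u => x (τ u), by simp [h3], hz.comp ?_, fun u hu => ?_⟩
  · exact h1.monotone.tendsto_atBot_atBot fun b => (h2 b).imp fun a ha => ha.le
  · have h6 := h5 u (by rw [← hpre] at hu; exact hu)
    rw [hpre] at h6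
    exact ⟨⟨τ u, by rw [← hpre] at hu; exact hu, rfl⟩, h6⟩

end TimeChange

namespace FenichelSystem

variable {k m l : ℕ} {S : FenichelSystem (k + 1) m l} {V : Set (EuclideanSpace ℝ (Fin l))}
  {δ₀ δ : ℝ}

namespace Reduction

variable (H : S.Reduction V δ₀)

/-- The rescaled field. -/
def vf : PhaseSpace (k + 1) m l → PhaseSpace (k + 1) m l := coeffField H.A H.B H.Q

/-- Orbits of the rescaled field. -/
def IsOrbit (Z : Set (PhaseSpace (k + 1) m l)) (X : ℝ → PhaseSpace (k + 1) m l) (J : Set ℝ) : Prop :=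
  ∀ t ∈ J, X t ∈ Z ∧ HasDerivWithinAt X (H.vf (X t)) J t

variable {H}

theorem IsOrbit.mono {Z Z' : Set (PhaseSpace (k + 1) m l)} {X : ℝ → PhaseSpace (k + 1) m l}
    {J J' : Set ℝ} (h : H.IsOrbit Z X J) (hZ : Z ⊆ Z') (hJ : J' ⊆ J) : H.IsOrbit Z' X J' :=
  fun t ht => ⟨hZ (h t (hJ ht)).1, (h t (hJ ht)).2.mono hJ⟩

theorem IsOrbit.continuousOn {Z : Set (PhaseSpace (k + 1) m l)} {X : ℝ → PhaseSpace (k + 1) m l}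
    {J : Set ℝ} (h : H.IsOrbit Z X J) : ContinuousOn X J :=
  fun t ht => (h t ht).2.continuousWithinAt

variable {x : ℝ → PhaseSpace (k + 1) m l} {J : Set ℝ} (hδ : δ ≤ δ₀)

theorem rate_hypotheses (hδ : δ ≤ δ₀) (hx : S.IsOrbitOn (cornerBox (k + 1) m δ V) x J) :
    (∀ t ∈ J, S.rate (x t) ∈ Icc H.rate₁ H.rate₂) ∧ ContinuousOn (fun t => S.rate (x t)) J ∧
    ∀ t ∈ J, HasDerivWithinAt x (S.rate (x t) • H.vf (x t)) J t := by
  have hm : ∀ t ∈ J, x t ∈ cornerBox (k + 1) m δ₀ V := fun t ht => cornerBox_mono hδ V (hx t ht).1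
  refine ⟨fun t ht => H.rate_mem _ (hm t ht), H.rate_cont.comp
    (fun t ht => (hx t ht).2.continuousWithinAt) hm, fun t ht => ?_⟩
  rw [vf, ← H.field_eq _ (hm t ht)]
  exact (hx t ht).2

theorem exists_isOrbit_Icc (hδ : δ ≤ δ₀) {T : ℝ} (hT : 0 ≤ T)
    (hx : S.IsOrbitOn (cornerBox (k + 1) m δ V) x (Icc 0 T)) :
    ∃ (T' : ℝ) (X : ℝ → PhaseSpace (k + 1) m l), H.rate₁ * T ≤ T' ∧ T' ≤ H.rate₂ * T ∧
      X 0 = x 0 ∧ X T' = x T ∧ H.IsOrbit (cornerBox (k + 1) m δ V) X (Icc 0 T') := by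
  obtain ⟨h1, h2, h3⟩ := rate_hypotheses (H := H) hδ hx
  obtain ⟨T', X, h4, h5, h6, h7, h8⟩ := time_change_Icc hT H.rate₁_pos h1 h2 h3
  refine ⟨T', X, h4, h5, h6, h7, fun t ht => ⟨?_, (h8 t ht).2⟩⟩
  obtain ⟨s, hs, e⟩ := (h8 t ht).1
  rw [e]; exact (hx s hs).1

theorem exists_isOrbit_Ici (hδ : δ ≤ δ₀) {z : PhaseSpace (k + 1) m l}
    (hx : S.IsOrbitOn (cornerBox (k + 1) m δ V) x (Ici 0)) (hz : Tendsto x atTop (𝓝 z)) :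
    ∃ X : ℝ → PhaseSpace (k + 1) m l, X 0 = x 0 ∧ Tendsto X atTop (𝓝 z) ∧
      H.IsOrbit (cornerBox (k + 1) m δ V) X (Ici 0) := by
  obtain ⟨h1, h2, h3⟩ := rate_hypotheses (H := H) hδ hx
  obtain ⟨X, h4, h5, h8⟩ := time_change_Ici H.rate₁_pos h1 h2 h3 hz
  refine ⟨X, h4, h5, fun t ht => ⟨?_, (h8 t ht).2⟩⟩
  obtain ⟨s, hs, e⟩ := (h8 t ht).1
  rw [e]; exact (hx s hs).1

theorem exists_isOrbit_Iic (hδ : δ ≤ δ₀) {z : PhaseSpace (k + 1) m l}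
    (hx : S.IsOrbitOn (cornerBox (k + 1) m δ V) x (Iic 0)) (hz : Tendsto x atBot (𝓝 z)) :
    ∃ X : ℝ → PhaseSpace (k + 1) m l, X 0 = x 0 ∧ Tendsto X atBot (𝓝 z) ∧
      H.IsOrbit (cornerBox (k + 1) m δ V) X (Iic 0) := by
  obtain ⟨h1, h2, h3⟩ := rate_hypotheses (H := H) hδ hx
  obtain ⟨X, h4, h5, h8⟩ := time_change_Iic H.rate₁_pos h1 h2 h3 hz
  refine ⟨X, h4, h5, fun t ht => ⟨?_, (h8 t ht).2⟩⟩
  obtain ⟨s, hs, e⟩ := (h8 t ht).1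
  rw [e]; exact (hx s hs).1

/-- Curves along a positive multiple of the rescaled field, in the form needed to return to the
original time. -/
theorem inv_rate_hypotheses (hδ : δ ≤ δ₀) {g : ℝ} (hg : 0 < g) (hne : J.Nonempty)
    (hx : ∀ t ∈ J, x t ∈ cornerBox (k + 1) m δ V ∧ HasDerivWithinAt x (g • H.vf (x t)) J t) :
    0 < g * H.rate₂⁻¹ ∧ (∀ t ∈ J, g * (S.rate (x t))⁻¹ ∈ Icc (g * H.rate₂⁻¹) (g * H.rate₁⁻¹)) ∧
    ContinuousOn (fun t => g * (S.rate (x t))⁻¹) J ∧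
    ∀ t ∈ J, HasDerivWithinAt x ((g * (S.rate (x t))⁻¹) • S.field (x t)) J t := by
  have hm : ∀ t ∈ J, x t ∈ cornerBox (k + 1) m δ₀ V := fun t ht => cornerBox_mono hδ V (hx t ht).1
  have hr := fun t ht => H.rate_mem _ (hm t ht)
  have hr1 := H.rate₁_pos
  have hp : ∀ t ∈ J, 0 < S.rate (x t) := fun t ht => hr1.trans_le (hr t ht).1
  obtain ⟨t₀, ht₀⟩ := hne
  have hr2 : 0 < H.rate₂ := (hp t₀ ht₀).trans_le (hr t₀ ht₀).2
  refine ⟨by positivity, fun t ht => ⟨?_, ?_⟩, ?_, fun t ht => ?_⟩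
  · have := hp t ht
    gcongr; exact (hr t ht).2
  · gcongr; exact (hr t ht).1
  · refine ContinuousOn.mul continuousOn_const (ContinuousOn.inv₀ (H.rate_cont.comp
      (fun t ht => (hx t ht).2.continuousWithinAt) hm) fun t ht => (hp t ht).ne')
  · rw [H.field_eq _ (hm t ht), smul_smul, mul_assoc, inv_mul_cancel₀ (hp t ht).ne', mul_one]
    exact (hx t ht).2

theorem flowsTo_of_curve (hδ : δ ≤ δ₀) {g T : ℝ} (hg : 0 < g) (hT : 0 ≤ T)
    (hx : ∀ t ∈ Icc 0 T, x t ∈ cornerBox (k + 1) m δ V ∧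
      HasDerivWithinAt x (g • H.vf (x t)) (Icc 0 T) t) :
    ∃ T', S.FlowsTo (cornerBox (k + 1) m δ V) (x 0) T' (x T) := by
  obtain ⟨h0, h1, h2, h3⟩ := inv_rate_hypotheses (J := Icc 0 T) hδ hg ⟨0, le_rfl, hT⟩ hx
  obtain ⟨T', X, h4, h5, h6, h7, h8⟩ :=
    time_change_Icc (w := fun x => g * (S.rate x)⁻¹) hT h0 h1 h2 h3
  refine ⟨T', (mul_nonneg h0.le hT).trans h4, X, fun t ht => ⟨?_, (h8 t ht).2⟩, h6, h7⟩
  obtain ⟨s, hs, e⟩ := (h8 t ht).1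
  rw [e]; exact (hx s hs).1

theorem stableProj_of_curve (hδ : δ ≤ δ₀) {g : ℝ} (hg : 0 < g) {z : PhaseSpace (k + 1) m l}
    (hx : ∀ t ∈ Ici (0 : ℝ), x t ∈ cornerBox (k + 1) m δ V ∧
      HasDerivWithinAt x (g • H.vf (x t)) (Ici 0) t) (hz : Tendsto x atTop (𝓝 z))
    (hzB : z ∈ cornerBox (k + 1) m δ V) (hz1 : z.1 = 0) (hz2 : z.2.1 = 0) :
    S.StableProj (cornerBox (k + 1) m δ V) (x 0) z := by
  obtain ⟨h0, h1, h2, h3⟩ := inv_rate_hypotheses (J := Ici 0) hδ hg nonempty_Ici hx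
  obtain ⟨X, h4, h5, h8⟩ := time_change_Ici (w := fun x => g * (S.rate x)⁻¹) h0 h1 h2 h3 hz
  refine ⟨hzB, hz1, hz2, X, fun t ht => ⟨?_, (h8 t ht).2⟩, h4, h5⟩
  obtain ⟨s, hs, e⟩ := (h8 t ht).1
  rw [e]; exact (hx s hs).1

theorem unstableProj_of_curve (hδ : δ ≤ δ₀) {g : ℝ} (hg : 0 < g) {z : PhaseSpace (k + 1) m l}
    (hx : ∀ t ∈ Iic (0 : ℝ), x t ∈ cornerBox (k + 1) m δ V ∧
      HasDerivWithinAt x (g • H.vf (x t)) (Iic 0) t) (hz : Tendsto x atBot (𝓝 z))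
    (hzB : z ∈ cornerBox (k + 1) m δ V) (hz1 : z.1 = 0) (hz2 : z.2.1 = 0) :
    S.UnstableProj (cornerBox (k + 1) m δ V) (x 0) z := by
  obtain ⟨h0, h1, h2, h3⟩ := inv_rate_hypotheses (J := Iic 0) hδ hg nonempty_Iic hx
  obtain ⟨X, h4, h5, h8⟩ := time_change_Iic (w := fun x => g * (S.rate x)⁻¹) h0 h1 h2 h3 hz
  refine ⟨hzB, hz1, hz2, X, fun t ht => ⟨?_, (h8 t ht).2⟩, h4, h5⟩
  obtain ⟨s, hs, e⟩ := (h8 t ht).1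
  rw [e]; exact (hx s hs).1

end Reduction

end FenichelSystem

end

/-! ### Solutions of the corner problem and orbits of the system -/

noncomputable section

namespace FenichelSystem

variable {k m l : ℕ} {S : FenichelSystem (k + 1) m l} {V : Set (EuclideanSpace ℝ (Fin l))}
  {δ₀ δ : ℝ}

namespace Reduction

variable {H : S.Reduction V δ₀} {z₀ : EuclideanSpace ℝ (Fin l)} {hz : z₀ ∈ V}
  {Y : Type} [NormedAddCommGroup Y] [NormedSpace ℝ Y] [CompleteSpace Y]
  {D : CornerData (EuclideanSpace ℝ (Fin (k + 1))) (EuclideanSpace ℝ (Fin m))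
    (EuclideanSpace ℝ (Fin l)) Y (H.corner hz).n (H.corner hz).μ (H.corner hz).K} {y : Y}

theorem speed_pos (hy : y ∈ ((H.corner hz).problem D).O) (e : ℝ) : 0 < 1 + D.s y * timeWeight e := by
  have h1 : |D.s y| < H.ϱ := hy
  have h2 := timeWeight_mem e
  have h3 := H.ϱ_le
  have h4 : |D.s y * timeWeight e| ≤ |D.s y| := by
    rw [abs_mul, abs_of_nonneg h2.1]
    exact mul_le_of_le_one_right (abs_nonneg _) h2.2
  have := neg_abs_le (D.s y * timeWeight e)
  linarith

/-- The solution of a corner problem on a nondegenerate hyperbola is an orbit. -/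
theorem flowsTo_phys (hδ : δ ≤ δ₀) (hy : y ∈ ((H.corner hz).problem D).O) {p : UnitSquare}
    (hp : 0 < (p.2 : ℝ)) (hgood : ∀ q : UnitSquare, (q.1 : ℝ) * q.2 = p.1 * p.2 →
      (H.corner hz).Good D y q ∧ (H.corner hz).phys D y q ∈ cornerBox (k + 1) m δ V) :
    ∃ T, S.FlowsTo (cornerBox (k + 1) m δ V) ((H.corner hz).phys D y p) T
      ((H.corner hz).phys D y (exitPt p)) := by
  have hT : 0 ≤ -Real.log p.2 := by
    have := Real.log_nonpos p.2.2.1 p.2.2.2; linarith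
  have hh : (p.2 : ℝ) * Real.exp (-Real.log p.2) ≤ 1 := by
    rw [Real.exp_neg, Real.exp_log hp, mul_inv_cancel₀ hp.ne']
  have hmul : ∀ r ∈ Icc 0 (-Real.log p.2), ((flow r p).1 : ℝ) * (flow r p).2 = p.1 * p.2 :=
    fun r hr => flow_mul hr.1 (le_one_of_le hh hr.2)
  have := flowsTo_of_curve (H := H) (x := fun r => (H.corner hz).phys D y (flow r p)) hδ
    (speed_pos hy (p.1 * p.2)) hT fun r hr => ⟨(hgood _ (hmul r hr)).2,
      CornerField.phys_hasDerivWithinAt hy hh (fun r hr => (hgood _ (hmul r hr)).1) hr⟩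
  simpa only [flow_zero, flow_exit hp] using this

theorem phys_zero_fst {p : UnitSquare} (hp : (p.2 : ℝ) = 0) : ((H.corner hz).phys D y p).1 = 0 := by
  rw [CornerField.phys_apply, hp, Real.zero_rpow (H.corner hz).μ_pos.ne']; simp

theorem phys_zero_snd {p : UnitSquare} (hp : (p.1 : ℝ) = 0) : ((H.corner hz).phys D y p).2.1 = 0 := by
  rw [CornerField.phys_apply, hp, Real.zero_rpow (H.corner hz).μ_pos.ne']; simp

/-- On the axis `η = 0` the solution of a corner problem is a stable fiber. -/
theorem stableProj_phys (hδ : δ ≤ δ₀) (hy : y ∈ ((H.corner hz).problem D).O)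
    (hgood : ∀ q : UnitSquare, (q.2 : ℝ) = 0 →
      (H.corner hz).Good D y q ∧ (H.corner hz).phys D y q ∈ cornerBox (k + 1) m δ V) :
    S.StableProj (cornerBox (k + 1) m δ V) ((H.corner hz).phys D y (1, 0))
      ((H.corner hz).phys D y (0, 0)) := by
  have h0 : ∀ r, ((flow r (1, 0)).2 : ℝ) = 0 := fun r => by
    rw [flow_snd (by simp)]; simp
  have hcurve : ∀ t ∈ Ici (0 : ℝ), (H.corner hz).phys D y (flow t (1, 0)) ∈ cornerBox (k + 1) m δ V ∧
      HasDerivWithinAt (fun r => (H.corner hz).phys D y (flow r (1, 0)))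
        ((1 : ℝ) • H.vf ((H.corner hz).phys D y (flow t (1, 0)))) (Ici 0) t := by
    intro t ht
    refine ⟨(hgood _ (h0 t)).2, ?_⟩
    have h1 := CornerField.phys_hasDerivWithinAt (p := (1, 0)) (h := t + 1) hy (by simp)
      (fun r _ => (hgood _ (h0 r)).1) (r := t) ⟨ht, by linarith⟩
    -- On the degenerate hyperbola 1/L is 0, so the speed is 1 whatever s is.
    have e1 : (1 : ℝ) + D.s y * timeWeight (((1, 0) : UnitSquare).1 * ((1, 0) : UnitSquare).2) = 1 := by
      simp [timeWeight_zero]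
    rw [e1] at h1
    refine h1.mono_of_mem_nhdsWithin ?_
    have : Icc 0 (t + 1) = Ici 0 ∩ Iic (t + 1) := rfl
    rw [this]
    exact inter_mem_nhdsWithin _ (Iic_mem_nhds (by linarith))
  have hlim : Tendsto (fun t => (H.corner hz).phys D y (flow t (1, 0))) atTop
      (𝓝 ((H.corner hz).phys D y (0, 0))) := by
    refine (((H.corner hz).phys D y).continuous.tendsto _).comp ?_
    have hc : Tendsto (fun r => clamp ((1 : ℝ) * Real.exp (-r), 0)) atTop (𝓝 (clamp (1 * 0, 0))) := by
      refine (continuous_clamp.tendsto _).comp (Tendsto.prodMk_nhds ?_ tendsto_const_nhds)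
      exact (Real.tendsto_exp_neg_atTop_nhds_zero).const_mul _
    have h2 : clamp ((1 : ℝ) * 0, 0) = (0, 0) := by simp [clamp, projIcc_left]
    rw [h2] at hc
    exact hc.congr fun r => by simp [flow]
  have := stableProj_of_curve (H := H) hδ one_pos hcurve hlim (hgood _ rfl).2
    (phys_zero_fst rfl) (phys_zero_snd rfl)
  simpa only [flow_zero] using this

/-- On the axis `ξ = 0` the solution of a corner problem is an unstable fiber. -/
theorem unstableProj_phys (hδ : δ ≤ δ₀) (hy : y ∈ ((H.corner hz).problem D).O)
    (hgood : ∀ q : UnitSquare, (q.1 : ℝ) = 0 →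
      (H.corner hz).Good D y q ∧ (H.corner hz).phys D y q ∈ cornerBox (k + 1) m δ V) :
    S.UnstableProj (cornerBox (k + 1) m δ V) ((H.corner hz).phys D y (0, 1))
      ((H.corner hz).phys D y (0, 0)) := by
  have h0 : ∀ r, ((clamp (0, Real.exp r)).1 : ℝ) = 0 := fun r => clamp_fst ⟨le_rfl, zero_le_one⟩
  have hcurve : ∀ t ∈ Iic (0 : ℝ),
      (H.corner hz).phys D y (clamp (0, Real.exp t)) ∈ cornerBox (k + 1) m δ V ∧
      HasDerivWithinAt (fun r => (H.corner hz).phys D y (clamp (0, Real.exp r)))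
        ((1 : ℝ) • H.vf ((H.corner hz).phys D y (clamp (0, Real.exp t)))) (Iic 0) t := by
    intro t ht
    have ht0 : t ≤ 0 := ht
    refine ⟨(hgood _ (h0 t)).2, ?_⟩
    -- The flow is started one unit of time before t, so that the interval on which the derivative
    -- is computed is a neighbourhood of t in the half line.
    set p : UnitSquare := clamp (0, Real.exp (t - 1)) with hp
    have hp1 : (p.1 : ℝ) = 0 := h0 _
    have hp2 : (p.2 : ℝ) = Real.exp (t - 1) :=
      clamp_snd ⟨(Real.exp_pos _).le, Real.exp_le_one_iff.2 (by linarith)⟩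
    have hh : (p.2 : ℝ) * Real.exp (1 - t) ≤ 1 := by
      rw [hp2, ← Real.exp_add]; simp
    have hf : ∀ u, flow (u - (t - 1)) p = clamp (0, Real.exp u) := by
      intro u
      rw [flow, hp1, hp2, ← Real.exp_add]
      simp
    have hfg : ∀ r, ((flow r p).1 : ℝ) = 0 := by
      intro r
      have := hf (r + (t - 1))
      rw [add_sub_cancel_right] at this
      rw [this]; exact h0 _
    have h1 := CornerField.phys_hasDerivWithinAt (p := p) (h := 1 - t) hy hh
      (fun r _ => (hgood _ (hfg r)).1) (r := t - (t - 1)) ⟨by linarith, by linarith⟩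
    have e1 : (1 : ℝ) + D.s y * timeWeight (p.1 * p.2) = 1 := by
      simp [hp1, timeWeight_zero]
    rw [e1] at h1
    have hm : MapsTo (fun u => id u - (t - 1)) (Icc (t - 1) 0) (Icc 0 (1 - t)) := fun u hu =>
      ⟨by simp only [id]; linarith [hu.1], by simp only [id]; linarith [hu.2]⟩
    have h2 := h1.scomp t (((hasDerivAt_id t).sub_const (t - 1)).hasDerivWithinAt (s := Icc (t - 1) 0))
      hm
    rw [one_smul, hf] at h2
    have h3 : (fun r => (H.corner hz).phys D y (flow r p)) ∘ (fun u => id u - (t - 1)) =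
        fun r => (H.corner hz).phys D y (clamp (0, Real.exp r)) := funext fun u => by
      simp only [Function.comp, id, hf]
    rw [h3] at h2
    refine h2.mono_of_mem_nhdsWithin ?_
    have : Icc (t - 1) 0 = Iic 0 ∩ Ici (t - 1) := inter_comm _ _
    rw [this]
    exact inter_mem_nhdsWithin _ (Ici_mem_nhds (by linarith))
  have hlim : Tendsto (fun t => (H.corner hz).phys D y (clamp (0, Real.exp t))) atBot
      (𝓝 ((H.corner hz).phys D y (0, 0))) := by
    refine (((H.corner hz).phys D y).continuous.tendsto _).comp ?_
    have hc : Tendsto (fun r => clamp (0, Real.exp r)) atBot (𝓝 (clamp (0, 0))) :=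
      (continuous_clamp.tendsto _).comp (tendsto_const_nhds.prodMk_nhds Real.tendsto_exp_atBot)
    have h2 : clamp ((0 : ℝ), 0) = (0, 0) := by simp [clamp, projIcc_left]
    rwa [h2] at hc
  have := unstableProj_of_curve (H := H) hδ one_pos hcurve hlim (hgood _ rfl).2
    (phys_zero_fst rfl) (phys_zero_snd rfl)
  have h2 : clamp (0, Real.exp 0) = (0, 1) := by simp [clamp, projIcc_left, projIcc_right]
  rwa [h2] at this

variable {X : ℝ → PhaseSpace (k + 1) m l}

theorem IsOrbit.estimates {t₀ t₁ : ℝ} (h01 : t₀ ≤ t₁)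
    (hX : H.IsOrbit (cornerBox (k + 1) m δ₀ V) X (Icc t₀ t₁)) :
    ‖(X t₁).2.1‖ ≤ H.ϱ ^ 2 * (H.R / 2) * Real.exp (-(4 * H.μ) * (t₁ - t₀)) ∧
    ‖(X t₀).1‖ ≤ H.ϱ ^ 2 * (H.R / 2) * Real.exp (-(4 * H.μ) * (t₁ - t₀)) ∧
    ‖(X t₁).2.2 - (X t₀).2.2‖ ≤ H.ϱ / 8 := by
  obtain ⟨h1, h2, h3⟩ := H.apriori X t₀ t₁ h01 hX
  have hR := H.R_pos
  have hb : ‖(X t₀).2.1‖ ≤ H.ϱ ^ 2 :=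
    (mem_ball_zero_iff.1 (hX t₀ ⟨le_rfl, h01⟩).1.2.1).le.trans H.δ₀_le
  have ha : ‖(X t₁).1‖ ≤ H.ϱ ^ 2 :=
    (mem_ball_zero_iff.1 (hX t₁ ⟨h01, le_rfl⟩).1.1).le.trans H.δ₀_le
  refine ⟨h1.trans ?_, h2.trans ?_, h3⟩
  · calc _ ≤ H.R / 2 * Real.exp (-(4 * H.μ) * (t₁ - t₀)) * H.ϱ ^ 2 := by gcongr
      _ = _ := by ring
  · calc _ ≤ H.R / 2 * Real.exp (-(4 * H.μ) * (t₁ - t₀)) * H.ϱ ^ 2 := by gcongr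
      _ = _ := by ring

/-- With speed at least 1/2 the exponent 4μ yields at least 2μ, the square of the weight. This
matches the hypothesis of `phys_eq_of_orbit`. -/
theorem exp_le_rpow_sq {μ g t : ℝ} (hμ : 0 < μ) (hg : 1 / 2 ≤ g) (ht : 0 < t) (ht1 : t ≤ 1) :
    Real.exp (-(4 * μ) * (g * -Real.log t)) ≤ (t ^ μ) ^ 2 := by
  have hl : 0 ≤ -Real.log t := by have := Real.log_nonpos ht.le ht1; linarith
  rw [Real.rpow_def_of_pos ht, ← Real.exp_nat_mul, Real.exp_le_exp]
  have := mul_nonneg hμ.le hl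
  push_cast
  nlinarith

/-- A finite orbit with the right boundary values is the solution of the corner problem. -/
theorem phys_eq_of_isOrbit (hy : y ∈ ((H.corner hz).problem D).O) {T L : ℝ} (hL : 2 ≤ L)
    (hT : T = L + D.s y) (hρ : Real.exp (-L) ≤ D.ρ)
    (hX : H.IsOrbit (cornerBox (k + 1) m δ₀ V) X (Icc 0 T))
    (hc : ‖(X T).2.2 - z₀‖ ≤ 3 * H.ϱ / 8) (hA : (X T).1 = D.a₁ y) (hB : (X 0).2.1 = D.b₁ y)
    (hC : (X T).2.2 = D.k (y, (X 0).1, (X T).2.2 - (X 0).2.2)) {p : UnitSquare}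
    (hp : (p.1 : ℝ) * p.2 = Real.exp (-L)) :
    (H.corner hz).phys D y p = X ((1 + D.s y / L) * -Real.log p.1) ∧
      (H.corner hz).Good D y p := by
  have hs : |D.s y| < 1 := lt_of_lt_of_le hy H.ϱ_le
  obtain ⟨hs1, hs2⟩ := abs_lt.1 hs
  have hμ := H.μ_pos
  have hR := H.R_pos
  have hϱ := H.ϱ_pos
  -- The flow on the hyperbola takes time L and the orbit takes time T = L + s, so g = T / L is the
  -- speed. The bounds L ≥ 2 and |s| < 1 give g ≥ 1/2.
  set g := 1 + D.s y / L with hg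
  have hgL : g * L = T := by rw [hg, hT]; field_simp
  have hg2 : 1 / 2 ≤ g := by
    have : -(1 / 2) ≤ D.s y / L := by
      rw [le_div_iff₀ (by linarith)]; linarith
    linarith
  have hpos : ∀ p : UnitSquare, (p.1 : ℝ) * p.2 = Real.exp (-L) → 0 < (p.1 : ℝ) ∧ 0 < (p.2 : ℝ) ∧
      -Real.log p.2 = L - -Real.log p.1 ∧ 0 ≤ -Real.log p.1 ∧ 0 ≤ -Real.log p.2 := by
    intro p hp
    have h := Real.exp_pos (-L)
    rw [← hp] at h
    have h1 : 0 < (p.1 : ℝ) := lt_of_le_of_ne p.1.2.1 fun h0 => by rw [← h0] at h; simp at h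
    have h2 : 0 < (p.2 : ℝ) := lt_of_le_of_ne p.2.2.1 fun h0 => by rw [← h0] at h; simp at h
    have h3 := congrArg Real.log hp
    rw [Real.log_mul h1.ne' h2.ne', Real.log_exp] at h3
    have h4 := Real.log_nonpos p.1.2.1 p.1.2.2
    have h5 := Real.log_nonpos p.2.2.1 p.2.2.2
    exact ⟨h1, h2, by linarith, by linarith, by linarith⟩
  have hmem : ∀ p : UnitSquare, (p.1 : ℝ) * p.2 = Real.exp (-L) → g * -Real.log p.1 ∈ Icc 0 T := by
    intro p hp
    obtain ⟨h1, h2, h3, h4, h5⟩ := hpos p hp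
    refine ⟨by positivity, ?_⟩
    rw [← hgL]; gcongr; linarith
  have hlog : ∀ p : UnitSquare, (p.1 : ℝ) * p.2 = Real.exp (-L) →
      T - g * -Real.log p.1 = g * -Real.log p.2 := by
    intro p hp
    obtain ⟨h1, h2, h3, h4, h5⟩ := hpos p hp
    rw [h3, ← hgL]; ring
  have hent : ∀ p : UnitSquare, g * -Real.log (entryPt p).1 = 0 := fun p => by simp [entryPt]
  have hex : ∀ p : UnitSquare, (p.1 : ℝ) * p.2 = Real.exp (-L) → g * -Real.log (exitPt p).1 = T := by
    intro p hp
    have : ((exitPt p).1 : ℝ) = Real.exp (-L) := by rw [← hp]; simp [exitPt]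
    rw [this, Real.log_exp, neg_neg, hgL]
  have hT0 : 0 ≤ T := by rw [hT]; linarith
  refine CornerField.phys_eq_of_orbit (C := H.corner hz) (e := Real.exp (-L))
    (Z := fun p => X (g * -Real.log p.1)) hy hρ ?_ ?_ ?_ ?_ ?_ ?_ ?_ ?_ hp
  · refine hX.continuousOn.comp (t := Icc 0 T) ?_ hmem
    refine continuousOn_const.mul (ContinuousOn.neg (ContinuousOn.log (by fun_prop) fun p hp => ?_))
    exact (hpos p hp).1.ne'
  · intro p hp
    have h1 := (hX.mono (Subset.refl _) (Icc_subset_Icc_left (hmem p hp).1)).estimates (hmem p hp).2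
    refine h1.2.1.trans ?_
    rw [hlog p hp]
    show _ ≤ H.ϱ ^ 2 * (H.R / 2) * ((p.2 : ℝ) ^ H.μ) ^ 2
    gcongr
    exact exp_le_rpow_sq hμ hg2 (hpos p hp).2.1 p.2.2.2
  · intro p hp
    have h1 := (hX.mono (Subset.refl _) (Icc_subset_Icc_right (hmem p hp).2)).estimates (hmem p hp).1
    refine h1.1.trans ?_
    rw [sub_zero]
    show _ ≤ H.ϱ ^ 2 * (H.R / 2) * ((p.1 : ℝ) ^ H.μ) ^ 2
    gcongr
    exact exp_le_rpow_sq hμ hg2 (hpos p hp).1 p.1.2.2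
  · intro p hp
    have h1 := (hX.mono (Subset.refl _) (Icc_subset_Icc_left (hmem p hp).1)).estimates (hmem p hp).2
    -- The exit value is within 3ϱ/8 of z₀ and the drift adds at most ϱ/8, which makes the permitted
    -- ϱ/2.
    have e : (X (g * -Real.log p.1)).2.2 - z₀ = ((X T).2.2 - z₀) -
      ((X T).2.2 - (X (g * -Real.log p.1)).2.2) := by abel
    show ‖(X (g * -Real.log p.1)).2.2 - z₀‖ ≤ H.ϱ / 2
    rw [e]
    refine (norm_sub_le _ _).trans ?_
    linarith [h1.2.2]
  · intro p hp h h0 hh r hr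
    obtain ⟨h1, h2, h3, h4, h5⟩ := hpos p hp
    have hlogf : ∀ r ∈ Icc 0 h, g * -Real.log (flow r p).1 = g * (-Real.log p.1 + r) := by
      intro r hr
      rw [flow_fst hr.1, Real.log_mul h1.ne' (Real.exp_pos _).ne', Real.log_exp]; ring
    have hmaps : ∀ r ∈ Icc 0 h, g * (-Real.log p.1 + r) ∈ Icc 0 T := fun r hr => by
      rw [← hlogf r hr]
      exact hmem _ ((flow_mul hr.1 (le_one_of_le hh hr.2)).trans hp)
    have hd := (hX _ (hmaps r hr)).2.scomp r
      ((((hasDerivAt_id r).const_add (-Real.log p.1)).const_mul g).hasDerivWithinAt (s := Icc 0 h))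
      hmaps
    refine (hd.congr (fun r hr => ?_) ?_).congr_deriv ?_
    · simp only [Function.comp, hlogf r hr, id]
    · simp only [Function.comp, hlogf r hr, id]
    · rw [timeWeight_of_le (by linarith), ← div_eq_mul_inv, ← hg, mul_one]
      simp only [hlogf r hr]
      rfl
  · intro p hp h1
    have : (p.1 : ℝ) = Real.exp (-L) := by rw [← hp, h1, mul_one]
    simp only [this, Real.log_exp, neg_neg, hgL, hA]
  · intro p hp h1
    simp only [h1, Real.log_one, neg_zero, mul_zero, hB]
  · intro p hp
    simp only [hent, hex p hp]
    exact hC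

end Reduction

end FenichelSystem

end

/-! ### Stable and unstable fibers as the degenerate hyperbola -/

noncomputable section

section LogExtend

variable {F : Type} [TopologicalSpace F]

/-- A curve on the half line as a function of `exp (-t)`, with a given value at the end. -/
def logExtend (X : ℝ → F) (z : F) : ℝ → F := Function.update (fun ξ => X (-Real.log ξ)) 0 z

variable {X : ℝ → F} {z : F}

theorem logExtend_zero : logExtend X z 0 = z := Function.update_self ..

theorem logExtend_of_ne {ξ : ℝ} (h : ξ ≠ 0) : logExtend X z ξ = X (-Real.log ξ) :=
  Function.update_of_ne h ..

theorem logExtend_one : logExtend X z 1 = X 0 := by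
  rw [logExtend_of_ne one_ne_zero, Real.log_one, neg_zero]

theorem continuousOn_logExtend (hX : ContinuousOn X (Ici 0)) (hz : Tendsto X atTop (𝓝 z)) :
    ContinuousOn (logExtend X z) (Icc 0 1) := by
  intro ξ hξ
  rcases eq_or_ne ξ 0 with rfl | h
  · refine continuousWithinAt_update_same.2 (hz.comp ?_)
    refine (tendsto_neg_atBot_atTop.comp Real.tendsto_log_nhdsNE_zero).mono_left
      (nhdsWithin_mono _ fun x hx => hx.2)
  · refine (continuousWithinAt_update_of_ne h).2 ?_
    refine ContinuousWithinAt.comp (t := Ici 0) (hX _ (mem_Ici.2 ?_))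
      (Real.continuousAt_log h).neg.continuousWithinAt fun x hx => mem_Ici.2 ?_
    · linarith [Real.log_nonpos hξ.1 hξ.2]
    · linarith [Real.log_nonpos hx.1 hx.2]

end LogExtend

namespace FenichelSystem

variable {k m l : ℕ} {S : FenichelSystem (k + 1) m l} {V : Set (EuclideanSpace ℝ (Fin l))}
  {δ₀ δ : ℝ}

namespace Reduction

variable {H : S.Reduction V δ₀} {z₀ : EuclideanSpace ℝ (Fin l)} {hz : z₀ ∈ V}
  {Y : Type} [NormedAddCommGroup Y] [NormedSpace ℝ Y] [CompleteSpace Y]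
  {D : CornerData (EuclideanSpace ℝ (Fin (k + 1))) (EuclideanSpace ℝ (Fin m))
    (EuclideanSpace ℝ (Fin l)) Y (H.corner hz).n (H.corner hz).μ (H.corner hz).K} {y : Y}
  {X X' : ℝ → PhaseSpace (k + 1) m l} {z : PhaseSpace (k + 1) m l}

theorem tendsto_exp_estimate (H : S.Reduction V δ₀) :
    Tendsto (fun T => H.ϱ ^ 2 * (H.R / 2) * Real.exp (-(4 * H.μ) * T)) atTop (𝓝 0) := by
  have h : Tendsto (fun T => -(4 * H.μ) * T) atTop atBot :=
    tendsto_id.const_mul_atTop_of_neg (by linarith [H.μ_pos])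
  simpa using (Real.tendsto_exp_atBot.comp h).const_mul (H.ϱ ^ 2 * (H.R / 2))

/-- At every later time a is bounded by the size of the box, and it decays exponentially backward
from there. Letting the later time tend to infinity leaves 0. -/
theorem IsOrbit.fst_eq_zero (hX : H.IsOrbit (cornerBox (k + 1) m δ₀ V) X (Ici 0)) {t : ℝ}
    (ht : 0 ≤ t) : (X t).1 = 0 := by
  refine norm_le_zero_iff.1 (ge_of_tendsto H.tendsto_exp_estimate ?_)
  filter_upwards [eventually_ge_atTop 0] with T hT
  have := ((hX.mono Subset.rfl (J' := Icc t (t + T)) fun s hs => mem_Ici.2 (ht.trans hs.1)).estimates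
    (by linarith)).2.1
  simpa using this

theorem IsOrbit.snd_eq_zero (hX : H.IsOrbit (cornerBox (k + 1) m δ₀ V) X (Iic 0)) {t : ℝ}
    (ht : t ≤ 0) : (X t).2.1 = 0 := by
  refine norm_le_zero_iff.1 (ge_of_tendsto H.tendsto_exp_estimate ?_)
  filter_upwards [eventually_ge_atTop 0] with T hT
  have := ((hX.mono Subset.rfl (J' := Icc (t - T) t) fun s hs => mem_Iic.2 (hs.2.trans ht)).estimates
    (by linarith)).1
  simpa using this

theorem IsOrbit.dist_limit_Ici (hX : H.IsOrbit (cornerBox (k + 1) m δ₀ V) X (Ici 0))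
    (hlim : Tendsto X atTop (𝓝 z)) {t : ℝ} (ht : 0 ≤ t) : ‖(X t).2.2 - z.2.2‖ ≤ H.ϱ / 8 := by
  have h1 : Tendsto (fun T => ‖(X T).2.2 - (X t).2.2‖) atTop (𝓝 ‖z.2.2 - (X t).2.2‖) :=
    (((continuous_snd.comp continuous_snd).tendsto _).comp hlim |>.sub_const _).norm
  rw [norm_sub_rev]
  refine le_of_tendsto h1 ?_
  filter_upwards [eventually_ge_atTop t] with T hT
  exact ((hX.mono Subset.rfl (J' := Icc t T) fun s hs => mem_Ici.2 (ht.trans hs.1)).estimates hT).2.2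

theorem IsOrbit.dist_limit_Iic (hX : H.IsOrbit (cornerBox (k + 1) m δ₀ V) X (Iic 0))
    (hlim : Tendsto X atBot (𝓝 z)) {t : ℝ} (ht : t ≤ 0) : ‖(X t).2.2 - z.2.2‖ ≤ H.ϱ / 8 := by
  have h1 : Tendsto (fun T => ‖(X t).2.2 - (X T).2.2‖) atBot (𝓝 ‖(X t).2.2 - z.2.2‖) :=
    (tendsto_const_nhds.sub (((continuous_snd.comp continuous_snd).tendsto _).comp hlim)).norm
  refine le_of_tendsto h1 ?_
  filter_upwards [eventually_le_atBot t] with T hT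
  exact ((hX.mono Subset.rfl (J' := Icc T t) fun s hs => mem_Iic.2 (hs.2.trans ht)).estimates hT).2.2

theorem vf_eq_zero (H : S.Reduction V δ₀) (h1 : z.1 = 0) (h2 : z.2.1 = 0) : H.vf z = 0 := by
  simp only [vf, coeffField, h1, h2, map_zero]
  rw [show ((0 : EuclideanSpace ℝ (Fin (k + 1))), (0 : EuclideanSpace ℝ (Fin m))) = 0 from rfl,
    map_zero]
  rfl

/-- A stable and an unstable fiber of one equilibrium with the right boundary values are the solution
of the corner problem on the degenerate hyperbola. -/
theorem phys_eq_of_fibers (hy : y ∈ ((H.corner hz).problem D).O) (hδ : δ ≤ δ₀)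
    (hX : H.IsOrbit (cornerBox (k + 1) m δ V) X (Ici 0)) (hlim : Tendsto X atTop (𝓝 z))
    (hX' : H.IsOrbit (cornerBox (k + 1) m δ V) X' (Iic 0)) (hlim' : Tendsto X' atBot (𝓝 z))
    (hzB : z ∈ cornerBox (k + 1) m δ V) (h1 : z.1 = 0) (h2 : z.2.1 = 0)
    (hc : ‖z.2.2 - z₀‖ ≤ 3 * H.ϱ / 8) (hA : (X' 0).1 = D.a₁ y) (hB : (X 0).2.1 = D.b₁ y)
    (hC : (X' 0).2.2 = D.k (y, 0, (X' 0).2.2 - (X 0).2.2)) :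
    (∀ p : UnitSquare, (p.1 : ℝ) * p.2 = 0 → (H.corner hz).Good D y p ∧
      (H.corner hz).phys D y p ∈ cornerBox (k + 1) m δ V) ∧
    (H.corner hz).phys D y (1, 0) = X 0 ∧ (H.corner hz).phys D y (0, 1) = X' 0 ∧
    (H.corner hz).phys D y (0, 0) = z := by
  have hbox := cornerBox_mono (k := k + 1) (m := m) hδ V
  have hX₀ := hX.mono hbox Subset.rfl
  have hX₀' := hX'.mono hbox Subset.rfl
  have hR := H.R_pos
  have hϱ := H.ϱ_pos
  set u := logExtend X z with hu
  set u' := logExtend (fun t => X' (-t)) z with hu'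
  -- The two fibers are glued at their common base point: on each axis one of the summands u, u'
  -- equals z and cancels.
  let Z : UnitSquare → PhaseSpace (k + 1) m l := fun p => u p.1 + u' p.2 - z
  have hZ1 : ∀ p : UnitSquare, (p.2 : ℝ) = 0 → Z p = u p.1 := fun p hp => by
    simp only [Z, hp, hu', logExtend_zero, add_sub_cancel_right]
  have hZ2 : ∀ p : UnitSquare, (p.1 : ℝ) = 0 → Z p = u' p.2 := fun p hp => by
    simp only [Z, hp, hu, logExtend_zero, add_sub_cancel_left]
  have hlog : ∀ t : unitInterval, Real.log t ≤ 0 := fun t => Real.log_nonpos t.2.1 t.2.2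
  have hum : ∀ t : unitInterval, u t = z ∨ (0 < (t : ℝ) ∧ u t = X (-Real.log t)) := fun t => by
    rcases eq_or_ne (t : ℝ) 0 with h | h
    · left; rw [h, hu, logExtend_zero]
    · exact Or.inr ⟨lt_of_le_of_ne t.2.1 h.symm, logExtend_of_ne h⟩
  have hum' : ∀ t : unitInterval, u' t = z ∨ (0 < (t : ℝ) ∧ u' t = X' (Real.log t)) := fun t => by
    rcases eq_or_ne (t : ℝ) 0 with h | h
    · left; rw [h, hu', logExtend_zero]
    · refine Or.inr ⟨lt_of_le_of_ne t.2.1 h.symm, ?_⟩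
      rw [hu', logExtend_of_ne h, neg_neg]
  have hcont : ContinuousOn u (Icc 0 1) := continuousOn_logExtend hX.continuousOn hlim
  have hcont' : ContinuousOn u' (Icc 0 1) := by
    refine continuousOn_logExtend (hX'.continuousOn.comp continuousOn_neg fun t ht => ?_)
      (hlim'.comp tendsto_neg_atTop_atBot)
    exact mem_Iic.2 (neg_nonpos.2 ht)
  have hcases : ∀ p : UnitSquare, (p.1 : ℝ) * p.2 = 0 → (Z p = u p.1 ∧ (p.2 : ℝ) = 0) ∨
      (Z p = u' p.2 ∧ (p.1 : ℝ) = 0) := fun p hp => by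
    rcases mul_eq_zero.1 hp with h | h
    · exact Or.inr ⟨hZ2 p h, h⟩
    · exact Or.inl ⟨hZ1 p h, h⟩
  have hpow : (0 : ℝ) ^ H.μ = 0 := Real.zero_rpow H.μ_pos.ne'
  have key : ∀ p : UnitSquare, (p.1 : ℝ) * p.2 = 0 →
      (H.corner hz).phys D y p = Z p ∧ (H.corner hz).Good D y p := by
    intro p hp
    refine CornerField.phys_eq_of_orbit (C := H.corner hz) (e := 0) (Z := Z) hy D.ρ_pos.le
      ?_ ?_ ?_ ?_ ?_ ?_ ?_ ?_ hp
    · refine Continuous.continuousOn ?_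
      exact ((hcont.comp_continuous (continuous_subtype_val.comp continuous_fst) fun p => p.1.2).add
        (hcont'.comp_continuous (continuous_subtype_val.comp continuous_snd) fun p => p.2.2)).sub
        continuous_const
    · intro p hp
      have h0 : 0 ≤ H.ϱ ^ 2 * (H.R / 2) * ((p.2 : ℝ) ^ H.μ) ^ 2 := by positivity
      show _ ≤ H.ϱ ^ 2 * (H.R / 2) * ((p.2 : ℝ) ^ H.μ) ^ 2
      rcases hcases p hp with ⟨h, -⟩ | ⟨h, -⟩ <;> rw [h]
      · rcases hum p.1 with h | ⟨-, h⟩ <;> rw [h]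
        · rwa [h1, norm_zero]
        · rwa [hX₀.fst_eq_zero (by linarith [hlog p.1]), norm_zero]
      · rcases hum' p.2 with h | ⟨h3, h⟩ <;> rw [h]
        · rwa [h1, norm_zero]
        · have := ((hX₀'.mono Subset.rfl (J' := Icc (Real.log p.2) 0) fun s hs => mem_Iic.2 hs.2).estimates
            (hlog _)).2.1
          refine this.trans ?_
          gcongr
          have h4 := exp_le_rpow_sq (g := 1) H.μ_pos (by norm_num) h3 p.2.2.2
          rwa [one_mul, ← zero_sub (Real.log _)] at h4
    · intro p hp
      have h0 : 0 ≤ H.ϱ ^ 2 * (H.R / 2) * ((p.1 : ℝ) ^ H.μ) ^ 2 := by positivity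
      show _ ≤ H.ϱ ^ 2 * (H.R / 2) * ((p.1 : ℝ) ^ H.μ) ^ 2
      rcases hcases p hp with ⟨h, -⟩ | ⟨h, -⟩ <;> rw [h]
      · rcases hum p.1 with h | ⟨h3, h⟩ <;> rw [h]
        · rwa [h2, norm_zero]
        · have := ((hX₀.mono Subset.rfl (J' := Icc 0 (-Real.log p.1)) fun s hs => mem_Ici.2 hs.1).estimates
            (by linarith [hlog p.1])).1
          refine this.trans ?_
          gcongr
          have h4 := exp_le_rpow_sq (g := 1) H.μ_pos (by norm_num) h3 p.1.2.2
          rwa [one_mul, ← sub_zero (-Real.log _)] at h4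
      · rcases hum' p.2 with h | ⟨-, h⟩ <;> rw [h]
        · rwa [h2, norm_zero]
        · rwa [hX₀'.snd_eq_zero (hlog _), norm_zero]
    · intro p hp
      have e : ∀ v : EuclideanSpace ℝ (Fin l), ‖v - z.2.2‖ ≤ H.ϱ / 8 → ‖v - z₀‖ ≤ H.ϱ / 2 :=
        fun v hv => by
          have : v - z₀ = (v - z.2.2) + (z.2.2 - z₀) := by abel
          rw [this]
          exact (norm_add_le _ _).trans (by linarith)
      refine e _ ?_
      have h0 : ‖z.2.2 - z.2.2‖ ≤ H.ϱ / 8 := by rw [sub_self, norm_zero]; positivity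
      rcases hcases p hp with ⟨h, -⟩ | ⟨h, -⟩ <;> rw [h]
      · rcases hum p.1 with h | ⟨h3, h⟩ <;> rw [h]
        · exact h0
        · exact hX₀.dist_limit_Ici hlim (by linarith [hlog p.1])
      · rcases hum' p.2 with h | ⟨-, h⟩ <;> rw [h]
        · exact h0
        · exact hX₀'.dist_limit_Iic hlim' (hlog _)
    · intro p hp h h0 hh r hr
      rw [timeWeight_zero, mul_zero, add_zero, one_smul]
      have hconst : (∀ r ∈ Icc 0 h, Z (flow r p) = z) →
          HasDerivWithinAt (fun r => Z (flow r p)) (H.vf (Z (flow r p))) (Icc 0 h) r := by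
        intro hc
        rw [hc r hr, H.vf_eq_zero h1 h2]
        exact (hasDerivWithinAt_const _ _ z).congr hc (hc r hr)
      rcases mul_eq_zero.1 hp with h3 | h3
      · have hZf : ∀ r ∈ Icc 0 h, Z (flow r p) = u' ((p.2 : ℝ) * Real.exp r) := fun r hr => by
          rw [hZ2 _ (by rw [flow_fst hr.1, h3, zero_mul]), flow_snd (le_one_of_le hh hr.2)]
        rcases eq_or_ne (p.2 : ℝ) 0 with h4 | h4
        · exact hconst fun r hr => by rw [hZf r hr, h4, zero_mul, hu', logExtend_zero]
        · have h5 : 0 < (p.2 : ℝ) := lt_of_le_of_ne p.2.2.1 h4.symm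
          have hZg : ∀ r ∈ Icc 0 h, Z (flow r p) = X' (Real.log p.2 + r) := fun r hr => by
            rw [hZf r hr, hu', logExtend_of_ne (mul_pos h5 (Real.exp_pos r)).ne', neg_neg,
              Real.log_mul h4 (Real.exp_pos r).ne', Real.log_exp]
          have hmaps : MapsTo (fun r => Real.log p.2 + r) (Icc 0 h) (Iic 0) := fun r hr => by
            have e : (fun r => Real.log p.2 + r) r = Real.log (p.2 * Real.exp r) := by
              rw [Real.log_mul h4 (Real.exp_pos r).ne', Real.log_exp]
            rw [mem_Iic, e]
            exact Real.log_nonpos (by positivity) (le_one_of_le hh hr.2)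
          have hd := (hX' _ (hmaps hr)).2.scomp r
            (((hasDerivAt_id r).const_add (Real.log p.2)).hasDerivWithinAt (s := Icc 0 h)) hmaps
          rw [one_smul] at hd
          rw [hZg r hr]
          exact hd.congr hZg (hZg r hr)
      · have hZf : ∀ r ∈ Icc 0 h, Z (flow r p) = u ((p.1 : ℝ) * Real.exp (-r)) := fun r hr => by
          rw [hZ1 _ (by rw [flow_snd (le_one_of_le hh hr.2), h3, zero_mul]), flow_fst hr.1]
        rcases eq_or_ne (p.1 : ℝ) 0 with h4 | h4
        · exact hconst fun r hr => by rw [hZf r hr, h4, zero_mul, hu, logExtend_zero]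
        · have h5 : 0 < (p.1 : ℝ) := lt_of_le_of_ne p.1.2.1 h4.symm
          have hZg : ∀ r ∈ Icc 0 h, Z (flow r p) = X (-Real.log p.1 + r) := fun r hr => by
            rw [hZf r hr, hu, logExtend_of_ne (mul_pos h5 (Real.exp_pos (-r))).ne',
              Real.log_mul h4 (Real.exp_pos _).ne', Real.log_exp]
            congr 1; ring
          have hmaps : MapsTo (fun r => -Real.log p.1 + r) (Icc 0 h) (Ici 0) := fun r hr => by
            rw [mem_Ici]
            linarith [hlog p.1, hr.1]
          have hd := (hX _ (hmaps hr)).2.scomp r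
            (((hasDerivAt_id r).const_add (-Real.log p.1)).hasDerivWithinAt (s := Icc 0 h)) hmaps
          rw [one_smul] at hd
          rw [hZg r hr]
          exact hd.congr hZg (hZg r hr)
    · intro p hp h3
      rw [h3, mul_one] at hp
      rw [hZ2 p hp, h3, hu', logExtend_one, neg_zero, hA]
    · intro p hp h3
      rw [h3, one_mul] at hp
      rw [hZ1 p hp, h3, hu, logExtend_one, hB]
    · intro p hp
      have e1 : Z (exitPt p) = X' 0 := by
        rw [hZ2 _ (by simpa [exitPt] using hp)]
        show u' 1 = _
        rw [hu', logExtend_one, neg_zero]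
      have e2 : Z (entryPt p) = X 0 := by
        rw [hZ1 _ (by simpa [entryPt] using hp)]
        show u 1 = _
        rw [hu, logExtend_one]
      rw [e1, e2, hX₀.fst_eq_zero le_rfl, ← hC]
  refine ⟨fun p hp => ⟨(key p hp).2, ?_⟩, ?_, ?_, ?_⟩
  · rw [(key p hp).1]
    rcases hcases p hp with ⟨h, -⟩ | ⟨h, -⟩ <;> rw [h]
    · rcases hum p.1 with h | ⟨h3, h⟩ <;> rw [h]
      · exact hzB
      · exact (hX _ (mem_Ici.2 (by linarith [hlog p.1]))).1
    · rcases hum' p.2 with h | ⟨-, h⟩ <;> rw [h]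
      · exact hzB
      · exact (hX' _ (mem_Iic.2 (hlog _))).1
  · rw [(key (1, 0) (by simp)).1, hZ1 _ (by simp)]
    simp [hu, logExtend_one]
  · rw [(key (0, 1) (by simp)).1, hZ2 _ (by simp)]
    simp [hu', logExtend_one]
  · rw [(key (0, 0) (by simp)).1, hZ1 _ (by simp)]
    simp [hu, logExtend_zero]

/-- The boundary values of the solution of a corner problem. -/
theorem phys_exit_fst (hy : y ∈ ((H.corner hz).problem D).O) {p : UnitSquare} (hp : (p.2 : ℝ) = 1) :
    ((H.corner hz).phys D y p).1 = D.a₁ y := by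
  have hϱ := H.ϱ_pos
  rw [CornerField.phys_apply, ((H.corner hz).problem D).sol_fst_exit hy hp, hp, Real.one_rpow, mul_one]
  show (H.ϱ ^ 2) • ((H.ϱ ^ 2)⁻¹ • D.a₁ y) = _
  rw [smul_smul, mul_inv_cancel₀ (by positivity), one_smul]

theorem phys_entry_snd (hy : y ∈ ((H.corner hz).problem D).O) {p : UnitSquare} (hp : (p.1 : ℝ) = 1) :
    ((H.corner hz).phys D y p).2.1 = D.b₁ y := by
  have hϱ := H.ϱ_pos
  rw [CornerField.phys_apply, ((H.corner hz).problem D).sol_snd_entry hy hp, hp, Real.one_rpow, mul_one]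
  show (H.ϱ ^ 2) • ((H.ϱ ^ 2)⁻¹ • D.b₁ y) = _
  rw [smul_smul, mul_inv_cancel₀ (by positivity), one_smul]

/-- The exit condition in physical coordinates. -/
theorem phys_exit_cond (hy : y ∈ ((H.corner hz).problem D).O) {p : UnitSquare}
    (hp : (p.1 : ℝ) * p.2 ≤ D.ρ) : ((H.corner hz).phys D y (exitPt p)).2.2 =
      D.k (y, ((H.corner hz).phys D y (entryPt p)).1, ((H.corner hz).phys D y (exitPt p)).2.2 -
        ((H.corner hz).phys D y (entryPt p)).2.2) := by
  have hϱ := H.ϱ_pos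
  have h := ((H.corner hz).problem D).sol_thd_exit hy p
  have hw : (((H.corner hz).problem D).θ (exitPt p)).2.2.2 = ((p.1 : ℝ) * p.2) ^ H.μ := by
    show (min (((exitPt p).1 : ℝ) * (exitPt p).2) D.ρ) ^ H.μ = _
    rw [mul_exitPt, min_eq_left hp]
  have hk : ∀ u, ((H.corner hz).problem D).k u = (H.corner hz).exitCond D u := fun _ => rfl
  rw [hk, CornerField.exitCond] at h
  simp only [hw] at h
  have e1 : ((H.corner hz).phys D y (entryPt p)).1 =
      (H.ϱ ^ 2 * ((p.1 : ℝ) * p.2) ^ H.μ) • (((H.corner hz).problem D).sol y).1 (entryPt p) := by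
    rw [CornerField.phys_apply]
    rfl
  have e2 : ∀ q, ((H.corner hz).phys D y q).2.2 =
      z₀ + H.ϱ • (((H.corner hz).problem D).sol y).2.2 q := fun q => by
    rw [CornerField.phys_apply]; rfl
  rw [e1, e2, e2, add_sub_add_left_eq_sub, ← smul_sub]
  nth_rewrite 1 [h]
  show z₀ + H.ϱ • H.ϱ⁻¹ • (_ - z₀) = _
  rw [smul_smul, mul_inv_cancel₀ hϱ.ne', one_smul, add_sub_cancel]
  rfl

end Reduction

end FenichelSystem

end

/-! ### Graph conditions at the entry, and persistence of good solutions -/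

noncomputable section

theorem exists_mul_rpow_le {a c μ : ℝ} (hc : 0 < c) (hμ : 0 < μ) :
    ∃ ρ : ℝ, 0 < ρ ∧ ρ ≤ 1 ∧ a * ρ ^ μ ≤ c := by
  have h : Tendsto (fun ρ : ℝ => a * ρ ^ μ) (𝓝 0) (𝓝 (a * 0 ^ μ)) :=
    ((Real.continuousAt_rpow_const 0 μ (Or.inr hμ.le)).tendsto).const_mul a
  rw [Real.zero_rpow hμ.ne', mul_zero] at h
  have h1 : ∀ᶠ ρ : ℝ in 𝓝[>] 0, a * ρ ^ μ < c := (h.eventually_lt_const hc).filter_mono nhdsWithin_le_nhds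
  have h2 : ∀ᶠ ρ : ℝ in 𝓝[>] 0, ρ < 1 := (eventually_lt_nhds one_pos).filter_mono nhdsWithin_le_nhds
  obtain ⟨ρ, hρ, hρ1, hρ0⟩ := (h1.and (h2.and self_mem_nhdsWithin)).exists
  exact ⟨ρ, hρ0, hρ1.le, hρ.le⟩

/-- Data of the condition that the entry point lies on a graph. -/
structure ExitGraph (EA EC F : Type) [NormedAddCommGroup EA] [NormedSpace ℝ EA]
    [NormedAddCommGroup EC] [NormedSpace ℝ EC] [NormedAddCommGroup F] [NormedSpace ℝ F] (n : ℕ) where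
  c₀ : EC
  incl : F →L[ℝ] EC
  proj : EC →L[ℝ] F
  h : EA × F → EC
  La : ℝ
  smooth : ContDiff ℝ n h
  La_nonneg : 0 ≤ La
  norm_proj : ∀ I, ‖proj I‖ ≤ ‖I‖
  norm_compl : ∀ I, ‖I - incl (proj I)‖ ≤ ‖I‖
  -- Constant 1 in w is attainable because the manifold is a graph over its own tangent directions,
  -- so the derivative in w vanishes at the base point.
  lip : ∀ a a' w w', ‖h (a, w) - h (a', w')‖ ≤ La * ‖a - a'‖ + ‖w - w'‖

namespace ExitGraph

variable {EA EB EC F : Type}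
  [NormedAddCommGroup EA] [InnerProductSpace ℝ EA] [FiniteDimensional ℝ EA]
  [NormedAddCommGroup EB] [InnerProductSpace ℝ EB] [FiniteDimensional ℝ EB]
  [NormedAddCommGroup EC] [InnerProductSpace ℝ EC] [FiniteDimensional ℝ EC]
  [NormedAddCommGroup F] [NormedSpace ℝ F] [CompleteSpace F] {n : ℕ}

/-- The exit value of the third coordinate as a function of the boundary data, the first coordinate of
the entry point and the difference of the third coordinates. -/
def cond (G : ExitGraph EA EC F n) (u : (EA × EB × ℝ × F) × EA × EC) : EC :=
  -- If v is the tangential coordinate at the exit and I the drift, the one at the entry is v - proj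
  -- I. The formula is then c_exit = c_entry + I with c_entry on the graph.
  G.c₀ + G.incl u.1.2.2.2 + (u.2.2 - G.incl (G.proj u.2.2)) + G.h (u.2.1, u.1.2.2.2 - G.proj u.2.2)

/-- The corner problem with prescribed `a` at the exit, prescribed `b` and a graph condition at the
entry. -/
def data (G : ExitGraph EA EC F n) (C : CornerField EA EB EC) (hn : C.n = n) :
    CornerData EA EB EC (EA × EB × ℝ × F) C.n C.μ C.K :=
  have hρ := exists_mul_rpow_le (a := G.La) (cornerLip_bounds C.K_nonneg C.μ_pos).1 C.μ_pos
  { La := G.La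
    ρ := hρ.choose
    s := fun y => y.2.2.1
    a₁ := fun y => y.1
    b₁ := fun y => y.2.1
    k := G.cond
    smooth_s := by fun_prop
    smooth_a₁ := by fun_prop
    smooth_b₁ := by fun_prop
    smooth_k := by
      rw [hn]
      have := G.smooth
      unfold cond
      fun_prop
    lip_k := fun y a a' I I' => by
      have e : G.cond (y, a, I) - G.cond (y, a', I') =
          ((I - I') - G.incl (G.proj (I - I'))) +
          (G.h (a, y.2.2.2 - G.proj I) - G.h (a', y.2.2.2 - G.proj I')) := by
        simp only [cond, map_sub]; abel
      have h1 := G.norm_compl (I - I')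
      have h2 := G.lip a a' (y.2.2.2 - G.proj I) (y.2.2.2 - G.proj I')
      have h3 := G.norm_proj (I' - I)
      rw [sub_sub_sub_cancel_left, ← map_sub] at h2
      rw [norm_sub_rev I' I] at h3
      rw [e]
      refine (norm_add_le _ _).trans ?_
      linarith
    La_nonneg := G.La_nonneg
    ρ_pos := hρ.choose_spec.1
    ρ_le := hρ.choose_spec.2.1
    ρ_small := hρ.choose_spec.2.2 }

/-- Prescribed third coordinate at the exit. -/
def exit : ExitGraph EA EC EC n where
  c₀ := 0
  incl := .id ℝ EC
  proj := .id ℝ EC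
  h := fun _ => 0
  La := 0
  smooth := contDiff_const
  La_nonneg := le_rfl
  norm_proj := fun I => le_rfl
  norm_compl := fun I => by simp
  lip := fun a a' w w' => by simp

/-- Prescribed third coordinate at the entry. -/
def entry : ExitGraph EA EC EC n where
  c₀ := 0
  incl := .id ℝ EC
  proj := 0
  h := fun _ => 0
  La := 0
  smooth := contDiff_const
  La_nonneg := le_rfl
  norm_proj := fun I => by simp
  norm_compl := fun I => by simp
  lip := fun a a' w w' => by simp

theorem exit_cond (u : (EA × EB × ℝ × EC) × EA × EC) :
    (exit (EA := EA) (n := n)).cond u = u.1.2.2.2 := by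
  simp [cond, exit]

theorem entry_cond (u : (EA × EB × ℝ × EC) × EA × EC) :
    (entry (EA := EA) (n := n)).cond u = u.1.2.2.2 + u.2.2 := by
  simp [cond, entry]

/-- The condition that the entry point lies on the graph. -/
def Mem (G : ExitGraph EA EC F n) (a : EA) (c : EC) : Prop :=
  c = G.c₀ + G.incl (G.proj (c - G.c₀)) + G.h (a, G.proj (c - G.c₀))

variable {G : ExitGraph EA EC F n} {y : EA × EB × ℝ × F} {a : EA} {c c' : EC}

theorem eq_cond_of_mem (h : G.Mem a c) (hv : y.2.2.2 = G.proj (c' - G.c₀)) :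
    c' = G.cond (y, a, c' - c) := by
  have e : G.proj (c' - G.c₀) - G.proj (c' - c) = G.proj (c - G.c₀) := by
    rw [← map_sub]; congr 1; abel
  have e' : G.incl (G.proj (c' - G.c₀)) - G.incl (G.proj (c' - c)) =
      G.incl (G.proj (c - G.c₀)) := by rw [← map_sub, e]
  simp only [cond, hv]
  rw [e]
  have h' : c = _ := h
  linear_combination (norm := module) h' - e'

theorem of_eq_cond (hπ : ∀ w, G.proj (G.incl w) = w) (hh : ∀ x, G.proj (G.h x) = 0)
    (h : c' = G.cond (y, a, c' - c)) : G.Mem a c ∧ y.2.2.2 = G.proj (c' - G.c₀) := by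
  have h1 : c = G.c₀ + G.incl (y.2.2.2 - G.proj (c' - c)) + G.h (a, y.2.2.2 - G.proj (c' - c)) := by
    have h2 : c = c' - (c' - c) := by abel
    rw [h2]
    nth_rewrite 1 [h]
    simp only [cond, sub_sub_cancel, map_sub]
    abel
  have h3 : G.proj (c - G.c₀) = y.2.2.2 - G.proj (c' - c) := by
    rw [h1]
    nth_rewrite 1 [add_assoc]
    rw [add_sub_cancel_left, map_add, hπ, hh, add_zero, ← h1]
  refine ⟨by rwa [Mem, h3], ?_⟩
  rw [map_sub, map_sub] at h3
  rw [map_sub]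
  linear_combination (norm := module) -h3

end ExitGraph

namespace FenichelSystem

variable {k m l : ℕ} {S : FenichelSystem (k + 1) m l} {V : Set (EuclideanSpace ℝ (Fin l))}
  {δ₀ δ : ℝ}

namespace Reduction

variable {H : S.Reduction V δ₀} {z₀ : EuclideanSpace ℝ (Fin l)} {hz : z₀ ∈ V}
  {Y : Type} [NormedAddCommGroup Y] [NormedSpace ℝ Y] [CompleteSpace Y]
  {D : CornerData (EuclideanSpace ℝ (Fin (k + 1))) (EuclideanSpace ℝ (Fin m))
    (EuclideanSpace ℝ (Fin l)) Y (H.corner hz).n (H.corner hz).μ (H.corner hz).K} {y : Y}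

theorem isOpen_cornerBox (hV : IsOpen V) : IsOpen (cornerBox k m δ V) :=
  Metric.isOpen_ball.prod (Metric.isOpen_ball.prod hV)

theorem continuousOn_phys : ContinuousOn (fun x : Y × UnitSquare => (H.corner hz).phys D x.1 x.2)
    (((H.corner hz).problem D).O ×ˢ univ) := by
  have h1 : ContinuousOn (fun x : Y × UnitSquare => ((H.corner hz).phys D x.1, x.2))
      (((H.corner hz).problem D).O ×ˢ univ) :=
    (((H.corner hz).contDiffOn_phys D).continuousOn.comp continuousOn_fst fun x hx => hx.1).prodMk
      continuousOn_snd
  exact continuous_eval.comp_continuousOn h1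

theorem continuousAt_phys (hy : y ∈ ((H.corner hz).problem D).O) (p : UnitSquare) :
    ContinuousAt (fun x : Y × UnitSquare => (H.corner hz).phys D x.1 x.2) (y, p) :=
  continuousOn_phys.continuousAt
    ((((H.corner hz).problem D).isOpen_O.prod isOpen_univ).mem_nhds ⟨hy, mem_univ _⟩)

/-- Solutions near a good one stay good, also on nearby hyperbolas. -/
theorem eventually_good {Z : Set (PhaseSpace (k + 1) m l)} (hZ : IsOpen Z)
    (hy : y ∈ ((H.corner hz).problem D).O)
    (hgood : ∀ p : UnitSquare, (p.1 : ℝ) * p.2 = 0 →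
      (H.corner hz).Good D y p ∧ (H.corner hz).phys D y p ∈ Z) :
    ∃ e₁ : ℝ, 0 < e₁ ∧ ∀ᶠ y' in 𝓝 y, y' ∈ ((H.corner hz).problem D).O ∧
      ∀ p : UnitSquare, (p.1 : ℝ) * p.2 ≤ e₁ →
        (H.corner hz).Good D y' p ∧ (H.corner hz).phys D y' p ∈ Z := by
  set O := ((H.corner hz).problem D).O with hO
  have hOo : IsOpen (O ×ˢ (univ : Set UnitSquare)) := ((H.corner hz).problem D).isOpen_O.prod isOpen_univ
  let G : Set (Y × UnitSquare) := {x | x ∈ O ×ˢ univ ∧ (H.corner hz).Good D x.1 x.2 ∧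
    (H.corner hz).phys D x.1 x.2 ∈ Z}
  have hsol : ContinuousOn (fun x : Y × UnitSquare => (((H.corner hz).problem D).sol x.1, x.2))
      (O ×ˢ univ) :=
    (((H.corner hz).problem D).contDiffOn_sol.continuousOn.comp continuousOn_fst
      fun x hx => hx.1).prodMk continuousOn_snd
  have h1 : ContinuousOn (fun x : Y × UnitSquare => (((H.corner hz).problem D).sol x.1).1 x.2)
      (O ×ˢ univ) :=
    continuous_eval.comp_continuousOn ((continuous_fst.comp_continuousOn
      (continuous_fst.comp_continuousOn hsol)).prodMk continuousOn_snd)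
  have h2 : ContinuousOn (fun x : Y × UnitSquare => (((H.corner hz).problem D).sol x.1).2.1 x.2)
      (O ×ˢ univ) :=
    continuous_eval.comp_continuousOn (((continuous_fst.comp continuous_snd).comp_continuousOn
      (continuous_fst.comp_continuousOn hsol)).prodMk continuousOn_snd)
  have h3 : ContinuousOn (fun x : Y × UnitSquare => (((H.corner hz).problem D).sol x.1).2.2 x.2)
      (O ×ˢ univ) :=
    continuous_eval.comp_continuousOn (((continuous_snd.comp continuous_snd).comp_continuousOn
      (continuous_fst.comp_continuousOn hsol)).prodMk continuousOn_snd)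
  have hGo : IsOpen G := by
    rw [isOpen_iff_mem_nhds]
    rintro x ⟨hx, ⟨g1, g2, g3⟩, hxZ⟩
    have hn := hOo.mem_nhds hx
    filter_upwards [hn, (h1.continuousAt hn).norm.eventually_lt continuousAt_const g1,
      (h2.continuousAt hn).norm.eventually_lt continuousAt_const g2,
      (h3.continuousAt hn).norm.eventually_lt continuousAt_const g3,
      (continuousOn_phys.continuousAt hn).eventually_mem (hZ.mem_nhds hxZ)] with x' e1 e2 e3 e4 e5
    exact ⟨e1, ⟨e2, e3, e4⟩, e5⟩
  have hf : Continuous fun p : UnitSquare => (p.1 : ℝ) * p.2 := by fun_prop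
  have hK : IsCompact {p : UnitSquare | (p.1 : ℝ) * p.2 = 0} := (CornerField.isClosed_hyperbola 0).isCompact
  -- The degenerate hyperbola is compact, so goodness on it extends to a product neighbourhood.
  obtain ⟨u, v, hu, hv, hyu, hHv, huv⟩ := generalized_tube_lemma (isCompact_singleton (x := y)) hK hGo
    (by rintro ⟨y', p⟩ ⟨rfl, hp⟩; exact ⟨⟨hy, mem_univ _⟩, hgood p hp⟩)
  -- On the compact complement of v the product ξη has a positive minimum. Hence v contains all
  -- hyperbolas with small e.
  obtain ⟨e₁, he₁, hv₁⟩ : ∃ e₁ : ℝ, 0 < e₁ ∧ ∀ p : UnitSquare, (p.1 : ℝ) * p.2 ≤ e₁ → p ∈ v := by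
    rcases (vᶜ : Set UnitSquare).eq_empty_or_nonempty with h0 | hne
    · exact ⟨1, one_pos, fun p _ => by rw [compl_empty_iff.1 h0]; trivial⟩
    · obtain ⟨p₀, hp₀, hmin⟩ := hv.isClosed_compl.isCompact.exists_isMinOn hne hf.continuousOn
      have hpos : 0 < (p₀.1 : ℝ) * p₀.2 := lt_of_le_of_ne (mul_nonneg p₀.1.2.1 p₀.2.2.1)
        fun h => hp₀ (hHv h.symm)
      refine ⟨(p₀.1 : ℝ) * p₀.2 / 2, by positivity, fun p hp => ?_⟩
      by_contra hpv
      have := hmin hpv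
      simp only [mem_ofPred_eq] at this
      linarith
  refine ⟨e₁, he₁, ?_⟩
  filter_upwards [hu.mem_nhds (hyu rfl)] with y' hy'
  have hm : ∀ p : UnitSquare, (p.1 : ℝ) * p.2 ≤ e₁ → (y', p) ∈ G := fun p hp => huv ⟨hy', hv₁ p hp⟩
  exact ⟨(hm (0, 0) (by simpa using he₁.le)).1.1, fun p hp => (hm p hp).2⟩

/-- The last expanding coordinate grows exponentially. -/
theorem last_growth {x : ℝ → PhaseSpace (k + 1) m l} {g T : ℝ} (hT : 0 ≤ T)
    (hx : ∀ t ∈ Icc 0 T, x t ∈ cornerBox (k + 1) m δ₀ V ∧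
      HasDerivWithinAt x (g • H.vf (x t)) (Icc 0 T) t) :
    (x T).1 (Fin.last k) = Real.exp (g * T) * (x 0).1 (Fin.last k) := by
  have hd : ∀ t ∈ Icc 0 T, HasDerivWithinAt (fun t => Real.exp (-(g * t)) * (x t).1 (Fin.last k)) 0
      (Icc 0 T) t := by
    intro t ht
    have h1 := (hx t ht).2.hasFDerivWithinAt.fst.hasDerivWithinAt
    have h2 : HasDerivWithinAt (fun t => (x t).1 (Fin.last k)) (g * (x t).1 (Fin.last k)) (Icc 0 T) t := by
      have h3 := ((EuclideanSpace.proj (𝕜 := ℝ) (Fin.last k)).hasFDerivAt.comp_hasDerivWithinAt t h1)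
      refine h3.congr_deriv ?_
      have := H.last_eq _ (hx t ht).1
      simp [vf, coeffField, this]
    have h4 : HasDerivWithinAt (fun t => Real.exp (-(g * t))) (Real.exp (-(g * t)) * -(g * 1)) (Icc 0 T) t :=
      (((hasDerivAt_id t).const_mul g).neg.exp).hasDerivWithinAt
    exact (h4.mul h2).congr_deriv (by ring)
  have := constant_of_has_deriv_right_zero (fun t ht => (hd t ht).continuousWithinAt)
    (fun t ht => (hd t ⟨ht.1, ht.2.le⟩).mono_of_mem_nhdsWithin
      (mem_of_superset (Icc_mem_nhdsGE_of_mem ⟨le_rfl, ht.2⟩) (Icc_subset_Icc_left ht.1))) T ⟨hT, le_rfl⟩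
  simp only [mul_zero, neg_zero, Real.exp_zero, one_mul] at this
  rw [← this, ← mul_assoc, ← Real.exp_add]
  simp

end Reduction

end FenichelSystem

end

/-! ### The solution map of a graph condition, fiber projections and entry points -/

noncomputable section

theorem exists_pos_of_mem_nhds_zero {B : Set unitInterval} (hB : B ∈ 𝓝 0) :
    ∃ e₁ : ℝ, 0 < e₁ ∧ ∀ e : unitInterval, (e : ℝ) < e₁ → e ∈ B := by
  obtain ⟨e₁, he₁, h⟩ := Metric.mem_nhds_iff.1 hB
  refine ⟨e₁, he₁, fun e he => h ?_⟩
  rw [Metric.mem_ball, Subtype.dist_eq]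
  show dist (e : ℝ) 0 < e₁
  rwa [dist_zero_right, Real.norm_of_nonneg e.2.1]

theorem ContinuousAt.exists_nhds_prod {X X₁ X₂ X₃ Z : Type} [TopologicalSpace X] [TopologicalSpace X₁]
    [TopologicalSpace X₂] [TopologicalSpace X₃] [TopologicalSpace Z] {f : (X × X₁) × X₂ × X₃ → Z} {x : X}
    {x₁ : X₁} {x₂ : X₂} {x₃ : X₃} (hf : ContinuousAt f ((x, x₁), (x₂, x₃))) {N : Set Z}
    (hN : N ∈ 𝓝 (f ((x, x₁), (x₂, x₃)))) : ∃ A ∈ 𝓝 x, ∃ A₁ ∈ 𝓝 x₁, ∃ A₃ ∈ 𝓝 x₃,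
      ∀ y ∈ A, ∀ y₁ ∈ A₁, ∀ y₃ ∈ A₃, f ((y, y₁), (x₂, y₃)) ∈ N := by
  obtain ⟨A, hA, B, hB, hAB⟩ := mem_nhds_prod_iff.1 (hf hN)
  obtain ⟨A₁, hA₁, A₂, hA₂, hA₁₂⟩ := mem_nhds_prod_iff.1 hA
  obtain ⟨B₁, hB₁, B₂, hB₂, hB₁₂⟩ := mem_nhds_prod_iff.1 hB
  exact ⟨A₁, hA₁, A₂, hA₂, B₂, hB₂, fun y hy y₁ hy₁ y₃ hy₃ =>
    hAB ⟨hA₁₂ ⟨hy, hy₁⟩, hB₁₂ ⟨mem_of_mem_nhds hB₁, hy₃⟩⟩⟩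

namespace FenichelSystem

variable {k m l : ℕ} {S : FenichelSystem (k + 1) m l} {V : Set (EuclideanSpace ℝ (Fin l))}
  {δ₀ δ : ℝ}

namespace Reduction

variable {H : S.Reduction V δ₀} {z₀ : EuclideanSpace ℝ (Fin l)} {hz : z₀ ∈ V}
  {F : Type} [NormedAddCommGroup F] [NormedSpace ℝ F] [CompleteSpace F]
  {G : ExitGraph (EuclideanSpace ℝ (Fin (k + 1))) (EuclideanSpace ℝ (Fin l)) F H.n}
  {y : EuclideanSpace ℝ (Fin (k + 1)) × EuclideanSpace ℝ (Fin m) × ℝ × F}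
  {p q z : PhaseSpace (k + 1) m l}

/-- The solution of the corner problem given by a graph. -/
def psi (H : S.Reduction V δ₀) (hz : z₀ ∈ V)
    (G : ExitGraph (EuclideanSpace ℝ (Fin (k + 1))) (EuclideanSpace ℝ (Fin l)) F H.n)
    (y : EuclideanSpace ℝ (Fin (k + 1)) × EuclideanSpace ℝ (Fin m) × ℝ × F) :
    C(UnitSquare, PhaseSpace (k + 1) m l) :=
  (H.corner hz).phys (G.data (H.corner hz) rfl) y

theorem mem_O (hs : |y.2.2.1| < H.ϱ) :
    y ∈ ((H.corner hz).problem (G.data (H.corner hz) rfl)).O := hs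

theorem contDiffOn_psi : ContDiffOn ℝ H.n (H.psi hz G : EuclideanSpace ℝ (Fin (k + 1)) ×
    EuclideanSpace ℝ (Fin m) × ℝ × F → _) {y | |y.2.2.1| < H.ϱ} :=
  (H.corner hz).contDiffOn_phys (G.data (H.corner hz) rfl)

theorem continuousAt_psi (hs : |y.2.2.1| < H.ϱ) (p : UnitSquare) : ContinuousAt
    (fun x : (EuclideanSpace ℝ (Fin (k + 1)) × EuclideanSpace ℝ (Fin m) × ℝ × F) × UnitSquare =>
      H.psi hz G x.1 x.2) (y, p) :=
  continuousAt_phys (mem_O hs) p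

theorem psi_exit_fst (hs : |y.2.2.1| < H.ϱ) {p : UnitSquare} (hp : (p.2 : ℝ) = 1) :
    (H.psi hz G y p).1 = y.1 := phys_exit_fst (mem_O hs) hp

theorem psi_entry_snd (hs : |y.2.2.1| < H.ϱ) {p : UnitSquare} (hp : (p.1 : ℝ) = 1) :
    (H.psi hz G y p).2.1 = y.2.1 := phys_entry_snd (mem_O hs) hp

/-- A bound for the hyperbolas on which the graph condition holds without cutoff. -/
def radius (H : S.Reduction V δ₀) (hz : z₀ ∈ V)
    (G : ExitGraph (EuclideanSpace ℝ (Fin (k + 1))) (EuclideanSpace ℝ (Fin l)) F H.n) : ℝ :=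
  (G.data (EB := EuclideanSpace ℝ (Fin m)) (H.corner hz) rfl).ρ

theorem radius_pos : 0 < H.radius hz G :=
  (G.data (EB := EuclideanSpace ℝ (Fin m)) (H.corner hz) rfl).ρ_pos

theorem psi_cond (hs : |y.2.2.1| < H.ϱ) {e : unitInterval} (he : (e : ℝ) ≤ H.radius hz G) :
    (H.psi hz G y (e, 1)).2.2 = G.cond (y, (H.psi hz G y (1, e)).1,
      (H.psi hz G y (e, 1)).2.2 - (H.psi hz G y (1, e)).2.2) := by
  have := phys_exit_cond (p := (1, e)) (mem_O (hz := hz) (G := G) hs) (by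
    show ((1 : unitInterval) : ℝ) * e ≤ _
    rw [Set.Icc.coe_one, one_mul]; exact he)
  have h1 : exitPt (1, e) = (e, 1) := by ext <;> simp [exitPt]
  have h2 : entryPt (1, e) = (1, e) := by ext <;> simp [entryPt]
  rw [h1, h2] at this
  exact this

theorem stableProj_fst (H : S.Reduction V δ₀) (hδ : δ ≤ δ₀)
    (h : S.StableProj (cornerBox (k + 1) m δ V) p z) : p.1 = 0 := by
  obtain ⟨-, -, -, x, hx, rfl, hlim⟩ := h
  obtain ⟨X, hX0, -, hX⟩ := exists_isOrbit_Ici (H := H) hδ hx hlim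
  rw [← hX0]
  exact (hX.mono (cornerBox_mono hδ V) Subset.rfl).fst_eq_zero le_rfl

theorem unstableProj_dist (H : S.Reduction V δ₀) (hδ : δ ≤ δ₀)
    (h : S.UnstableProj (cornerBox (k + 1) m δ V) q z) : ‖q.2.2 - z.2.2‖ ≤ H.ϱ / 8 := by
  obtain ⟨-, -, -, x, hx, rfl, hlim⟩ := h
  obtain ⟨X, hX0, hXl, hX⟩ := exists_isOrbit_Iic (H := H) hδ hx hlim
  rw [← hX0]
  exact (hX.mono (cornerBox_mono hδ V) Subset.rfl).dist_limit_Iic hXl le_rfl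

theorem psi_eq_of_proj (hδ : δ ≤ δ₀) (hs : |y.2.2.1| < H.ϱ)
    (hp : S.StableProj (cornerBox (k + 1) m δ V) p z)
    (hq : S.UnstableProj (cornerBox (k + 1) m δ V) q z) (hc : ‖z.2.2 - z₀‖ ≤ 3 * H.ϱ / 8)
    (hA : q.1 = y.1) (hB : p.2.1 = y.2.1) (hC : q.2.2 = G.cond (y, 0, q.2.2 - p.2.2)) :
    (∀ r : UnitSquare, (r.1 : ℝ) * r.2 = 0 →
      (H.corner hz).Good (G.data (H.corner hz) rfl) y r ∧
      H.psi hz G y r ∈ cornerBox (k + 1) m δ V) ∧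
    H.psi hz G y (1, 0) = p ∧ H.psi hz G y (0, 1) = q ∧ H.psi hz G y (0, 0) = z := by
  obtain ⟨hzB, h1, h2, x, hx, rfl, hlim⟩ := hp
  obtain ⟨-, -, -, x', hx', rfl, hlim'⟩ := hq
  obtain ⟨X, hX0, hXl, hX⟩ := exists_isOrbit_Ici (H := H) hδ hx hlim
  obtain ⟨X', hX0', hXl', hX'⟩ := exists_isOrbit_Iic (H := H) hδ hx' hlim'
  rw [← hX0'] at hA hC ⊢
  rw [← hX0] at hB hC ⊢
  exact phys_eq_of_fibers (mem_O (hz := hz) (G := G) hs) hδ hX hXl hX' hXl' hzB h1 h2 hc hA hB hC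

theorem exists_isOrbit_of_flowsTo (H : S.Reduction V δ₀) (hδ : δ ≤ δ₀) {T : ℝ}
    (h : S.FlowsTo (cornerBox (k + 1) m δ V) p T q) :
    ∃ (T' : ℝ) (X : ℝ → PhaseSpace (k + 1) m l), 0 ≤ T' ∧ H.rate₁ * T ≤ T' ∧ T' ≤ H.rate₂ * T ∧
      X 0 = p ∧ X T' = q ∧ H.IsOrbit (cornerBox (k + 1) m δ₀ V) X (Icc 0 T') ∧
      q.1 (Fin.last k) = Real.exp T' * p.1 (Fin.last k) := by
  obtain ⟨hT, x, hx, rfl, rfl⟩ := h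
  obtain ⟨T', X, h1, h2, h3, h4, h5⟩ := exists_isOrbit_Icc (H := H) hδ hT hx
  have hT' : 0 ≤ T' := (mul_nonneg H.rate₁_pos.le hT).trans h1
  have h6 := h5.mono (cornerBox_mono hδ V) Subset.rfl
  refine ⟨T', X, hT', h1, h2, h3, h4, h6, ?_⟩
  have := last_growth (H := H) (g := 1) hT' fun t ht => ⟨(h6 t ht).1, by
    rw [one_smul]; exact (h6 t ht).2⟩
  rwa [h3, h4, one_mul] at this

theorem psi_eq_of_flowsTo (hδ : δ ≤ δ₀) (hs : |y.2.2.1| < H.ϱ) {T α : ℝ} (hα : 0 < α)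
    (h : S.FlowsTo (cornerBox (k + 1) m δ V) p T q) {e : unitInterval} (he0 : 0 < (e : ℝ))
    (he : e * α = p.1 (Fin.last k)) (he2 : (e : ℝ) ≤ Real.exp (-2))
    (heρ : (e : ℝ) ≤ H.radius hz G) (hc : ‖q.2.2 - z₀‖ ≤ 3 * H.ϱ / 8)
    (hA : q.1 = y.1) (hB : p.2.1 = y.2.1) (hy : y.2.2.1 = Real.log (q.1 (Fin.last k) / α))
    (hC : q.2.2 = G.cond (y, p.1, q.2.2 - p.2.2)) :
    H.psi hz G y (1, e) = p ∧ H.psi hz G y (e, 1) = q := by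
  obtain ⟨T', X, hT', -, -, hp, hq, hX, hgrow⟩ := H.exists_isOrbit_of_flowsTo hδ h
  set L := -Real.log e with hL
  have hL2 : 2 ≤ L := by
    have := (Real.log_le_iff_le_exp he0).2 he2
    linarith
  have hexp : Real.exp (-L) = e := by rw [hL, neg_neg, Real.exp_log he0]
  -- The last coordinate is eα at the entry and αe^s at the exit, and it grows like e^t. The transit
  -- time is therefore -log e + s.
  have hT : T' = L + y.2.2.1 := by
    rw [hy, hgrow, ← he, ← mul_assoc, mul_div_cancel_right₀ _ hα.ne',
      Real.log_mul (Real.exp_pos _).ne' he0.ne', Real.log_exp]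
    ring
  have key := fun r : UnitSquare => phys_eq_of_isOrbit (hz := hz) (p := r) (X := X) (T := T')
    (mem_O (hz := hz) (G := G) hs) hL2 hT
    (by rw [hexp]; exact heρ) hX (by rw [hq]; exact hc) (by rw [hq]; exact hA)
    (by rw [hp]; exact hB) (by rw [hp, hq]; exact hC)
  refine ⟨?_, ?_⟩
  · have := (key (1, e) (by rw [hexp]; simp)).1
    rw [← hp]
    refine this.trans ?_
    simp
  · have := (key (e, 1) (by rw [hexp]; simp)).1
    rw [← hq]
    refine this.trans ?_
    congr 1
    rw [← hL, hT]
    have : (G.data (EB := EuclideanSpace ℝ (Fin m)) (H.corner hz) rfl).s y = y.2.2.1 := rfl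
    rw [this]
    field_simp

theorem isOrbit_const (H : S.Reduction V δ₀) {Z : Set (PhaseSpace (k + 1) m l)} {J : Set ℝ}
    (hzZ : z ∈ Z) (h1 : z.1 = 0) (h2 : z.2.1 = 0) : H.IsOrbit Z (fun _ => z) J := fun t _ =>
  ⟨hzZ, by rw [H.vf_eq_zero h1 h2]; exact hasDerivWithinAt_const _ _ _⟩

/-- The equilibrium itself solves the problem with a = b = 0 and s = 0. Goodness of this constant
solution is an open property of the data. -/
theorem psi_const_good (H : S.Reduction V δ₀) (hz : z₀ ∈ V) (hδ0 : 0 < δ) (hδ : δ ≤ δ₀)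
    {G : ExitGraph (EuclideanSpace ℝ (Fin (k + 1))) (EuclideanSpace ℝ (Fin l)) F H.n}
    {v : F} (hC : z₀ = G.cond (((0, 0, 0, v) : EuclideanSpace ℝ (Fin (k + 1)) ×
      EuclideanSpace ℝ (Fin m) × ℝ × F), 0, 0)) (hV : IsOpen V) :
    ∀ᶠ y in 𝓝 ((0, 0, 0, v) : EuclideanSpace ℝ (Fin (k + 1)) × EuclideanSpace ℝ (Fin m) × ℝ × F),
      |y.2.2.1| < H.ϱ ∧ ∀ r : UnitSquare, (r.1 : ℝ) * r.2 = 0 →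
        (H.corner hz).Good (G.data (H.corner hz) rfl) y r ∧
        H.psi hz G y r ∈ cornerBox (k + 1) m δ V := by
  have hϱ := H.ϱ_pos
  have hzB : ((0, 0, z₀) : PhaseSpace (k + 1) m l) ∈ cornerBox (k + 1) m δ V :=
    ⟨Metric.mem_ball_self hδ0, Metric.mem_ball_self hδ0, hz⟩
  have hs : |((0, 0, 0, v) : EuclideanSpace ℝ (Fin (k + 1)) × EuclideanSpace ℝ (Fin m) ×
      ℝ × F).2.2.1| < H.ϱ := by simpa using hϱ
  have h1 := phys_eq_of_fibers (mem_O (hz := hz) (G := G) hs) hδ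
    (H.isOrbit_const (J := Ici 0) hzB rfl rfl) tendsto_const_nhds
    (H.isOrbit_const (J := Iic 0) hzB rfl rfl) tendsto_const_nhds hzB rfl rfl
    (by rw [sub_self, norm_zero]; positivity) rfl rfl (by rw [sub_self]; exact hC)
  obtain ⟨e₁, he₁, hev⟩ := eventually_good (isOpen_cornerBox hV) (mem_O (hz := hz) (G := G) hs) h1.1
  filter_upwards [hev] with y hy
  exact ⟨hy.1, fun r hr => hy.2 r (hr.le.trans he₁.le)⟩

/-- Prescribing b and c at the entry and a = 0 at the exit, the restriction of the solution to the
axis η = 0 is the stable fiber through (0, b, c). For unstable fibers c is prescribed at the exit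
instead. -/
theorem eventually_stableProj (H : S.Reduction V δ₀) (hz : z₀ ∈ V) (hδ0 : 0 < δ) (hδ : δ ≤ δ₀)
    (hV : IsOpen V) : ∀ᶠ x in 𝓝 ((0, z₀) : EuclideanSpace ℝ (Fin m) × EuclideanSpace ℝ (Fin l)),
      ∃ z, S.StableProj (cornerBox (k + 1) m δ V) (0, x.1, x.2) z := by
  have h := H.psi_const_good hz hδ0 hδ (G := .entry) (v := z₀) (m := m) (by simp [ExitGraph.entry_cond]) hV
  have hc : Continuous fun x : EuclideanSpace ℝ (Fin m) × EuclideanSpace ℝ (Fin l) =>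
    ((0, x.1, 0, x.2) : EuclideanSpace ℝ (Fin (k + 1)) × EuclideanSpace ℝ (Fin m) × ℝ ×
      EuclideanSpace ℝ (Fin l)) := by fun_prop
  filter_upwards [(hc.tendsto (0, z₀)).eventually h] with x hx
  obtain ⟨hs, hg⟩ := hx
  have h1 := stableProj_phys hδ (mem_O (hz := hz) (G := .entry) hs) fun r hr =>
    hg r (by rw [hr, mul_zero])
  have h2 : H.psi hz .entry (0, x.1, 0, x.2) (1, 0) = (0, x.1, x.2) := by
    refine Prod.ext ?_ (Prod.ext ?_ ?_)
    · exact phys_zero_fst rfl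
    · exact psi_entry_snd hs rfl
    · have := psi_cond (hz := hz) (G := .entry) (y := (0, x.1, 0, x.2)) hs (e := 0) radius_pos.le
      rw [ExitGraph.entry_cond] at this
      simp only at this ⊢
      linear_combination (norm := module) this
  rw [← h2]
  exact ⟨_, h1⟩

theorem eventually_unstableProj (H : S.Reduction V δ₀) (hz : z₀ ∈ V) (hδ0 : 0 < δ) (hδ : δ ≤ δ₀)
    (hV : IsOpen V) :
    ∀ᶠ x in 𝓝 ((0, z₀) : EuclideanSpace ℝ (Fin (k + 1)) × EuclideanSpace ℝ (Fin l)),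
      ∃ z, S.UnstableProj (cornerBox (k + 1) m δ V) (x.1, 0, x.2) z := by
  have h := H.psi_const_good hz hδ0 hδ (G := .exit) (v := z₀) (m := m) (by simp [ExitGraph.exit_cond]) hV
  have hc : Continuous fun x : EuclideanSpace ℝ (Fin (k + 1)) × EuclideanSpace ℝ (Fin l) =>
    ((x.1, 0, 0, x.2) : EuclideanSpace ℝ (Fin (k + 1)) × EuclideanSpace ℝ (Fin m) × ℝ ×
      EuclideanSpace ℝ (Fin l)) := by fun_prop
  filter_upwards [(hc.tendsto (0, z₀)).eventually h] with x hx
  obtain ⟨hs, hg⟩ := hx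
  have h1 := unstableProj_phys hδ (mem_O (hz := hz) (G := .exit) hs) fun r hr =>
    hg r (by rw [hr, zero_mul])
  have h2 : H.psi hz .exit (x.1, 0, 0, x.2) (0, 1) = (x.1, 0, x.2) := by
    refine Prod.ext ?_ (Prod.ext ?_ ?_)
    · exact psi_exit_fst hs rfl
    · exact phys_zero_snd rfl
    · have := psi_cond (hz := hz) (G := .exit) (y := (x.1, 0, 0, x.2)) hs (e := 0) radius_pos.le
      rwa [ExitGraph.exit_cond] at this
  rw [← h2]
  exact ⟨_, h1⟩

/-- The fiber projections exist near compact sets of equilibria. -/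
theorem exists_fibers (H : S.Reduction V δ₀) (hδ0 : 0 < δ) (hδ : δ ≤ δ₀) (hV : IsOpen V)
    {K : Set (EuclideanSpace ℝ (Fin l))} (hK : IsCompact K) (hKV : K ⊆ V) :
    ∃ η : ℝ, 0 < η ∧ ∀ c ∈ K,
      (∀ b : EuclideanSpace ℝ (Fin m), ‖b‖ < η →
        ∃ z, S.StableProj (cornerBox (k + 1) m δ V) (0, b, c) z) ∧
      (∀ a : EuclideanSpace ℝ (Fin (k + 1)), ‖a‖ < η →
        ∃ z, S.UnstableProj (cornerBox (k + 1) m δ V) (a, 0, c) z) := by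
  have h1 := hK.eventually_forall_of_forall_eventually (x₀ := (0 : EuclideanSpace ℝ (Fin m)))
    (P := fun b c => ∃ z, S.StableProj (cornerBox (k + 1) m δ V) (0, b, c) z)
    fun c hc => H.eventually_stableProj (hKV hc) hδ0 hδ hV
  have h2 := hK.eventually_forall_of_forall_eventually (x₀ := (0 : EuclideanSpace ℝ (Fin (k + 1))))
    (P := fun a c => ∃ z, S.UnstableProj (cornerBox (k + 1) m δ V) (a, 0, c) z)
    fun c hc => H.eventually_unstableProj (hKV hc) hδ0 hδ hV
  obtain ⟨η₁, hη₁, h1⟩ := Metric.eventually_nhds_iff.1 h1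
  obtain ⟨η₂, hη₂, h2⟩ := Metric.eventually_nhds_iff.1 h2
  refine ⟨min η₁ η₂, lt_min hη₁ hη₂, fun c hc => ⟨fun b hb => h1 ?_ c hc, fun a ha => h2 ?_ c hc⟩⟩
  · rw [dist_zero_right]; exact hb.trans_le (min_le_left _ _)
  · rw [dist_zero_right]; exact ha.trans_le (min_le_right _ _)

/-- Entry points depend continuously on exit points, uniformly in the transit time. -/
theorem exists_entry_near (H : S.Reduction V δ₀) (hδ : δ ≤ δ₀)
    (hp : S.StableProj (cornerBox (k + 1) m δ V) p z)
    (hq : S.UnstableProj (cornerBox (k + 1) m δ V) q z) (hα : 0 < q.1 (Fin.last k))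
    {N : Set (PhaseSpace (k + 1) m l)} (hN : N ∈ 𝓝 p) :
    ∃ N' ∈ 𝓝 q, ∃ ε₁ : ℝ, 0 < ε₁ ∧
      (∀ q' ∈ N', ∀ p' z', S.StableProj (cornerBox (k + 1) m δ V) p' z' →
        S.UnstableProj (cornerBox (k + 1) m δ V) q' z' → p'.2.1 = p.2.1 → p' ∈ N) ∧
      ∀ ε, 0 < ε → ε < ε₁ → ∀ q' ∈ N', ∀ p' T, S.FlowsTo (cornerBox (k + 1) m δ V) p' T q' →
        p'.2.1 = p.2.1 → p'.1 (Fin.last k) = ε → p' ∈ N := by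
  have hϱ := H.ϱ_pos
  have hz : z.2.2 ∈ V := hp.1.2.2
  set α := q.1 (Fin.last k) with hαdef
  -- The whole exit point is prescribed, together with the fixed b at the entry. Any passage, or
  -- pair of fibers, that ends at x is then given by the solution map, whose value at the entry is
  -- continuous in x, s and e.
  let Y : PhaseSpace (k + 1) m l × ℝ → EuclideanSpace ℝ (Fin (k + 1)) × EuclideanSpace ℝ (Fin m) ×
      ℝ × EuclideanSpace ℝ (Fin l) := fun x => (x.1.1, p.2.1, x.2, x.1.2.2)
  have hY : Continuous Y := by fun_prop
  have hs0 : |(Y (q, 0)).2.2.1| < H.ϱ := by simpa [Y] using hϱ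
  have hbase := (psi_eq_of_proj (hz := hz) (G := .exit) (y := Y (q, 0)) hδ hs0 hp hq
    (by rw [sub_self, norm_zero]; positivity) rfl rfl (by rw [ExitGraph.exit_cond])).2.1
  have hqd := H.unstableProj_dist hδ hq
  have hcont : ContinuousAt (fun x : (PhaseSpace (k + 1) m l × ℝ) × UnitSquare =>
      H.psi hz .exit (Y x.1) x.2) ((q, 0), (1, 0)) :=
    ContinuousAt.comp (x := ((q, 0), (1, 0)))
      (f := fun x : (PhaseSpace (k + 1) m l × ℝ) × UnitSquare => (Y x.1, x.2))
      (g := fun x => H.psi hz .exit x.1 x.2) (continuousAt_psi hs0 (1, 0)) (by fun_prop)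
  obtain ⟨A₁, hA₁, A₂, hA₂, B₂, hB₂, hmem⟩ := hcont.exists_nhds_prod
    (N := N) (show N ∈ 𝓝 (H.psi hz .exit (Y (q, 0)) (1, 0)) by rwa [hbase])
  have hlast : Continuous fun x : PhaseSpace (k + 1) m l => x.1 (Fin.last k) := by fun_prop
  have hlog : Tendsto (fun x : PhaseSpace (k + 1) m l => Real.log (x.1 (Fin.last k) / α)) (𝓝 q)
      (𝓝 0) := by
    have h1 : ContinuousAt (fun x : PhaseSpace (k + 1) m l => Real.log (x.1 (Fin.last k) / α)) q :=
      (hlast.continuousAt.div_const α).log (div_pos hα hα).ne'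
    have h2 : Real.log (q.1 (Fin.last k) / α) = 0 := by rw [← hαdef, div_self hα.ne', Real.log_one]
    rw [ContinuousAt, h2] at h1
    exact h1
  have hsmall : ∀ᶠ s in 𝓝 (0 : ℝ), |s| < H.ϱ := by
    have := Metric.ball_mem_nhds (0 : ℝ) hϱ
    filter_upwards [this] with s hs
    simpa using hs
  have hdist : ∀ᶠ x : PhaseSpace (k + 1) m l in 𝓝 q, ‖x.2.2 - q.2.2‖ < H.ϱ / 8 := by
    have h1 : Continuous fun x : PhaseSpace (k + 1) m l => ‖x.2.2 - q.2.2‖ := by fun_prop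
    exact h1.continuousAt.eventually_lt continuousAt_const (by rw [sub_self, norm_zero]; positivity)
  let N' : Set (PhaseSpace (k + 1) m l) := {x | x ∈ A₁ ∧ Real.log (x.1 (Fin.last k) / α) ∈ A₂ ∧
    |Real.log (x.1 (Fin.last k) / α)| < H.ϱ ∧ ‖x.2.2 - q.2.2‖ < H.ϱ / 8}
  have hN' : N' ∈ 𝓝 q := by
    filter_upwards [hA₁, hlog hA₂, hlog.eventually hsmall, hdist] with x h1 h2 h3 h4
    exact ⟨h1, h2, h3, h4⟩
  obtain ⟨e₁, he₁, he₁B⟩ := exists_pos_of_mem_nhds_zero hB₂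
  have hrad : 0 < H.radius hz .exit := radius_pos
  have hexp := Real.exp_pos (-2)
  refine ⟨N', hN', α * min e₁ (min (Real.exp (-2)) (min 1 (H.radius hz .exit))), by positivity, ?_, ?_⟩
  · intro q' hq' p' z' hp' hqz' hb
    have hd := H.unstableProj_dist hδ hqz'
    have := (psi_eq_of_proj (hz := hz) (G := .exit) (y := Y (q', 0)) hδ (by simpa [Y] using hϱ) hp' hqz'
      (by
        -- Each of the three distances is at most ϱ/8, which adds up to the permitted 3ϱ/8.
        have e : z'.2.2 - z.2.2 = -(q'.2.2 - z'.2.2) + ((q'.2.2 - q.2.2) + (q.2.2 - z.2.2)) := by abel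
        rw [e]
        refine (norm_add_le _ _).trans ?_
        have := norm_add_le (q'.2.2 - q.2.2) (q.2.2 - z.2.2)
        rw [norm_neg]
        linarith [hq'.2.2.2])
      rfl hb (by rw [ExitGraph.exit_cond])).2.1
    rw [← this]
    exact hmem q' hq'.1 0 (mem_of_mem_nhds hA₂) 0 (mem_of_mem_nhds hB₂)
  · intro ε hε hε₁ q' hq' p' T hT hb hpε
    have hlt : ε / α < min e₁ (min (Real.exp (-2)) (min 1 (H.radius hz .exit))) := by
      rw [div_lt_iff₀ hα, mul_comm]; exact hε₁
    simp only [lt_min_iff] at hlt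
    let e : unitInterval := ⟨ε / α, by positivity, hlt.2.2.1.le⟩
    have := (psi_eq_of_flowsTo (hz := hz) (G := .exit)
      (y := Y (q', Real.log (q'.1 (Fin.last k) / α))) hδ hq'.2.2.1 hα hT (e := e) (div_pos hε hα)
      (by rw [hpε]; exact div_mul_cancel₀ _ hα.ne') hlt.2.1.le hlt.2.2.2.le
      (by
        have e : q'.2.2 - z.2.2 = (q'.2.2 - q.2.2) + (q.2.2 - z.2.2) := by abel
        rw [e]
        refine (norm_add_le _ _).trans ?_
        linarith [hq'.2.2.2])
      rfl hb rfl (by rw [ExitGraph.exit_cond])).1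
    rw [← this]
    exact hmem q' hq'.1 _ hq'.2.1 e (he₁B e hlt.1)

end Reduction

end FenichelSystem

end

/-! ### Parametrization of the passage -/

noncomputable section

theorem ContinuousAt.exists_nhds_interval {X Z : Type} [TopologicalSpace X] [TopologicalSpace Z]
    {f : X × unitInterval → Z} {x : X} (hf : ContinuousAt f (x, 0)) {N : Set Z} (hN : N ∈ 𝓝 (f (x, 0))) :
    ∃ A ∈ 𝓝 x, ∃ e₁ : ℝ, 0 < e₁ ∧ ∀ y ∈ A, ∀ e : unitInterval, (e : ℝ) < e₁ → f (y, e) ∈ N := by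
  obtain ⟨A, hA, B, hB, hAB⟩ := mem_nhds_prod_iff.1 (hf hN)
  obtain ⟨e₁, he₁, h⟩ := exists_pos_of_mem_nhds_zero hB
  exact ⟨A, hA, e₁, he₁, fun y hy e he => hAB ⟨hy, h e he⟩⟩

/-- The exit coordinates attached to a graph. -/
def ExitGraph.chart {EA EB EC F : Type} [NormedAddCommGroup EA] [NormedSpace ℝ EA]
    [NormedAddCommGroup EC] [NormedSpace ℝ EC] [NormedAddCommGroup F] [NormedSpace ℝ F] {n : ℕ}
    (G : ExitGraph EA EC F n) (x : EA × EB × EC) : EA × F := (x.1, G.proj (x.2.2 - G.c₀))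

namespace FenichelSystem

variable {k m l : ℕ} {S : FenichelSystem (k + 1) m l} {V : Set (EuclideanSpace ℝ (Fin l))}
  {δ₀ δ : ℝ}

namespace Reduction

variable {H : S.Reduction V δ₀} {z₀ : EuclideanSpace ℝ (Fin l)} {hz : z₀ ∈ V}
  {F : Type} [NormedAddCommGroup F] [NormedSpace ℝ F] [CompleteSpace F]
  {G : ExitGraph (EuclideanSpace ℝ (Fin (k + 1))) (EuclideanSpace ℝ (Fin l)) F H.n}
  {y : EuclideanSpace ℝ (Fin (k + 1)) × EuclideanSpace ℝ (Fin m) × ℝ × F}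
  {p q z : PhaseSpace (k + 1) m l}

/-- Over the passage a_k grows by exp(L + s), and s is chosen such that the exit value is αe^s. The
entry value αe^{-L} = eα is therefore the same for all exit data, so a slice corresponds to a single
hyperbola. -/
theorem psi_entry_last (hs : |y.2.2.1| < H.ϱ) {e : unitInterval} (he0 : 0 < (e : ℝ))
    (he : (e : ℝ) ≤ Real.exp (-2)) (hgood : ∀ r : UnitSquare, (r.1 : ℝ) * r.2 = e →
      (H.corner hz).Good (G.data (H.corner hz) rfl) y r ∧
      H.psi hz G y r ∈ cornerBox (k + 1) m δ₀ V) {α : ℝ} (hα : 0 < α) (hy : 0 < y.1 (Fin.last k))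
    (hys : y.2.2.1 = Real.log (y.1 (Fin.last k) / α)) :
    (H.psi hz G y (1, e)).1 (Fin.last k) = e * α := by
  set L := -Real.log e with hL
  have hL2 : 2 ≤ L := by
    have := (Real.log_le_iff_le_exp he0).2 he
    linarith
  have hexp : Real.exp (-L) = e := by rw [hL, neg_neg, Real.exp_log he0]
  have hh : (((1, e) : UnitSquare).2 : ℝ) * Real.exp L ≤ 1 := by
    show (e : ℝ) * _ ≤ 1
    rw [← hexp, ← Real.exp_add]; simp
  have hmul : ∀ r ∈ Icc 0 L, ((flow r (1, e)).1 : ℝ) * (flow r (1, e)).2 = e := fun r hr => by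
    rw [flow_mul hr.1 (le_one_of_le hh hr.2)]; simp
  have h1 := last_growth (H := H) (x := fun r => H.psi hz G y (flow r (1, e)))
    (g := 1 + y.2.2.1 * timeWeight e) (T := L) (by linarith) fun r hr =>
      ⟨(hgood _ (hmul r hr)).2, by
        have := CornerField.phys_hasDerivWithinAt (mem_O (hz := hz) (G := G) hs) hh
          (fun r hr => (hgood _ (hmul r hr)).1) hr
        rw [show (((1, e) : UnitSquare).1 : ℝ) * ((1, e) : UnitSquare).2 = e by simp] at this
        exact this⟩
  have h2 : flow L (1, e) = exitPt (1, e) := flow_exit (p := (1, e)) he0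
  have h3 : exitPt (1, e) = (e, 1) := by ext <;> simp [exitPt]
  have h4 : (1 + y.2.2.1 * timeWeight e) * L = L + y.2.2.1 := by
    rw [← hexp, timeWeight_of_le (by linarith)]
    field_simp
  have h5 : Real.exp (-L) * Real.exp L = 1 := by rw [← Real.exp_add]; simp
  simp only [flow_zero] at h1
  rw [h2, h3, psi_exit_fst hs rfl, h4, Real.exp_add, hys, Real.exp_log (div_pos hy hα)] at h1
  rw [← hexp]
  field_simp at h1
  have h8 : Real.exp L * (Real.exp (-L) * α) = Real.exp L * (H.psi hz G y (1, e)).1 (Fin.last k) := by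
    rw [← h1, ← mul_assoc, mul_comm (Real.exp L), h5, one_mul]
  exact (mul_left_cancel₀ (Real.exp_pos L).ne' h8).symm

/-- The passage near a connection from a graph to a point of its unstable manifold. -/
theorem exists_passage (H : S.Reduction V δ₀) (hδ : δ ≤ δ₀) (hV : IsOpen V)
    (G : ExitGraph (EuclideanSpace ℝ (Fin (k + 1))) (EuclideanSpace ℝ (Fin l)) F H.n)
    (hπ : ∀ w, G.proj (G.incl w) = w) (hh : ∀ x, G.proj (G.h x) = 0)
    {M : Set (PhaseSpace (k + 1) m l)} (hMb : ∀ x ∈ M, x.2.1 = p.2.1)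
    (hM : ∀ᶠ x in 𝓝 p, x.2.1 = p.2.1 → (x ∈ M ↔ G.Mem x.1 x.2.2)) (hpM : p ∈ M)
    (hp : S.StableProj (cornerBox (k + 1) m δ V) p z)
    (hq : S.UnstableProj (cornerBox (k + 1) m δ V) q z) (hα : 0 < q.1 (Fin.last k)) :
    ∃ (D : Set (PhaseSpace (k + 1) m l)) (P : Set (EuclideanSpace ℝ (Fin (k + 1)) × F))
      (Ψ : EuclideanSpace ℝ (Fin (k + 1)) × F → C(UnitSquare, PhaseSpace (k + 1) m l)) (e₁ : ℝ),
      IsOpen D ∧ q ∈ D ∧ IsOpen P ∧ G.chart q ∈ P ∧ 0 < e₁ ∧ ContDiffOn ℝ H.n Ψ P ∧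
      (∀ u ∈ P, ∀ e : unitInterval, (e : ℝ) < e₁ → Ψ u (e, 1) ∈ D ∧ G.chart (Ψ u (e, 1)) = u) ∧
      (∀ u ∈ P, Ψ u (0, 1) ∈ S.unstableManifold (cornerBox (k + 1) m δ V)
        (S.stableProjImage (cornerBox (k + 1) m δ V) M)) ∧
      (∀ x ∈ D, G.chart x ∈ P → x ∈ S.unstableManifold (cornerBox (k + 1) m δ V)
        (S.stableProjImage (cornerBox (k + 1) m δ V) M) → Ψ (G.chart x) (0, 1) = x) ∧
      (∀ u ∈ P, ∀ e : unitInterval, 0 < (e : ℝ) → (e : ℝ) < e₁ → Ψ u (e, 1) ∈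
        S.forwardEvolution (cornerBox (k + 1) m δ V) (slice M (e * q.1 (Fin.last k)))) ∧
      ∀ x ∈ D, G.chart x ∈ P → ∀ e : unitInterval, 0 < (e : ℝ) → (e : ℝ) < e₁ → x ∈
        S.forwardEvolution (cornerBox (k + 1) m δ V) (slice M (e * q.1 (Fin.last k))) →
          Ψ (G.chart x) (e, 1) = x := by
  have hϱ := H.ϱ_pos
  have hz : z.2.2 ∈ V := hp.1.2.2
  have hbox := cornerBox_mono (k := k + 1) (m := m) hδ V
  set α := q.1 (Fin.last k) with hαdef
  -- Passages ending near q start near p, where M coincides with the graph. Hence no other piece of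
  -- M contributes near q.
  obtain ⟨N', hN', ε₁, hε₁, hnear, hnear'⟩ := H.exists_entry_near hδ hp hq hα hM
  let D : Set (PhaseSpace (k + 1) m l) := interior N' ∩ {x | ‖x.2.2 - q.2.2‖ < H.ϱ / 8}
  have hDo : IsOpen D := isOpen_interior.inter (isOpen_lt (by fun_prop) continuous_const)
  have hqD : q ∈ D := ⟨mem_interior_iff_mem_nhds.2 hN', by
    show ‖q.2.2 - q.2.2‖ < _
    rw [sub_self, norm_zero]; positivity⟩
  -- The excess s is a smooth function of the exit coordinate a_k > 0, so the solution map remains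
  -- smooth after the substitution.
  let Y : EuclideanSpace ℝ (Fin (k + 1)) × F → EuclideanSpace ℝ (Fin (k + 1)) ×
    EuclideanSpace ℝ (Fin m) × ℝ × F := fun u => (u.1, p.2.1, Real.log (u.1 (Fin.last k) / α), u.2)
  let P₁ : Set (EuclideanSpace ℝ (Fin (k + 1)) × F) := {u | 0 < u.1 (Fin.last k)}
  have hP₁ : IsOpen P₁ := isOpen_lt continuous_const (by fun_prop)
  have hYsmooth : ContDiffOn ℝ H.n Y P₁ := by
    refine contDiffOn_fst.prodMk (contDiffOn_const.prodMk (ContDiffOn.prodMk ?_ contDiffOn_snd))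
    refine ContDiffOn.log ?_ fun u hu => (div_pos hu hα).ne'
    have : ContDiff ℝ H.n fun u : EuclideanSpace ℝ (Fin (k + 1)) × F => u.1 (Fin.last k) :=
      (EuclideanSpace.proj (𝕜 := ℝ) (Fin.last k)).contDiff.comp contDiff_fst
    exact (this.div_const α).contDiffOn
  set u₀ := G.chart q with hu₀
  have hu₀P : u₀ ∈ P₁ := hα
  have hYc : ContinuousAt Y u₀ := (hYsmooth.continuousOn).continuousAt (hP₁.mem_nhds hu₀P)
  have hlog0 : (Y u₀).2.2.1 = 0 := by
    show Real.log (q.1 (Fin.last k) / α) = 0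
    rw [← hαdef, div_self hα.ne', Real.log_one]
  have hs0 : |(Y u₀).2.2.1| < H.ϱ := by rw [hlog0]; simpa using hϱ
  have hqd := H.unstableProj_dist hδ hq
  have hp0 : p.1 = 0 := H.stableProj_fst hδ hp
  have hpMem : G.Mem p.1 p.2.2 := (hM.self_of_nhds rfl).1 hpM
  obtain ⟨hg0, hψp, hψq, -⟩ := psi_eq_of_proj (hz := hz) (G := G) (y := Y u₀) hδ hs0 hp hq
    (by rw [sub_self, norm_zero]; positivity) rfl rfl
    (by rw [← hp0]; exact ExitGraph.eq_cond_of_mem hpMem rfl)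
  obtain ⟨e₂, he₂, hgood⟩ := eventually_good (isOpen_cornerBox hV) (mem_O (hz := hz) (G := G) hs0) hg0
  have hc1 : ContinuousAt (fun x : (EuclideanSpace ℝ (Fin (k + 1)) × F) × unitInterval =>
      H.psi hz G (Y x.1) (x.2, 1)) (u₀, 0) :=
    ContinuousAt.comp (x := (u₀, (0 : unitInterval)))
      (f := fun x : (EuclideanSpace ℝ (Fin (k + 1)) × F) × unitInterval =>
        (Y x.1, ((x.2, 1) : UnitSquare)))
      (g := fun x => H.psi hz G x.1 x.2) (continuousAt_psi hs0 (0, 1))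
      ((ContinuousAt.comp (x := (u₀, (0 : unitInterval))) (f := Prod.fst) (g := Y) hYc
        continuousAt_fst).prodMk (Continuous.continuousAt (by fun_prop)))
  have hc2 : ContinuousAt (fun x : (EuclideanSpace ℝ (Fin (k + 1)) × F) × unitInterval =>
      H.psi hz G (Y x.1) (1, x.2)) (u₀, 0) :=
    ContinuousAt.comp (x := (u₀, (0 : unitInterval)))
      (f := fun x : (EuclideanSpace ℝ (Fin (k + 1)) × F) × unitInterval =>
        (Y x.1, ((1, x.2) : UnitSquare)))
      (g := fun x => H.psi hz G x.1 x.2) (continuousAt_psi hs0 (1, 0))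
      ((ContinuousAt.comp (x := (u₀, (0 : unitInterval))) (f := Prod.fst) (g := Y) hYc
        continuousAt_fst).prodMk (Continuous.continuousAt (by fun_prop)))
  obtain ⟨A₁, hA₁, e₃, he₃, h₃⟩ := hc1.exists_nhds_interval (N := D) (hDo.mem_nhds (by
    show H.psi hz G (Y u₀) (0, 1) ∈ D
    rwa [hψq]))
  obtain ⟨A₂, hA₂, e₄, he₄, h₄⟩ := hc2.exists_nhds_interval
    (N := {x | x.2.1 = p.2.1 → (x ∈ M ↔ G.Mem x.1 x.2.2)}) (by
    show _ ∈ 𝓝 (H.psi hz G (Y u₀) (1, 0))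
    rw [hψp]; exact hM)
  obtain ⟨P, hPsub, hPo, hu₀P'⟩ := mem_nhds_iff.1
    (inter_mem (inter_mem hA₁ hA₂) (inter_mem (hP₁.mem_nhds hu₀P) (hYc.eventually hgood)))
  have hrad : 0 < H.radius hz G := radius_pos
  have hexp := Real.exp_pos (-2)
  refine ⟨D, P, fun u => H.psi hz G (Y u),
    min (min e₂ (min e₃ e₄)) (min (Real.exp (-2)) (min (H.radius hz G) (ε₁ / α))), hDo, hqD, hPo, hu₀P',
    by positivity, ?_, ?_, ?_, ?_, ?_, ?_⟩
  · exact contDiffOn_psi.comp (hYsmooth.mono fun u hu => (hPsub hu).2.1) fun u hu => (hPsub hu).2.2.1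
  · intro u hu e he
    simp only [lt_min_iff] at he
    have hs : |(Y u).2.2.1| < H.ϱ := (hPsub hu).2.2.1
    refine ⟨h₃ u (hPsub hu).1.1 e he.1.2.1, Prod.ext (psi_exit_fst hs rfl) ?_⟩
    exact (ExitGraph.of_eq_cond hπ hh (psi_cond (hz := hz) (G := G) hs he.2.2.1.le)).2.symm
  · intro u hu
    obtain ⟨⟨-, huA⟩, huP, huO, hug⟩ := hPsub hu
    have hs : |(Y u).2.2.1| < H.ϱ := huO
    have hb : (H.psi hz G (Y u) (1, 0)).2.1 = p.2.1 := psi_entry_snd hs rfl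
    have hmem := (h₄ u huA 0 he₄ hb).2
      (ExitGraph.of_eq_cond hπ hh (psi_cond (hz := hz) (G := G) hs hrad.le)).1
    refine ⟨H.psi hz G (Y u) (0, 0), ⟨H.psi hz G (Y u) (1, 0), hmem, ?_⟩, ?_⟩
    · exact stableProj_phys hδ huO fun r hr => hug r (by rw [hr, mul_zero]; exact he₂.le)
    · exact unstableProj_phys hδ huO fun r hr => hug r (by rw [hr, zero_mul]; exact he₂.le)
  -- A point of the unstable manifold comes with an entry point on the stable fiber of the same base
  -- point. The pair of fibers solves the problem on the degenerate hyperbola, so the solution map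
  -- returns x.
  · rintro x ⟨hxN, hxd⟩ hxP ⟨z', ⟨p', hp'M, hp'⟩, hx⟩
    obtain ⟨-, -, huO, -⟩ := hPsub hxP
    have hxd' : ‖x.2.2 - q.2.2‖ < H.ϱ / 8 := hxd
    have hb := hMb p' hp'M
    have hmem := (hnear x (interior_subset hxN) p' z' hp' hx hb hb).1 hp'M
    rw [H.stableProj_fst hδ hp'] at hmem
    have hd := H.unstableProj_dist hδ hx
    refine (psi_eq_of_proj (hz := hz) (G := G) (y := Y (G.chart x)) hδ huO hp' hx ?_ rfl hb
      (ExitGraph.eq_cond_of_mem hmem rfl)).2.2.1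
    have e : z'.2.2 - z.2.2 = -(x.2.2 - z'.2.2) + ((x.2.2 - q.2.2) + (q.2.2 - z.2.2)) := by abel
    rw [e]
    refine (norm_add_le _ _).trans ?_
    have := norm_add_le (x.2.2 - q.2.2) (q.2.2 - z.2.2)
    rw [norm_neg]
    linarith
  · intro u hu e he0 he
    simp only [lt_min_iff] at he
    obtain ⟨⟨-, huA⟩, huP, huO, hug⟩ := hPsub hu
    have hs : |(Y u).2.2.1| < H.ϱ := huO
    have hb : (H.psi hz G (Y u) (1, e)).2.1 = p.2.1 := psi_entry_snd hs rfl
    have hmem := (h₄ u huA e he.1.2.2 hb).2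
      (ExitGraph.of_eq_cond hπ hh (psi_cond (hz := hz) (G := G) hs he.2.2.1.le)).1
    obtain ⟨T, hT⟩ := flowsTo_phys hδ huO (p := (1, e)) he0 fun r hr =>
      hug r (by rw [hr]; simpa using he.1.1.le)
    have h3 : exitPt (1, e) = (e, 1) := by ext <;> simp [exitPt]
    rw [h3] at hT
    refine ⟨_, ⟨hmem, ?_⟩, T, hT⟩
    exact psi_entry_last hs he0 he.2.1.le (fun r hr => by
      have := hug r (by rw [hr]; exact he.1.1.le)
      exact ⟨this.1, hbox this.2⟩) hα huP rfl
  · rintro x ⟨hxN, hxd⟩ hxP e he0 he ⟨p', ⟨hp'M, hp'ε⟩, T, hT⟩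
    simp only [lt_min_iff] at he
    obtain ⟨-, -, huO, -⟩ := hPsub hxP
    have hxd' : ‖x.2.2 - q.2.2‖ < H.ϱ / 8 := hxd
    have hb := hMb p' hp'M
    have hmem := (hnear' (e * α) (by positivity) ((lt_div_iff₀ hα).1 he.2.2.2) x (interior_subset hxN)
      p' T hT hb hp'ε hb).1 hp'M
    refine (psi_eq_of_flowsTo (hz := hz) (G := G) (y := Y (G.chart x)) hδ huO hα hT he0 hp'ε.symm
      he.2.1.le he.2.2.1.le ?_ rfl hb rfl (ExitGraph.eq_cond_of_mem hmem rfl)).2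
    have e : x.2.2 - z.2.2 = (x.2.2 - q.2.2) + (q.2.2 - z.2.2) := by abel
    rw [e]
    refine (norm_add_le _ _).trans ?_
    linarith

end Reduction

end FenichelSystem

end

/-! ### Local graph form of the entry manifold -/

noncomputable section

section Submanifold

variable {E X Z : Type} [NormedAddCommGroup E] [NormedSpace ℝ E] [CompleteSpace E]
  [NormedAddCommGroup X] [NormedSpace ℝ X] [NormedAddCommGroup Z] [NormedSpace ℝ Z]
  {n : ℕ} {φ : E → X} {φ' : E →L[ℝ] X} {P : Set E} {M U : Set X} {u₀ : E} {p : X}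

/-- A submanifold is locally the set of fixed points of a retraction, for every choice of linear
coordinates on its tangent space. -/
theorem exists_local_retraction (hn : n ≠ 0) (hP : IsOpen P) (hφ : ContDiffOn ℝ n φ P) (hu₀ : u₀ ∈ P)
    (hφ' : HasFDerivAt φ φ' u₀) (hemb : IsEmbedding fun u : P => φ u) (himg : φ '' P = M ∩ U)
    (hU : U ∈ 𝓝 p) (hp : φ u₀ = p) (ℓ : X →L[ℝ] Z) (e : E ≃L[ℝ] Z) (he : ∀ u, ℓ (φ' u) = e u) :
    ∃ g : Z → E, ContDiffAt ℝ n g 0 ∧ HasFDerivAt g (e.symm : Z →L[ℝ] E) 0 ∧ g 0 = u₀ ∧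
      (∀ᶠ x in 𝓝 p, x ∈ M ↔ x = φ (g (ℓ (x - p)))) ∧
      ∀ᶠ z in 𝓝 0, φ (g z) ∈ M ∧ ℓ (φ (g z) - p) = z := by
  have hn' : ((n : ℕ) : WithTop ℕ∞) ≠ 0 := by exact_mod_cast hn
  let f : E → Z := fun u => ℓ (φ u - p)
  have hfc : ContDiffAt ℝ n f u₀ :=
    ℓ.contDiff.contDiffAt.comp _ ((hφ.contDiffAt (hP.mem_nhds hu₀)).sub contDiffAt_const)
  have hf0 : f u₀ = 0 := by simp only [f, hp, sub_self, map_zero]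
  have hfd : HasFDerivAt f (e : E →L[ℝ] Z) u₀ := by
    have h1 := ℓ.hasFDerivAt.comp u₀ (hφ'.sub_const p)
    have h2 : (e : E →L[ℝ] Z) = ℓ.comp φ' := by ext u; exact (he u).symm
    rw [h2]; exact h1
  have hs : HasStrictFDerivAt f (e : E →L[ℝ] Z) u₀ := hfc.hasStrictFDerivAt' hfd hn'
  have hg0 : hs.localInverse f e u₀ 0 = u₀ := by rw [← hf0]; exact hs.localInverse_apply_image
  have hgd : HasFDerivAt (hs.localInverse f e u₀) (e.symm : Z →L[ℝ] E) 0 := by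
    have := hs.to_localInverse.hasFDerivAt
    rwa [hf0] at this
  have hgc : ContDiffAt ℝ n (hs.localInverse f e u₀) 0 := by
    have := hfc.to_localInverse hfd hn'
    rwa [hf0] at this
  have hgP : ∀ᶠ z in 𝓝 (0 : Z), hs.localInverse f e u₀ z ∈ P :=
    hgc.continuousAt.eventually_mem (by rw [hg0]; exact hP.mem_nhds hu₀)
  have hmem : ∀ u ∈ P, φ u ∈ M := fun u hu => (himg ▸ mem_image_of_mem φ hu : φ u ∈ M ∩ U).1
  refine ⟨hs.localInverse f e u₀, hgc, hgd, hg0, ?_, ?_⟩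
  · have hl := hs.eventually_left_inverse
    -- Being an embedding is essential: points of M close to p have parameters close to u₀, where
    -- the local inverse applies.
    have hN : (Subtype.val : P → E) ⁻¹' {u | hs.localInverse f e u₀ (f u) = u} ∈ 𝓝 (⟨u₀, hu₀⟩ : P) :=
      continuousAt_subtype_val.preimage_mem_nhds hl
    rw [hemb.nhds_eq_comap] at hN
    obtain ⟨O, hO, hON⟩ := mem_comap.1 hN
    have hO' : O ∈ 𝓝 p := by rw [← hp]; exact hO
    have hz : ∀ᶠ x in 𝓝 p, hs.localInverse f e u₀ (ℓ (x - p)) ∈ P := by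
      have hc : Tendsto (fun x => ℓ (x - p)) (𝓝 p) (𝓝 0) := by
        have : Continuous fun x => ℓ (x - p) := by fun_prop
        simpa using this.tendsto p
      exact hc.eventually hgP
    filter_upwards [hO', hU, hz] with x hxO hxU hxP
    constructor
    · intro hxM
      obtain ⟨u, hu, rfl⟩ : x ∈ φ '' P := by rw [himg]; exact ⟨hxM, hxU⟩
      have h1 : hs.localInverse f e u₀ (f u) = u := hON (show (⟨u, hu⟩ : P) ∈ _ from hxO)
      exact (congrArg φ h1).symm
    · intro h
      rw [h]; exact hmem _ hxP
  · have hr := hs.eventually_right_inverse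
    rw [hf0] at hr
    filter_upwards [hgP, hr] with z h1 h2
    exact ⟨hmem _ h1, h2⟩

/-- Velocities of curves in a submanifold are tangent to it. -/
theorem tangent_of_curve [FiniteDimensional ℝ X] (hn : n ≠ 0) (hP : IsOpen P) (hφ : ContDiffOn ℝ n φ P)
    (hu₀ : u₀ ∈ P) (hφ' : HasFDerivAt φ φ' u₀) (hinj : Function.Injective φ')
    (hemb : IsEmbedding fun u : P => φ u) (himg : φ '' P = M ∩ U)
    (hU : U ∈ 𝓝 p) (hp : φ u₀ = p) {γ : ℝ → X} {v : X} (hγ : HasDerivAt γ v 0) (hγ0 : γ 0 = p)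
    (hγM : ∀ᶠ t in 𝓝 0, γ t ∈ M) : ∃ u, φ' u = v := by
  -- With a left inverse of φ' as linear coordinates, the curve equals its own retraction near p.
  -- The chain rule then exhibits its velocity as a value of φ'.
  obtain ⟨L, hL⟩ := (φ' : E →ₗ[ℝ] X).exists_leftInverse_of_injective (LinearMap.ker_eq_bot.2 hinj)
  obtain ⟨g, -, hgd, hg0, hM, -⟩ := exists_local_retraction hn hP hφ hu₀ hφ' hemb himg hU hp
    (LinearMap.toContinuousLinearMap L) (ContinuousLinearEquiv.refl ℝ E)
    (fun u => LinearMap.congr_fun hL u)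
  have hev : γ =ᶠ[𝓝 0] fun t => φ (g (LinearMap.toContinuousLinearMap L (γ t - p))) := by
    have hc : Tendsto γ (𝓝 0) (𝓝 p) := by rw [← hγ0]; exact hγ.continuousAt
    filter_upwards [hc.eventually hM, hγM] with t h1 h2
    exact h1.1 h2
  have h1 : HasDerivAt (fun t => LinearMap.toContinuousLinearMap L (γ t - p)) (L v) 0 :=
    (LinearMap.toContinuousLinearMap L).hasFDerivAt.comp_hasDerivAt 0 (hγ.sub_const p)
  have e0 : LinearMap.toContinuousLinearMap L (γ 0 - p) = 0 := by rw [hγ0, sub_self, map_zero]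
  have h2 : HasDerivAt (fun t => g (LinearMap.toContinuousLinearMap L (γ t - p))) (L v) 0 := by
    rw [← e0] at hgd
    exact hgd.comp_hasDerivAt 0 h1
  have h3 : HasDerivAt (fun t => φ (g (LinearMap.toContinuousLinearMap L (γ t - p)))) (φ' (L v)) 0 := by
    have e1 : u₀ = g (LinearMap.toContinuousLinearMap L (γ 0 - p)) := by rw [e0, hg0]
    rw [e1] at hφ'
    exact hφ'.comp_hasDerivAt 0 h2
  exact ⟨L v, (h3.congr_of_eventuallyEq hev).unique hγ⟩

end Submanifold

section Localize

variable {A T Z : Type} [NormedAddCommGroup A] [InnerProductSpace ℝ A] [FiniteDimensional ℝ A]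
  [NormedAddCommGroup T] [InnerProductSpace ℝ T] [FiniteDimensional ℝ T]
  [NormedAddCommGroup Z] [NormedSpace ℝ Z] {n : ℕ}

/-- A map whose derivative at the origin vanishes in the second direction can be cut off such that it
has Lipschitz constant one in this direction. -/
theorem exists_localization (hn : n ≠ 0) {f : A × T → Z} (hf : ContDiffAt ℝ n f 0)
    {f' : A × T →L[ℝ] Z} (hf' : HasFDerivAt f f' 0) (hT : ∀ w, f' (0, w) = 0) :
    ∃ ζ : A × T → A × T, ContDiff ℝ n (f ∘ ζ) ∧ (∀ᶠ x in 𝓝 0, ζ x = x) ∧ ∃ La : ℝ, 0 ≤ La ∧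
      ∀ a a' w w', ‖f (ζ (a, w)) - f (ζ (a', w'))‖ ≤ La * ‖a - a'‖ + ‖w - w'‖ := by
  have hn' : ((n : ℕ) : WithTop ℕ∞) ≠ 0 := by exact_mod_cast hn
  have hs : HasStrictFDerivAt f f' 0 := hf.hasStrictFDerivAt' hf' hn'
  set CA := cutoffLip A 1 with hCA
  set CT := cutoffLip T 1 with hCT
  have hCA0 : 0 ≤ CA := cutoffLip_nonneg one_pos
  have hCT0 : 0 ≤ CT := cutoffLip_nonneg one_pos
  -- The remainder of the linearization is made so small that the Lipschitz constant CT of the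
  -- cutoff in the second direction is compensated: c · CT ≤ 1.
  set c : ℝ := (CT + 1)⁻¹ with hc
  have hc0 : 0 < c := by positivity
  have hcT : c * CT ≤ 1 := by
    rw [hc, inv_mul_le_iff₀ (by positivity)]; linarith
  have h1 : ∀ᶠ x : (A × T) × (A × T) in 𝓝 (0, 0), ‖f x.1 - f x.2 - f' (x.1 - x.2)‖ ≤ c * ‖x.1 - x.2‖ :=
    hs.isLittleO.def hc0
  have h2 : ∀ᶠ x in 𝓝 (0 : A × T), ContDiffAt ℝ n f x := hf.eventually (by simp)
  obtain ⟨ε₁, hε₁, h1⟩ := Metric.eventually_nhds_iff.1 h1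
  obtain ⟨ε₂, hε₂, h2⟩ := Metric.eventually_nhds_iff.1 h2
  set ε := min ε₁ ε₂ / 4 with hε
  have hε0 : 0 < ε := by positivity
  let ζ : A × T → A × T := fun x => (ε • cutoff 1 (ε⁻¹ • x.1), ε • cutoff 1 (ε⁻¹ • x.2))
  have hζs : ContDiff ℝ n ζ :=
    (((contDiff_cutoff one_pos n).comp (contDiff_fst.const_smul ε⁻¹)).const_smul ε).prodMk
      (((contDiff_cutoff one_pos n).comp (contDiff_snd.const_smul ε⁻¹)).const_smul ε)
  have hζn : ∀ x, ‖ζ x‖ < min ε₁ ε₂ := by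
    intro x
    have hA := cutoff_norm_le one_pos (ε⁻¹ • x.1)
    have hT := cutoff_norm_le one_pos (ε⁻¹ • x.2)
    have hm : 0 < min ε₁ ε₂ := lt_min hε₁ hε₂
    refine max_lt ?_ ?_
    · show ‖ε • cutoff 1 (ε⁻¹ • x.1)‖ < _
      rw [norm_smul, Real.norm_of_nonneg hε0.le]
      nlinarith
    · show ‖ε • cutoff 1 (ε⁻¹ • x.2)‖ < _
      rw [norm_smul, Real.norm_of_nonneg hε0.le]
      nlinarith
  have hsc : ∀ {W : Type} [NormedAddCommGroup W] [InnerProductSpace ℝ W] [FiniteDimensional ℝ W] (w w' : W),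
      ‖ε • cutoff 1 (ε⁻¹ • w) - ε • cutoff 1 (ε⁻¹ • w')‖ ≤ cutoffLip W 1 * ‖w - w'‖ := by
    intro W _ _ _ w w'
    rw [← smul_sub, norm_smul, Real.norm_of_nonneg hε0.le]
    have := cutoff_lipschitz one_pos (ε⁻¹ • w) (ε⁻¹ • w')
    rw [← smul_sub, norm_smul, norm_inv, Real.norm_of_nonneg hε0.le] at this
    calc _ ≤ ε * (cutoffLip W 1 * (ε⁻¹ * ‖w - w'‖)) := by gcongr
      _ = _ := by field_simp
  refine ⟨ζ, ?_, ?_, (‖f'‖ + c) * CA, by positivity, ?_⟩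
  · refine contDiff_iff_contDiffAt.2 fun x => ContDiffAt.comp x (h2 ?_) hζs.contDiffAt
    rw [dist_zero_right]
    exact (hζn x).trans_le (min_le_right _ _)
  · filter_upwards [Metric.ball_mem_nhds (0 : A × T) hε0] with x hx
    rw [mem_ball_zero_iff, Prod.norm_def, max_lt_iff] at hx
    have hsm : ∀ {W : Type} [NormedAddCommGroup W] [InnerProductSpace ℝ W] [FiniteDimensional ℝ W] (w : W),
        ‖w‖ < ε → ε • cutoff 1 (ε⁻¹ • w) = w := by
      intro W _ _ _ w hw
      rw [cutoff_eq_self one_pos, smul_smul, mul_inv_cancel₀ hε0.ne', one_smul]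
      rw [norm_smul, norm_inv, Real.norm_of_nonneg hε0.le, inv_mul_le_iff₀ hε0, mul_one]
      exact hw.le
    exact Prod.ext (hsm x.1 hx.1) (hsm x.2 hx.2)
  · intro a a' w w'
    set x := ζ (a, w) with hx
    set x' := ζ (a', w') with hx'
    have hA : ‖(x - x').1‖ ≤ CA * ‖a - a'‖ := hsc a a'
    have hT' : ‖(x - x').2‖ ≤ CT * ‖w - w'‖ := hsc w w'
    have h3 := h1 (y := (x, x')) (by
      rw [dist_eq_norm]
      show ‖(x - 0, x' - 0)‖ < _
      rw [sub_zero, sub_zero]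
      exact max_lt ((hζn _).trans_le (min_le_left _ _)) ((hζn _).trans_le (min_le_left _ _)))
    have h4 : f' (x - x') = f' ((x - x').1, 0) := by
      have : x - x' = ((x - x').1, 0) + (0, (x - x').2) := Prod.ext (by simp) (by simp)
      nth_rewrite 1 [this]
      rw [map_add, hT, add_zero]
    have h5 : ‖f' ((x - x').1, 0)‖ ≤ ‖f'‖ * ‖(x - x').1‖ := by
      refine (f'.le_opNorm _).trans ?_
      simp [Prod.norm_def]
    have h6 : ‖x - x'‖ ≤ ‖(x - x').1‖ + ‖(x - x').2‖ :=
      max_le (le_add_of_nonneg_right (norm_nonneg _)) (le_add_of_nonneg_left (norm_nonneg _))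
    have e : f x - f x' = (f x - f x' - f' (x - x')) + f' ((x - x').1, 0) := by rw [h4]; abel
    rw [e]
    calc _ ≤ c * ‖x - x'‖ + ‖f'‖ * ‖(x - x').1‖ := (norm_add_le _ _).trans (add_le_add h3 h5)
      _ ≤ c * (‖(x - x').1‖ + ‖(x - x').2‖) + ‖f'‖ * ‖(x - x').1‖ := by gcongr
      _ = (‖f'‖ + c) * ‖(x - x').1‖ + c * ‖(x - x').2‖ := by ring
      _ ≤ (‖f'‖ + c) * (CA * ‖a - a'‖) + c * (CT * ‖w - w'‖) := by gcongr
      _ = (‖f'‖ + c) * CA * ‖a - a'‖ + c * CT * ‖w - w'‖ := by ring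
      _ ≤ _ := by
        have := mul_le_of_le_one_left (norm_nonneg (w - w')) hcT
        linarith

end Localize

section Graph

variable {E A B C : Type} [NormedAddCommGroup E] [NormedSpace ℝ E] [FiniteDimensional ℝ E]
  [NormedAddCommGroup A] [InnerProductSpace ℝ A] [FiniteDimensional ℝ A]
  [NormedAddCommGroup B] [InnerProductSpace ℝ B] [FiniteDimensional ℝ B]
  [NormedAddCommGroup C] [InnerProductSpace ℝ C] [FiniteDimensional ℝ C]
  {n : ℕ} {φ : E → A × B × C} {φ' : E →L[ℝ] A × B × C} {P : Set E} {M U : Set (A × B × C)} {u₀ : E}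
  {p : A × B × C}

/-- A submanifold of a slice `{b = b₀}` which is transverse to `{a = 0}` is locally a graph. -/
theorem exists_exitGraph (hn : n ≠ 0) (hP : IsOpen P) (hφ : ContDiffOn ℝ n φ P) (hu₀ : u₀ ∈ P)
    (hφ' : HasFDerivAt φ φ' u₀) (hinj : Function.Injective φ') (hemb : IsEmbedding fun u : P => φ u)
    (himg : φ '' P = M ∩ U) (hU : U ∈ 𝓝 p) (hp : φ u₀ = p) (hMb : ∀ x ∈ M, x.2.1 = p.2.1)
    (hp0 : p.1 = 0)
    (hcurve : ∀ a : A, ∃ (γ : ℝ → A × B × C) (v : A × B × C), HasDerivAt γ v 0 ∧ γ 0 = p ∧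
      (∀ᶠ t in 𝓝 0, γ t ∈ M) ∧ v.1 = a) :
    ∃ (T : Submodule ℝ C) (G : ExitGraph A C T n), Nonempty (E ≃L[ℝ] A × T) ∧
      (∀ w, G.proj (G.incl w) = w) ∧ (∀ x, G.proj (G.h x) = 0) ∧
      ∀ᶠ x in 𝓝 p, x.2.1 = p.2.1 → (x ∈ M ↔ G.Mem x.1 x.2.2) := by
  have hb : ∀ u, (φ' u).2.1 = 0 := by
    intro u
    have h1 : HasFDerivAt (fun u => (φ u).2.1) ((ContinuousLinearMap.fst ℝ B C).comp
        ((ContinuousLinearMap.snd ℝ A (B × C)).comp φ')) u₀ := hφ'.snd.fst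
    have h2 : (fun u => (φ u).2.1) =ᶠ[𝓝 u₀] fun _ => p.2.1 := by
      filter_upwards [hP.mem_nhds hu₀] with u hu
      exact hMb _ (himg ▸ mem_image_of_mem φ hu : φ u ∈ M ∩ U).1
    have h3 := (h1.congr_of_eventuallyEq h2.symm).unique (hasFDerivAt_const _ _)
    exact congrArg (fun f => f u) h3
  let J : C →ₗ[ℝ] A × B × C := LinearMap.inr ℝ A (B × C) ∘ₗ LinearMap.inr ℝ B C
  -- The tangent directions with a = 0. Since b is constant on M, they are directions in C alone.
  let T : Submodule ℝ C := (LinearMap.range (φ' : E →ₗ[ℝ] A × B × C)).comap J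
  have hT : ∀ u, (φ' u).1 = 0 → (φ' u).2.2 ∈ T := by
    intro u hu
    refine ⟨u, ?_⟩
    exact Prod.ext hu (Prod.ext (hb u) rfl)
  let ℓ : A × B × C →L[ℝ] A × T := (ContinuousLinearMap.fst ℝ A (B × C)).prod
    (T.orthogonalProjectionOnto ∘L (ContinuousLinearMap.snd ℝ B C) ∘L (ContinuousLinearMap.snd ℝ A (B × C)))
  have hℓ : ∀ x, ℓ x = (x.1, T.orthogonalProjectionOnto x.2.2) := fun x => rfl
  have hker : ∀ u, ℓ (φ' u) = 0 → u = 0 := by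
    intro u hu
    rw [hℓ, Prod.mk_eq_zero] at hu
    have h1 := hT u hu.1
    have h2 : (φ' u).2.2 = 0 := by
      have := hu.2
      rw [Submodule.orthogonalProjectionOnto_mem_subspace_eq_self ⟨_, h1⟩] at this
      exact congrArg Subtype.val this
    exact hinj (by rw [map_zero]; exact Prod.ext hu.1 (Prod.ext (hb u) h2))
  -- The given curves provide tangent vectors with arbitrary a-component. Vectors of T correct the
  -- remaining component.
  have hsurj : Function.Surjective (ℓ ∘L φ') := by
    rintro ⟨a, τ⟩
    obtain ⟨γ, v, hγ, hγ0, hγM, rfl⟩ := hcurve a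
    obtain ⟨u, rfl⟩ := tangent_of_curve hn hP hφ hu₀ hφ' hinj hemb himg hU hp hγ hγ0 hγM
    obtain ⟨u', hu'⟩ := (τ - T.orthogonalProjectionOnto (φ' u).2.2).2
    have hu'' : φ' u' = (0, 0, ((τ - T.orthogonalProjectionOnto (φ' u).2.2 : T) : C)) := hu'
    refine ⟨u + u', ?_⟩
    show ℓ (φ' (u + u')) = _
    rw [map_add, hu'', hℓ]
    refine Prod.ext (by simp) ?_
    show T.orthogonalProjectionOnto ((φ' u).2.2 + _) = τ
    rw [map_add, Submodule.orthogonalProjectionOnto_mem_subspace_eq_self]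
    abel
  let e : E ≃L[ℝ] A × T := ContinuousLinearEquiv.ofBijective (ℓ ∘L φ')
    (LinearMap.ker_eq_bot'.2 hker) (LinearMap.range_eq_top.2 hsurj)
  have he : ∀ u, ℓ (φ' u) = e u := fun u => rfl
  obtain ⟨g, hgc, hgd, hg0, hM, hz⟩ := exists_local_retraction hn hP hφ hu₀ hφ' hemb himg hU hp ℓ e he
  let Q : C →L[ℝ] C := .id ℝ C - T.subtypeL ∘L T.orthogonalProjectionOnto
  have hQ : ∀ c, Q c = c - T.orthogonalProjectionOnto c := fun c => rfl
  have hPQ : ∀ c, T.orthogonalProjectionOnto (Q c) = 0 := fun c => by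
    rw [hQ, map_sub, Submodule.orthogonalProjectionOnto_mem_subspace_eq_self, sub_self]
  let f : A × T → C := fun z => Q ((φ (g z)).2.2 - p.2.2)
  have hfc : ContDiffAt ℝ n f 0 := by
    have h1 : ContDiffAt ℝ n φ (g 0) := by rw [hg0]; exact hφ.contDiffAt (hP.mem_nhds hu₀)
    exact Q.contDiff.contDiffAt.comp _ ((h1.comp 0 hgc).snd.snd.sub contDiffAt_const)
  have hfd : HasFDerivAt f (Q ∘L (ContinuousLinearMap.snd ℝ B C) ∘L (ContinuousLinearMap.snd ℝ A (B × C)) ∘L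
      φ' ∘L (e.symm : A × T →L[ℝ] E)) 0 := by
    have h1 : HasFDerivAt φ φ' (g 0) := by rw [hg0]; exact hφ'
    exact Q.hasFDerivAt.comp 0 ((h1.comp 0 hgd).snd.snd.sub_const p.2.2)
  obtain ⟨ζ, hζs, hζ, La, hLa, hlip⟩ := exists_localization hn hfc hfd (by
    intro w
    set u := e.symm (0, w) with hu
    have h1 : ℓ (φ' u) = (0, w) := by rw [he, hu, e.apply_symm_apply]
    rw [hℓ, Prod.mk.injEq] at h1
    show Q (φ' u).2.2 = 0
    rw [hQ, Submodule.orthogonalProjectionOnto_mem_subspace_eq_self ⟨_, hT u h1.1⟩, sub_self])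
  refine ⟨T, ⟨p.2.2, T.subtypeL, T.orthogonalProjectionOnto, f ∘ ζ, La, hζs, hLa, ?_, ?_, hlip⟩, ⟨e⟩, ?_, ?_, ?_⟩
  · exact fun I => Submodule.norm_orthogonalProjectionOnto_apply_le T I
  · intro I
    have h := Submodule.norm_orthogonalProjectionOnto_apply_le Tᗮ I
    show ‖I - T.starProjection I‖ ≤ _
    rw [← T.starProjection_orthogonal_val I]
    exact h
  · exact fun w => Submodule.orthogonalProjectionOnto_mem_subspace_eq_self w
  · exact fun x => hPQ _
  · have hc : Tendsto (fun x => ℓ (x - p)) (𝓝 p) (𝓝 0) := by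
      have : Continuous fun x => ℓ (x - p) := by fun_prop
      simpa using this.tendsto p
    filter_upwards [hM, hc.eventually hζ, hc.eventually hz] with x h1 h2 h3 hxb
    set z := ℓ (x - p) with hzdef
    have hz' : z = (x.1, T.orthogonalProjectionOnto (x.2.2 - p.2.2)) := by
      rw [hzdef, hℓ]; simp [hp0]
    have hmem : ∀ c, c - p.2.2 = T.orthogonalProjectionOnto (c - p.2.2) + Q (c - p.2.2) := fun c => by
      rw [hQ]; abel
    rw [h1]
    simp only [ExitGraph.Mem, Function.comp]
    show _ ↔ x.2.2 = p.2.2 + (T.orthogonalProjectionOnto (x.2.2 - p.2.2) : C) +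
      f (ζ (x.1, T.orthogonalProjectionOnto (x.2.2 - p.2.2)))
    rw [← hz', h2]
    constructor
    · intro h
      have h4 : f z = Q (x.2.2 - p.2.2) := by
        show Q ((φ (g z)).2.2 - p.2.2) = _
        rw [← h]
      rw [h4, add_assoc, ← hmem]; abel
    · intro h
      have h4 := h3.2
      rw [hz', hℓ, ← hz', Prod.mk.injEq] at h4
      refine Prod.ext ?_ (Prod.ext ?_ ?_)
      · have h5 : (φ (g z)).1 - p.1 = x.1 - p.1 := by rw [hzdef] at h4 ⊢; exact h4.1
        exact (sub_left_injective h5).symm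
      · rw [hxb, hMb _ h3.1]
      · rw [h]
        have h5 := hmem (φ (g z)).2.2
        have h6 : T.orthogonalProjectionOnto ((φ (g z)).2.2 - p.2.2) =
          T.orthogonalProjectionOnto (x.2.2 - p.2.2) := h4.2
        rw [h6] at h5
        show _ + _ + Q ((φ (g z)).2.2 - p.2.2) = _
        rw [add_assoc, ← h5]; abel

end Graph

end

/-! ### Uniform convergence of derivatives and closeness of parametrizations -/

noncomputable section

section JointContinuity

variable {E F Q : Type} [NormedAddCommGroup E] [NormedSpace ℝ E]
  [NormedAddCommGroup F] [NormedSpace ℝ F] [TopologicalSpace Q] {n i : ℕ}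

/-- In finite dimension the multilinear maps embed linearly, hence homeomorphically, into functions
with the topology of pointwise convergence. -/
theorem continuous_multilinear_of_apply [FiniteDimensional ℝ E] [FiniteDimensional ℝ F]
    {f : Q → E [×i]→L[ℝ] F} (h : ∀ v, Continuous fun q => f q v) : Continuous f := by
  have hfin : FiniteDimensional ℝ (E [×i]→L[ℝ] F) := FiniteDimensional.of_injective
    (ContinuousMultilinearMap.toMultilinearMapLinear (R' := ℝ) (A := ℝ) (M₁ := fun _ : Fin i => E) (M₂ := F))
    ContinuousMultilinearMap.toMultilinearMap_injective
  let g : (E [×i]→L[ℝ] F) →ₗ[ℝ] ((Fin i → E) → F) :=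
    { toFun := fun f v => f v
      map_add' := fun _ _ => rfl
      map_smul' := fun _ _ => rfl }
  have hg : LinearMap.ker g = ⊥ := LinearMap.ker_eq_bot'.2 fun f hf => by
    ext v; exact congrFun hf v
  exact (LinearMap.isClosedEmbedding_of_injective hg).isEmbedding.continuous_iff.2 (continuous_pi h)

variable [CompactSpace Q]

theorem norm_evalCLM_le (q : Q) : ‖ContinuousMap.evalCLM ℝ q (M := F)‖ ≤ 1 :=
  ContinuousLinearMap.opNorm_le_bound _ zero_le_one fun f => by
    rw [one_mul]; exact f.norm_coe_le_norm q

/-- Evaluation at q is 1-Lipschitz in the multilinear map uniformly in q, and for a fixed map it is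
continuous in q. Together these give joint continuity. -/
theorem continuous_eval_multilinear [FiniteDimensional ℝ E] [FiniteDimensional ℝ F] :
    Continuous fun x : (E [×i]→L[ℝ] C(Q, F)) × Q =>
      (ContinuousMap.evalCLM ℝ x.2).compContinuousMultilinearMap x.1 := by
  refine continuous_prod_of_continuous_lipschitzWith _ 1 (fun f => ?_) fun q => ?_
  · exact continuous_multilinear_of_apply fun v => (f v).continuous
  · refine LipschitzWith.of_dist_le_mul fun f g => ?_
    rw [dist_eq_norm, dist_eq_norm]
    have h : (ContinuousMap.evalCLM ℝ q).compContinuousMultilinearMap f -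
        (ContinuousMap.evalCLM ℝ q).compContinuousMultilinearMap g =
        (ContinuousMap.evalCLM ℝ q (M := F)).compContinuousMultilinearMap (f - g) := by
      ext v; simp
    simp only at h ⊢
    rw [h]
    refine (ContinuousLinearMap.norm_compContinuousMultilinearMap_le _ _).trans ?_
    exact mul_le_mul_of_nonneg_right (norm_evalCLM_le q) (norm_nonneg _)

variable {P : Set E} {Ψ : E → C(Q, F)}

theorem contDiffOn_eval (hΨ : ContDiffOn ℝ n Ψ P) (q : Q) : ContDiffOn ℝ n (fun u => Ψ u q) P :=
  (ContinuousMap.evalCLM ℝ q (M := F)).contDiff.comp_contDiffOn hΨ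

/-- The derivatives of the members of a family that is smooth as a map into the continuous functions
depend uniformly on the point of evaluation. -/
theorem tendstoUniformlyOn_iteratedFDeriv [FiniteDimensional ℝ E] [FiniteDimensional ℝ F] (hP : IsOpen P)
    (hΨ : ContDiffOn ℝ n Ψ P) (hi : i ≤ n) {K : Set E} (hK : IsCompact K) (hKP : K ⊆ P) {ι : Type}
    {l : Filter ι} {q : ι → Q} {q₀ : Q} (hq : Tendsto q l (𝓝 q₀)) :
    TendstoUniformlyOn (fun j => iteratedFDeriv ℝ i (fun u => Ψ u (q j)))
      (iteratedFDeriv ℝ i (fun u => Ψ u q₀)) l K := by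
  have hin : ((i : ℕ) : WithTop ℕ∞) ≤ n := by exact_mod_cast hi
  have hform : ∀ q, ∀ u ∈ P, iteratedFDeriv ℝ i (fun u => Ψ u q) u =
      (ContinuousMap.evalCLM ℝ q (M := F)).compContinuousMultilinearMap (iteratedFDeriv ℝ i Ψ u) :=
    fun q u hu => (ContinuousMap.evalCLM ℝ q (M := F)).iteratedFDeriv_comp_left
      (hΨ.contDiffAt (hP.mem_nhds hu)) hin
  have hD : ContinuousOn (iteratedFDeriv ℝ i Ψ) P := fun u hu =>
    ((hΨ.contDiffAt (hP.mem_nhds hu)).continuousAt_iteratedFDeriv hin).continuousWithinAt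
  have hcont : ContinuousOn (Function.uncurry fun (q : Q) (u : E) =>
      iteratedFDeriv ℝ i (fun u => Ψ u q) u) (univ ×ˢ K) := by
    have h1 : ContinuousOn (fun x : Q × E => (iteratedFDeriv ℝ i Ψ x.2, x.1)) (univ ×ˢ K) :=
      (hD.comp continuousOn_snd fun x hx => hKP hx.2).prodMk continuousOn_fst
    exact (continuous_eval_multilinear.comp_continuousOn h1).congr fun x hx => hform x.1 x.2 (hKP hx.2)
  intro s hs
  obtain ⟨v, hv, h⟩ := hK.mem_uniformity_of_prod hcont (mem_univ q₀) (UniformSpace.symm hs)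
  rw [nhdsWithin_univ] at hv
  filter_upwards [hq hv] with j hj u hu
  exact h _ hj u hu

end JointContinuity

section Param

variable {X Z : Type} [NormedAddCommGroup X] [NormedSpace ℝ X] [NormedAddCommGroup Z] [NormedSpace ℝ Z]
  {d j : ℕ} {P : Set (EuclideanSpace ℝ (Fin d))} {φ : EuclideanSpace ℝ (Fin d) → X} {L : X → Z}

/-- A smooth map with a smooth left inverse is a parametrization of its image. -/
theorem isCkParam_of_leftInverse (hP : IsOpen P) (hφ : ContDiffOn ℝ j φ P) (hL : Differentiable ℝ L)
    (e : EuclideanSpace ℝ (Fin d) ≃L[ℝ] Z) (he : ∀ u ∈ P, L (φ u) = e u) : IsCkParam j P φ (φ '' P) where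
  isOpen := hP
  contDiffOn := hφ
  immersion := fun hj u hu => by
    have h1 : DifferentiableAt ℝ φ u := (hφ.contDiffAt (hP.mem_nhds hu)).differentiableAt (by
      have : ((j : ℕ) : WithTop ℕ∞) ≠ 0 := by exact_mod_cast (by omega : j ≠ 0)
      exact this)
    have h2 : HasFDerivAt (fun u => L (φ u)) ((fderiv ℝ L (φ u)).comp (fderiv ℝ φ u)) u :=
      (hL (φ u)).hasFDerivAt.comp u h1.hasFDerivAt
    have h3 : (fun u => L (φ u)) =ᶠ[𝓝 u] e := by
      filter_upwards [hP.mem_nhds hu] with v hv using he v hv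
    have h4 := (h2.congr_of_eventuallyEq h3.symm).unique e.hasFDerivAt
    intro v w hvw
    apply e.injective
    have h5 := fun v => congrArg (fun f => f v) h4
    simp only [ContinuousLinearMap.comp_apply] at h5
    exact (h5 v).symm.trans ((congrArg _ hvw).trans (h5 w))
  isEmbedding := by
    refine IsEmbedding.of_comp (g := L) (continuousOn_iff_continuous_domRestrict.1 hφ.continuousOn)
      hL.continuous ?_
    have h : L ∘ (fun u : P => φ u) = e ∘ Subtype.val := funext fun u => he u u.2
    rw [h]
    exact e.toHomeomorph.isEmbedding.comp IsEmbedding.subtypeVal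
  image_eq := rfl

/-- Closeness of a family of submanifolds given by one map into the continuous functions. -/
theorem ckClose_of_family {Q : Type} [TopologicalSpace Q] [CompactSpace Q] [FiniteDimensional ℝ X] {n : ℕ}
    (hjn : j ≤ n) (hL : Differentiable ℝ L) (e : EuclideanSpace ℝ (Fin d) ≃L[ℝ] Z) {D : Set X} {O : Set Z}
    (hD : IsOpen D) (hO : IsOpen O) {Ψ : Z → C(Q, X)} (hΨ : ContDiffOn ℝ n Ψ O) {x₀ : X} (hx₀ : x₀ ∈ D)
    (hLx₀ : L x₀ ∈ O) {q : ℝ → Q} {q₀ : Q} (hq : Tendsto q (𝓝[>] 0) (𝓝 q₀)) {M : ℝ → Set X} {M₀ : Set X}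
    (hleft₀ : ∀ u ∈ O, Ψ u q₀ ∈ D ∩ M₀ ∧ L (Ψ u q₀) = u)
    (hright₀ : ∀ x ∈ D ∩ M₀, L x ∈ O → Ψ (L x) q₀ = x)
    (hleft : ∀ᶠ ε in 𝓝[>] 0, ∀ u ∈ O, Ψ u (q ε) ∈ D ∩ M ε ∧ L (Ψ u (q ε)) = u)
    (hright : ∀ᶠ ε in 𝓝[>] 0, ∀ x ∈ D ∩ M ε, L x ∈ O → Ψ (L x) (q ε) = x) :
    ∃ V₀, IsOpen V₀ ∧ x₀ ∈ V₀ ∧ V₀ ⊆ L ⁻¹' O ∧ CkClose j d (fun ε => M ε ∩ V₀) (M₀ ∩ V₀) := by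
  set u₀ := e.symm (L x₀) with hu₀
  have hOe : IsOpen (e ⁻¹' O) := hO.preimage e.continuous
  -- A closed ball inside the domain gives compactness, which makes the convergence uniform on the
  -- open ball used as parameter set.
  obtain ⟨ρ, hρ, hball⟩ := Metric.nhds_basis_closedBall.mem_iff.1 (hOe.mem_nhds (x := u₀)
    (by rw [mem_preimage, hu₀, e.apply_symm_apply]; exact hLx₀))
  set P : Set (EuclideanSpace ℝ (Fin d)) := Metric.ball u₀ ρ with hPdef
  have hPO : ∀ u ∈ P, e u ∈ O := fun u hu => hball (Metric.ball_subset_closedBall hu)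
  let V₀ : Set X := D ∩ L ⁻¹' (e.symm ⁻¹' P)
  have hV₀O : V₀ ⊆ L ⁻¹' O := fun x hx => by
    have := hPO _ hx.2
    rwa [e.apply_symm_apply] at this
  have hΨe : ContDiffOn ℝ n (fun u => Ψ (e u)) (e ⁻¹' O) := hΨ.comp e.contDiff.contDiffOn fun u hu => hu
  have hparam : ∀ (p : Q) (N : Set X), (∀ u ∈ O, Ψ u p ∈ D ∩ N ∧ L (Ψ u p) = u) →
      (∀ x ∈ D ∩ N, L x ∈ O → Ψ (L x) p = x) → IsCkParam j P (fun u => Ψ (e u) p) (N ∩ V₀) := by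
    intro p N h1 h2
    have himg : (fun u => Ψ (e u) p) '' P = N ∩ V₀ := by
      ext x
      constructor
      · rintro ⟨u, hu, rfl⟩
        obtain ⟨h3, h4⟩ := h1 _ (hPO u hu)
        refine ⟨h3.2, h3.1, ?_⟩
        show e.symm (L (Ψ (e u) p)) ∈ P
        rwa [h4, e.symm_apply_apply]
      · rintro ⟨hxN, hxD, hxP⟩
        refine ⟨e.symm (L x), hxP, ?_⟩
        show Ψ (e (e.symm (L x))) p = x
        rw [e.apply_symm_apply]
        exact h2 x ⟨hxD, hxN⟩ (hV₀O ⟨hxD, hxP⟩)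
    rw [← himg]
    refine isCkParam_of_leftInverse Metric.isOpen_ball ?_ hL e fun u hu => (h1 _ (hPO u hu)).2
    exact ((contDiffOn_eval hΨe p).mono fun u hu => hPO u hu).of_le (by exact_mod_cast hjn)
  refine ⟨V₀, hD.inter ((Metric.isOpen_ball.preimage e.symm.continuous).preimage hL.continuous),
    ⟨hx₀, Metric.mem_ball_self hρ⟩, hV₀O, P, fun u => Ψ (e u) q₀, fun ε u => Ψ (e u) (q ε),
    hparam _ _ hleft₀ hright₀, ?_, fun i hi => ?_⟩
  · filter_upwards [hleft, hright] with ε h1 h2 using hparam _ _ h1 h2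
  · exact (tendstoUniformlyOn_iteratedFDeriv hOe hΨe (hi.trans hjn) (isCompact_closedBall u₀ ρ) hball hq).mono
      Metric.ball_subset_closedBall

end Param

end

/-! ### Transit times, uniqueness of the entry point, curves in the entry manifold -/

noncomputable section

namespace FenichelSystem

variable {k m l : ℕ} {S : FenichelSystem (k + 1) m l} {V : Set (EuclideanSpace ℝ (Fin l))}
  {δ₀ δ : ℝ}

namespace Reduction

/-- Transit times are comparable to the logarithm of the distance to the hyperplane `{a_k = 0}`. -/
theorem exists_time_bounds (H : S.Reduction V δ₀) (hδ : δ ≤ δ₀) {z : PhaseSpace (k + 1) m l}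
    (hz : z ∈ cornerBox (k + 1) m δ V) {α : ℝ} (hα : 0 < α) :
    ∃ C : ℝ, 0 < C ∧ ∃ ε₂ : ℝ, 0 < ε₂ ∧ ∀ ε, 0 < ε → ε < ε₂ → ∀ (p q : PhaseSpace (k + 1) m l) (T : ℝ),
      S.FlowsTo (cornerBox (k + 1) m δ V) p T q → p.1 (Fin.last k) = ε → α / 2 < q.1 (Fin.last k) →
      q.1 (Fin.last k) < 2 * α → C⁻¹ * Real.log (1 / ε) ≤ T ∧ T ≤ C * Real.log (1 / ε) := by
  have hr1 := H.rate₁_pos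
  have hr2 : 0 < H.rate₂ := by
    have := H.rate_mem z (cornerBox_mono hδ V hz)
    exact hr1.trans_le (this.1.trans this.2)
  set B := max |Real.log (α / 2)| |Real.log (2 * α)| with hB
  have hB0 : 0 ≤ B := le_max_of_le_left (abs_nonneg _)
  have hC : 0 < 2 / H.rate₁ + 2 * H.rate₂ := by positivity
  refine ⟨2 / H.rate₁ + 2 * H.rate₂, hC, Real.exp (-(2 * B)), Real.exp_pos _,
    -- For ε below e^{-2B} the term log a_k(q), bounded by B, is at most half of log(1/ε). The
    -- rescaled time then lies between half and twice log(1/ε), and the bounds of the rate convert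
    -- it to the original time.
    fun ε hε hε₂ p q T hT hp hq1 hq2 => ?_⟩
  obtain ⟨T', -, -, h1, h2, -, -, -, h3⟩ := H.exists_isOrbit_of_flowsTo hδ hT
  have hT0 := hT.1
  have hq0 : 0 < q.1 (Fin.last k) := lt_trans (by positivity) hq1
  have hΛ : Real.log (1 / ε) = -Real.log ε := by rw [one_div, Real.log_inv]
  have hΛB : 2 * B ≤ Real.log (1 / ε) := by
    have := (Real.log_lt_iff_lt_exp hε).2 hε₂
    rw [hΛ]; linarith
  set Λ := Real.log (1 / ε)
  have hT' : T' = Real.log (q.1 (Fin.last k)) + Λ := by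
    rw [h3, hp, Real.log_mul (Real.exp_pos _).ne' hε.ne', Real.log_exp, hΛ]; ring
  have hlow : -B ≤ Real.log (q.1 (Fin.last k)) := by
    have e1 := Real.log_le_log (by positivity) hq1.le
    have e2 := neg_abs_le (Real.log (α / 2))
    have e3 : |Real.log (α / 2)| ≤ B := le_max_left _ _
    linarith
  have hup : Real.log (q.1 (Fin.last k)) ≤ B := by
    have e1 := Real.log_le_log hq0 hq2.le
    have e2 := le_abs_self (Real.log (2 * α))
    have e3 : |Real.log (2 * α)| ≤ B := le_max_right _ _
    linarith
  have hΛ0 : 0 ≤ Λ := by linarith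
  constructor
  · rw [inv_mul_le_iff₀ hC]
    have : 0 ≤ 2 / H.rate₁ * T := by positivity
    nlinarith
  · have h4 : T ≤ 2 / H.rate₁ * Λ := by
      rw [div_mul_eq_mul_div, le_div_iff₀ hr1]
      linarith
    nlinarith [mul_nonneg hr2.le hΛ0]

/-- Points of a section `{b = const}` on the stable fiber of the base point of a given unstable fiber
are unique. -/
theorem stable_entry_unique (H : S.Reduction V δ₀) (hδ : δ ≤ δ₀) {p p' q z z' : PhaseSpace (k + 1) m l}
    (hp : S.StableProj (cornerBox (k + 1) m δ V) p z)
    (hq : S.UnstableProj (cornerBox (k + 1) m δ V) q z)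
    (hp' : S.StableProj (cornerBox (k + 1) m δ V) p' z')
    (hq' : S.UnstableProj (cornerBox (k + 1) m δ V) q z') (hb : p'.2.1 = p.2.1) : p' = p := by
  have hϱ := H.ϱ_pos
  have hz : z.2.2 ∈ V := hp.1.2.2
  have hs : |((q.1, p.2.1, 0, q.2.2) : EuclideanSpace ℝ (Fin (k + 1)) × EuclideanSpace ℝ (Fin m) ×
      ℝ × EuclideanSpace ℝ (Fin l)).2.2.1| < H.ϱ := by simpa using hϱ
  have h1 := (psi_eq_of_proj (hz := hz) (G := .exit) (y := (q.1, p.2.1, 0, q.2.2)) hδ hs hp hq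
    (by rw [sub_self, norm_zero]; positivity) rfl rfl (by rw [ExitGraph.exit_cond])).2.1
  have h2 := (psi_eq_of_proj (hz := hz) (G := .exit) (y := (q.1, p.2.1, 0, q.2.2)) hδ hs hp' hq'
    (by
      have e : z'.2.2 - z.2.2 = -(q.2.2 - z'.2.2) + (q.2.2 - z.2.2) := by abel
      rw [e]
      refine (norm_add_le _ _).trans ?_
      rw [norm_neg]
      linarith [H.unstableProj_dist hδ hq, H.unstableProj_dist hδ hq'])
    rfl hb (by rw [ExitGraph.exit_cond])).2.1
  exact h2.symm.trans h1

end Reduction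

/-- Through points with `a = 0`, the entry manifold contains curves with all velocities in the direction
of `a`. -/
theorem exists_curve_entryManifold {Δ₁ : ℝ} (hΔ₁ : 0 < Δ₁) {b₀ : EuclideanSpace ℝ (Fin m)}
    {θ : EuclideanSpace ℝ (Fin k) → EuclideanSpace ℝ (Fin l) → Matrix (Fin l) (Fin k) ℝ}
    {Λ : Set (EuclideanSpace ℝ (Fin l))}
    (hθ : ∀ i j, ContinuousOn (fun y : EuclideanSpace ℝ (Fin k) × EuclideanSpace ℝ (Fin l) =>
      θ y.1 y.2 i j) (Metric.ball 0 Δ₁ ×ˢ Λ)) {c : EuclideanSpace ℝ (Fin l)} (hc : c ∈ Λ)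
    (a : EuclideanSpace ℝ (Fin k)) : ∃ (γ : ℝ → PhaseSpace k m l) (v : PhaseSpace k m l),
      HasDerivAt γ v 0 ∧ γ 0 = (0, b₀, c) ∧ (∀ᶠ t in 𝓝 0, γ t ∈ entryManifold Δ₁ b₀ θ Λ) ∧ v.1 = a := by
  let G : ℝ → EuclideanSpace ℝ (Fin l) := fun t => WithLp.toLp 2 ((θ (t • a) c).mulVec a)
  have hball : ∀ᶠ t : ℝ in 𝓝 0, t • a ∈ Metric.ball (0 : EuclideanSpace ℝ (Fin k)) Δ₁ := by
    have h1 : Continuous fun t : ℝ => t • a := by fun_prop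
    exact h1.continuousAt.eventually_mem (Metric.isOpen_ball.mem_nhds (by simpa using hΔ₁))
  have hG : Tendsto G (𝓝 0) (𝓝 (G 0)) := by
    refine ((PiLp.continuous_toLp 2 _).tendsto _).comp (tendsto_pi_nhds.2 fun i => ?_)
    show Tendsto (fun t : ℝ => ∑ j, θ (t • a) c i j * a j) (𝓝 0)
      (𝓝 (∑ j, θ ((0 : ℝ) • a) c i j * a j))
    refine tendsto_finsetSum _ fun j _ => Tendsto.mul_const (a j) ?_
    have h1 := (hθ i j).continuousWithinAt (x := ((0 : ℝ) • a, c)) ⟨by simpa using hΔ₁, hc⟩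
    refine Tendsto.comp (g := fun y : EuclideanSpace ℝ (Fin k) × EuclideanSpace ℝ (Fin l) =>
      θ y.1 y.2 i j) (f := fun t : ℝ => (t • a, c)) h1 (tendsto_nhdsWithin_iff.2 ⟨?_, ?_⟩)
    · have h2 : Continuous fun t : ℝ => (t • a, c) := by fun_prop
      exact h2.tendsto 0
    · filter_upwards [hball] with t ht using ⟨ht, hc⟩
  -- Since G is multiplied by t, the derivative at 0 exists as soon as G is continuous there; no
  -- derivative of θ is needed.
  have hd : HasDerivAt (fun t => c + t • G t) (G 0) 0 := by
    rw [hasDerivAt_iff_tendsto_slope_zero]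
    refine (hG.mono_left nhdsWithin_le_nhds).congr' ?_
    filter_upwards [self_mem_nhdsWithin] with t ht
    have ht' : t ≠ 0 := ht
    simp only [zero_add, zero_smul, add_zero, add_sub_cancel_left]
    rw [smul_smul, inv_mul_cancel₀ ht', one_smul]
  refine ⟨fun t => (t • a, b₀, c + t • G t), (a, 0, G 0), ?_, by simp, ?_, rfl⟩
  · have h1 : HasDerivAt (fun t : ℝ => t • a) a 0 := by
      simpa using (hasDerivAt_id (0 : ℝ)).smul_const a
    exact h1.prodMk ((hasDerivAt_const _ _).prodMk hd)
  · filter_upwards [hball] with t ht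
    refine ⟨mem_ball_zero_iff.1 ht, rfl, c, hc, ?_⟩
    show c + t • G t = c + WithLp.toLp 2 ((θ (t • a) c).mulVec (t • a))
    congr 1
    ext i
    simp [G, Matrix.mulVec_smul]

end FenichelSystem

end

/-! ### The Corner Lemma -/

theorem mainTheorem2 (n m l r : ℕ) (hr : 3 ≤ r)
    (S : FenichelSystem (n + 1) m l) (Δ : ℝ) (hΔ : 0 < Δ)
    (V : Set (EuclideanSpace ℝ (Fin l))) (hVopen : IsOpen V) (hVbdd : Bornology.IsBounded V)
    (U : Set (PhaseSpace (n + 1) m l)) (hU : IsOpen U)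
    (hBU : closure (cornerBox (n + 1) m Δ V) ⊆ U)
    (hCk : S.IsCk r U)
    (hform : S.HasInvariantHyperplane (closure (cornerBox (n + 1) m Δ V)))
    (hgap : S.HasSpectralGap (closure (cornerBox (n + 1) m Δ V)))
    (hE : S.VanishesOnCritical (closure (cornerBox (n + 1) m Δ V))) :
    ∃ δ₀ : ℝ, 0 < δ₀ ∧ δ₀ ≤ Δ ∧ ∀ δ : ℝ, 0 < δ → δ ≤ δ₀ →
      -- the fiber projections are defined near the critical manifold
      (∀ K : Set (EuclideanSpace ℝ (Fin l)), IsCompact K → K ⊆ V →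
        ∃ η : ℝ, 0 < η ∧ ∀ c ∈ K,
          (∀ b : EuclideanSpace ℝ (Fin m), ‖b‖ < η →
            ∃ z, S.StableProj (cornerBox (n + 1) m δ V) (0, b, c) z) ∧
          (∀ a : EuclideanSpace ℝ (Fin (n + 1)), ‖a‖ < η →
            ∃ z, S.UnstableProj (cornerBox (n + 1) m δ V) (a, 0, c) z)) ∧
      ∀ (σ : ℕ) (_ : σ ≤ l) (Λ : Set (EuclideanSpace ℝ (Fin l))) (_ : Λ ⊆ V)
        (_ : IsCkSubmanifold r σ Λ)
        (Δ₁ : ℝ) (_ : 0 < Δ₁) (_ : Δ₁ < δ)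
        (b₀ : EuclideanSpace ℝ (Fin m)) (_ : 0 < ‖b₀‖) (_ : ‖b₀‖ < δ)
        (θ : EuclideanSpace ℝ (Fin (n + 1)) → EuclideanSpace ℝ (Fin l) →
          Matrix (Fin l) (Fin (n + 1)) ℝ)
        (_ : ∀ i j, ContDiffOn ℝ r
          (fun y : EuclideanSpace ℝ (Fin (n + 1)) × EuclideanSpace ℝ (Fin l) => θ y.1 y.2 i j)
          (Metric.ball 0 Δ₁ ×ˢ Λ))
        (M : Set (PhaseSpace (n + 1) m l)) (_ : M = entryManifold Δ₁ b₀ θ Λ)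
        (_ : IsCkSubmanifold r (n + 1 + σ) M)
        (B : Set (PhaseSpace (n + 1) m l)) (_ : B = cornerBox (n + 1) m δ V)
        (W : Set (PhaseSpace (n + 1) m l))
        (_ : W = S.unstableManifold B (S.stableProjImage B M))
        (q₀ : PhaseSpace (n + 1) m l) (_ : q₀ ∈ W) (_ : 0 < q₀.1 (Fin.last n)),
        ∃ V₀ : Set (PhaseSpace (n + 1) m l), IsOpen V₀ ∧ q₀ ∈ V₀ ∧
          CkClose (r - 3) (n + 1 + σ)
            (fun ε => S.forwardEvolution B (slice M ε) ∩ V₀) (W ∩ V₀) ∧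
          ∃ C : ℝ, 0 < C ∧
            ∀ (ι : Type) (F : Filter ι) (ε : ι → ℝ) (_ : Tendsto ε F (𝓝[>] 0))
              (p q : ι → PhaseSpace (n + 1) m l) (T : ι → ℝ)
              (_ : ∀ᶠ i in F, p i ∈ slice M (ε i) ∧ q i ∈ V₀ ∧ 0 < T i ∧
                S.FlowsTo B (p i) (T i) (q i))
              (q' : PhaseSpace (n + 1) m l) (_ : q' ∈ W) (_ : Tendsto q F (𝓝 q')),
              (∃ p₀ ∈ slice M 0,
                (∀ p' ∈ slice M 0,
                  (∃ z, S.StableProj B p' z ∧ S.UnstableProj B q' z) ↔ p' = p₀) ∧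
                Tendsto p F (𝓝 p₀)) ∧
              ∀ᶠ i in F, C⁻¹ * Real.log (1 / ε i) ≤ T i ∧ T i ≤ C * Real.log (1 / ε i) := by
  -- Hadamard's lemma costs one derivative, so the solution map is of class C^{r-1}, more than the
  -- C^{r-3} required.
  obtain ⟨r', rfl⟩ : ∃ r', r = r' + 1 := ⟨r - 1, by omega⟩
  obtain ⟨δ₀, hδ₀, hδ₀Δ, H, hHn⟩ := S.exists_reduction (r := r') (by omega) hΔ hVbdd hU hBU hCk hform hgap hE
  refine ⟨δ₀, hδ₀, hδ₀Δ, fun δ hδ0 hδ => ⟨fun K hK hKV => H.exists_fibers hδ0 hδ hVopen hK hKV, ?_⟩⟩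
  intro σ _ Λ hΛV _ Δ₁ hΔ₁ _ b₀ _ _ θ hθ M hM hMsub B hB W hW q₀ hq₀W hα
  subst hB
  have hMb : ∀ x ∈ M, x.2.1 = b₀ := fun x hx => by rw [hM] at hx; exact hx.2.1
  obtain ⟨z, ⟨p, hpM, hp⟩, hq⟩ : q₀ ∈ S.unstableManifold _ _ := hW ▸ hq₀W
  have hp0 : p.1 = 0 := H.stableProj_fst hδ hp
  have hpb : p.2.1 = b₀ := hMb p hpM
  obtain ⟨Φ, hΦ, hpΦ, P', φ, hφ⟩ := hMsub p hpM
  obtain ⟨u₀, hu₀, hφu₀⟩ : p ∈ φ '' P' := by rw [hφ.image_eq]; exact ⟨hpM, hpΦ⟩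
  have hdiff : DifferentiableAt ℝ φ u₀ := (hφ.contDiffOn.contDiffAt (hφ.isOpen.mem_nhds hu₀)).differentiableAt
    (by exact_mod_cast (by omega : r' + 1 ≠ 0))
  have hΛp : p.2.2 ∈ Λ := by
    have h := hpM
    rw [hM] at h
    obtain ⟨-, -, c₀, hc₀, h⟩ := h
    rw [hp0, WithLp.ofLp_zero, Matrix.mulVec_zero, WithLp.toLp_zero, add_zero] at h
    rwa [h]
  obtain ⟨Y, G, ⟨e⟩, hπ, hh, hgraph⟩ := exists_exitGraph H.n_ne_zero hφ.isOpen
    (hφ.contDiffOn.of_le (by rw [hHn]; exact_mod_cast Nat.le_succ r')) hu₀ hdiff.hasFDerivAt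
    (hφ.immersion (by omega) u₀ hu₀) hφ.isEmbedding hφ.image_eq (hΦ.mem_nhds hpΦ) hφu₀
    (fun x hx => (hMb x hx).trans hpb.symm) hp0 (fun a => by
      obtain ⟨γ, v, h1, h2, h3, h4⟩ := FenichelSystem.exists_curve_entryManifold (b₀ := b₀) hΔ₁
        (fun i j => (hθ i j).continuousOn) hΛp a
      rw [← hM] at h3
      exact ⟨γ, v, h1, h2.trans (by rw [← hpb, ← hp0]), h3, h4⟩)
  obtain ⟨D, P, Ψ, e₁, hD, hqD, hP, hqP, he₁, hΨ, h1, h2, h3, h4, h5⟩ := H.exists_passage hδ hVopen G hπ hh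
    (fun x hx => (hMb x hx).trans hpb.symm) hgraph hpM hp hq hα
  set α := q₀.1 (Fin.last n) with hαdef
  rw [← hW] at h2 h3
  -- The restriction on the last coordinate is for the transit times: it keeps log a_k bounded at
  -- the exit.
  let O : Set (EuclideanSpace ℝ (Fin (n + 1)) × Y) :=
    P ∩ {u | α / 2 < u.1 (Fin.last n) ∧ u.1 (Fin.last n) < 2 * α}
  have hO : IsOpen O := by
    have h : Continuous fun u : EuclideanSpace ℝ (Fin (n + 1)) × Y => u.1 (Fin.last n) := by fun_prop
    exact hP.inter ((isOpen_lt continuous_const h).inter (isOpen_lt h continuous_const))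
  have hqO : G.chart q₀ ∈ O := ⟨hqP, by show α / 2 < α; linarith, by show α < 2 * α; linarith⟩
  -- The hyperbola that belongs to the slice {a_k = ε} is e = ε/α, independently of the exit point.
  let E : ℝ → unitInterval := fun ε => projIcc 0 1 zero_le_one (ε / α)
  have hE0 : Tendsto E (𝓝[>] 0) (𝓝 0) := by
    have h : Continuous E := continuous_projIcc.comp (continuous_id.div_const α)
    have h' := h.tendsto 0
    have h0 : E 0 = 0 := by simp [E, projIcc_left]
    rw [h0] at h'
    exact h'.mono_left nhdsWithin_le_nhds
  have hEe : ∀ᶠ ε : ℝ in 𝓝[>] 0, 0 < (E ε : ℝ) ∧ (E ε : ℝ) < e₁ ∧ E ε * α = ε := by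
    have hpos : 0 < α * min 1 e₁ := by positivity
    filter_upwards [Ioo_mem_nhdsGT hpos] with ε hε
    have hlt : ε / α < min 1 e₁ := by rw [div_lt_iff₀ hα, mul_comm]; exact hε.2
    have hval : (E ε : ℝ) = ε / α := by
      show ((projIcc 0 1 zero_le_one (ε / α) : unitInterval) : ℝ) = _
      rw [projIcc_of_mem zero_le_one ⟨(div_pos hε.1 hα).le, (hlt.trans_le (min_le_left _ _)).le⟩]
    rw [hval]
    exact ⟨div_pos hε.1 hα, hlt.trans_le (min_le_right _ _), div_mul_cancel₀ _ hα.ne'⟩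
  have hchart : Differentiable ℝ (G.chart (EB := EuclideanSpace ℝ (Fin m))) := by
    unfold ExitGraph.chart
    fun_prop
  obtain ⟨V₀, hV₀, hqV₀, hV₀O, hclose⟩ := ckClose_of_family (j := r' + 1 - 3) (n := H.n) (by omega) hchart e hD hO
    (hΨ.mono inter_subset_left) hqD hqO (q := fun ε => (E ε, 1)) (q₀ := (0, 1))
    (M := fun ε => S.forwardEvolution (cornerBox (n + 1) m δ V) (slice M ε)) (M₀ := W)
    (hE0.prodMk_nhds tendsto_const_nhds)
    (fun u hu => ⟨⟨(h1 u hu.1 0 he₁).1, h2 u hu.1⟩, (h1 u hu.1 0 he₁).2⟩)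
    (fun x hx hxO => h3 x hx.1 hxO.1 hx.2)
    (by
      filter_upwards [hEe] with ε hε u hu
      have h := h4 u hu.1 (E ε) hε.1 hε.2.1
      rw [hε.2.2] at h
      exact ⟨⟨(h1 u hu.1 (E ε) hε.2.1).1, h⟩, (h1 u hu.1 (E ε) hε.2.1).2⟩)
    (by
      filter_upwards [hEe] with ε hε x hx hxO
      refine h5 x hx.1 hxO.1 (E ε) hε.1 hε.2.1 ?_
      rw [hε.2.2]
      exact hx.2)
  obtain ⟨C, hC, ε₂, hε₂, htime⟩ := H.exists_time_bounds hδ hp.1 hα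
  refine ⟨V₀, hV₀, hqV₀, hclose, C, hC, ?_⟩
  intro ι F ε hε p' q T hev q' hq' hlim
  obtain ⟨z', ⟨p₀, hp₀M, hp₀⟩, hqz'⟩ : q' ∈ S.unstableManifold _ _ := hW ▸ hq'
  have hεpos : ∀ᶠ i in F, 0 < ε i := hε.eventually self_mem_nhdsWithin
  have hεsmall : ∀ c : ℝ, 0 < c → ∀ᶠ i in F, ε i < c := fun c hc =>
    (hε.mono_right nhdsWithin_le_nhds).eventually_lt_const hc
  have hp₀0 : p₀.1 = 0 := H.stableProj_fst hδ hp₀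
  refine ⟨⟨p₀, ⟨hp₀M, by rw [hp₀0]; rfl⟩, fun p'' hp'' => ⟨?_, ?_⟩, ?_⟩, ?_⟩
  · rintro ⟨z'', hs, hu⟩
    exact H.stable_entry_unique hδ hp₀ hqz' hs hu ((hMb _ hp''.1).trans (hMb _ hp₀M).symm)
  · rintro rfl
    exact ⟨z', hp₀, hqz'⟩
  · rcases F.eq_or_neBot with rfl | hF
    · exact tendsto_bot
    intro N hN
    have hq'k : 0 < q'.1 (Fin.last n) := by
      have hlast : Continuous fun x : PhaseSpace (n + 1) m l => x.1 (Fin.last n) := by fun_prop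
      -- The limit q' may leave the open set V₀, but the weak inequality passes to the limit and
      -- still gives a positive last coordinate, as `exists_entry_near` requires.
      have h : α / 2 ≤ q'.1 (Fin.last n) := by
        refine ge_of_tendsto ((hlast.tendsto q').comp hlim) ?_
        filter_upwards [hev] with i hi using (hV₀O hi.2.1).2.1.le
      linarith
    obtain ⟨N', hN', ε₁, hε₁, -, h⟩ := H.exists_entry_near hδ hp₀ hqz' hq'k hN
    rw [mem_map]
    filter_upwards [hlim hN', hεpos, hεsmall ε₁ hε₁, hev] with i hi1 hi2 hi3 hi4
    exact h (ε i) hi2 hi3 (q i) hi1 (p' i) (T i) hi4.2.2.2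
      ((hMb _ hi4.1.1).trans (hMb _ hp₀M).symm) hi4.1.2
  · filter_upwards [hεpos, hεsmall ε₂ hε₂, hev] with i hi1 hi2 hi3
    have hiO := (hV₀O hi3.2.1).2
    exact htime (ε i) hi1 hi2 (p' i) (q i) (T i) hi3.2.2.2 hi3.1.2 hiO.1 hiO.2
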